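/- **Setting.** Fix two coordinate charts with coordinates $(\theta^1,\theta^2)$ which cover $S^2$, each of them relatively compact in a larger smooth chart, and let $\gamma$ be the round metric of the unit sphere. For $u_0<u'\le u_f$, $v_0<v'<\infty$ let $\mathcal A=[u_0,u']\times[v_0,v']\times S^2$ carry a smooth Lorentzian metric in double null gauge $$g=-2\Omega^2(du\otimes dv+dv\otimes du)+\slashed g_{AB}(d\theta^A-b^Adv)\otimes(d\theta^B-b^Bdv),$$ with $\Omega>0$ and $\slashed g$ Riemannian on the spheres $S_{u,v}$. Put $r=v-u+r_0$ with $r_0>0$, $\slashed g^\circ=r^2\gamma$, $e_A=\partial_{\theta^A}$, $e_3=\Omega^{-2}\partial_u$, $e_4=\partial_v+b^A\partial_{\theta^A}$, and let $\chi_{AB}=g(\nabla_{e_A}e_4,e_B)$, $\underline\chi_{AB}=g(\nabla_{e_A}e_3,e_B)$ (with traces $\mathrm{tr}\chi,\mathrm{tr}\underline\chi$ and trace free parts $\hat\chi,\hat{\underline\chi}$ with respect to $\slashed g$), $\eta_A=-\tfrac12g(\nabla_{e_3}e_A,e_4)$, $\underline\eta_A=-\tfrac12g(\nabla_{e_4}e_A,e_3)$,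 $\omega=\tfrac12g(\nabla_{e_4}e_3,e_4)$. Let $\slashed\nabla,\slashed\nabla_3,\slashed\nabla_4$ denote the projections to the spheres of the covariant derivatives $\nabla_{e_A},\nabla_{e_3},\nabla_{e_4}$ of tensors on the spheres, let $\slashed\Gamma,\slashed\Gamma^\circ$ be the Christoffel symbols of $\slashed g,\slashed g^\circ$, and let $\mathfrak D^k$ be any composition of $k$ operators from $\{\slashed\nabla_3,r\slashed\nabla_4,r\slashed\nabla\}$. Write $\Gamma_0=\Omega^{-2}-1$; $\Gamma_1=\hat{\underline\chi},\ \slashed g-\slashed g^\circ,\ b,\ \eta$; $\Gamma_2=\underline\eta,\ \mathrm{tr}\underline\chi+\tfrac2r,\ \mathrm{tr}\chi-\tfrac2r,\ \hat\chi$; $\Gamma_3=\omega$. *Bootstrap assumptions with constant $\overline C$:* for all $(u,v)\in[u_0,u']\times[v_0,v']$, all $k\in\{0,1,2\}$, all $\mathfrak D^k$ and all $\Gamma_p$, $$r^{2p-2}\int|\mathfrak D^k\Gamma_p|^2\,d\mu\le\overline C,$$ $$\int|\mathfrak D^k(\slashed\Gamma-\slashed\Gamma^\circ)|^2+|\mathfrak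 D^k\slashed\nabla_3(\slashed\Gamma-\slashed\Gamma^\circ)|^2+|\mathfrak D^kr\slashed\nabla_4(\slashed\Gamma-\slashed\Gamma^\circ)|^2\,d\mu\le\overline C,$$ where norms and $d\mu$ are those of $\slashed g$ on $S_{u,v}$. (It suffices that these bounds hold for the integrals over the part of $S_{u,v}$ covered by each of the two charts.) *Initial assumptions:* on $\{u=u_0\}\cup\{v=v_0\}$, in each chart, $|\slashed g_{AB}-\slashed g^\circ_{AB}|\le C_g r$ and $|\slashed g^{AB}-\slashed g_\circ^{AB}|\le C_g r^{-3}$. *Matter:* let $P$ be the set of future directed null vectors (including zero) over $\mathcal A$, written $p=p^Ae_A+p^3e_3+p^4e_4$, and let $f:P\to[0,\infty)$ be continuous and constant along the flow of null geodesics, with $f=0$ over $\{u=u_0\}$. Let $S_0$ be the support of the restriction of $f$ to $P|_{\{v=v_0\}}$, and assume that on $S_0$ $$0\le p^4,\qquad 0\le r^2p^3\le C_{p^3}p^4,\qquad |r^2p^A|\le C_{p^A}p^4\quad(A=1,2),$$ the last bound in each chart which contains the base point. **Statement.** There is $\overline C_0>0$, depending only on the charts, such that for all $u_0<u_f$, all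 $C_g$ and all $C_{p^1},C_{p^2},C_{p^3}>0$ there is $V$ such that the following holds whenever $v_0\ge V$, $r_0>0$, $u_0<u'\le u_f$, $v_0<v'$, $\overline C\le\overline C_0$, and $(\mathcal A,g,f)$ is as above. 1. Let $\gamma:[0,T]\to\mathcal A$, $T\ge0$, be a geodesic with $(\gamma(0),\dot\gamma(0))\in S_0$, and write $p^\mu(s)$, $r(s)$, $u(s)$ for $p^\mu(\dot\gamma(s))$, $r(\gamma(s))$, $u(\gamma(s))$. Then, for all $s\in[0,T]$, $$\tfrac12p^4(0)\le p^4(s)\le\tfrac32p^4(0),\qquad 0\le r(s)^2p^3(s)\le2C_{p^3}p^4(0),\qquad |u(s)-u(0)|\le\frac{32\,C_{p^3}}{r(0)},$$ and $|r(s)^2p^A(s)|\le2C_{p^A}p^4(0)$ for $A=1,2$ in each chart in which $\gamma$ remains on $[0,s]$. Moreover $\gamma$ remains in one of the two charts on all of $[0,T]$. 2. If $u_f$ is so large that $u+\frac{32\,C_{p^3}}{r}+1\le u_f$ on $S_0$, then $u(s)\le u_f-1$ along each geodesic as in 1, and $u\le u_f-1$ on the support of $f$ in $P$. -/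

import Mathlib

open Set MeasureTheory
open scoped ContDiff Matrix

noncomputable section

namespace DoubleNull

/-! ### The unit sphere and its coordinate charts -/

/-- Euclidean three-space; the unit sphere `S²` is the set of its vectors of norm one. -/
abbrev E3 : Type := EuclideanSpace ℝ (Fin 3)

/-- Coordinates `(θ¹, θ²)` (indices `0, 1`). -/
abbrev Plane : Type := Fin 2 → ℝ

/-- Coordinates `(u, v, θ¹, θ²)` (indices `0, 1, 2, 3`). -/
abbrev Pt : Type := Fin 4 → ℝ

/-- The product `ℝ × ℝ × S²` is regarded as a submanifold of `ℝ × ℝ × E3`.  Its points `(u, v, x)`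
and its tangent vectors `(X.1, X.2.1, X.2.2)`, with `X.2.2 ⟂ x`, are both elements of this type. -/
abbrev Event : Type := ℝ × ℝ × E3

/-- A coordinate chart of `S²`, given by its inverse `Φ : U → S²`.  As usual the chart is
relatively compact in a larger chart `N`, so that the coordinates are regular up to the boundary. -/
structure SphereChart where
  U : Set Plane
  N : Set Plane
  Φ : Plane → E3
  isOpen_U : IsOpen U
  isOpen_N : IsOpen N
  isCompact_closure : IsCompact (closure U)
  closure_subset : closure U ⊆ N
  smooth : ContDiffOn ℝ ∞ Φ N
  mem_sphere : ∀ θ ∈ N, ‖Φ θ‖ = 1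
  injOn : InjOn Φ N
  immersion : ∀ θ ∈ N, Function.Injective (fderiv ℝ Φ θ)

/-- Two charts which cover the sphere. -/
structure SphereAtlas where
  chart : Fin 2 → SphereChart
  cover : ∀ x : E3, ‖x‖ = 1 → ∃ i, x ∈ (chart i).Φ '' (chart i).U

namespace SphereChart

variable (κ : SphereChart)

/-- The part of the sphere covered by the chart. -/
def range : Set E3 := κ.Φ '' κ.U

/-- The coordinate vector field `∂/∂θ^A` as a vector in `E3`. -/
def dPhi (θ : Plane) (A : Fin 2) : E3 := fderiv ℝ κ.Φ θ (Pi.single A 1)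

/-- Components `γ_AB` of the round metric of the unit sphere. -/
def round (θ : Plane) : Matrix (Fin 2) (Fin 2) ℝ :=
  Matrix.of fun A B => inner ℝ (κ.dPhi θ A) (κ.dPhi θ B)

/-- The components `X^A`, `X = X^A ∂/∂θ^A`, of a vector `X` tangent to the sphere at `Φ θ`. -/
def tangentComp (θ : Plane) (X : E3) : Fin 2 → ℝ :=
  (κ.round θ)⁻¹ *ᵥ fun A => inner ℝ (κ.dPhi θ A) X

/-- The coordinates of a point of the sphere in the range of the chart. -/
def theta (x : E3) : Plane := Function.invFunOn κ.Φ κ.U x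

end SphereChart

/-- The spherical coordinates of a coordinate point. -/
def ang (c : Pt) : Plane := ![c 2, c 3]

/-- The coordinate point `(u, v, θ¹, θ²)`. -/
def mkPt (u v : ℝ) (θ : Plane) : Pt := ![u, v, θ 0, θ 1]

/-- The position of the spherical index `A` among the four coordinate indices. -/
def sph : Fin 2 → Fin 4 := ![2, 3]

namespace SphereChart

variable (κ : SphereChart)

/-- The coordinate domain `ℝ × ℝ × U`. -/
def dom : Set Pt := {c | ang c ∈ κ.U}

/-- The point of `ℝ × ℝ × S²` with given coordinates. -/
def place (c : Pt) : Event := (c 0, c 1, κ.Φ (ang c))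

/-- The coordinate vector fields `∂_u, ∂_v, ∂_θ¹, ∂_θ²` at a point with given coordinates. -/
def dPlace (c : Pt) : Fin 4 → Event :=
  ![(1, 0, 0), (0, 1, 0), (0, 0, κ.dPhi (ang c) 0), (0, 0, κ.dPhi (ang c) 1)]

/-- The coordinates of a point `w = (u, v, x)`. -/
def coord (w : Event) : Pt := mkPt w.1 w.2.1 (κ.theta w.2.2)

/-- The components of a tangent vector `X` at `w` in the coordinate frame. -/
def coordVel (w X : Event) : Pt :=
  mkPt X.1 X.2.1 (κ.tangentComp (κ.theta w.2.2) X.2.2)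

end SphereChart

/-! ### Metrics in double null gauge -/

/-- The fields which make up a metric in double null gauge: the lapse `Ω`, the shift `b` (tangent
to the spheres) and the induced metric `gs` of the spheres. -/
structure Fields where
  Ω : Event → ℝ
  b : Event → E3
  gs : Event → E3 →ₗ[ℝ] E3 →ₗ[ℝ] ℝ

/-- The rectangle `[u₀, u'] × [v₀, v'] × S²`. -/
def rect (u₀ u' v₀ v' : ℝ) : Set Event :=
  {w | w.1 ∈ Icc u₀ u' ∧ w.2.1 ∈ Icc v₀ v' ∧ ‖w.2.2‖ = 1}

/-- The function `r = v - u + r₀`. -/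
def radius (r₀ : ℝ) (w : Event) : ℝ := w.2.1 - w.1 + r₀

namespace Fields

variable (F : Fields)

/-- The metric `g = -2 Ω² (du ⊗ dv + dv ⊗ du) + gs_AB (dθ^A - b^A dv) ⊗ (dθ^B - b^B dv)`. -/
def g (w X Y : Event) : ℝ :=
  -2 * F.Ω w ^ 2 * (X.1 * Y.2.1 + X.2.1 * Y.1)
    + F.gs w (X.2.2 - X.2.1 • F.b w) (Y.2.2 - Y.2.1 • F.b w)

variable (κ : SphereChart)

/-- The components `gs_AB` in a chart. -/
def gsMat (c : Pt) : Matrix (Fin 2) (Fin 2) ℝ :=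
  Matrix.of fun A B => F.gs (κ.place c) (κ.dPhi (ang c) A) (κ.dPhi (ang c) B)

/-- The components `b^A` in a chart. -/
def shift (c : Pt) : Fin 2 → ℝ := κ.tangentComp (ang c) (F.b (κ.place c))

/-- The components `g_μν` in a chart. -/
def gMat (c : Pt) : Matrix (Fin 4) (Fin 4) ℝ :=
  Matrix.of fun μ ν => F.g (κ.place c) (κ.dPlace c μ) (κ.dPlace c ν)

/-- The fields define a smooth Lorentzian metric in double null gauge on the rectangle.  Smoothness
on this manifold with corners is understood as usual: the fields on the rectangle are the
restrictions of tensor fields on the spheres which are smooth on `ℝ × ℝ × S²`. -/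
structure IsDoubleNull (𝔄 : SphereAtlas) (u₀ u' v₀ v' : ℝ) : Prop where
  smooth_lapse : ∀ i, ContDiffOn ℝ ∞ (fun c => F.Ω ((𝔄.chart i).place c)) (𝔄.chart i).dom
  smooth_shift : ∀ i, ContDiffOn ℝ ∞ (fun c => F.b ((𝔄.chart i).place c)) (𝔄.chart i).dom
  smooth_gs : ∀ i A B, ContDiffOn ℝ ∞ (fun c => F.gsMat (𝔄.chart i) c A B) (𝔄.chart i).dom
  lapse_pos : ∀ w ∈ rect u₀ u' v₀ v', 0 < F.Ω w
  shift_tangent : ∀ w : Event, ‖w.2.2‖ = 1 → inner ℝ w.2.2 (F.b w) = 0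
  gs_symm : ∀ w : Event, ‖w.2.2‖ = 1 → ∀ X Y : E3, inner ℝ w.2.2 X = 0 → inner ℝ w.2.2 Y = 0 →
    F.gs w X Y = F.gs w Y X
  gs_pos : ∀ w ∈ rect u₀ u' v₀ v', ∀ X : E3, inner ℝ w.2.2 X = 0 → X ≠ 0 → 0 < F.gs w X X

end Fields

/-! ### The Levi-Civita connection in coordinates -/

/-- The partial derivative `∂_μ h`. -/
def pd (μ : Fin 4) (h : Pt → ℝ) (c : Pt) : ℝ := fderiv ℝ h c (Pi.single μ 1)

/-- Christoffel symbols `Γ^k_ij` of a metric `h` whose indices range over the coordinate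
directions `dir`. -/
def christoffel {ι : Type} [Fintype ι] [DecidableEq ι] (dir : ι → Fin 4)
    (h : Pt → Matrix ι ι ℝ) (c : Pt) (k i j : ι) : ℝ :=
  1 / 2 * ∑ l, (h c)⁻¹ k l *
    (pd (dir i) (fun y => h y l j) c + pd (dir j) (fun y => h y l i) c
      - pd (dir l) (fun y => h y i j) c)

namespace Fields

variable (F : Fields) (κ : SphereChart)

/-- The Christoffel symbols of the spacetime metric. -/
def chr4 (c : Pt) (μ α β : Fin 4) : ℝ := christoffel id (F.gMat κ) c μ α β

/-- The covariant derivative `∇_X Y` of coordinate vector fields. -/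
def cov (X Y : Pt → Fin 4 → ℝ) (c : Pt) : Fin 4 → ℝ := fun μ =>
  ∑ α, X c α * pd α (fun y => Y y μ) c + ∑ α, ∑ β, F.chr4 κ c μ α β * X c α * Y c β

/-- The scalar product `g(X, Y)` in coordinates. -/
def ip (c : Pt) (X Y : Fin 4 → ℝ) : ℝ := ∑ μ, ∑ ν, F.gMat κ c μ ν * X μ * Y ν

/-! ### The double null frame and the Ricci coefficients -/

/-- `e_A = ∂/∂θ^A`. -/
def eS (A : Fin 2) : Pt → Fin 4 → ℝ := fun _ => Pi.single (sph A) 1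

/-- `e_3 = Ω⁻² ∂_u`. -/
def e3 : Pt → Fin 4 → ℝ := fun c => Pi.single 0 (1 / F.Ω (κ.place c) ^ 2)

/-- `e_4 = ∂_v + b^A ∂/∂θ^A`. -/
def e4 : Pt → Fin 4 → ℝ := fun c => ![0, 1, F.shift κ c 0, F.shift κ c 1]

def chi (A B : Fin 2) (c : Pt) : ℝ := F.ip κ c (F.cov κ (eS A) (F.e4 κ) c) (eS B c)

def chibar (A B : Fin 2) (c : Pt) : ℝ := F.ip κ c (F.cov κ (eS A) (F.e3 κ) c) (eS B c)

def eta (A : Fin 2) (c : Pt) : ℝ := -(1 / 2) * F.ip κ c (F.cov κ (F.e3 κ) (eS A) c) (F.e4 κ c)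

def etabar (A : Fin 2) (c : Pt) : ℝ := -(1 / 2) * F.ip κ c (F.cov κ (F.e4 κ) (eS A) c) (F.e3 κ c)

def omega (c : Pt) : ℝ := 1 / 2 * F.ip κ c (F.cov κ (F.e4 κ) (F.e3 κ) c) (F.e4 κ c)

/-- The trace with respect to `gs`. -/
def trace (h : Fin 2 → Fin 2 → Pt → ℝ) (c : Pt) : ℝ :=
  ∑ A, ∑ B, (F.gsMat κ c)⁻¹ A B * h A B c

/-- The trace free part with respect to `gs`. -/
def traceFree (h : Fin 2 → Fin 2 → Pt → ℝ) (A B : Fin 2) (c : Pt) : ℝ :=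
  h A B c - 1 / 2 * F.trace κ h c * F.gsMat κ c A B

end Fields

/-! ### Covariant tensors on the spheres and their derivatives -/

/-- The components in a chart of a covariant tensor field of some rank on the spheres. -/
structure STensor where
  rank : ℕ
  comp : (Fin rank → Fin 2) → Pt → ℝ

namespace STensor

def ofScalar (h : Pt → ℝ) : STensor := ⟨0, fun _ => h⟩

def ofOneForm (ξ : Fin 2 → Pt → ℝ) : STensor := ⟨1, fun I => ξ (I 0)⟩

def ofTwoTensor (ξ : Fin 2 → Fin 2 → Pt → ℝ) : STensor := ⟨2, fun I => ξ (I 0) (I 1)⟩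

/-- Multiplication by a function. -/
def smul (h : Pt → ℝ) (T : STensor) : STensor := ⟨T.rank, fun I c => h c * T.comp I c⟩

end STensor

/-- The commutation operators `∇̸_3`, `r ∇̸_4` and `r ∇̸`. -/
inductive DOp where
  | three
  | rFour
  | rAngular

/-- `r = v - u + r₀` as a function of the coordinates. -/
def rad (r₀ : ℝ) (c : Pt) : ℝ := c 1 - c 0 + r₀

/-- The components of the metric `r² γ`. -/
def gCirc (κ : SphereChart) (r₀ : ℝ) (c : Pt) : Matrix (Fin 2) (Fin 2) ℝ :=
  rad r₀ c ^ 2 • κ.round (ang c)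

namespace Fields

variable (F : Fields) (κ : SphereChart)

/-- The `e_B` component of the projection of `∇_X e_A` to the tangent space of the sphere. -/
def projCov (X : Pt → Fin 4 → ℝ) (A B : Fin 2) (c : Pt) : ℝ :=
  ∑ D, (F.gsMat κ c)⁻¹ B D * F.ip κ c (F.cov κ X (eS A) c) (eS D c)

/-- The projected covariant derivative `∇̸_X T`. -/
def along (X : Pt → Fin 4 → ℝ) (T : STensor) : STensor :=
  ⟨T.rank, fun I c => ∑ α, X c α * pd α (T.comp I) c
    - ∑ i, ∑ B, F.projCov κ X (I i) B c * T.comp (Function.update I i B) c⟩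

/-- The covariant derivative `∇̸ T` on the spheres; the new index is the first one. -/
def angular (T : STensor) : STensor :=
  ⟨T.rank + 1, fun J => (F.along κ (eS (J 0)) T).comp (Fin.tail J)⟩

def applyOp (r₀ : ℝ) : DOp → STensor → STensor
  | DOp.three, T => F.along κ (F.e3 κ) T
  | DOp.rFour, T => (F.along κ (F.e4 κ) T).smul (rad r₀)
  | DOp.rAngular, T => (F.angular κ T).smul (rad r₀)

/-- A composition `𝔇^k` of `k` operators, where `k` is the length of the list. -/
def applyOps (r₀ : ℝ) (ops : List DOp) (T : STensor) : STensor :=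
  ops.foldr (F.applyOp κ r₀) T

/-- The squared norm `|T|²` of a covariant tensor with respect to `gs`. -/
def normSq (T : STensor) (c : Pt) : ℝ :=
  ∑ I : Fin T.rank → Fin 2, ∑ J : Fin T.rank → Fin 2,
    (∏ i, (F.gsMat κ c)⁻¹ (I i) (J i)) * T.comp I c * T.comp J c

/-- The integral of `|T|²` over the part of the sphere `S_{u,v}` which is covered by the chart,
with respect to the volume measure of `gs`. -/
def patchInt (T : STensor) (u v : ℝ) : ENNReal :=
  ∫⁻ θ in κ.U, ENNReal.ofReal
    (F.normSq κ T (mkPt u v θ) * Real.sqrt (F.gsMat κ (mkPt u v θ)).det)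

end Fields

/-! ### The bootstrap assumptions -/

/-- Names for the renormalised Ricci coefficients and metric quantities `Γ`. -/
inductive RicciName where
  | lapse
  | shift
  | metric
  | trChi
  | trChibar
  | chiHat
  | chibarHat
  | eta
  | etabar
  | omega

/-- The weight `p` of a quantity `Γ_p`. -/
def RicciName.index : RicciName → ℕ
  | lapse => 0
  | shift => 1
  | metric => 1
  | chibarHat => 1
  | eta => 1
  | trChi => 2
  | trChibar => 2
  | chiHat => 2
  | etabar => 2
  | omega => 3

namespace Fields

variable (F : Fields) (κ : SphereChart) (r₀ : ℝ)

/-- The quantities `Γ`, each of which vanishes in Minkowski space.  The index of `b` is lowered with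
`gs`. -/
def ricci : RicciName → STensor
  | RicciName.lapse => STensor.ofScalar fun c => 1 / F.Ω (κ.place c) ^ 2 - 1
  | RicciName.shift => STensor.ofOneForm fun A c => ∑ B, F.gsMat κ c A B * F.shift κ c B
  | RicciName.metric => STensor.ofTwoTensor fun A B c => F.gsMat κ c A B - gCirc κ r₀ c A B
  | RicciName.trChi => STensor.ofScalar fun c => F.trace κ (F.chi κ) c - 2 / rad r₀ c
  | RicciName.trChibar => STensor.ofScalar fun c => F.trace κ (F.chibar κ) c + 2 / rad r₀ c
  | RicciName.chiHat => STensor.ofTwoTensor (F.traceFree κ (F.chi κ))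
  | RicciName.chibarHat => STensor.ofTwoTensor (F.traceFree κ (F.chibar κ))
  | RicciName.eta => STensor.ofOneForm (F.eta κ)
  | RicciName.etabar => STensor.ofOneForm (F.etabar κ)
  | RicciName.omega => STensor.ofScalar (F.omega κ)

/-- The difference of the Christoffel symbols of `gs` and of `r² γ`, a tensor on the spheres, with
its upper index lowered with `gs`. -/
def christoffelDiff : STensor :=
  ⟨3, fun I c => ∑ D, F.gsMat κ c (I 2) D *
    (christoffel sph (F.gsMat κ) c D (I 0) (I 1) - christoffel sph (gCirc κ r₀) c D (I 0) (I 1))⟩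

/-- `r^{2p-2} ∫ |𝔇^k Γ_p|² ≤ C̄` on `S_{u,v}` for `k ≤ 2` and all `Γ_p`.  The integral is taken over
the part of the sphere covered by either chart, so that this is implied by the same bound for the
integral over the whole sphere. -/
def RicciBootstrap (𝔄 : SphereAtlas) (Cbar u v : ℝ) : Prop :=
  ∀ (i : Fin 2) (n : RicciName) (ops : List DOp), ops.length ≤ 2 →
    ENNReal.ofReal ((v - u + r₀) ^ (2 * n.index) / (v - u + r₀) ^ 2) *
      F.patchInt (𝔄.chart i)
        (F.applyOps (𝔄.chart i) r₀ ops (F.ricci (𝔄.chart i) r₀ n)) u v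
      ≤ ENNReal.ofReal Cbar

/-- `∫ |𝔇^k D|² + ∫ |𝔇^k ∇̸_3 D|² + ∫ |𝔇^k r ∇̸_4 D|² ≤ C̄` on `S_{u,v}` for `k ≤ 2`, where `D`
is the difference of the Christoffel symbols; again over the part of the sphere covered by either
chart. -/
def ChristoffelBootstrap (𝔄 : SphereAtlas) (Cbar u v : ℝ) : Prop :=
  ∀ (i : Fin 2) (ops : List DOp), ops.length ≤ 2 →
    F.patchInt (𝔄.chart i)
        (F.applyOps (𝔄.chart i) r₀ ops (F.christoffelDiff (𝔄.chart i) r₀)) u v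
      + F.patchInt (𝔄.chart i)
        (F.applyOps (𝔄.chart i) r₀ (ops ++ [DOp.three])
          (F.christoffelDiff (𝔄.chart i) r₀)) u v
      + F.patchInt (𝔄.chart i)
        (F.applyOps (𝔄.chart i) r₀ (ops ++ [DOp.rFour])
          (F.christoffelDiff (𝔄.chart i) r₀)) u v
      ≤ ENNReal.ofReal Cbar

/-- The initial assumption `|gs_AB - r² γ_AB| ≤ C r` and `|gs^AB - r⁻² γ^AB| ≤ C / r³` in each of
the charts on the initial hypersurfaces `{u = u₀}` and `{v = v₀}`. -/
def InitialMetricBound (𝔄 : SphereAtlas) (C u₀ u' v₀ v' : ℝ) : Prop :=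
  ∀ i, ∀ c ∈ (𝔄.chart i).dom, c 0 ∈ Icc u₀ u' → c 1 ∈ Icc v₀ v' → (c 0 = u₀ ∨ c 1 = v₀) →
    ∀ A B,
      |F.gsMat (𝔄.chart i) c A B - gCirc (𝔄.chart i) r₀ c A B| ≤ C * rad r₀ c ∧
      |(F.gsMat (𝔄.chart i) c)⁻¹ A B - (gCirc (𝔄.chart i) r₀ c)⁻¹ A B| ≤ C / rad r₀ c ^ 3

end Fields

/-! ### Null geodesics and the Vlasov equation -/

namespace Fields

variable (F : Fields)

/-- The component `p³` of a tangent vector `X = p^A e_A + p³ e_3 + p⁴ e_4` at `w`. -/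
def p3 (w X : Event) : ℝ := F.Ω w ^ 2 * X.1

/-- The component `p⁴` of a tangent vector. -/
def p4 (X : Event) : ℝ := X.2.1

/-- The components `p^A` of a tangent vector in a chart. -/
def pS (κ : SphereChart) (w X : Event) : Fin 2 → ℝ :=
  κ.tangentComp (κ.theta w.2.2) (X.2.2 - X.2.1 • F.b w)

/-- The mass shell `P` over the rectangle: the pairs of a point and a future directed null vector
(possibly zero) at that point. -/
def massShell (u₀ u' v₀ v' : ℝ) : Set (Event × Event) :=
  {q | q.1 ∈ rect u₀ u' v₀ v' ∧ inner ℝ q.1.2.2 q.2.2.2 = 0 ∧ F.g q.1 q.2 q.2 = 0 ∧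
    0 ≤ q.2.1 ∧ 0 ≤ q.2.2.1}

/-- `γ` is an affinely parametrised geodesic on `[0, T]`, with velocity `γ'`, in the rectangle: the
geodesic equation holds in each chart. -/
def IsGeodesic (𝔄 : SphereAtlas) (u₀ u' v₀ v' T : ℝ) (γ γ' : ℝ → Event) : Prop :=
  ∀ s ∈ Icc 0 T, γ s ∈ rect u₀ u' v₀ v' ∧ HasDerivWithinAt γ (γ' s) (Icc 0 T) s ∧
    ∀ i, (γ s).2.2 ∈ (𝔄.chart i).range →
      HasDerivWithinAt (fun t => (𝔄.chart i).coordVel (γ t) (γ' t))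
        (fun μ => -∑ α, ∑ β, F.chr4 (𝔄.chart i) ((𝔄.chart i).coord (γ s)) μ α β *
          (𝔄.chart i).coordVel (γ s) (γ' s) α * (𝔄.chart i).coordVel (γ s) (γ' s) β)
        (Icc 0 T) s

/-- A particle density `f : P → [0, ∞)`: a nonnegative continuous function on the mass shell which
solves the Vlasov equation, i.e. is constant along the flow of null geodesics. -/
structure IsVlasov (𝔄 : SphereAtlas) (u₀ u' v₀ v' : ℝ) (f : Event × Event → ℝ) : Prop where
  nonneg : ∀ q ∈ F.massShell u₀ u' v₀ v', 0 ≤ f q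
  continuousOn : ContinuousOn f (F.massShell u₀ u' v₀ v')
  transport : ∀ (T : ℝ) (γ γ' : ℝ → Event), 0 ≤ T → F.IsGeodesic 𝔄 u₀ u' v₀ v' T γ γ' →
    (γ 0, γ' 0) ∈ F.massShell u₀ u' v₀ v' → f (γ T, γ' T) = f (γ 0, γ' 0)

/-- The support of `f` in the mass shell. -/
def supp (u₀ u' v₀ v' : ℝ) (f : Event × Event → ℝ) : Set (Event × Event) :=
  {q | q ∈ F.massShell u₀ u' v₀ v' ∧ q ∈ closure {q | q ∈ F.massShell u₀ u' v₀ v' ∧ f q ≠ 0}}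

/-- The support of the restriction of `f` to the mass shell over `{v = v₀}`. -/
def initialSupp (u₀ u' v₀ v' : ℝ) (f : Event × Event → ℝ) : Set (Event × Event) :=
  {q | q ∈ F.massShell u₀ u' v₀ v' ∧ q.1.2.1 = v₀ ∧
    q ∈ closure {q | q ∈ F.massShell u₀ u' v₀ v' ∧ q.1.2.1 = v₀ ∧ f q ≠ 0}}

/-- The assumption on the initial data of `f`: `f` vanishes over `{u = u₀}`, and
`0 ≤ r² p³ ≤ C₃ p⁴` and `|r² p^A| ≤ C_A p⁴` on the support of `f` over `{v = v₀}`. -/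
def InitialMatterBound (𝔄 : SphereAtlas) (r₀ u₀ u' v₀ v' C₃ : ℝ) (CA : Fin 2 → ℝ)
    (f : Event × Event → ℝ) : Prop :=
  (∀ q ∈ F.massShell u₀ u' v₀ v', q.1.1 = u₀ → f q = 0) ∧
  ∀ q ∈ F.initialSupp u₀ u' v₀ v' f,
    0 ≤ p4 q.2 ∧ 0 ≤ radius r₀ q.1 ^ 2 * F.p3 q.1 q.2 ∧
    radius r₀ q.1 ^ 2 * F.p3 q.1 q.2 ≤ C₃ * p4 q.2 ∧
    ∀ i, q.1.2.2 ∈ (𝔄.chart i).range → ∀ A,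
      |radius r₀ q.1 ^ 2 * F.pS (𝔄.chart i) q.1 q.2 A| ≤ CA A * p4 q.2

end Fields

end DoubleNull

end

/-! The theorem is a bootstrap argument for null geodesics in a spacetime that approaches Minkowski
space as `r` grows. While `p⁴` is comparable to its initial value `P` and `r²p³` is at most of order
`P`, the function `r` increases at a rate at least `P / 4`. A term of size `P² r⁻ᵃ` with `a > 1` in
a geodesic equation then contributes at most a multiple of `P r(0)^(1-a)` after integration. Since
`r(0)` exceeds any prescribed constant once `v₀` is large, all relevant quantities stay as close to
their initial values as desired, and the assumed bounds improve.

Geometry. The `L²` assumptions have to become pointwise bounds with constants that depend only on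
the charts. On a sphere whose metric is comparable to `r²γ`, Kato's inequality along coordinate
lines (`GoodSphere.kato`), used in both coordinate directions, yields the Sobolev inequality
`GoodSphere.sobolev`. The Sobolev inequality bounds `gs - r²γ` by a multiple of `r`, much less than
`r²`, so comparability itself propagates by continuity in `u` from `{u = u₀}`
(`goodSphere_of_bootstrap`). Two derivatives in `L²` then bound all quantities `Γ_p`, the difference
of the connections and its derivative along `e₄` (`ptBound_of_bootstrap`).

The first derivatives of the shift need more, because only two derivatives of `b` lie in `L²` and
the Sobolev inequality does not reach `∂b`. By the formula for `χ`, the second derivatives of `b`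
are expressed through first derivatives of `χ`, the `e₄` derivative of the connection of `gs` and
lower order terms (`metric_mul_pd_pd_shift`). First derivatives of `χ` have square integrable traces
on coordinate lines, and integration of `∂(∂b)²` along one such line gives `|∂b| ≤ K r^(-3/2)`
(`pd_shift_sq_le`). This rate is still integrable in `r`. The outcome is `exists_regBound`.

Geodesics. In Euler–Lagrange form the equations for `p⁴` and for the covariant components `p_A`
contain only the controlled coefficients. The null condition `gs_AB p^A p^B = 4 p³ p⁴` converts the
bound for `p³` into `|p^A| ≤ const · P / r²`. Hence the derivative of `p⁴` is `O(P² r⁻²)`, that of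
`p_A` is `O(P² r^(-3/2))`, and the angles and `u` move by `O(1/r(0))`. Since `gs` is close to `r²γ`,
the rescaled component `r²p^A` is close to `γ^AB p_B`, and `r²p³p⁴ = ¼ p_A r²p^A`; so these too are
almost constant (`exists_geodesic_estimate`). A continuity argument in the affine parameter closes
the estimate (`exists_geodesic_bounds`). It runs in one chart, chosen so that a coordinate ball of
fixed radius about the initial point lies in it. Components in the other chart follow from uniform
continuity of the transition matrix. Zero momentum gives a constant geodesic by uniqueness for
ordinary differential equations (`IsGeodesic.eq_const`).

Support. A nonzero null vector over the rectangle is reached by a null geodesic from `{u = u₀}` or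
`{v = v₀}`: normalised null vectors over the rectangle lie in a compact set of coordinate data, so a
backward extension exists for a uniform time and lowers `u + v` by a uniform amount unless it meets
the initial hypersurfaces (`exists_past_extension`, `exists_past_geodesic`). As `f` is constant
along it and vanishes over `{u = u₀}`, a vector with `f ≠ 0` comes from `S₀`, and the bound for `u`
transfers to the support (`u_le_of_mem_supp`). Since a geodesic must satisfy its equation in every
chart, the backward solution found in one chart is transported by `ChartGeodesic.change_chart`. -/

namespace DoubleNull

/-! ### Charts of the sphere -/

namespace SphereChart

variable (κ : SphereChart)

theorem U_subset_N : κ.U ⊆ κ.N := subset_closure.trans κ.closure_subset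

theorem contDiffAt_phi {θ : Plane} (hθ : θ ∈ κ.N) : ContDiffAt ℝ ∞ κ.Φ θ :=
  κ.smooth.contDiffAt (κ.isOpen_N.mem_nhds hθ)

theorem hasFDerivAt_phi {θ : Plane} (hθ : θ ∈ κ.N) : HasFDerivAt κ.Φ (fderiv ℝ κ.Φ θ) θ :=
  ((κ.contDiffAt_phi hθ).differentiableAt (by simp)).hasFDerivAt

theorem contDiffOn_dPhi (A : Fin 2) : ContDiffOn ℝ ∞ (fun θ => κ.dPhi θ A) κ.N := by
  unfold dPhi
  exact (κ.smooth.fderiv_of_isOpen κ.isOpen_N (by simp)).clm_apply contDiffOn_const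

theorem contDiffOn_round (A B : Fin 2) : ContDiffOn ℝ ∞ (fun θ => κ.round θ A B) κ.N := by
  simp only [round, Matrix.of_apply]
  exact (κ.contDiffOn_dPhi A).inner ℝ (κ.contDiffOn_dPhi B)

theorem fderiv_phi_apply (θ : Plane) (a : Plane) :
    fderiv ℝ κ.Φ θ a = ∑ A, a A • κ.dPhi θ A := by
  have h : a = ∑ A, a A • (Pi.single A (1 : ℝ) : Plane) := by
    ext i; fin_cases i <;> simp
  conv_lhs => rw [h]
  simp [dPhi]

theorem inner_phi_dPhi {θ : Plane} (hθ : θ ∈ κ.N) (A : Fin 2) :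
    inner ℝ (κ.Φ θ) (κ.dPhi θ A) = 0 := by
  have h1 : HasFDerivAt (fun y => inner ℝ (κ.Φ y) (κ.Φ y))
      (((fderivInnerCLM ℝ (κ.Φ θ, κ.Φ θ)).comp ((fderiv ℝ κ.Φ θ).prod (fderiv ℝ κ.Φ θ)))) θ :=
    (κ.hasFDerivAt_phi hθ).inner ℝ (κ.hasFDerivAt_phi hθ)
  have h2 : HasFDerivAt (fun y => inner ℝ (κ.Φ y) (κ.Φ y)) (0 : Plane →L[ℝ] ℝ) θ := by
    refine (hasFDerivAt_const (1 : ℝ) θ).congr_of_eventuallyEq ?_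
    filter_upwards [κ.isOpen_N.mem_nhds hθ] with y hy
    rw [real_inner_self_eq_norm_sq, κ.mem_sphere y hy]; norm_num
  have h3 := congrArg (fun L => L (Pi.single A 1)) (h1.unique h2)
  simp only [ContinuousLinearMap.comp_apply, ContinuousLinearMap.prod_apply,
    fderivInnerCLM_apply, zero_apply] at h3
  rw [real_inner_comm (κ.Φ θ)] at h3
  simp only [dPhi]
  linarith

theorem dPhi_injective {θ : Plane} (hθ : θ ∈ κ.N) {a : Plane}
    (h : ∑ A, a A • κ.dPhi θ A = 0) : a = 0 := by
  rw [← fderiv_phi_apply] at h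
  exact κ.immersion θ hθ (by simpa using h)

theorem round_symm (θ : Plane) (A B : Fin 2) : κ.round θ A B = κ.round θ B A := by
  simp [round, real_inner_comm]

theorem round_quad (θ : Plane) (a : Plane) :
    ∑ A, ∑ B, κ.round θ A B * a A * a B = ‖∑ A, a A • κ.dPhi θ A‖ ^ 2 := by
  rw [← real_inner_self_eq_norm_sq]
  simp only [Fin.sum_univ_two, inner_add_left, inner_add_right, inner_smul_left, inner_smul_right,
    round, Matrix.of_apply]
  simp
  ring

theorem round_pos {θ : Plane} (hθ : θ ∈ κ.N) {a : Plane} (ha : a ≠ 0) :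
    0 < ∑ A, ∑ B, κ.round θ A B * a A * a B := by
  rw [round_quad]
  have : ∑ A, a A • κ.dPhi θ A ≠ 0 := fun h => ha (κ.dPhi_injective hθ h)
  positivity

end SphereChart

/-- Positivity of the determinant of a positive definite two by two matrix. -/
theorem det_pos_of_quad {h : Matrix (Fin 2) (Fin 2) ℝ} (hs : ∀ A B, h A B = h B A)
    (hp : ∀ a : Fin 2 → ℝ, a ≠ 0 → 0 < ∑ A, ∑ B, h A B * a A * a B) : 0 < h.det := by
  have h0 : 0 < h 0 0 := by
    have := hp ![1, 0] (by intro h; simpa using congrFun h 0)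
    simpa [Fin.sum_univ_two] using this
  have h1 := hp ![- h 0 1, h 0 0] (by intro h; have := congrFun h 1; simp at this; linarith)
  simp [Fin.sum_univ_two] at h1
  rw [Matrix.det_fin_two]
  have e := hs 0 1
  rw [← e] at h1 ⊢
  by_contra hcon
  push Not at hcon
  nlinarith [mul_nonneg h0.le (sub_nonneg.2 hcon)]

namespace SphereChart

variable (κ : SphereChart)

theorem round_det_pos {θ : Plane} (hθ : θ ∈ κ.N) : 0 < (κ.round θ).det :=
  det_pos_of_quad (κ.round_symm θ) fun _ ha => κ.round_pos hθ ha

theorem round_isUnit {θ : Plane} (hθ : θ ∈ κ.N) : IsUnit (κ.round θ).det :=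
  (κ.round_det_pos hθ).ne'.isUnit

theorem tangentComp_sum {θ : Plane} (hθ : θ ∈ κ.N) (a : Plane) :
    κ.tangentComp θ (∑ A, a A • κ.dPhi θ A) = a := by
  have : (fun A => inner ℝ (κ.dPhi θ A) (∑ A, a A • κ.dPhi θ A)) = κ.round θ *ᵥ a := by
    ext A
    simp [Fin.sum_univ_two, inner_add_right, real_inner_smul_right, Matrix.mulVec, dotProduct, round, mul_comm]
  rw [tangentComp, this, Matrix.mulVec_mulVec, Matrix.nonsing_inv_mul _ (κ.round_isUnit hθ),
    Matrix.one_mulVec]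

theorem tangentComp_add (θ : Plane) (X Y : E3) :
    κ.tangentComp θ (X + Y) = κ.tangentComp θ X + κ.tangentComp θ Y := by
  simp only [tangentComp, inner_add_right, ← Matrix.mulVec_add]; rfl

theorem tangentComp_smul (θ : Plane) (a : ℝ) (X : E3) :
    κ.tangentComp θ (a • X) = a • κ.tangentComp θ X := by
  simp only [tangentComp, inner_smul_right, ← Matrix.mulVec_smul]; rfl

theorem tangentComp_sub (θ : Plane) (X Y : E3) :
    κ.tangentComp θ (X - Y) = κ.tangentComp θ X - κ.tangentComp θ Y := by
  rw [sub_eq_add_neg, tangentComp_add, ← neg_one_smul ℝ Y, tangentComp_smul]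
  ext; simp [sub_eq_add_neg]

/-- The bijection `(a, t) ↦ a^A ∂_A Φ + t Φ`. -/
theorem frame_bijective {θ : Plane} (hθ : θ ∈ κ.N) :
    Function.Bijective
      ((fderiv ℝ κ.Φ θ).coprod (ContinuousLinearMap.toSpanSingleton ℝ (κ.Φ θ))) := by
  have hinj : Function.Injective
      ((fderiv ℝ κ.Φ θ).coprod (ContinuousLinearMap.toSpanSingleton ℝ (κ.Φ θ))) := by
    rw [injective_iff_map_eq_zero]
    rintro ⟨a, t⟩ h
    simp only [ContinuousLinearMap.coprod_apply, ContinuousLinearMap.toSpanSingleton_apply] at h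
    have h2 := congrArg (fun x => inner ℝ (κ.Φ θ) x) h
    simp only [inner_add_right, inner_smul_right, inner_zero_right, real_inner_self_eq_norm_sq,
      κ.mem_sphere θ hθ, fderiv_phi_apply, inner_sum, κ.inner_phi_dPhi hθ] at h2
    have ht : t = 0 := by simpa using h2
    subst ht
    have : a = 0 := κ.immersion θ hθ (by simpa using h)
    simp [this]
  refine ⟨hinj, ?_⟩
  have := LinearMap.injective_iff_surjective_of_finrank_eq_finrank (K := ℝ)
    (f := (((fderiv ℝ κ.Φ θ).coprod (ContinuousLinearMap.toSpanSingleton ℝ (κ.Φ θ)) :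
      Plane × ℝ →L[ℝ] E3) : Plane × ℝ →ₗ[ℝ] E3)) (by simp)
  exact this.1 hinj

theorem sum_tangentComp {θ : Plane} (hθ : θ ∈ κ.N) {X : E3} (hX : inner ℝ (κ.Φ θ) X = 0) :
    ∑ A, κ.tangentComp θ X A • κ.dPhi θ A = X := by
  obtain ⟨⟨a, t⟩, h⟩ := (κ.frame_bijective hθ).2 X
  simp only [ContinuousLinearMap.coprod_apply, ContinuousLinearMap.toSpanSingleton_apply,
    fderiv_phi_apply] at h
  have h2 := congrArg (fun x => inner ℝ (κ.Φ θ) x) h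
  simp only [inner_add_right, inner_smul_right, real_inner_self_eq_norm_sq,
      κ.mem_sphere θ hθ, inner_sum, κ.inner_phi_dPhi hθ, hX] at h2
  have ht : t = 0 := by simpa using h2
  subst ht
  rw [zero_smul, add_zero] at h
  rw [← h, κ.tangentComp_sum hθ]

theorem theta_phi {θ : Plane} (hθ : θ ∈ κ.U) : κ.theta (κ.Φ θ) = θ :=
  (κ.injOn.mono κ.U_subset_N).leftInvOn_invFunOn hθ

theorem theta_mem {x : E3} (hx : x ∈ κ.range) : κ.theta x ∈ κ.U := Function.invFunOn_mem hx

theorem phi_theta {x : E3} (hx : x ∈ κ.range) : κ.Φ (κ.theta x) = x := Function.invFunOn_eq hx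

/-- A smooth extension of the coordinates to a neighbourhood in `E3` of a point of the sphere. -/
theorem exists_local_coord {θ₀ : Plane} (hθ : θ₀ ∈ κ.N) {O : Set Plane} (hO : IsOpen O)
    (hθO : θ₀ ∈ O) :
    ∃ ψ : E3 → Plane, ContDiffAt ℝ ∞ ψ (κ.Φ θ₀) ∧ ψ (κ.Φ θ₀) = θ₀ ∧
      ∀ᶠ x in nhds (κ.Φ θ₀), ‖x‖ = 1 → κ.Φ (ψ x) = x ∧ ψ x ∈ O := by
  -- Extending the chart homogeneously off the sphere gives a map between three dimensional spaces
  -- with invertible derivative at `(θ₀, 1)`. The inverse function theorem applies to it, and on the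
  -- unit sphere the radial coordinate is forced to be `1`.
  set G : Plane × ℝ → E3 := fun p => p.2 • κ.Φ p.1 with hG
  have hc : ContDiffAt ℝ ∞ G (θ₀, 1) := by
    refine contDiffAt_snd.smul ?_
    exact ContDiffAt.comp (θ₀, (1 : ℝ)) (κ.contDiffAt_phi hθ) contDiffAt_fst
  set e := ContinuousLinearEquiv.ofBijective _
    (LinearMap.ker_eq_bot.2 (κ.frame_bijective hθ).1)
    (LinearMap.range_eq_top.2 (κ.frame_bijective hθ).2) with he
  have hd : HasFDerivAt G (e : Plane × ℝ →L[ℝ] E3) (θ₀, 1) := by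
    have h1 : HasFDerivAt (fun p : Plane × ℝ => κ.Φ p.1)
        ((fderiv ℝ κ.Φ θ₀).comp (ContinuousLinearMap.fst ℝ Plane ℝ)) (θ₀, 1) :=
      HasFDerivAt.comp (θ₀, (1 : ℝ)) (κ.hasFDerivAt_phi hθ) hasFDerivAt_fst
    refine (hasFDerivAt_snd.smul h1).congr_fderiv ?_
    ext p <;> simp [he]
  have hn : (∞ : WithTop ℕ∞) ≠ 0 := by simp
  have hG1 : G (θ₀, 1) = κ.Φ θ₀ := by simp [hG]
  have hl := hc.to_localInverse hd hn
  have hl0 := hc.localInverse_apply_image hd hn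
  have hr : ∀ᶠ x in nhds (G (θ₀, 1)), G (hc.localInverse hd hn x) = x :=
    (hc.hasStrictFDerivAt' hd hn).eventually_right_inverse
  rw [hG1] at hl hl0 hr
  refine ⟨fun x => (hc.localInverse hd hn x).1, contDiffAt_fst.comp _ hl, by simp [hl0], ?_⟩
  have hcont := hl.continuousAt
  have hn1 : ∀ᶠ x in nhds (κ.Φ θ₀), hc.localInverse hd hn x ∈
      {p : Plane × ℝ | p.1 ∈ O ∩ κ.N ∧ 0 < p.2} := by
    apply hcont
    rw [hl0]
    refine IsOpen.mem_nhds ?_ ⟨⟨hθO, hθ⟩, one_pos⟩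
    exact ((hO.inter κ.isOpen_N).preimage continuous_fst).inter
      (isOpen_lt continuous_const continuous_snd)
  filter_upwards [hr, hn1] with x hx ⟨⟨hxO, hxN⟩, hx0⟩ hx1
  refine ⟨?_, hxO⟩
  have h2 : ‖(hc.localInverse hd hn x).2 • κ.Φ (hc.localInverse hd hn x).1‖ = 1 :=
    (congrArg norm hx).trans hx1
  rw [norm_smul, κ.mem_sphere _ hxN, mul_one, Real.norm_of_nonneg hx0.le] at h2
  have h3 := hx
  simp only [hG] at h3
  rwa [h2, one_smul] at h3

/-- Near a point of the chart range, the coordinates agree on the sphere with a smooth function. -/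
theorem exists_theta_extension {x₀ : E3} (hx : x₀ ∈ κ.range) :
    ∃ ψ : E3 → Plane, ContDiffAt ℝ ∞ ψ x₀ ∧
      ∀ᶠ x in nhds x₀, ‖x‖ = 1 → κ.theta x = ψ x ∧ x ∈ κ.range := by
  have hU := κ.theta_mem hx
  obtain ⟨ψ, h1, -, h3⟩ := κ.exists_local_coord (κ.U_subset_N hU) κ.isOpen_U hU
  rw [κ.phi_theta hx] at h1 h3
  refine ⟨ψ, h1, h3.mono fun x h hx1 => ?_⟩
  obtain ⟨h4, h5⟩ := h hx1
  exact ⟨by conv_lhs => rw [← h4, κ.theta_phi h5], ⟨_, h5, h4⟩⟩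

theorem eventually_mem_range {x₀ : E3} (hx : x₀ ∈ κ.range) :
    ∀ᶠ x in nhds x₀, ‖x‖ = 1 → x ∈ κ.range := by
  obtain ⟨ψ, -, h⟩ := κ.exists_theta_extension hx
  exact h.mono fun x hx h1 => (hx h1).2

end SphereChart

/-! ### Compact cores of the charts -/

/-- Compact pieces of the two coordinate domains which cover the sphere, together with a margin. -/
structure Cover (𝔄 : SphereAtlas) where
  K : Fin 2 → Set Plane
  ℓ : ℝ
  isCompact : ∀ j, IsCompact (K j)
  pos : 0 < ℓ
  thick : ∀ j, Metric.cthickening (3 * ℓ) (K j) ⊆ (𝔄.chart j).U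
  cover : ∀ x : E3, ‖x‖ = 1 → ∃ j, ∃ θ ∈ K j, (𝔄.chart j).Φ θ = x

/-- Compactness of the sphere: near each point a small closed coordinate ball suffices, and finite
unions preserve the property. The margin is cut into three parts `ℓ`. The first is the room in which
a geodesic moves, the second contains the lines on which `∂b` is integrated, and the third contains
the squares of the Sobolev inequality at points of those lines. -/
theorem exists_cover (𝔄 : SphereAtlas) : Nonempty (Cover 𝔄) := by
  have key : ∃ K : Fin 2 → Set Plane, (∀ j, IsCompact (K j)) ∧ (∀ j, K j ⊆ (𝔄.chart j).U) ∧
      ∀ x ∈ Metric.sphere (0 : E3) 1, ‖x‖ = 1 → ∃ j, ∃ θ ∈ K j, (𝔄.chart j).Φ θ = x := by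
    refine IsCompact.induction_on (p := fun s => ∃ K : Fin 2 → Set Plane, (∀ j, IsCompact (K j)) ∧
      (∀ j, K j ⊆ (𝔄.chart j).U) ∧ ∀ x ∈ s, ‖x‖ = 1 → ∃ j, ∃ θ ∈ K j, (𝔄.chart j).Φ θ = x)
      (isCompact_sphere (0 : E3) 1) ?_ ?_ ?_ ?_
    · exact ⟨fun _ => ∅, fun _ => isCompact_empty, fun _ => empty_subset _, by simp⟩
    · rintro s t hst ⟨K, h1, h2, h3⟩
      exact ⟨K, h1, h2, fun x hx => h3 x (hst hx)⟩
    · rintro s t ⟨K, h1, h2, h3⟩ ⟨K', h1', h2', h3'⟩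
      refine ⟨fun j => K j ∪ K' j, fun j => (h1 j).union (h1' j),
        fun j => union_subset (h2 j) (h2' j), ?_⟩
      rintro x (hx | hx) hx1
      · obtain ⟨j, θ, h, e⟩ := h3 x hx hx1
        exact ⟨j, θ, Or.inl h, e⟩
      · obtain ⟨j, θ, h, e⟩ := h3' x hx hx1
        exact ⟨j, θ, Or.inr h, e⟩
    · intro x hx
      obtain ⟨j, θ, hθ, rfl⟩ := 𝔄.cover x (by simpa using hx)
      obtain ⟨ρ, hρ, hb⟩ := Metric.nhds_basis_closedBall.mem_iff.1
        ((𝔄.chart j).isOpen_U.mem_nhds hθ)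
      obtain ⟨ψ, -, -, h⟩ := (𝔄.chart j).exists_local_coord ((𝔄.chart j).U_subset_N hθ)
        Metric.isOpen_ball (Metric.mem_ball_self hρ)
      refine ⟨_, mem_nhdsWithin_of_mem_nhds h, fun i => if i = j then Metric.closedBall θ ρ else ∅,
        fun i => ?_, fun i => ?_, ?_⟩
      · dsimp only
        split_ifs
        · exact isCompact_closedBall _ _
        · exact isCompact_empty
      · dsimp only
        split_ifs with hi
        · rw [hi]; exact hb
        · exact empty_subset _
      · intro y hy hy1
        obtain ⟨h4, h5⟩ := hy hy1
        exact ⟨j, ψ y, by simpa using Metric.ball_subset_closedBall h5, h4⟩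
  obtain ⟨K, h1, h2, h3⟩ := key
  have hd : ∀ j, ∃ δ, 0 < δ ∧ Metric.cthickening δ (K j) ⊆ (𝔄.chart j).U := fun j =>
    (h1 j).exists_cthickening_subset_open (𝔄.chart j).isOpen_U (h2 j)
  choose δ hδ hδ' using hd
  refine ⟨⟨K, min (δ 0) (δ 1) / 3, h1, by have := hδ 0; have := hδ 1; positivity, fun j => ?_,
    fun x hx => h3 x (by simpa using hx) hx⟩⟩
  refine (Metric.cthickening_mono ?_ _).trans (hδ' j)
  have : min (δ 0) (δ 1) ≤ δ j := by fin_cases j <;> simp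
  linarith

end DoubleNull


namespace DoubleNull

/-! ### Calculus with coordinate derivatives -/

theorem pd_congr {μ : Fin 4} {f g : Pt → ℝ} {c : Pt} {s : Set Pt} (hs : IsOpen s) (hc : c ∈ s)
    (h : ∀ y ∈ s, f y = g y) : pd μ f c = pd μ g c := by
  unfold pd
  rw [Filter.EventuallyEq.fderiv_eq (f₁ := f) (f := g)]
  filter_upwards [hs.mem_nhds hc] with y hy using h y hy

theorem pd_const (μ : Fin 4) (a : ℝ) (c : Pt) : pd μ (fun _ => a) c = 0 := by simp [pd]

theorem pd_add {μ : Fin 4} {f g : Pt → ℝ} {c : Pt} (hf : DifferentiableAt ℝ f c)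
    (hg : DifferentiableAt ℝ g c) : pd μ (fun y => f y + g y) c = pd μ f c + pd μ g c := by
  simp only [pd, fderiv_fun_add hf hg, add_apply]

theorem pd_sub {μ : Fin 4} {f g : Pt → ℝ} {c : Pt} (hf : DifferentiableAt ℝ f c)
    (hg : DifferentiableAt ℝ g c) : pd μ (fun y => f y - g y) c = pd μ f c - pd μ g c := by
  simp only [pd, fderiv_fun_sub hf hg, sub_apply]

theorem pd_mul {μ : Fin 4} {f g : Pt → ℝ} {c : Pt} (hf : DifferentiableAt ℝ f c)
    (hg : DifferentiableAt ℝ g c) :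
    pd μ (fun y => f y * g y) c = pd μ f c * g c + f c * pd μ g c := by
  simp only [pd, fderiv_fun_mul hf hg, add_apply, smul_apply, smul_eq_mul]
  ring

theorem pd_mul_const {μ : Fin 4} {f : Pt → ℝ} {c : Pt} (hf : DifferentiableAt ℝ f c) (a : ℝ) :
    pd μ (fun y => f y * a) c = pd μ f c * a := by
  rw [pd_mul hf (by fun_prop), pd_const, mul_zero, add_zero]

theorem pd_const_mul {μ : Fin 4} {f : Pt → ℝ} {c : Pt} (hf : DifferentiableAt ℝ f c) (a : ℝ) :
    pd μ (fun y => a * f y) c = a * pd μ f c := by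
  rw [pd_mul (by fun_prop) hf, pd_const, zero_mul, zero_add]

theorem pd_sum {ι : Type*} {s : Finset ι} {μ : Fin 4} {f : ι → Pt → ℝ} {c : Pt}
    (hf : ∀ i ∈ s, DifferentiableAt ℝ (f i) c) :
    pd μ (fun y => ∑ i ∈ s, f i y) c = ∑ i ∈ s, pd μ (f i) c := by
  simp only [pd, fderiv_fun_sum hf, sum_apply]

theorem pd_inv {μ : Fin 4} {f : Pt → ℝ} {c : Pt} (hf : DifferentiableAt ℝ f c) (h0 : f c ≠ 0) :
    pd μ (fun y => 1 / f y) c = - pd μ f c / f c ^ 2 := by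
  have h : HasFDerivAt (fun y => (f y)⁻¹) (-(f c ^ 2)⁻¹ • fderiv ℝ f c) c :=
    (hasDerivAt_inv h0).comp_hasFDerivAt c hf.hasFDerivAt
  simp only [pd, one_div, h.fderiv, smul_apply, smul_eq_mul]
  ring

theorem contDiffOn_pd {f : Pt → ℝ} {s : Set Pt} (hs : IsOpen s) (hf : ContDiffOn ℝ ∞ f s)
    (μ : Fin 4) : ContDiffOn ℝ ∞ (pd μ f) s :=
  (hf.fderiv_of_isOpen hs (by simp)).clm_apply contDiffOn_const

theorem _root_.ContDiffOn.diffAt {f : Pt → ℝ} {s : Set Pt} (hf : ContDiffOn ℝ ∞ f s)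
    (hs : IsOpen s) {c : Pt} (hc : c ∈ s) : DifferentiableAt ℝ f c :=
  (hf.contDiffAt (hs.mem_nhds hc)).differentiableAt (by simp)

theorem pd_comm {f : Pt → ℝ} {s : Set Pt} (hs : IsOpen s) (hf : ContDiffOn ℝ ∞ f s) {c : Pt}
    (hc : c ∈ s) (μ ν : Fin 4) : pd μ (pd ν f) c = pd ν (pd μ f) c := by
  have h1 : ContDiffAt ℝ ∞ f c := hf.contDiffAt (hs.mem_nhds hc)
  have h2 : DifferentiableAt ℝ (fderiv ℝ f) c :=
    ((hf.fderiv_of_isOpen (m := ∞) hs (by simp)).contDiffAt (hs.mem_nhds hc)).differentiableAt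
      (by simp)
  have h3 : ∀ α β, pd α (pd β f) c = fderiv ℝ (fderiv ℝ f) c (Pi.single α 1) (Pi.single β 1) := by
    intro α β
    unfold pd
    rw [fderiv_clm_apply h2 (by fun_prop)]
    simp
  rw [h3, h3]
  exact (h1.isSymmSndFDerivAt (by simpa using (WithTop.coe_le_coe.2 le_top : ((2 : ℕ∞) : WithTop ℕ∞) ≤ ((⊤ : ℕ∞) : WithTop ℕ∞)))).eq _ _

theorem contDiffOn_finprod {ι : Type*} {s : Finset ι} {f : ι → Pt → ℝ} {R : Set Pt}
    (hf : ∀ i ∈ s, ContDiffOn ℝ ∞ (f i) R) : ContDiffOn ℝ ∞ (fun c => ∏ i ∈ s, f i c) R :=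
  contDiffOn_prod hf

theorem contDiffOn_det {ι : Type*} [Fintype ι] [DecidableEq ι] {R : Set Pt}
    {M : Pt → Matrix ι ι ℝ} (h : ∀ i j, ContDiffOn ℝ ∞ (fun c => M c i j) R) :
    ContDiffOn ℝ ∞ (fun c => (M c).det) R := by
  simp only [Matrix.det_apply']
  exact ContDiffOn.sum fun σ _ => contDiffOn_const.mul (contDiffOn_finprod fun i _ => h _ _)

theorem contDiffOn_matInv {ι : Type*} [Fintype ι] [DecidableEq ι] {R : Set Pt}
    {M : Pt → Matrix ι ι ℝ} (h : ∀ i j, ContDiffOn ℝ ∞ (fun c => M c i j) R)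
    (h0 : ∀ c ∈ R, (M c).det ≠ 0) (i j : ι) : ContDiffOn ℝ ∞ (fun c => (M c)⁻¹ i j) R := by
  simp only [Matrix.inv_def, Matrix.smul_apply, Ring.inverse_eq_inv', smul_eq_mul,
    Matrix.adjugate_apply]
  refine ((contDiffOn_det h).inv h0).mul (contDiffOn_det fun k l => ?_)
  simp only [Matrix.updateRow_apply]
  split_ifs
  · exact contDiffOn_const
  · exact h k l

theorem contDiffOn_christoffel {ι : Type} [Fintype ι] [DecidableEq ι] {R : Set Pt} (hR : IsOpen R)
    (dir : ι → Fin 4) {M : Pt → Matrix ι ι ℝ} (h : ∀ i j, ContDiffOn ℝ ∞ (fun c => M c i j) R)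
    (h0 : ∀ c ∈ R, (M c).det ≠ 0) (k i j : ι) :
    ContDiffOn ℝ ∞ (fun c => christoffel dir M c k i j) R := by
  unfold christoffel
  exact contDiffOn_const.mul (ContDiffOn.sum fun l _ => (contDiffOn_matInv h h0 k l).mul
    (((contDiffOn_pd hR (h l j) _).add (contDiffOn_pd hR (h l i) _)).sub
      (contDiffOn_pd hR (h i j) _)))

/-- Lowering the upper index of the Christoffel symbols. -/
theorem sum_mul_christoffel {ι : Type} [Fintype ι] [DecidableEq ι] (dir : ι → Fin 4)
    (h : Pt → Matrix ι ι ℝ) (c : Pt) (hd : (h c).det ≠ 0) (m i j : ι) :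
    ∑ k, h c m k * christoffel dir h c k i j =
      1 / 2 * (pd (dir i) (fun y => h y m j) c + pd (dir j) (fun y => h y m i) c
        - pd (dir m) (fun y => h y i j) c) := by
  unfold christoffel
  set X : ι → ℝ := fun l => pd (dir i) (fun y => h y l j) c + pd (dir j) (fun y => h y l i) c
        - pd (dir l) (fun y => h y i j) c with hX
  have h1 : ∑ k, h c m k * (1 / 2 * ∑ l, (h c)⁻¹ k l * X l)
      = 1 / 2 * (h c *ᵥ ((h c)⁻¹ *ᵥ X)) m := by
    simp only [Matrix.mulVec, dotProduct, Finset.mul_sum]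
    exact Finset.sum_congr rfl fun k _ => Finset.sum_congr rfl fun l _ => by ring
  rw [h1, Matrix.mulVec_mulVec, Matrix.mul_nonsing_inv _ (Ne.isUnit hd), Matrix.one_mulVec]

/-! ### The metric in coordinates -/

theorem continuous_ang : Continuous ang := by
  unfold ang; fun_prop

theorem contDiff_ang : ContDiff ℝ ∞ ang := by
  unfold ang
  rw [contDiff_pi]
  intro i
  fin_cases i <;> simp <;> fun_prop

theorem ang_mkPt (u v : ℝ) (θ : Plane) : ang (mkPt u v θ) = θ := by
  ext i; fin_cases i <;> simp [ang, mkPt]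

theorem mkPt_ang (c : Pt) : mkPt (c 0) (c 1) (ang c) = c := by
  ext i; fin_cases i <;> simp [ang, mkPt]

theorem mkPt_zero (u v : ℝ) (θ : Plane) : mkPt u v θ 0 = u := by simp [mkPt]
theorem mkPt_one (u v : ℝ) (θ : Plane) : mkPt u v θ 1 = v := by simp [mkPt]
theorem mkPt_sph (u v : ℝ) (θ : Plane) (A : Fin 2) : mkPt u v θ (sph A) = θ A := by
  fin_cases A <;> simp [mkPt, sph]

theorem ang_apply (c : Pt) (A : Fin 2) : ang c A = c (sph A) := by
  fin_cases A <;> simp [ang, sph]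

namespace SphereChart

variable (κ : SphereChart)

theorem isOpen_dom : IsOpen κ.dom := κ.isOpen_U.preimage continuous_ang

end SphereChart

/-- The properties of the fields in a chart which follow from `IsDoubleNull`. -/
structure ChartFields (F : Fields) (κ : SphereChart) : Prop where
  smooth_lapse : ContDiffOn ℝ ∞ (fun c => F.Ω (κ.place c)) κ.dom
  smooth_shift : ∀ A, ContDiffOn ℝ ∞ (fun c => F.shift κ c A) κ.dom
  smooth_gs : ∀ A B, ContDiffOn ℝ ∞ (fun c => F.gsMat κ c A B) κ.dom
  symm : ∀ c ∈ κ.dom, ∀ A B, F.gsMat κ c A B = F.gsMat κ c B A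
  shift_eq : ∀ c ∈ κ.dom, ∑ A, F.shift κ c A • κ.dPhi (ang c) A = F.b (κ.place c)

namespace Fields

variable {F : Fields} {𝔄 : SphereAtlas} {u₀ u' v₀ v' : ℝ}

theorem IsDoubleNull.chartFields (hF : F.IsDoubleNull 𝔄 u₀ u' v₀ v') (i : Fin 2) :
    ChartFields F (𝔄.chart i) := by
  set κ := 𝔄.chart i
  have hN : ∀ c ∈ κ.dom, ang c ∈ κ.N := fun c hc => κ.U_subset_N hc
  have hn : ∀ c ∈ κ.dom, ‖(κ.place c).2.2‖ = 1 := fun c hc => κ.mem_sphere _ (hN c hc)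
  refine ⟨hF.smooth_lapse i, fun A => ?_, hF.smooth_gs i, fun c hc A B => ?_, fun c hc => ?_⟩
  · simp only [shift, SphereChart.tangentComp, Matrix.mulVec, dotProduct]
    refine ContDiffOn.sum fun B _ => ContDiffOn.mul ?_ ?_
    · refine contDiffOn_matInv (M := fun c => κ.round (ang c)) (fun A B => ?_)
        (fun c hc => (κ.round_det_pos (hN c hc)).ne') A B
      exact (κ.contDiffOn_round A B).comp contDiff_ang.contDiffOn hN
    · exact ((κ.contDiffOn_dPhi B).comp contDiff_ang.contDiffOn hN).inner ℝ (hF.smooth_shift i)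
  · exact hF.gs_symm _ (hn c hc) _ _ (κ.inner_phi_dPhi (hN c hc) A) (κ.inner_phi_dPhi (hN c hc) B)
  · exact κ.sum_tangentComp (hN c hc) (hF.shift_tangent _ (hn c hc))

end Fields

namespace Fields

variable (F : Fields) (κ : SphereChart)

/-- The components `X^A - b^A X^v` of a vector. -/
noncomputable def sp (c : Pt) (X : Fin 4 → ℝ) (A : Fin 2) : ℝ := X (sph A) - F.shift κ c A * X 1

/-- The contraction `∂_μ g_αβ X^α Y^β`. -/
noncomputable def dG (c : Pt) (μ : Fin 4) (X Y : Fin 4 → ℝ) : ℝ :=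
  ∑ α, ∑ β, pd μ (fun y => F.gMat κ y α β) c * X α * Y β

/-- The square of the lapse. -/
noncomputable def lapseSq (c : Pt) : ℝ := F.Ω (κ.place c) ^ 2

/-- The coordinate points at which the metric is regular and `r ≠ 0`. -/
noncomputable def reg (r₀ : ℝ) : Set Pt :=
  {c | c ∈ κ.dom ∧ F.Ω (κ.place c) ≠ 0 ∧ (F.gsMat κ c).det ≠ 0 ∧ rad r₀ c ≠ 0}

end Fields

theorem sum_smul_dPlace (κ : SphereChart) (c : Pt) (X : Fin 4 → ℝ) :
    ∑ μ, X μ • κ.dPlace c μ = (X 0, X 1, ∑ A, X (sph A) • κ.dPhi (ang c) A) := by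
  simp [Fin.sum_univ_four, SphereChart.dPlace, sph]

namespace Fields

theorem g_sum (F : Fields) (w : Event) (X Y : Fin 4 → ℝ) (e : Fin 4 → Event) :
    F.g w (∑ μ, X μ • e μ) (∑ ν, Y ν • e ν) = ∑ μ, ∑ ν, F.g w (e μ) (e ν) * X μ * Y ν := by
  simp only [Fin.sum_univ_four, g, Prod.fst_add, Prod.snd_add, Prod.smul_fst, Prod.smul_snd,
    smul_eq_mul, add_smul, map_add, map_sub, map_smul, LinearMap.add_apply, LinearMap.sub_apply,
    LinearMap.smul_apply, mul_smul]
  ring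

variable {F : Fields} {κ : SphereChart} (hF : ChartFields F κ)
include hF

theorem g_frame {c : Pt} (hc : c ∈ κ.dom) (X Y : Fin 4 → ℝ) :
    F.g (κ.place c) (∑ μ, X μ • κ.dPlace c μ) (∑ μ, Y μ • κ.dPlace c μ) =
      -2 * F.lapseSq κ c * (X 0 * Y 1 + X 1 * Y 0)
        + ∑ A, ∑ B, F.gsMat κ c A B * F.sp κ c X A * F.sp κ c Y B := by
  rw [sum_smul_dPlace, sum_smul_dPlace, g, ← hF.shift_eq c hc]
  simp only [sp, gsMat, Matrix.of_apply, lapseSq, Fin.sum_univ_two, smul_add, map_add, map_sub,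
    map_smul, LinearMap.add_apply, LinearMap.sub_apply, LinearMap.smul_apply, smul_eq_mul]
  ring

/-- In the components `X^u`, `X^v`, `X^A - b^A X^v` the metric splits into a null part and a
spherical part. All coordinate formulas below are computed from this form instead of the four by
four matrix. -/
theorem ip_eq {c : Pt} (hc : c ∈ κ.dom) (X Y : Fin 4 → ℝ) :
    F.ip κ c X Y = -2 * F.lapseSq κ c * (X 0 * Y 1 + X 1 * Y 0)
        + ∑ A, ∑ B, F.gsMat κ c A B * F.sp κ c X A * F.sp κ c Y B := by
  rw [← g_frame hF hc, g_sum]; rfl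

end Fields
end DoubleNull


/-! ### Derivatives of the metric coefficients and Koszul's formula -/

namespace DoubleNull

/-- The product rule for the double null form with frozen vectors, stated for arbitrary coefficient
functions so that the lapse, shift and sphere metric remain opaque during the computation. -/
theorem pd_metric_form {W : Pt → ℝ} {H : Fin 2 → Fin 2 → Pt → ℝ} {b : Fin 2 → Pt → ℝ} {c : Pt}
    (hW : DifferentiableAt ℝ W c) (hH : ∀ A B, DifferentiableAt ℝ (H A B) c)
    (hb : ∀ A, DifferentiableAt ℝ (b A) c) (μ : Fin 4) (x0 x1 y0 y1 : ℝ) (x y : Fin 2 → ℝ) :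
    pd μ (fun z => -2 * W z * (x0 * y1 + x1 * y0)
      + ∑ A, ∑ B, H A B z * (x A - b A z * x1) * (y B - b B z * y1)) c =
    -2 * pd μ W c * (x0 * y1 + x1 * y0)
      + ∑ A, ∑ B, pd μ (H A B) c * (x A - b A c * x1) * (y B - b B c * y1)
      - ∑ A, ∑ B, H A B c * (pd μ (b A) c * x1 * (y B - b B c * y1)
          + (x A - b A c * x1) * (pd μ (b B) c * y1)) := by
  have hs : ∀ A (t s : ℝ), DifferentiableAt ℝ (fun z => t - b A z * s) c := fun A t s =>
    (differentiableAt_const _).sub ((hb A).mul_const _)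
  have ds : ∀ A (t s : ℝ), pd μ (fun z => t - b A z * s) c = - (pd μ (b A) c * s) := fun A t s => by
    rw [pd_sub (differentiableAt_const _) ((hb A).mul_const _), pd_const, pd_mul_const (hb A)]; ring
  have hT : ∀ A B, DifferentiableAt ℝ (fun z => H A B z * (x A - b A z * x1) * (y B - b B z * y1)) c :=
    fun A B => ((hH A B).mul (hs _ _ _)).mul (hs _ _ _)
  have dT : ∀ A B, pd μ (fun z => H A B z * (x A - b A z * x1) * (y B - b B z * y1)) c =
      pd μ (H A B) c * (x A - b A c * x1) * (y B - b B c * y1)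
       - H A B c * (pd μ (b A) c * x1 * (y B - b B c * y1)
          + (x A - b A c * x1) * (pd μ (b B) c * y1)) := fun A B => by
    rw [pd_mul ((hH A B).fun_mul (hs _ _ _)) (hs _ _ _), pd_mul (hH A B) (hs _ _ _), ds, ds]; ring
  rw [pd_add ((hW.const_mul _).mul_const _) (DifferentiableAt.fun_sum fun A _ =>
      DifferentiableAt.fun_sum fun B _ => hT A B), pd_mul_const (hW.const_mul _), pd_const_mul hW,
    pd_sum fun A _ => DifferentiableAt.fun_sum fun B _ => hT A B]
  simp only [pd_sum fun B _ => hT _ B, dT, Finset.sum_sub_distrib]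
  ring

namespace Fields

variable {F : Fields} {κ : SphereChart} (hF : ChartFields F κ)

theorem sp_single_sph (F : Fields) (κ : SphereChart) (c : Pt) (A B : Fin 2) :
    F.sp κ c (Pi.single (sph A) 1) B = if A = B then 1 else 0 := by
  fin_cases A <;> fin_cases B <;> simp [sp, sph]

theorem gMat_eq_ip (F : Fields) (κ : SphereChart) (c : Pt) (α β : Fin 4) :
    F.gMat κ c α β = F.ip κ c (Pi.single α 1) (Pi.single β 1) := by
  simp [ip, Pi.single_apply]

include hF

theorem smooth_lapseSq : ContDiffOn ℝ ∞ (F.lapseSq κ) κ.dom := hF.smooth_lapse.pow 2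

theorem smooth_gMat (α β : Fin 4) : ContDiffOn ℝ ∞ (fun c => F.gMat κ c α β) κ.dom := by
  have : ∀ c ∈ κ.dom, F.gMat κ c α β = _ := fun c hc =>
    (gMat_eq_ip F κ c α β).trans (ip_eq hF hc _ _)
  refine ContDiffOn.congr ?_ this
  have hs : ∀ (X : Fin 4 → ℝ) A, ContDiffOn ℝ ∞ (fun c => F.sp κ c X A) κ.dom := fun X A => by
    unfold sp
    exact contDiffOn_const.sub ((hF.smooth_shift A).mul contDiffOn_const)
  exact ((contDiffOn_const.mul (smooth_lapseSq hF)).mul contDiffOn_const).add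
    (ContDiffOn.sum fun A _ => ContDiffOn.sum fun B _ =>
      ((hF.smooth_gs A B).mul (hs _ _)).mul (hs _ _))

theorem gMat_symm {c : Pt} (hc : c ∈ κ.dom) (α β : Fin 4) : F.gMat κ c α β = F.gMat κ c β α := by
  rw [gMat_eq_ip, gMat_eq_ip, ip_eq hF hc, ip_eq hF hc]
  simp only [Fin.sum_univ_two, hF.symm c hc 1 0]
  ring

theorem dG_eq {c : Pt} (hc : c ∈ κ.dom) (μ : Fin 4) (X Y : Fin 4 → ℝ) :
    F.dG κ c μ X Y = -2 * pd μ (F.lapseSq κ) c * (X 0 * Y 1 + X 1 * Y 0)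
      + ∑ A, ∑ B, pd μ (fun y => F.gsMat κ y A B) c * F.sp κ c X A * F.sp κ c Y B
      - ∑ A, ∑ B, F.gsMat κ c A B * (pd μ (fun y => F.shift κ y A) c * X 1 * F.sp κ c Y B
          + F.sp κ c X A * (pd μ (fun y => F.shift κ y B) c * Y 1)) := by
  have hO := κ.isOpen_dom
  -- The components of `X` and `Y` are constants here, so the contraction of `∂_μ g` is the
  -- derivative of the scalar product, to which the double null form applies.
  have h1 : F.dG κ c μ X Y = pd μ (fun y => F.ip κ y X Y) c := by
    have hd : ∀ α β, DifferentiableAt ℝ (fun y => F.gMat κ y α β) c := fun α β =>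
      (smooth_gMat hF α β).diffAt hO hc
    unfold dG ip
    rw [pd_sum fun α _ => DifferentiableAt.fun_sum fun β _ => ((hd α β).mul_const _).mul_const _]
    refine Finset.sum_congr rfl fun α _ => ?_
    rw [pd_sum fun β _ => ((hd α β).mul_const _).mul_const _]
    refine Finset.sum_congr rfl fun β _ => ?_
    rw [pd_mul_const ((hd α β).mul_const _), pd_mul_const (hd α β)]
  rw [h1, pd_congr hO hc fun y hy => ip_eq hF hy X Y]
  exact pd_metric_form ((smooth_lapseSq hF).diffAt hO hc)
    (fun A B => (hF.smooth_gs A B).diffAt hO hc) (fun A => (hF.smooth_shift A).diffAt hO hc) μ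
    (X 0) (X 1) (Y 0) (Y 1) (fun A => X (sph A)) (fun A => Y (sph A))

/-- The sign reflects the Lorentzian signature. What is used is that the determinant does not vanish
where the lapse and `det gs` do not, so that Christoffel symbols can be lowered. -/
theorem det_gMat {c : Pt} (hc : c ∈ κ.dom) :
    (F.gMat κ c).det = -4 * F.lapseSq κ c ^ 2 * (F.gsMat κ c).det := by
  have : ∀ α β, F.gMat κ c α β = _ := fun α β => (gMat_eq_ip F κ c α β).trans (ip_eq hF hc _ _)
  rw [Matrix.det_succ_row_zero, Matrix.det_fin_two]
  simp [Fin.sum_univ_succ, Matrix.det_fin_three, Matrix.submatrix_apply, Fin.succAbove, this, sp, sph,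
    hF.symm c hc 1 0]
  ring

theorem isOpen_reg (r₀ : ℝ) : IsOpen (F.reg κ r₀) := by
  have h1 : ContinuousOn (fun c => (F.Ω (κ.place c), (F.gsMat κ c).det, rad r₀ c)) κ.dom := by
    refine hF.smooth_lapse.continuousOn.prodMk
      ((contDiffOn_det hF.smooth_gs).continuousOn.prodMk ?_)
    unfold rad
    fun_prop
  have h2 := h1.isOpen_inter_preimage κ.isOpen_dom
    (t := {p : ℝ × ℝ × ℝ | p.1 ≠ 0 ∧ p.2.1 ≠ 0 ∧ p.2.2 ≠ 0}) (by
      refine (isOpen_ne_fun continuous_fst continuous_const).inter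
        ((isOpen_ne_fun (by fun_prop) continuous_const).inter
          (isOpen_ne_fun (by fun_prop) continuous_const)))
  exact h2

omit hF in
theorem reg_subset_dom (r₀ : ℝ) : F.reg κ r₀ ⊆ κ.dom := fun _ h => h.1

theorem det_gMat_ne {r₀ : ℝ} {c : Pt} (hc : c ∈ F.reg κ r₀) : (F.gMat κ c).det ≠ 0 := by
  rw [det_gMat hF hc.1]
  have h1 := hc.2.1
  have h2 := hc.2.2.1
  simp only [lapseSq]
  positivity

theorem gMat_chr4 {r₀ : ℝ} {c : Pt} (hc : c ∈ F.reg κ r₀) (μ α β : Fin 4) :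
    ∑ ν, F.gMat κ c μ ν * F.chr4 κ c ν α β =
      1 / 2 * (pd α (fun y => F.gMat κ y μ β) c + pd β (fun y => F.gMat κ y μ α) c
        - pd μ (fun y => F.gMat κ y α β) c) :=
  sum_mul_christoffel id (F.gMat κ) c (det_gMat_ne hF hc) μ α β

/-- The contraction `g(Γ(X, Y), Z)`. -/
theorem ip_chr4 {r₀ : ℝ} {c : Pt} (hc : c ∈ F.reg κ r₀) (X Y Z : Fin 4 → ℝ) :
    F.ip κ c (fun μ => ∑ α, ∑ β, F.chr4 κ c μ α β * X α * Y β) Z =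
      1 / 2 * ∑ α, (X α * F.dG κ c α Y Z + Y α * F.dG κ c α X Z - Z α * F.dG κ c α X Y) := by
  have h1 : F.ip κ c (fun μ => ∑ α, ∑ β, F.chr4 κ c μ α β * X α * Y β) Z =
      ∑ α, ∑ β, ∑ ν, X α * Y β * Z ν * (∑ μ, F.gMat κ c ν μ * F.chr4 κ c μ α β) := by
    unfold ip
    simp only [Finset.mul_sum, Finset.sum_mul]
    rw [Finset.sum_comm' (t' := Finset.univ) (s' := fun _ => Finset.univ) (by simp)]
    rw [Finset.sum_congr rfl fun ν _ => Finset.sum_comm]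
    rw [Finset.sum_comm]
    refine Finset.sum_congr rfl fun α _ => ?_
    rw [Finset.sum_congr rfl fun ν _ => Finset.sum_comm]
    rw [Finset.sum_comm]
    refine Finset.sum_congr rfl fun β _ => Finset.sum_congr rfl fun ν _ =>
      Finset.sum_congr rfl fun μ _ => ?_
    rw [gMat_symm hF hc.1 μ ν]
    ring
  rw [h1]
  simp only [gMat_chr4 hF hc]
  have hsum : ∀ f : Fin 4 → Fin 4 → Fin 4 → ℝ, ∑ α, ∑ β, ∑ ν, f α β ν = ∑ β, ∑ α, ∑ ν, f α β ν :=
    fun f => Finset.sum_comm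
  have e1 : ∑ α, X α * F.dG κ c α Y Z =
      ∑ α, ∑ β, ∑ ν, X α * Y β * Z ν * pd α (fun y => F.gMat κ y ν β) c := by
    simp only [dG, Finset.mul_sum]
    refine Finset.sum_congr rfl fun α _ => Finset.sum_congr rfl fun β _ =>
      Finset.sum_congr rfl fun ν _ => ?_
    rw [pd_congr κ.isOpen_dom hc.1 fun y hy => gMat_symm hF hy β ν]
    ring
  have e2 : ∑ α, Y α * F.dG κ c α X Z =
      ∑ α, ∑ β, ∑ ν, X α * Y β * Z ν * pd β (fun y => F.gMat κ y ν α) c := by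
    rw [hsum]
    simp only [dG, Finset.mul_sum]
    refine Finset.sum_congr rfl fun α _ => Finset.sum_congr rfl fun β _ =>
      Finset.sum_congr rfl fun ν _ => ?_
    rw [pd_congr κ.isOpen_dom hc.1 fun y hy => gMat_symm hF hy β ν]
    ring
  have e3 : ∑ α, Z α * F.dG κ c α X Y =
      ∑ α, ∑ β, ∑ ν, X α * Y β * Z ν * pd ν (fun y => F.gMat κ y α β) c := by
    simp only [dG, Finset.mul_sum]
    rw [Finset.sum_comm]
    refine Finset.sum_congr rfl fun α _ => ?_
    rw [Finset.sum_comm]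
    refine Finset.sum_congr rfl fun β _ =>
      Finset.sum_congr rfl fun ν _ => ?_
    ring
  rw [Finset.sum_sub_distrib, Finset.sum_add_distrib, e1, e2, e3]
  simp only [Finset.mul_sum, ← Finset.sum_add_distrib, ← Finset.sum_sub_distrib]
  refine Finset.sum_congr rfl fun α _ => Finset.sum_congr rfl fun β _ =>
      Finset.sum_congr rfl fun ν _ => ?_
  ring

omit hF in
theorem ip_add_left (F : Fields) (κ : SphereChart) (c : Pt) (X Y Z : Fin 4 → ℝ) :
    F.ip κ c (fun μ => X μ + Y μ) Z = F.ip κ c X Z + F.ip κ c Y Z := by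
  simp only [ip, mul_add, add_mul, Finset.sum_add_distrib]

/-- Koszul's formula for `g(∇_X Y, Z)` in coordinates. -/
theorem ip_cov {r₀ : ℝ} {c : Pt} (hc : c ∈ F.reg κ r₀) (X Y : Pt → Fin 4 → ℝ) (Z : Fin 4 → ℝ) :
    F.ip κ c (F.cov κ X Y c) Z = F.ip κ c (fun μ => ∑ α, X c α * pd α (fun y => Y y μ) c) Z +
      1 / 2 * ∑ α, (X c α * F.dG κ c α (Y c) Z + Y c α * F.dG κ c α (X c) Z
        - Z α * F.dG κ c α (X c) (Y c)) := by
  rw [← ip_chr4 hF hc, ← ip_add_left]; rfl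

/-- The covariant derivative of a coordinate vector field. -/
theorem ip_cov_eS {r₀ : ℝ} {c : Pt} (hc : c ∈ F.reg κ r₀) (X : Pt → Fin 4 → ℝ) (A : Fin 2)
    (Z : Fin 4 → ℝ) :
    F.ip κ c (F.cov κ X (eS A) c) Z =
      1 / 2 * (∑ α, (X c α * F.dG κ c α (eS A c) Z - Z α * F.dG κ c α (X c) (eS A c))
        + F.dG κ c (sph A) (X c) Z) := by
  rw [ip_cov hF hc]
  have h0 : F.ip κ c (fun μ => ∑ α, X c α * pd α (fun y => eS A y μ) c) Z = 0 := by
    simp [eS, pd_const, ip]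
  have h1 : ∀ a : Fin 4 → ℝ, ∑ α, eS A c α * a α = a (sph A) := fun a => by
    simp [eS, Pi.single_apply]
  have h2 := h1 fun α => F.dG κ c α (X c) Z
  rw [h0, zero_add, ← h2, ← Finset.sum_add_distrib]
  congr 1
  exact Finset.sum_congr rfl fun α _ => by ring

/-! ### The Ricci coefficients in coordinates -/

theorem dh_symm {c : Pt} (hc : c ∈ κ.dom) (μ : Fin 4) (A B : Fin 2) :
    pd μ (fun y => F.gsMat κ y A B) c = pd μ (fun y => F.gsMat κ y B A) c :=
  pd_congr κ.isOpen_dom hc fun y hy => hF.symm y hy A B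

omit hF in
theorem lapseSq_ne {r₀ : ℝ} {c : Pt} (hc : c ∈ F.reg κ r₀) : F.lapseSq κ c ≠ 0 := by
  have := hc.2.1
  simp only [lapseSq]
  positivity

/-- The derivative of the factor `Ω⁻²` of `e₃` multiplies `∂_u`, which is orthogonal to the spheres,
so only `∂_u gs` survives. -/
theorem chibar_eq {r₀ : ℝ} {c : Pt} (hc : c ∈ F.reg κ r₀) (A B : Fin 2) :
    F.chibar κ A B c = 1 / (2 * F.lapseSq κ c) * pd 0 (fun y => F.gsMat κ y A B) c := by
  have hW := lapseSq_ne hc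
  have hp : ∀ α μ, pd α (fun y => F.e3 κ y μ) c =
      if μ = 0 then pd α (fun y => 1 / F.lapseSq κ y) c else 0 := fun α μ => by
    unfold e3
    by_cases h : μ = 0
    · subst h; simp [lapseSq]
    · simp [h, pd_const]
  rw [chibar, ip_cov hF hc, ip_eq hF hc.1]
  simp only [dG_eq hF hc.1, hp]
  fin_cases A <;> fin_cases B <;>
    simp [Fin.sum_univ_four, Fin.sum_univ_two, eS, e3, sp, sph, lapseSq, dh_symm hF hc.1 0 1 0] <;> ring

/-- The second fundamental form is half the Lie derivative of `gs` along `e₄`. The terms with `∂b`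
are the reason why bounds for `χ` carry information on the derivatives of the shift. -/
theorem chi_eq {r₀ : ℝ} {c : Pt} (hc : c ∈ F.reg κ r₀) (A B : Fin 2) :
    F.chi κ A B c = 1 / 2 * (∑ α, F.e4 κ c α * pd α (fun y => F.gsMat κ y A B) c
      + ∑ C, (F.gsMat κ c C B * pd (sph A) (fun y => F.shift κ y C) c
        + F.gsMat κ c A C * pd (sph B) (fun y => F.shift κ y C) c)) := by
  rw [chi, ip_cov hF hc, ip_eq hF hc.1]
  simp only [dG_eq hF hc.1]
  have s := hF.symm c hc.1 1 0
  fin_cases A <;> fin_cases B <;>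
    simp [Fin.sum_univ_four, Fin.sum_univ_two, eS, e4, sp, sph, s, pd_const,
      fun μ => dh_symm hF hc.1 μ 1 0] <;> ring

/-- Together with `etabar_eq`: the sum of the two forms is `∂_A log Ω²`, and their difference is
proportional to `gs_AB ∂_u b^B`. Through these two relations the derivatives of lapse and shift in
the geodesic equations become Ricci coefficients. -/
theorem eta_eq {r₀ : ℝ} {c : Pt} (hc : c ∈ F.reg κ r₀) (A : Fin 2) :
    F.eta κ A c = 1 / (4 * F.lapseSq κ c) *
      (∑ B, F.gsMat κ c A B * pd 0 (fun y => F.shift κ y B) c + 2 * pd (sph A) (F.lapseSq κ) c) := by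
  have hW := lapseSq_ne hc
  rw [eta, ip_cov_eS hF hc]
  simp only [dG_eq hF hc.1]
  have s := hF.symm c hc.1 1 0
  fin_cases A <;>
    simp [Fin.sum_univ_four, Fin.sum_univ_two, eS, e4, e3, sp, sph, s, lapseSq] <;> ring

theorem etabar_eq {r₀ : ℝ} {c : Pt} (hc : c ∈ F.reg κ r₀) (A : Fin 2) :
    F.etabar κ A c = 1 / (4 * F.lapseSq κ c) *
      (2 * pd (sph A) (F.lapseSq κ) c - ∑ B, F.gsMat κ c A B * pd 0 (fun y => F.shift κ y B) c) := by
  have hW := lapseSq_ne hc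
  rw [etabar, ip_cov_eS hF hc]
  simp only [dG_eq hF hc.1]
  have s := hF.symm c hc.1 1 0
  fin_cases A <;>
    simp [Fin.sum_univ_four, Fin.sum_univ_two, eS, e4, e3, sp, sph, s, lapseSq] <;> ring

theorem omega_eq {r₀ : ℝ} {c : Pt} (hc : c ∈ F.reg κ r₀) :
    F.omega κ c = 1 / F.lapseSq κ c * ∑ α, F.e4 κ c α * pd α (F.lapseSq κ) c := by
  have hW := lapseSq_ne hc
  have hp : ∀ α μ, pd α (fun y => F.e3 κ y μ) c =
      if μ = 0 then - pd α (F.lapseSq κ) c / F.lapseSq κ c ^ 2 else 0 := fun α μ => by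
    rw [← pd_inv ((smooth_lapseSq hF).diffAt κ.isOpen_dom hc.1) hW]
    unfold e3
    by_cases h : μ = 0
    · subst h; simp [lapseSq]
    · simp [h, pd_const]
  have he : F.e3 κ c = Pi.single 0 (1 / F.lapseSq κ c) := rfl
  rw [omega, ip_cov hF hc, ip_eq hF hc.1]
  simp only [dG_eq hF hc.1, hp, he]
  simp [Fin.sum_univ_four, Fin.sum_univ_two, e4, sp, sph]
  field_simp
  ring

omit hF in
theorem projCov_ip {r₀ : ℝ} {c : Pt} (hc : c ∈ F.reg κ r₀) (X : Pt → Fin 4 → ℝ) (A B : Fin 2) :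
    ∑ D, F.gsMat κ c B D * F.projCov κ X A D c = F.ip κ c (F.cov κ X (eS A) c) (eS B c) := by
  unfold projCov
  have := congrFun (Matrix.mulVec_mulVec (fun D => F.ip κ c (F.cov κ X (eS A) c) (eS D c))
    (F.gsMat κ c) (F.gsMat κ c)⁻¹) B
  rw [Matrix.mul_nonsing_inv _ (Ne.isUnit hc.2.2.1), Matrix.one_mulVec] at this
  exact this

theorem ip_cov_eS_eS {r₀ : ℝ} {c : Pt} (hc : c ∈ F.reg κ r₀) (A B C : Fin 2) :
    F.ip κ c (F.cov κ (eS C) (eS A) c) (eS B c) =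
      1 / 2 * (pd (sph C) (fun y => F.gsMat κ y B A) c + pd (sph A) (fun y => F.gsMat κ y B C) c
        - pd (sph B) (fun y => F.gsMat κ y C A) c) := by
  rw [ip_cov_eS hF hc]
  simp only [dG_eq hF hc.1]
  fin_cases A <;> fin_cases B <;> fin_cases C <;>
    simp [Fin.sum_univ_four, Fin.sum_univ_two, eS, sp, sph, fun μ => dh_symm hF hc.1 μ 1 0] <;> ring

/-- The connection is torsion free, so `∇_4 e_A` differs from `∇_A e_4` by the commutator of `e₄`
and `e_A`, which is `-(∂_A b^C) e_C`. -/
theorem ip_cov_e4_eS {r₀ : ℝ} {c : Pt} (hc : c ∈ F.reg κ r₀) (A B : Fin 2) :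
    F.ip κ c (F.cov κ (F.e4 κ) (eS A) c) (eS B c) =
      F.chi κ A B c - ∑ C, F.gsMat κ c B C * pd (sph A) (fun y => F.shift κ y C) c := by
  rw [ip_cov_eS hF hc, chi_eq hF hc]
  simp only [dG_eq hF hc.1]
  have s := hF.symm c hc.1 1 0
  fin_cases A <;> fin_cases B <;>
    simp [Fin.sum_univ_four, Fin.sum_univ_two, eS, e4, sp, sph, s,
      fun μ => dh_symm hF hc.1 μ 1 0] <;> ring

end Fields
end DoubleNull


namespace DoubleNull

/-! ### Norms of covariant tensors -/

section Tensor

variable {n : ℕ}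

/-- The scalar product of two covariant tensors with respect to the inverse metric `a`. -/
noncomputable def nip (a : Matrix (Fin 2) (Fin 2) ℝ) (s t : (Fin n → Fin 2) → ℝ) : ℝ :=
  ∑ I, ∑ J, (∏ i, a (I i) (J i)) * s I * t J

/-- The components of a tensor in another frame. -/
noncomputable def frameComp (B : Matrix (Fin 2) (Fin 2) ℝ) (t : (Fin n → Fin 2) → ℝ)
    (K : Fin n → Fin 2) : ℝ :=
  ∑ I, (∏ i, B (K i) (I i)) * t I

theorem sum_prod_pi (f : Fin n → Fin 2 → ℝ) :
    ∏ i, ∑ k, f i k = ∑ K : Fin n → Fin 2, ∏ i, f i (K i) := by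
  rw [Finset.prod_univ_sum, Fintype.piFinset_univ]

/-- In an orthonormal frame the norm of a tensor is the Euclidean norm of its array of components.
The inequalities below thereby reduce to the Cauchy–Schwarz inequality for finite sums. -/
theorem nip_frame (B : Matrix (Fin 2) (Fin 2) ℝ) (s t : (Fin n → Fin 2) → ℝ) :
    nip (Bᵀ * B) s t = ∑ K, frameComp B s K * frameComp B t K := by
  have h : ∀ I J : Fin n → Fin 2, ∏ i, (Bᵀ * B) (I i) (J i) =
      ∑ K : Fin n → Fin 2, (∏ i, B (K i) (I i)) * ∏ i, B (K i) (J i) := fun I J => by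
    simp only [Matrix.mul_apply, Matrix.transpose_apply, sum_prod_pi, Finset.prod_mul_distrib]
  simp only [nip, h, frameComp, Finset.sum_mul, Finset.mul_sum]
  rw [Finset.sum_congr rfl fun I _ => Finset.sum_comm, Finset.sum_comm]
  refine Finset.sum_congr rfl fun K _ => ?_
  rw [Finset.sum_comm]
  exact Finset.sum_congr rfl fun I _ => Finset.sum_congr rfl fun J _ => by ring

theorem frameComp_frameComp (L B : Matrix (Fin 2) (Fin 2) ℝ) (t : (Fin n → Fin 2) → ℝ) :
    frameComp L (frameComp B t) = frameComp (L * B) t := by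
  ext K
  simp only [frameComp, Matrix.mul_apply, sum_prod_pi, Finset.mul_sum, Finset.sum_mul,
    Finset.prod_mul_distrib]
  rw [Finset.sum_comm]
  exact Finset.sum_congr rfl fun I _ => Finset.sum_congr rfl fun J _ => by ring

theorem frameComp_one (t : (Fin n → Fin 2) → ℝ) : frameComp 1 t = t := by
  ext K
  rw [frameComp, Finset.sum_eq_single K]
  · simp
  · intro I _ hI
    obtain ⟨i, hi⟩ := Function.ne_iff.1 hI
    have : ∏ i, (1 : Matrix (Fin 2) (Fin 2) ℝ) (K i) (I i) = 0 :=
      Finset.prod_eq_zero (Finset.mem_univ i) (Matrix.one_apply_ne (Ne.symm hi))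
    rw [this, zero_mul]
  · simp

/-- A positive definite symmetric two by two matrix. -/
structure PD (h : Matrix (Fin 2) (Fin 2) ℝ) : Prop where
  symm : ∀ A B, h A B = h B A
  pos : ∀ a : Fin 2 → ℝ, a ≠ 0 → 0 < ∑ A, ∑ B, h A B * a A * a B

theorem PD.det_pos {h : Matrix (Fin 2) (Fin 2) ℝ} (hp : PD h) : 0 < h.det :=
  det_pos_of_quad hp.symm hp.pos

theorem PD.diag_pos {h : Matrix (Fin 2) (Fin 2) ℝ} (hp : PD h) (A : Fin 2) : 0 < h A A := by
  have := hp.pos (Pi.single A 1) (by simp)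
  simpa [Pi.single_apply] using this

/-- Orthonormal frames. -/
theorem PD.exists_frame {h : Matrix (Fin 2) (Fin 2) ℝ} (hp : PD h) :
    ∃ L B : Matrix (Fin 2) (Fin 2) ℝ, L * B = 1 ∧ h = L * Lᵀ ∧ h⁻¹ = Bᵀ * B := by
  have h0 := hp.diag_pos 0
  have hd := hp.det_pos
  set x := Real.sqrt (h 0 0) with hx
  set z := Real.sqrt (h.det / h 0 0) with hz
  have hx2 : x * x = h 0 0 := Real.mul_self_sqrt h0.le
  have hz2 : z * z = h.det / h 0 0 := Real.mul_self_sqrt (by positivity)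
  have hx0 : x ≠ 0 := (Real.sqrt_pos.2 h0).ne'
  have hz0 : z ≠ 0 := (Real.sqrt_pos.2 (by positivity)).ne'
  -- The Cholesky factor of `h`; its inverse is the matrix of an orthonormal frame.
  set L : Matrix (Fin 2) (Fin 2) ℝ := !![x, 0; h 0 1 / x, z] with hL
  have hLL : h = L * Lᵀ := by
    have e : h 1 1 = h 0 1 / x * (h 0 1 / x) + z * z := by
      rw [hz2, Matrix.det_fin_two, hp.symm 1 0, div_mul_div_comm, hx2]
      field_simp
      ring
    ext i j
    fin_cases i <;> fin_cases j <;> simp [hL, Matrix.mul_apply, hx2, e, hp.symm 1 0] <;>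
      field_simp
  have hLd : IsUnit L.det := by
    simp [hL, Matrix.det_fin_two, hx0, hz0]
  refine ⟨L, L⁻¹, Matrix.mul_nonsing_inv _ hLd, hLL, ?_⟩
  conv_lhs => rw [hLL]
  rw [Matrix.mul_inv_rev, Matrix.transpose_nonsing_inv]

variable {h : Matrix (Fin 2) (Fin 2) ℝ}

theorem PD.nip_nonneg (hp : PD h) (t : (Fin n → Fin 2) → ℝ) : 0 ≤ nip h⁻¹ t t := by
  obtain ⟨L, B, -, -, h3⟩ := hp.exists_frame
  rw [h3, nip_frame]
  exact Finset.sum_nonneg fun K _ => mul_self_nonneg _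

theorem PD.nip_sq_le (hp : PD h) (s t : (Fin n → Fin 2) → ℝ) :
    nip h⁻¹ s t ^ 2 ≤ nip h⁻¹ s s * nip h⁻¹ t t := by
  obtain ⟨L, B, -, -, h3⟩ := hp.exists_frame
  rw [h3, nip_frame, nip_frame, nip_frame]
  simpa only [sq] using Finset.sum_mul_sq_le_sq_mul_sq Finset.univ (frameComp B s) (frameComp B t)

theorem diag_of_frame {L : Matrix (Fin 2) (Fin 2) ℝ} (e : h = L * Lᵀ) (A : Fin 2) :
    ∑ k, L A k ^ 2 = h A A := by
  rw [e]; simp [Matrix.mul_apply, sq]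

/-- A component is the contraction of the frame components with a product of rows of `L`, and the
row with index `A` has squared length `h A A`. Each index thus costs one factor of the diagonal of
the metric, which is of size `r²` in the application. -/
theorem PD.comp_sq_le (hp : PD h) (t : (Fin n → Fin 2) → ℝ) (I : Fin n → Fin 2) :
    t I ^ 2 ≤ (∏ i, h (I i) (I i)) * nip h⁻¹ t t := by
  obtain ⟨L, B, h1, h2, h3⟩ := hp.exists_frame
  have e : t I = ∑ K, (∏ i, L (I i) (K i)) * frameComp B t K := by
    conv_lhs => rw [← frameComp_one t, ← h1, ← frameComp_frameComp]
    rfl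
  rw [h3, nip_frame, e]
  refine (Finset.sum_mul_sq_le_sq_mul_sq _ _ _).trans_eq ?_
  congr 1
  · simp only [← Finset.prod_pow, ← sum_prod_pi (fun i k => L (I i) k ^ 2), diag_of_frame h2]
  · simp only [sq]

theorem sum_cons (f : (Fin (n + 1) → Fin 2) → ℝ) :
    ∑ J, f J = ∑ k, ∑ K : Fin n → Fin 2, f (Fin.cons k K) := by
  rw [← Fintype.sum_prod_type', ← (Fin.consEquiv fun _ => Fin 2).sum_comp]
  rfl

/-- The Cauchy–Schwarz argument for a single index, with the remaining indices kept in the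
orthonormal frame. It bounds `|∇_A T|` for one coordinate direction by the norm of the full
covariant derivative. -/
theorem PD.nip_slice_le (hp : PD h) (t : (Fin (n + 1) → Fin 2) → ℝ) (A : Fin 2) :
    nip h⁻¹ (fun I => t (Fin.cons A I)) (fun I => t (Fin.cons A I)) ≤ h A A * nip h⁻¹ t t := by
  obtain ⟨L, B, h1, h2, h3⟩ := hp.exists_frame
  rw [h3, nip_frame, nip_frame, sum_cons, Finset.sum_comm, Finset.mul_sum]
  refine Finset.sum_le_sum fun K _ => ?_
  have e1 : ∀ k, frameComp B t (Fin.cons k K) =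
      ∑ D, B k D * frameComp B (fun I => t (Fin.cons D I)) K := fun k => by
    simp only [frameComp, sum_cons, Fin.prod_univ_succ, Fin.cons_zero, Fin.cons_succ,
      Finset.mul_sum, mul_assoc]
  have e2 : frameComp B (fun I => t (Fin.cons A I)) K =
      ∑ k, L A k * frameComp B t (Fin.cons k K) := by
    simp only [e1, Finset.mul_sum]
    rw [Finset.sum_comm]
    simp only [← mul_assoc, ← Finset.sum_mul, ← Matrix.mul_apply, h1, Matrix.one_apply, ite_mul,
      one_mul, zero_mul, Finset.sum_ite_eq, Finset.mem_univ, if_true]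
  rw [e2, ← sq]
  refine (Finset.sum_mul_sq_le_sq_mul_sq _ _ _).trans_eq ?_
  rw [diag_of_frame h2]
  simp only [sq]

theorem nip_smul (a : Matrix (Fin 2) (Fin 2) ℝ) (x : ℝ) (t : (Fin n → Fin 2) → ℝ) :
    nip a (fun I => x * t I) (fun I => x * t I) = x ^ 2 * nip a t t := by
  simp only [nip, Finset.mul_sum]
  exact Finset.sum_congr rfl fun I _ => Finset.sum_congr rfl fun J _ => by ring

/-- Exchanging the free value with the entry at `i` is an involution of the pairs `(J, E)`. -/
theorem sum_update_swap (i : Fin n) (f : (Fin n → Fin 2) → Fin 2 → ℝ) :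
    ∑ J, ∑ E, f (Function.update J i E) (J i) = ∑ J, ∑ E, f J E := by
  rw [← Fintype.sum_prod_type', ← Fintype.sum_prod_type']
  let e : (Fin n → Fin 2) × Fin 2 → (Fin n → Fin 2) × Fin 2 :=
    fun p => (Function.update p.1 i p.2, p.1 i)
  have he : Function.Involutive e := fun p => by simp [e]
  exact Equiv.sum_comp he.toPerm fun p : (Fin n → Fin 2) × Fin 2 => f p.1 p.2

theorem nip_comm {a : Matrix (Fin 2) (Fin 2) ℝ} (ha : ∀ A B, a A B = a B A)
    (s t : (Fin n → Fin 2) → ℝ) : nip a s t = nip a t s := by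
  unfold nip
  rw [Finset.sum_comm]
  refine Finset.sum_congr rfl fun I _ => Finset.sum_congr rfl fun J _ => ?_
  simp only [ha (J _) (I _)]
  ring

/-- The action of a matrix on a covariant tensor as a derivation. -/
noncomputable def derivAct (G : Matrix (Fin 2) (Fin 2) ℝ) (t : (Fin n → Fin 2) → ℝ)
    (I : Fin n → Fin 2) : ℝ := ∑ i, ∑ B, G (I i) B * t (Function.update I i B)

theorem nip_derivAct (a G : Matrix (Fin 2) (Fin 2) ℝ) (s t : (Fin n → Fin 2) → ℝ) :
    ∑ I, ∑ J, (∑ i, (∏ k ∈ Finset.univ.erase i, a (I k) (J k)) *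
      ∑ E, a (I i) E * G E (J i)) * s I * t J = nip a s (derivAct G t) := by
  unfold nip derivAct
  refine Finset.sum_congr rfl fun I _ => ?_
  simp only [Finset.sum_mul, Finset.mul_sum]
  rw [Finset.sum_comm]
  conv_rhs => rw [Finset.sum_comm]
  refine Finset.sum_congr rfl fun i _ => ?_
  rw [← sum_update_swap i]
  refine Finset.sum_congr rfl fun J _ => Finset.sum_congr rfl fun E _ => ?_
  rw [← Finset.mul_prod_erase _ _ (Finset.mem_univ i)]
  have : ∏ k ∈ Finset.univ.erase i, a (I k) (Function.update J i E k) =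
      ∏ k ∈ Finset.univ.erase i, a (I k) (J k) :=
    Finset.prod_congr rfl fun k hk => by rw [Function.update_of_ne (Finset.ne_of_mem_erase hk)]
  rw [this]
  simp
  ring

/-- Metric compatibility for the scalar product of tensors. -/
theorem hasDerivAt_nip {a : ℝ → Matrix (Fin 2) (Fin 2) ℝ} {G : Matrix (Fin 2) (Fin 2) ℝ}
    {t : ℝ → (Fin n → Fin 2) → ℝ} {t' : (Fin n → Fin 2) → ℝ} {x : ℝ}
    (hs : ∀ A B, a x A B = a x B A)
    (ha : ∀ B C, HasDerivAt (fun y => a y B C)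
      (-∑ E, (a x B E * G E C + a x C E * G E B)) x)
    (ht : ∀ I, HasDerivAt (fun y => t y I) (t' I) x) :
    HasDerivAt (fun y => nip (a y) (t y) (t y))
      (2 * nip (a x) (t x) (fun J => t' J - derivAct G (t x) J)) x := by
  have hprod : ∀ I J : Fin n → Fin 2, HasDerivAt (fun y => ∏ i, a y (I i) (J i))
      (∑ i, (∏ k ∈ Finset.univ.erase i, a x (I k) (J k)) *
        (-∑ E, (a x (I i) E * G E (J i) + a x (J i) E * G E (I i)))) x := fun I J => by
    have := HasDerivAt.fun_finsetProd (u := Finset.univ) (f := fun i y => a y (I i) (J i))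
      (f' := fun i => (-∑ E, (a x (I i) E * G E (J i) + a x (J i) E * G E (I i)))) (x := x)
      fun i _ => ha (I i) (J i)
    simpa only [smul_eq_mul] using this
  have h1 : HasDerivAt (fun y => nip (a y) (t y) (t y))
      (∑ I, ∑ J, (((∑ i, (∏ k ∈ Finset.univ.erase i, a x (I k) (J k)) *
        (-∑ E, (a x (I i) E * G E (J i) + a x (J i) E * G E (I i)))) * t x I
        + (∏ i, a x (I i) (J i)) * t' I) * t x J + (∏ i, a x (I i) (J i)) * t x I * t' J)) x :=
    HasDerivAt.fun_sum fun I _ => HasDerivAt.fun_sum fun J _ =>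
      ((hprod I J).fun_mul (ht I)).fun_mul (ht J)
  refine h1.congr_deriv ?_
  have e1 := nip_derivAct (a x) G (t x) (t x)
  have e2 : ∑ I, ∑ J, (∑ i, (∏ k ∈ Finset.univ.erase i, a x (I k) (J k)) *
      ∑ E, a x (J i) E * G E (I i)) * t x I * t x J = nip (a x) (t x) (derivAct G (t x)) := by
    rw [← e1, Finset.sum_comm]
    refine Finset.sum_congr rfl fun I _ => Finset.sum_congr rfl fun J _ => ?_
    simp only [hs (J _) (I _)]
    ring
  have e3 : nip (a x) t' (t x) = nip (a x) (t x) t' := nip_comm hs _ _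
  have e4 : nip (a x) (t x) (fun J => t' J - derivAct G (t x) J) =
      nip (a x) (t x) t' - nip (a x) (t x) (derivAct G (t x)) := by
    simp only [nip, mul_sub, Finset.sum_sub_distrib]
  rw [e4]
  have e5 : 2 * (nip (a x) (t x) t' - nip (a x) (t x) (derivAct G (t x))) =
      -(nip (a x) (t x) (derivAct G (t x))) - nip (a x) (t x) (derivAct G (t x))
        + nip (a x) t' (t x) + nip (a x) (t x) t' := by rw [e3]; ring
  rw [e5]
  nth_rewrite 1 [← e1]
  rw [← e2]
  simp only [nip, ← Finset.sum_neg_distrib, ← Finset.sum_sub_distrib, ← Finset.sum_add_distrib]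
  refine Finset.sum_congr rfl fun I _ => Finset.sum_congr rfl fun J _ => ?_
  have e6 : (∑ i, (∏ k ∈ Finset.univ.erase i, a x (I k) (J k)) *
        (∑ E, -(a x (I i) E * G E (J i) + a x (J i) E * G E (I i)))) =
      -(∑ i, (∏ k ∈ Finset.univ.erase i, a x (I k) (J k)) * ∑ E, a x (I i) E * G E (J i))
      - ∑ i, (∏ k ∈ Finset.univ.erase i, a x (I k) (J k)) * ∑ E, a x (J i) E * G E (I i) := by
    simp only [Finset.sum_neg_distrib, Finset.sum_add_distrib, mul_neg, mul_add]
    ring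
  rw [e6]
  ring

end Tensor

end DoubleNull


namespace DoubleNull

/-! ### Smoothness of the tensors on the spheres -/

/-- All components of the tensor are smooth on `R`. -/
def STensor.SmoothOn (T : STensor) (R : Set Pt) : Prop := ∀ I, ContDiffOn ℝ ∞ (T.comp I) R

theorem contDiff_rad (r₀ : ℝ) : ContDiff ℝ ∞ (rad r₀) := by
  unfold rad; fun_prop

/-- Smoothness of the components of a vector field. -/
def VSmooth (X : Pt → Fin 4 → ℝ) (R : Set Pt) : Prop := ∀ μ, ContDiffOn ℝ ∞ (fun c => X c μ) R

namespace Fields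

theorem eS_smooth (A : Fin 2) (R : Set Pt) : VSmooth (eS A) R := fun μ => by
  unfold eS; exact contDiffOn_const

variable {F : Fields} {κ : SphereChart} (hF : ChartFields F κ) (r₀ : ℝ)
include hF

theorem smooth_h (A B : Fin 2) : ContDiffOn ℝ ∞ (fun c => F.gsMat κ c A B) (F.reg κ r₀) :=
  (hF.smooth_gs A B).mono (reg_subset_dom r₀)

theorem smooth_b (A : Fin 2) : ContDiffOn ℝ ∞ (fun c => F.shift κ c A) (F.reg κ r₀) :=
  (hF.smooth_shift A).mono (reg_subset_dom r₀)

theorem smooth_hInv (A B : Fin 2) : ContDiffOn ℝ ∞ (fun c => (F.gsMat κ c)⁻¹ A B) (F.reg κ r₀) :=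
  contDiffOn_matInv (smooth_h hF r₀) (fun _ hc => hc.2.2.1) A B

theorem smooth_W : ContDiffOn ℝ ∞ (F.lapseSq κ) (F.reg κ r₀) := (smooth_lapseSq hF).mono (reg_subset_dom r₀)

theorem smooth_WInv : ContDiffOn ℝ ∞ (fun c => 1 / F.Ω (κ.place c) ^ 2) (F.reg κ r₀) :=
  contDiffOn_const.div (smooth_W hF r₀) fun _ hc => lapseSq_ne hc

theorem e3_smooth : VSmooth (F.e3 κ) (F.reg κ r₀) := fun μ => by
  unfold e3
  by_cases h : μ = 0
  · subst h; simpa using smooth_WInv hF r₀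
  · simpa [h] using contDiffOn_const

theorem e4_smooth : VSmooth (F.e4 κ) (F.reg κ r₀) := fun μ => by
  have h := smooth_b hF r₀
  unfold e4
  fin_cases μ <;> simp
  · exact contDiffOn_const
  · exact contDiffOn_const
  · exact h 0
  · exact h 1

theorem smooth_chr4 (μ α β : Fin 4) : ContDiffOn ℝ ∞ (fun c => F.chr4 κ c μ α β) (F.reg κ r₀) :=
  contDiffOn_christoffel (isOpen_reg hF r₀) id
    (fun i j => (smooth_gMat hF i j).mono (reg_subset_dom r₀)) (fun _ hc => det_gMat_ne hF hc) μ α β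

theorem cov_smooth {X Y : Pt → Fin 4 → ℝ} (hX : VSmooth X (F.reg κ r₀)) (hY : VSmooth Y (F.reg κ r₀)) :
    VSmooth (F.cov κ X Y) (F.reg κ r₀) := fun μ => by
  unfold cov
  exact (ContDiffOn.sum fun α _ => (hX α).mul (contDiffOn_pd (isOpen_reg hF r₀) (hY μ) α)).add
    (ContDiffOn.sum fun α _ => ContDiffOn.sum fun β _ =>
      ((smooth_chr4 hF r₀ μ α β).mul (hX α)).mul (hY β))

theorem ip_smooth {X Y : Pt → Fin 4 → ℝ} (hX : VSmooth X (F.reg κ r₀)) (hY : VSmooth Y (F.reg κ r₀)) :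
    ContDiffOn ℝ ∞ (fun c => F.ip κ c (X c) (Y c)) (F.reg κ r₀) := by
  unfold ip
  exact ContDiffOn.sum fun α _ => ContDiffOn.sum fun β _ =>
      (((smooth_gMat hF α β).mono (reg_subset_dom r₀)).mul (hX α)).mul (hY β)

theorem chi_smooth (A B : Fin 2) : ContDiffOn ℝ ∞ (F.chi κ A B) (F.reg κ r₀) :=
  ip_smooth hF r₀ (cov_smooth hF r₀ (eS_smooth A _) (e4_smooth hF r₀)) (eS_smooth B _)

theorem chibar_smooth (A B : Fin 2) : ContDiffOn ℝ ∞ (F.chibar κ A B) (F.reg κ r₀) :=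
  ip_smooth hF r₀ (cov_smooth hF r₀ (eS_smooth A _) (e3_smooth hF r₀)) (eS_smooth B _)

theorem trace_smooth {h : Fin 2 → Fin 2 → Pt → ℝ} (hh : ∀ A B, ContDiffOn ℝ ∞ (h A B) (F.reg κ r₀)) :
    ContDiffOn ℝ ∞ (F.trace κ h) (F.reg κ r₀) := by
  unfold trace
  exact ContDiffOn.sum fun A _ => ContDiffOn.sum fun B _ => (smooth_hInv hF r₀ A B).mul (hh A B)

theorem traceFree_smooth {h : Fin 2 → Fin 2 → Pt → ℝ} (hh : ∀ A B, ContDiffOn ℝ ∞ (h A B) (F.reg κ r₀))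
    (A B : Fin 2) : ContDiffOn ℝ ∞ (F.traceFree κ h A B) (F.reg κ r₀) := by
  unfold traceFree
  exact (hh A B).sub ((contDiffOn_const.mul (trace_smooth hF r₀ hh)).mul (smooth_h hF r₀ A B))

theorem projCov_smooth {X : Pt → Fin 4 → ℝ} (hX : VSmooth X (F.reg κ r₀)) (A B : Fin 2) :
    ContDiffOn ℝ ∞ (F.projCov κ X A B) (F.reg κ r₀) := by
  unfold projCov
  exact ContDiffOn.sum fun D _ => (smooth_hInv hF r₀ B D).mul
    (ip_smooth hF r₀ (cov_smooth hF r₀ hX (eS_smooth A _)) (eS_smooth D _))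

theorem along_smooth {X : Pt → Fin 4 → ℝ} (hX : VSmooth X (F.reg κ r₀)) {T : STensor} (hT : T.SmoothOn (F.reg κ r₀)) :
    (F.along κ X T).SmoothOn (F.reg κ r₀) := fun I => by
  unfold along
  exact (ContDiffOn.sum fun α _ => (hX α).mul (contDiffOn_pd (isOpen_reg hF r₀) (hT I) α)).sub
    (ContDiffOn.sum fun i _ => ContDiffOn.sum fun B _ =>
      (projCov_smooth hF r₀ hX (I i) B).mul (hT _))

theorem angular_smooth {T : STensor} (hT : T.SmoothOn (F.reg κ r₀)) : (F.angular κ T).SmoothOn (F.reg κ r₀) :=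
  fun (J : Fin (T.rank + 1) → Fin 2) => along_smooth hF r₀ (eS_smooth (J 0) _) hT (Fin.tail J)

omit hF in
theorem smul_rad_smooth {T : STensor} (hT : T.SmoothOn (F.reg κ r₀)) : (T.smul (rad r₀)).SmoothOn (F.reg κ r₀) :=
  fun I => (contDiff_rad r₀).contDiffOn.mul (hT I)

theorem applyOp_smooth (o : DOp) {T : STensor} (hT : T.SmoothOn (F.reg κ r₀)) :
    (F.applyOp κ r₀ o T).SmoothOn (F.reg κ r₀) := by
  cases o
  · exact along_smooth hF r₀ (e3_smooth hF r₀) hT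
  · exact smul_rad_smooth r₀ (along_smooth hF r₀ (e4_smooth hF r₀) hT)
  · exact smul_rad_smooth r₀ (angular_smooth hF r₀ hT)

omit hF in
theorem det_gCirc (c : Pt) : (gCirc κ r₀ c).det = rad r₀ c ^ 4 * (κ.round (ang c)).det := by
  rw [gCirc, Matrix.det_smul, Fintype.card_fin]; ring

omit hF in
theorem smooth_gCirc (A B : Fin 2) : ContDiffOn ℝ ∞ (fun c => gCirc κ r₀ c A B) κ.dom := by
  simp only [gCirc, Matrix.smul_apply, smul_eq_mul]
  exact ((contDiff_rad r₀).pow 2).contDiffOn.mul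
    ((κ.contDiffOn_round A B).comp contDiff_ang.contDiffOn fun c hc => κ.U_subset_N hc)

omit hF in
theorem det_gCirc_ne {c : Pt} (hc : c ∈ (F.reg κ r₀)) : (gCirc κ r₀ c).det ≠ 0 := by
  rw [det_gCirc]
  exact mul_ne_zero (pow_ne_zero _ hc.2.2.2) (κ.round_det_pos (κ.U_subset_N hc.1)).ne'

theorem christoffelDiff_smooth : (F.christoffelDiff κ r₀).SmoothOn (F.reg κ r₀) :=
  fun (I : Fin 3 → Fin 2) => by
  change ContDiffOn ℝ ∞ (fun c => ∑ D, F.gsMat κ c (I 2) D *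
    (christoffel sph (F.gsMat κ) c D (I 0) (I 1) - christoffel sph (gCirc κ r₀) c D (I 0) (I 1))) _
  exact ContDiffOn.sum fun D _ => (smooth_h hF r₀ (I 2) D).mul
    ((contDiffOn_christoffel (M := F.gsMat κ) (isOpen_reg hF r₀) sph (smooth_h hF r₀)
      (fun _ hc => hc.2.2.1) D (I 0) (I 1)).sub
    (contDiffOn_christoffel (M := gCirc κ r₀) (isOpen_reg hF r₀) sph
      (fun i j => (smooth_gCirc r₀ i j).mono (reg_subset_dom r₀)) (fun _ hc => det_gCirc_ne r₀ hc)
      D (I 0) (I 1)))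

theorem ricci_smooth (n : RicciName) : (F.ricci κ r₀ n).SmoothOn (F.reg κ r₀) := by
  have hr : ContDiffOn ℝ ∞ (fun c => 2 / rad r₀ c) (F.reg κ r₀) :=
    contDiffOn_const.div (contDiff_rad r₀).contDiffOn fun _ hc => hc.2.2.2
  intro I
  cases n
  · exact (smooth_WInv hF r₀).sub contDiffOn_const
  · change ContDiffOn ℝ ∞ (fun c => ∑ B, F.gsMat κ c (I (0 : Fin 1)) B * F.shift κ c B) _
    exact ContDiffOn.sum fun B _ => (smooth_h hF r₀ _ B).mul (smooth_b hF r₀ B)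
  · exact (smooth_h hF r₀ _ _).sub ((smooth_gCirc r₀ _ _).mono (reg_subset_dom r₀))
  · exact (trace_smooth hF r₀ (chi_smooth hF r₀)).sub hr
  · exact (trace_smooth hF r₀ (chibar_smooth hF r₀)).add hr
  · exact traceFree_smooth hF r₀ (chi_smooth hF r₀) _ _
  · exact traceFree_smooth hF r₀ (chibar_smooth hF r₀) _ _
  · exact contDiffOn_const.mul
      (ip_smooth hF r₀ (cov_smooth hF r₀ (e3_smooth hF r₀) (eS_smooth _ _)) (e4_smooth hF r₀))
  · exact contDiffOn_const.mul
      (ip_smooth hF r₀ (cov_smooth hF r₀ (e4_smooth hF r₀) (eS_smooth _ _)) (e3_smooth hF r₀))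
  · exact contDiffOn_const.mul
      (ip_smooth hF r₀ (cov_smooth hF r₀ (e4_smooth hF r₀) (e3_smooth hF r₀)) (e4_smooth hF r₀))

/-! ### Metric compatibility -/

theorem normSq_smooth {T : STensor} (hT : T.SmoothOn (F.reg κ r₀)) : ContDiffOn ℝ ∞ (F.normSq κ T) (F.reg κ r₀) := by
  unfold normSq
  exact ContDiffOn.sum fun I _ => ContDiffOn.sum fun J _ =>
    ((contDiffOn_finprod fun i _ => smooth_hInv hF r₀ _ _).mul (hT I)).mul (hT J)

variable {r₀}

/-- This is metric compatibility of the induced connection: adding two Christoffel symbols of the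
first kind with exchanged indices leaves one derivative of the metric. -/
theorem pd_h_eq {c : Pt} (hc : c ∈ (F.reg κ r₀)) (C A B : Fin 2) :
    pd (sph C) (fun y => F.gsMat κ y A B) c =
      ∑ D, (F.gsMat κ c B D * F.projCov κ (eS C) A D c + F.gsMat κ c A D * F.projCov κ (eS C) B D c) := by
  rw [Finset.sum_add_distrib, projCov_ip hc, projCov_ip hc, ip_cov_eS_eS hF hc,
    ip_cov_eS_eS hF hc, dh_symm hF hc.1 _ B A, dh_symm hF hc.1 _ B C, dh_symm hF hc.1 _ A C]
  ring

/-- Differentiate `h⁻¹ h = 1` and multiply by `h⁻¹` from the right. -/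
theorem pd_hInv {c : Pt} (hc : c ∈ (F.reg κ r₀)) (μ : Fin 4) (A B : Fin 2) :
    pd μ (fun y => (F.gsMat κ y)⁻¹ A B) c = -∑ E, ∑ D, (F.gsMat κ c)⁻¹ A E *
      pd μ (fun y => F.gsMat κ y E D) c * (F.gsMat κ c)⁻¹ D B := by
  have hO := isOpen_reg hF r₀
  have dh := fun A B => (smooth_h hF r₀ A B).diffAt hO hc
  have da := fun A B => (smooth_hInv hF r₀ A B).diffAt hO hc
  have h0 : ∀ D, ∑ E, (pd μ (fun y => (F.gsMat κ y)⁻¹ A E) c * F.gsMat κ c E D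
      + (F.gsMat κ c)⁻¹ A E * pd μ (fun y => F.gsMat κ y E D) c) = 0 := fun D => by
    have e : pd μ (fun y => ∑ E, (F.gsMat κ y)⁻¹ A E * F.gsMat κ y E D) c = 0 := by
      rw [pd_congr (g := fun _ => (1 : Matrix (Fin 2) (Fin 2) ℝ) A D) hO hc fun y hy => ?_, pd_const]
      rw [← Matrix.nonsing_inv_mul _ (Ne.isUnit hy.2.2.1), Matrix.mul_apply]
    rw [pd_sum fun E _ => (da A E).fun_mul (dh E D)] at e
    simpa only [pd_mul (da A _) (dh _ D)] using e
  set x : Fin 2 → ℝ := fun E => pd μ (fun y => (F.gsMat κ y)⁻¹ A E) c with hx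
  set H := F.gsMat κ c
  set dH : Matrix (Fin 2) (Fin 2) ℝ := Matrix.of fun E D => pd μ (fun y => F.gsMat κ y E D) c with hdH
  have h1 : x ᵥ* H = -(H⁻¹.row A ᵥ* dH) := by
    ext D
    have := h0 D
    rw [Finset.sum_add_distrib] at this
    simp only [Matrix.vecMul, dotProduct, Pi.neg_apply, Matrix.row, hdH, Matrix.of_apply]
    linarith
  have h2 := congrArg (fun w => w ᵥ* H⁻¹) h1
  have hH : H * H⁻¹ = 1 := Matrix.mul_nonsing_inv _ (Ne.isUnit hc.2.2.1)
  simp only [Matrix.vecMul_vecMul, Matrix.neg_vecMul, hH, Matrix.vecMul_one] at h2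
  have h3 := congrFun h2 B
  simp only [hx] at h3
  rw [h3]
  simp only [Matrix.vecMul, dotProduct, Pi.neg_apply, Matrix.row, hdH, Matrix.mul_apply,
    Matrix.of_apply, Finset.mul_sum, mul_assoc]

omit hF in
theorem hasDerivAt_line {f : Pt → ℝ} {c : Pt} (hf : DifferentiableAt ℝ f c) (μ : Fin 4) :
    HasDerivAt (fun x => f (Function.update c μ x)) (pd μ f c) (c μ) := by
  have h1 : HasDerivAt (fun x => Function.update c μ x) (Pi.single μ 1) (c μ) :=
    hasDerivAt_update c μ (c μ)
  have h2 : HasFDerivAt f (fderiv ℝ f c) (Function.update c μ (c μ)) := by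
    rw [Function.update_eq_self]; exact hf.hasFDerivAt
  exact h2.comp_hasDerivAt (c μ) h1

theorem hInv_symm {c : Pt} (hc : c ∈ κ.dom) (A B : Fin 2) :
    (F.gsMat κ c)⁻¹ A B = (F.gsMat κ c)⁻¹ B A := by
  have : (F.gsMat κ c)ᵀ = F.gsMat κ c := by ext i j; exact hF.symm c hc j i
  conv_rhs => rw [← this, ← Matrix.transpose_nonsing_inv, Matrix.transpose_apply]

/-- The derivative of `|T|²` along the sphere. -/
theorem hasDerivAt_normSq {c : Pt} (hc : c ∈ (F.reg κ r₀)) {T : STensor} (hT : T.SmoothOn (F.reg κ r₀)) (A : Fin 2) :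
    HasDerivAt (fun x => F.normSq κ T (Function.update c (sph A) x))
      (2 * nip (F.gsMat κ c)⁻¹ (fun I => T.comp I c) (fun I => (F.along κ (eS A) T).comp I c))
      (c (sph A)) := by
  have hO := isOpen_reg hF r₀
  -- The connection matrix in the direction `e_A`. The inverse metric is parallel for it, which is
  -- the hypothesis of `hasDerivAt_nip`, and the remaining term is then the covariant derivative of
  -- `T`.
  set G : Matrix (Fin 2) (Fin 2) ℝ := Matrix.of fun E D => F.projCov κ (eS A) E D c with hG
  have key := hasDerivAt_nip (a := fun x => (F.gsMat κ (Function.update c (sph A) x))⁻¹) (G := G)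
    (t := fun x I => T.comp I (Function.update c (sph A) x))
    (t' := fun I => pd (sph A) (T.comp I) c) (x := c (sph A))
    (by rw [Function.update_eq_self]; exact hInv_symm hF hc.1)
    (fun B C => by
      refine (hasDerivAt_line ((smooth_hInv hF r₀ B C).diffAt hO hc) (sph A)).congr_deriv ?_
      rw [pd_hInv hF hc, Function.update_eq_self]
      congr 1
      simp only [pd_h_eq hF hc]
      have hm : ∀ X Y, ∑ D, (F.gsMat κ c)⁻¹ X D * F.gsMat κ c D Y = if X = Y then 1 else 0 :=
        fun X Y => by
          rw [← Matrix.mul_apply, Matrix.nonsing_inv_mul _ (Ne.isUnit hc.2.2.1), Matrix.one_apply]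
      have hm' : ∀ X Y, ∑ D, F.gsMat κ c X D * (F.gsMat κ c)⁻¹ D Y = if X = Y then 1 else 0 :=
        fun X Y => by
          rw [← Matrix.mul_apply, Matrix.mul_nonsing_inv _ (Ne.isUnit hc.2.2.1), Matrix.one_apply]
      have e1 : ∑ E, ∑ D, (F.gsMat κ c)⁻¹ B E * (∑ X, F.gsMat κ c D X * F.projCov κ (eS A) E X c) *
          (F.gsMat κ c)⁻¹ D C = ∑ E, (F.gsMat κ c)⁻¹ B E * G E C := by
        refine Finset.sum_congr rfl fun E _ => ?_
        have : ∑ D, (F.gsMat κ c)⁻¹ B E * (∑ X, F.gsMat κ c D X * F.projCov κ (eS A) E X c) *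
          (F.gsMat κ c)⁻¹ D C = (F.gsMat κ c)⁻¹ B E * ∑ X, F.projCov κ (eS A) E X c *
            ∑ D, F.gsMat κ c X D * (F.gsMat κ c)⁻¹ D C := by
          simp only [Finset.mul_sum, Finset.sum_mul]
          rw [Finset.sum_comm]
          refine Finset.sum_congr rfl fun X _ => Finset.sum_congr rfl fun D _ => ?_
          rw [hF.symm c hc.1 D X]
          ring
        rw [this]
        simp [hm', hG]
      have e2 : ∑ E, ∑ D, (F.gsMat κ c)⁻¹ B E * (∑ X, F.gsMat κ c E X * F.projCov κ (eS A) D X c) *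
          (F.gsMat κ c)⁻¹ D C = ∑ E, (F.gsMat κ c)⁻¹ C E * G E B := by
        rw [Finset.sum_comm]
        refine Finset.sum_congr rfl fun D _ => ?_
        have : ∑ E, (F.gsMat κ c)⁻¹ B E * (∑ X, F.gsMat κ c E X * F.projCov κ (eS A) D X c) *
          (F.gsMat κ c)⁻¹ D C = (F.gsMat κ c)⁻¹ C D * ∑ X, (∑ E, (F.gsMat κ c)⁻¹ B E * F.gsMat κ c E X) *
            F.projCov κ (eS A) D X c := by
          simp only [Finset.mul_sum, Finset.sum_mul]
          rw [Finset.sum_comm]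
          refine Finset.sum_congr rfl fun X _ => Finset.sum_congr rfl fun E _ => ?_
          rw [hInv_symm hF hc.1 C D]
          ring
        rw [this]
        simp [hm, hG]
      rw [Finset.sum_add_distrib, ← e1, ← e2]
      simp only [← Finset.sum_add_distrib, ← add_mul, ← mul_add])
    (fun I => hasDerivAt_line ((hT I).diffAt hO hc) (sph A))
  refine key.congr_deriv ?_
  rw [Function.update_eq_self]
  congr 2
  ext I
  simp [along, derivAct, hG, eS, Pi.single_apply]

end Fields
end DoubleNull


namespace DoubleNull

/-! ### Elementary trace inequalities -/

/-- For every `x` in the interval `f a ≤ f x + ∫ |f'| ≤ g x + K ∫ g`; the average over `x` gives the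
bound. This is the one dimensional trace inequality underlying both the Sobolev inequality and the
estimate for `∂b`. -/
theorem le_setIntegral_of_deriv_le {f f' g : ℝ → ℝ} {a ℓ K : ℝ} (hℓ : 0 < ℓ) (hK : 0 ≤ K)
    (hf : ∀ x ∈ Icc a (a + ℓ), HasDerivAt f (f' x) x) (hg : ContinuousOn g (Icc a (a + ℓ)))
    (h0 : ∀ x ∈ Icc a (a + ℓ), 0 ≤ g x) (hfg : ∀ x ∈ Icc a (a + ℓ), f x ≤ g x)
    (hf' : ∀ x ∈ Icc a (a + ℓ), |f' x| ≤ K * g x) :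
    f a ≤ (1 / ℓ + K) * ∫ x in Icc a (a + ℓ), g x := by
  have hle : a ≤ a + ℓ := by linarith
  have hint : IntegrableOn g (Icc a (a + ℓ)) := hg.integrableOn_Icc
  set J := ∫ x in Icc a (a + ℓ), g x with hJ
  have h1 : ∀ x ∈ Icc a (a + ℓ), f a ≤ g x + K * J := by
    intro x hx
    have hsub : Icc a x ⊆ Icc a (a + ℓ) := Icc_subset_Icc_right hx.2
    have h2 := intervalIntegral.sub_le_integral_of_hasDeriv_right_of_le (g := fun y => - f y)
      (g' := fun y => - f' y) (φ := fun y => K * g y) hx.1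
      (fun y hy => (hf y (hsub hy)).neg.continuousAt.continuousWithinAt)
      (fun y hy => (hf y (hsub (Ioo_subset_Icc_self hy))).neg.hasDerivWithinAt)
      ((hint.mono_set hsub).const_mul K)
      (fun y hy => (neg_le_abs _).trans (hf' y (hsub (Ioo_subset_Icc_self hy))))
    rw [intervalIntegral.integral_const_mul, intervalIntegral.integral_of_le hx.1,
      ← integral_Icc_eq_integral_Ioc] at h2
    have h3 : ∫ y in Icc a x, g y ≤ J :=
      setIntegral_mono_set hint ((ae_restrict_iff' measurableSet_Icc).2 (Filter.Eventually.of_forall h0))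
        (LE.le.eventuallyLE hsub)
    have := hfg x hx
    nlinarith [mul_le_mul_of_nonneg_left h3 hK]
  have h4 : ∫ x in Icc a (a + ℓ), (f a - K * J) ≤ J :=
    setIntegral_mono_on (by simp) hint measurableSet_Icc fun x hx => by
      have := h1 x hx; linarith
  rw [setIntegral_const] at h4
  simp [hℓ.le] at h4
  rw [add_mul, one_div, inv_mul_eq_div]
  have : f a - K * J ≤ J / ℓ := by rw [le_div_iff₀ hℓ]; linarith
  linarith

theorem ofReal_le_lintegral_of_deriv_le {f f' g : ℝ → ℝ} {a ℓ K : ℝ} (hℓ : 0 < ℓ) (hK : 0 ≤ K)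
    (hf : ∀ x ∈ Icc a (a + ℓ), HasDerivAt f (f' x) x) (hg : ContinuousOn g (Icc a (a + ℓ)))
    (h0 : ∀ x ∈ Icc a (a + ℓ), 0 ≤ g x) (hfg : ∀ x ∈ Icc a (a + ℓ), f x ≤ g x)
    (hf' : ∀ x ∈ Icc a (a + ℓ), |f' x| ≤ K * g x) :
    ENNReal.ofReal (f a) ≤
      ENNReal.ofReal (1 / ℓ + K) * ∫⁻ x in Icc a (a + ℓ), ENNReal.ofReal (g x) := by
  rw [← ofReal_integral_eq_lintegral_ofReal hg.integrableOn_Icc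
    ((ae_restrict_iff' measurableSet_Icc).2 (Filter.Eventually.of_forall h0)),
    ← ENNReal.ofReal_mul (by positivity)]
  exact ENNReal.ofReal_le_ofReal (le_setIntegral_of_deriv_le hℓ hK hf hg h0 hfg hf')

/-- The square with lower left corner `θ` and side `ℓ`. -/
def square (θ : Plane) (ℓ : ℝ) : Set Plane := Icc θ (fun i => θ i + ℓ)

theorem mem_square {θ η : Plane} {ℓ : ℝ} :
    η ∈ square θ ℓ ↔ ∀ i, η i ∈ Icc (θ i) (θ i + ℓ) := by
  simp [square, Pi.le_def, mem_Icc, forall_and]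

theorem square_subset_closedBall {θ : Plane} {ℓ : ℝ} (hℓ : 0 ≤ ℓ) :
    square θ ℓ ⊆ Metric.closedBall θ ℓ := fun η hη => by
  rw [Metric.mem_closedBall, dist_pi_le_iff hℓ]
  intro i
  have := mem_square.1 hη i
  rw [Real.dist_eq, abs_le]
  constructor <;> linarith [this.1, this.2]

theorem lintegral_square {g : Plane → ℝ} {θ : Plane} {ℓ : ℝ} (hg : ContinuousOn g (square θ ℓ)) :
    ∫⁻ η in square θ ℓ, ENNReal.ofReal (g η) =
      ∫⁻ x in Icc (θ 0) (θ 0 + ℓ), ∫⁻ y in Icc (θ 1) (θ 1 + ℓ), ENNReal.ofReal (g ![x, y]) := by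
  have hS : MeasurableSet (square θ ℓ) := measurableSet_Icc
  have e1 := (volume_preserving_finTwoArrow ℝ).symm
  have hpre : (MeasurableEquiv.finTwoArrow.symm : ℝ × ℝ → Plane) ⁻¹' square θ ℓ =
      Icc (θ 0) (θ 0 + ℓ) ×ˢ Icc (θ 1) (θ 1 + ℓ) := by
    ext p
    rw [mem_preimage, mem_square, Fin.forall_fin_two]
    rfl
  rw [← e1.setLIntegral_comp_preimage_emb (MeasurableEquiv.measurableEmbedding _), hpre,
    Measure.volume_eq_prod, ← Measure.prod_restrict, lintegral_prod]
  · rfl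
  · rw [Measure.prod_restrict, ← Measure.volume_eq_prod]
    refine AEMeasurable.ennreal_ofReal ?_
    refine ContinuousOn.aemeasurable ?_ (measurableSet_Icc.prod measurableSet_Icc)
    rw [← hpre]
    refine hg.comp ?_ (fun _ h => h)
    have : Continuous (MeasurableEquiv.finTwoArrow.symm : ℝ × ℝ → Plane) := by
      refine continuous_pi fun i => ?_
      fin_cases i
      · exact continuous_fst
      · exact continuous_snd
    exact this.continuousOn

/-! ### Spheres on which the metric is comparable to the round metric -/

/-- The metric of `S_{u,v}` is comparable to `r² γ` in the chart. -/
structure GoodSphere (F : Fields) (κ : SphereChart) (r₀ u v : ℝ) : Prop where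
  fields : ChartFields F κ
  r_pos : 0 < v - u + r₀
  lapse : ∀ θ ∈ κ.U, F.Ω (κ.place (mkPt u v θ)) ≠ 0
  lower : ∀ θ ∈ κ.U, ∀ a : Plane, 1 / 2 * (v - u + r₀) ^ 2 * ∑ A, ∑ B, κ.round θ A B * a A * a B ≤
    ∑ A, ∑ B, F.gsMat κ (mkPt u v θ) A B * a A * a B
  upper : ∀ θ ∈ κ.U, ∀ a : Plane, ∑ A, ∑ B, F.gsMat κ (mkPt u v θ) A B * a A * a B ≤
    2 * (v - u + r₀) ^ 2 * ∑ A, ∑ B, κ.round θ A B * a A * a B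

/-- Bounds for the round metric in a chart. -/
structure RoundBound (κ : SphereChart) (M : ℝ) : Prop where
  one_le : 1 ≤ M
  diag : ∀ θ ∈ κ.U, ∀ A, κ.round θ A A ≤ M
  det : ∀ θ ∈ κ.U, 1 ≤ M * (κ.round θ).det

theorem RoundBound.mono {κ : SphereChart} {M M' : ℝ} (h : RoundBound κ M) (hM : M ≤ M') :
    RoundBound κ M' :=
  ⟨h.one_le.trans hM, fun θ hθ A => (h.diag θ hθ A).trans hM, fun θ hθ => (h.det θ hθ).trans
    (mul_le_mul_of_nonneg_right hM (κ.round_det_pos (κ.U_subset_N hθ)).le)⟩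

theorem exists_roundBound (κ : SphereChart) : ∃ M, RoundBound κ M := by
  have hc : ∀ A B, ContinuousOn (fun θ => κ.round θ A B) (closure κ.U) := fun A B =>
    (κ.contDiffOn_round A B).continuousOn.mono κ.closure_subset
  have hd : ContinuousOn (fun θ => ((κ.round θ).det)⁻¹) (closure κ.U) := by
    simp only [Matrix.det_fin_two]
    refine ContinuousOn.inv₀ (((hc 0 0).mul (hc 1 1)).sub ((hc 0 1).mul (hc 1 0))) fun θ hθ => ?_
    have := κ.round_det_pos (κ.closure_subset hθ)
    rw [Matrix.det_fin_two] at this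
    exact this.ne'
  obtain ⟨M0, h0⟩ := κ.isCompact_closure.exists_bound_of_continuousOn (hc 0 0)
  obtain ⟨M1, h1⟩ := κ.isCompact_closure.exists_bound_of_continuousOn (hc 1 1)
  obtain ⟨M2, h2⟩ := κ.isCompact_closure.exists_bound_of_continuousOn hd
  refine ⟨max 1 (max M0 (max M1 M2)), le_max_left _ _, fun θ hθ A => ?_, fun θ hθ => ?_⟩
  · have hθ' := subset_closure hθ
    fin_cases A
    · exact (le_abs_self _).trans ((h0 θ hθ').trans (by simp))
    · exact (le_abs_self _).trans ((h1 θ hθ').trans (by simp))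
  · have hp := κ.round_det_pos (κ.U_subset_N hθ)
    have h3 := (le_abs_self _).trans (h2 θ (subset_closure hθ))
    have h4 : ((κ.round θ).det)⁻¹ ≤ max 1 (max M0 (max M1 M2)) := h3.trans (by simp)
    rwa [inv_le_iff_one_le_mul₀ hp] at h4

/-- Monotonicity of the determinant. -/
theorem det_mul_le_det {h γ : Matrix (Fin 2) (Fin 2) ℝ} (hp : PD h) (hs : ∀ A B, γ A B = γ B A)
    (hd : 0 < γ.det) (ha : 0 < γ 0 0) {ρ : ℝ} (hρ : 0 ≤ ρ)
    (hle : ∀ a : Plane, ρ * ∑ A, ∑ B, γ A B * a A * a B ≤ ∑ A, ∑ B, h A B * a A * a B) :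
    ρ ^ 2 * γ.det ≤ h.det := by
  have h00 := hp.diag_pos 0
  have e0 := hle (Pi.single 0 1)
  simp [Pi.single_apply] at e0
  -- This vector minimises the form of `h` among the vectors with second component `1`, and the
  -- minimum is `det h / h 0 0`. The form of `γ` at any such vector is at least `det γ / γ 0 0`.
  have e1 := hle ![-h 0 1 / h 0 0, 1]
  simp only [Fin.sum_univ_two, Matrix.cons_val_zero, Matrix.cons_val_one, mul_one] at e1
  have hps := hp.symm 1 0
  have hγs := hs 1 0
  rw [Matrix.det_fin_two, hγs] at hd
  rw [Matrix.det_fin_two, Matrix.det_fin_two, hps, hγs]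
  rw [hps, hγs] at e1
  generalize h 0 0 = p at *
  generalize h 0 1 = q at *
  generalize h 1 1 = s at *
  generalize γ 0 0 = a at *
  generalize γ 0 1 = b at *
  generalize γ 1 1 = d at *
  set t := -q / p with ht
  have hpt : p * t = -q := by rw [ht]; field_simp
  have e2 : p * (p * t * t + q * t + (q * t + s)) = p * s - q * q := by
    linear_combination (p * t + q) * hpt
  have e3 : a * d - b * b ≤ a * (a * t * t + b * t + (b * t + d)) := by
    nlinarith [sq_nonneg (a * t + b)]
  rw [← e2]
  have hX : 0 < a * t * t + b * t + (b * t + d) := by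
    by_contra hcon
    push Not at hcon
    nlinarith [mul_nonneg ha.le (neg_nonneg.2 hcon)]
  calc ρ ^ 2 * (a * d - b * b) ≤ ρ ^ 2 * (a * (a * t * t + b * t + (b * t + d))) := by gcongr
      _ = (ρ * a) * (ρ * (a * t * t + b * t + (b * t + d))) := by ring
      _ ≤ _ := mul_le_mul e0 e1 (by positivity) h00.le

namespace GoodSphere

variable {F : Fields} {κ : SphereChart} {r₀ u v : ℝ} (hS : GoodSphere F κ r₀ u v)
include hS

omit hS in
theorem mem_dom (u v : ℝ) {θ : Plane} (hθ : θ ∈ κ.U) : mkPt u v θ ∈ κ.dom := by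
  simpa [SphereChart.dom, ang_mkPt] using hθ

omit hS in
theorem rad_mkPt (r₀ u v : ℝ) (θ : Plane) : rad r₀ (mkPt u v θ) = v - u + r₀ := by
  simp [rad, mkPt_zero, mkPt_one]

theorem pd_metric {θ : Plane} (hθ : θ ∈ κ.U) : PD (F.gsMat κ (mkPt u v θ)) := by
  refine ⟨hS.fields.symm _ (mem_dom u v hθ), fun a ha => lt_of_lt_of_le ?_ (hS.lower θ hθ a)⟩
  have := hS.r_pos
  have := κ.round_pos (κ.U_subset_N hθ) ha
  positivity

theorem mem_reg {θ : Plane} (hθ : θ ∈ κ.U) : mkPt u v θ ∈ F.reg κ r₀ :=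
  ⟨mem_dom u v hθ, hS.lapse θ hθ, (hS.pd_metric hθ).det_pos.ne', by
    rw [rad_mkPt]; exact hS.r_pos.ne'⟩

theorem diag_le {M : ℝ} (hM : RoundBound κ M) {θ : Plane} (hθ : θ ∈ κ.U) (A : Fin 2) :
    F.gsMat κ (mkPt u v θ) A A ≤ 2 * M * (v - u + r₀) ^ 2 := by
  have h1 := hS.upper θ hθ (Pi.single A 1)
  simp [Pi.single_apply] at h1
  have h2 := hM.diag θ hθ A
  nlinarith [sq_nonneg (v - u + r₀)]

theorem det_ge {M : ℝ} (hM : RoundBound κ M) {θ : Plane} (hθ : θ ∈ κ.U) :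
    (v - u + r₀) ^ 4 ≤ 4 * M * (F.gsMat κ (mkPt u v θ)).det := by
  have hγ : 0 < κ.round θ 0 0 := by
    have := κ.round_pos (κ.U_subset_N hθ) (a := Pi.single 0 1) (by simp)
    simpa [Pi.single_apply] using this
  have e1 := det_mul_le_det (hS.pd_metric hθ) (κ.round_symm θ)
    (κ.round_det_pos (κ.U_subset_N hθ)) hγ (ρ := 1 / 2 * (v - u + r₀) ^ 2) (by positivity)
    (hS.lower θ hθ)
  have e2 := hM.det θ hθ
  have hM1 := hM.one_le
  calc (v - u + r₀) ^ 4 = (v - u + r₀) ^ 4 * 1 := by ring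
    _ ≤ (v - u + r₀) ^ 4 * (M * (κ.round θ).det) := by gcongr
    _ = 4 * M * ((1 / 2 * (v - u + r₀) ^ 2) ^ 2 * (κ.round θ).det) := by ring
    _ ≤ _ := by gcongr

/-- Kato's inequality for the derivative of `|T|²` along the sphere. -/
theorem kato {M : ℝ} (hM : RoundBound κ M) {T : STensor} (hT : T.SmoothOn (F.reg κ r₀))
    {θ : Plane} (hθ : θ ∈ κ.U) (A : Fin 2) :
    ∃ D, HasDerivAt (fun x => F.normSq κ T (mkPt u v (Function.update θ A x))) D (θ A) ∧
      |D| ≤ 2 * M * (F.normSq κ T (mkPt u v θ)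
        + F.normSq κ (F.applyOp κ r₀ DOp.rAngular T) (mkPt u v θ)) := by
  set c := mkPt u v θ with hc
  have hreg : c ∈ F.reg κ r₀ := hS.mem_reg hθ
  have h1 := Fields.hasDerivAt_normSq hS.fields hreg hT A
  have e : ∀ x, Function.update c (sph A) x = mkPt u v (Function.update θ A x) := fun x => by
    ext μ
    fin_cases μ <;> fin_cases A <;> simp [hc, mkPt, sph]
  simp only [e] at h1
  rw [hc, mkPt_sph, ← hc] at h1
  refine ⟨_, h1, ?_⟩
  have hp := hS.pd_metric hθ
  rw [← hc] at hp
  have h2 := hp.nip_sq_le (fun I => T.comp I c) (fun I => (F.along κ (Fields.eS A) T).comp I c)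
  have h3 : nip (F.gsMat κ c)⁻¹ (fun I => (F.along κ (Fields.eS A) T).comp I c)
      (fun I => (F.along κ (Fields.eS A) T).comp I c) ≤
      F.gsMat κ c A A * F.normSq κ (F.angular κ T) c :=
    hp.nip_slice_le (n := T.rank) (fun J => (F.angular κ T).comp J c) A
  have h4 : F.normSq κ (F.applyOp κ r₀ DOp.rAngular T) c =
      rad r₀ c ^ 2 * F.normSq κ (F.angular κ T) c :=
    nip_smul (F.gsMat κ c)⁻¹ (rad r₀ c) fun J => (F.angular κ T).comp J c
  have h5 := hS.diag_le hM hθ A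
  have h6 : 0 ≤ F.normSq κ (F.angular κ T) c :=
    hp.nip_nonneg fun J => (F.angular κ T).comp J c
  have h7 : 0 ≤ F.normSq κ T c := hp.nip_nonneg fun J => T.comp J c
  rw [h4, hc, rad_mkPt, ← hc]
  rw [← hc] at h5
  set p := nip (F.gsMat κ c)⁻¹ (fun I => T.comp I c) (fun I => (F.along κ (Fields.eS A) T).comp I c)
  set q := F.normSq κ T c
  have h8 : p ^ 2 ≤ q * (2 * M * ((v - u + r₀) ^ 2 * F.normSq κ (F.angular κ T) c)) := by
    refine h2.trans (mul_le_mul_of_nonneg_left (h3.trans ?_) h7)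
    nlinarith
  set w := (v - u + r₀) ^ 2 * F.normSq κ (F.angular κ T) c
  have hw : 0 ≤ w := by positivity
  have hM1 := hM.one_le
  rw [abs_mul, abs_two]
  -- Here `p² ≤ 2M q w`, and the inequality between geometric and arithmetic means absorbs the
  -- factor because `M ≥ 1`.
  have h9 : (2 * |p|) ^ 2 ≤ (2 * M * (q + w)) ^ 2 := by
    rw [mul_pow, sq_abs]
    have : 0 ≤ q * w := mul_nonneg h7 hw
    nlinarith [sq_nonneg (q - w), mul_nonneg this (sub_nonneg.2 hM1), mul_nonneg (sq_nonneg (q + w)) (sub_nonneg.2 hM1)]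
  exact abs_le_of_sq_le_sq' h9 (by positivity) |>.2

theorem normSq_nonneg {θ : Plane} (hθ : θ ∈ κ.U) (T : STensor) :
    0 ≤ F.normSq κ T (mkPt u v θ) :=
  (hS.pd_metric hθ).nip_nonneg fun J => T.comp J _

omit hS in
theorem _root_.DoubleNull.continuous_mkPt (u v : ℝ) : Continuous (mkPt u v) := by
  unfold mkPt; fun_prop

theorem normSq_continuousOn {T : STensor} (hT : T.SmoothOn (F.reg κ r₀)) :
    ContinuousOn (fun θ => F.normSq κ T (mkPt u v θ)) κ.U :=
  (Fields.normSq_smooth hS.fields r₀ hT).continuousOn.comp (continuous_mkPt u v).continuousOn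
    fun _ hθ => hS.mem_reg hθ

/-- Pointwise values are controlled on lines. -/
theorem normSq_le_line {M ℓ : ℝ} (hM : RoundBound κ M) (hℓ : 0 < ℓ) {T : STensor}
    (hT : T.SmoothOn (F.reg κ r₀)) {θ : Plane} (A : Fin 2)
    (hθ : ∀ x ∈ Icc (θ A) (θ A + ℓ), Function.update θ A x ∈ κ.U) :
    ENNReal.ofReal (F.normSq κ T (mkPt u v θ)) ≤
      ENNReal.ofReal (1 / ℓ + 2 * M) * ∫⁻ x in Icc (θ A) (θ A + ℓ),
        ENNReal.ofReal (F.normSq κ T (mkPt u v (Function.update θ A x))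
          + F.normSq κ (F.applyOp κ r₀ DOp.rAngular T) (mkPt u v (Function.update θ A x))) := by
  have hk : ∀ x ∈ Icc (θ A) (θ A + ℓ), ∃ D,
      HasDerivAt (fun x => F.normSq κ T (mkPt u v (Function.update θ A x))) D x ∧
      |D| ≤ 2 * M * (F.normSq κ T (mkPt u v (Function.update θ A x))
        + F.normSq κ (F.applyOp κ r₀ DOp.rAngular T) (mkPt u v (Function.update θ A x))) := by
    intro x hx
    have := hS.kato hM hT (hθ x hx) A
    simpa using this
  choose! D hD1 hD2 using hk
  have hcont : Continuous fun x => Function.update θ A x := continuous_const.update A continuous_id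
  have key := ofReal_le_lintegral_of_deriv_le (f := fun x => F.normSq κ T (mkPt u v (Function.update θ A x)))
    (f' := D) (g := fun x => F.normSq κ T (mkPt u v (Function.update θ A x))
        + F.normSq κ (F.applyOp κ r₀ DOp.rAngular T) (mkPt u v (Function.update θ A x)))
    hℓ (K := 2 * M) (by have := hM.one_le; positivity) hD1
    (((hS.normSq_continuousOn hT).comp hcont.continuousOn hθ).add
      ((hS.normSq_continuousOn (Fields.applyOp_smooth hS.fields r₀ _ hT)).comp hcont.continuousOn hθ))
    (fun x hx => add_nonneg (hS.normSq_nonneg (hθ x hx) _) (hS.normSq_nonneg (hθ x hx) _))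
    (fun x hx => le_add_of_nonneg_right (hS.normSq_nonneg (hθ x hx) _))
    hD2
  simpa using key

/-- The area element of `gs` is at least `r² / (2M)`, so replacing it by the coordinate measure
gains the factor `r⁻²`. -/
theorem lintegral_square_le {M ℓ : ℝ} (hM : RoundBound κ M) (T : STensor) {θ : Plane}
    (hθ : square θ ℓ ⊆ κ.U) :
    ∫⁻ η in square θ ℓ, ENNReal.ofReal (F.normSq κ T (mkPt u v η)) ≤
      ENNReal.ofReal (2 * M / (v - u + r₀) ^ 2) * F.patchInt κ T u v := by
  have hM1 := hM.one_le
  have hr := hS.r_pos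
  unfold Fields.patchInt
  rw [← lintegral_const_mul' _ _ (by simp)]
  refine (setLIntegral_mono' measurableSet_Icc fun η hη => ?_).trans
    (lintegral_mono_set (μ := volume) hθ)
  rw [← ENNReal.ofReal_mul (by positivity)]
  refine ENNReal.ofReal_le_ofReal ?_
  have hN := hS.normSq_nonneg (hθ hη) T
  have hd := hS.det_ge hM (hθ hη)
  have h2 : (v - u + r₀) ^ 2 ≤ 2 * M * Real.sqrt (F.gsMat κ (mkPt u v η)).det := by
    have h3 : (v - u + r₀) ^ 2 / (2 * M) ≤ Real.sqrt (F.gsMat κ (mkPt u v η)).det := by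
      refine Real.le_sqrt_of_sq_le ?_
      rw [div_pow, div_le_iff₀ (by positivity)]
      have hdet := (hS.pd_metric (hθ hη)).det_pos
      calc ((v - u + r₀) ^ 2) ^ 2 = (v - u + r₀) ^ 4 := by ring
        _ ≤ 4 * M * (F.gsMat κ (mkPt u v η)).det := hd
        _ ≤ (F.gsMat κ (mkPt u v η)).det * (2 * M) ^ 2 := by
          nlinarith [mul_nonneg (mul_nonneg hdet.le (sub_nonneg.2 hM1)) (zero_le_one.trans hM1)]
    rwa [div_le_iff₀ (by positivity), mul_comm] at h3
  have h4 : 1 ≤ 2 * M / (v - u + r₀) ^ 2 * Real.sqrt (F.gsMat κ (mkPt u v η)).det := by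
    rw [div_mul_eq_mul_div, le_div_iff₀ (by positivity)]; linarith
  nlinarith

/-- The trace of a tensor on a line. -/
theorem lintegral_line_le {M ℓ : ℝ} (hM : RoundBound κ M) (hℓ : 0 < ℓ) {T : STensor}
    (hT : T.SmoothOn (F.reg κ r₀)) {θ : Plane} (hθ : square θ ℓ ⊆ κ.U) {E : ℝ}
    (h0 : F.patchInt κ T u v ≤ ENNReal.ofReal E)
    (h1 : F.patchInt κ (F.applyOp κ r₀ DOp.rAngular T) u v ≤ ENNReal.ofReal E) :
    ∫⁻ x in Icc (θ 0) (θ 0 + ℓ), ENNReal.ofReal (F.normSq κ T (mkPt u v (Function.update θ 0 x))) ≤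
      ENNReal.ofReal ((1 / ℓ + 2 * M) * (4 * M / (v - u + r₀) ^ 2 * E)) := by
  have hM1 := hM.one_le
  have hr := hS.r_pos
  have hT' := Fields.applyOp_smooth hS.fields r₀ DOp.rAngular hT
  set T' := F.applyOp κ r₀ DOp.rAngular T
  have hmem : ∀ x ∈ Icc (θ 0) (θ 0 + ℓ), ∀ y ∈ Icc (θ 1) (θ 1 + ℓ), ![x, y] ∈ κ.U :=
    fun x hx y hy => hθ (mem_square.2 (by rw [Fin.forall_fin_two]; exact ⟨hx, hy⟩))
  have hup : ∀ x y, Function.update (Function.update θ 0 x) 1 y = ![x, y] := fun x y => by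
    ext i; fin_cases i <;> simp
  have e1 : ∀ x ∈ Icc (θ 0) (θ 0 + ℓ),
      ENNReal.ofReal (F.normSq κ T (mkPt u v (Function.update θ 0 x))) ≤
        ENNReal.ofReal (1 / ℓ + 2 * M) * ∫⁻ y in Icc (θ 1) (θ 1 + ℓ),
          ENNReal.ofReal (F.normSq κ T (mkPt u v ![x, y]) + F.normSq κ T' (mkPt u v ![x, y])) := by
    intro x hx
    have := hS.normSq_le_line hM hℓ hT (θ := Function.update θ 0 x) 1 (fun y hy => by
      rw [hup]; exact hmem x hx y (by simpa using hy))
    simpa [hup] using this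
  have hc : ContinuousOn (fun η => F.normSq κ T (mkPt u v η)) (square θ ℓ) :=
    (hS.normSq_continuousOn hT).mono hθ
  have hc' : ContinuousOn (fun η => F.normSq κ T' (mkPt u v η)) (square θ ℓ) :=
    (hS.normSq_continuousOn hT').mono hθ
  calc _ ≤ ∫⁻ x in Icc (θ 0) (θ 0 + ℓ), (ENNReal.ofReal (1 / ℓ + 2 * M) *
          ∫⁻ y in Icc (θ 1) (θ 1 + ℓ),
          ENNReal.ofReal (F.normSq κ T (mkPt u v ![x, y]) + F.normSq κ T' (mkPt u v ![x, y]))) :=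
        setLIntegral_mono' measurableSet_Icc e1
    _ = ENNReal.ofReal (1 / ℓ + 2 * M) * ∫⁻ η in square θ ℓ,
          ENNReal.ofReal (F.normSq κ T (mkPt u v η) + F.normSq κ T' (mkPt u v η)) := by
        rw [lintegral_const_mul' _ _ (by simp), lintegral_square (g := fun η => F.normSq κ T (mkPt u v η) + F.normSq κ T' (mkPt u v η))
          (hc.add hc')]
    _ ≤ ENNReal.ofReal (1 / ℓ + 2 * M) * (ENNReal.ofReal (2 * M / (v - u + r₀) ^ 2) *
          (ENNReal.ofReal E + ENNReal.ofReal E)) := by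
        gcongr
        calc _ = ∫⁻ η in square θ ℓ, (ENNReal.ofReal (F.normSq κ T (mkPt u v η)) +
              ENNReal.ofReal (F.normSq κ T' (mkPt u v η))) :=
              setLIntegral_congr_fun measurableSet_Icc fun η hη =>
                ENNReal.ofReal_add (hS.normSq_nonneg (hθ hη) _) (hS.normSq_nonneg (hθ hη) _)
          _ = (∫⁻ η in square θ ℓ, ENNReal.ofReal (F.normSq κ T (mkPt u v η))) +
              ∫⁻ η in square θ ℓ, ENNReal.ofReal (F.normSq κ T' (mkPt u v η)) :=
              lintegral_add_left' (hc.aemeasurable measurableSet_Icc).ennreal_ofReal _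
          _ ≤ _ := by
              rw [mul_add]
              exact add_le_add
                ((hS.lintegral_square_le hM T hθ).trans (mul_le_mul_right h0 _))
                ((hS.lintegral_square_le hM T' hθ).trans (mul_le_mul_right h1 _))
    _ = _ := by
        have h2M : (0 : ℝ) ≤ 2 * M / (v - u + r₀) ^ 2 := by positivity
        rw [ENNReal.ofReal_mul (by positivity)]
        congr 1
        rw [show 4 * M / (v - u + r₀) ^ 2 * E = 2 * M / (v - u + r₀) ^ 2 * (2 * E) by ring,
          ENNReal.ofReal_mul h2M, ← two_mul, ENNReal.ofReal_mul zero_le_two]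
        simp

/-- The Sobolev inequality. -/
theorem sobolev {M ℓ : ℝ} (hM : RoundBound κ M) (hℓ : 0 < ℓ) {T : STensor}
    (hT : T.SmoothOn (F.reg κ r₀)) {θ : Plane} (hθ : square θ ℓ ⊆ κ.U) {E : ℝ} (hE : 0 ≤ E)
    (h0 : F.patchInt κ T u v ≤ ENNReal.ofReal E)
    (h1 : F.patchInt κ (F.applyOp κ r₀ DOp.rAngular T) u v ≤ ENNReal.ofReal E)
    (h2 : F.patchInt κ (F.applyOp κ r₀ DOp.rAngular (F.applyOp κ r₀ DOp.rAngular T)) u v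
      ≤ ENNReal.ofReal E) :
    F.normSq κ T (mkPt u v θ) ≤ (1 / ℓ + 2 * M) ^ 2 * (8 * M / (v - u + r₀) ^ 2 * E) := by
  have hM1 := hM.one_le
  have hr := hS.r_pos
  have hT' := Fields.applyOp_smooth hS.fields r₀ DOp.rAngular hT
  have hmem : ∀ x ∈ Icc (θ 0) (θ 0 + ℓ), Function.update θ 0 x ∈ κ.U := fun x hx =>
    hθ (mem_square.2 (by
      rw [Fin.forall_fin_two]
      exact ⟨by simpa using hx, by simp [hℓ.le]⟩))
  have hcont : Continuous fun x => Function.update θ 0 x := continuous_const.update 0 continuous_id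
  -- The point value is bounded by an integral over a horizontal line of `|T|²` and `|r∇T|²`. Each
  -- of these line integrals is in turn bounded by an integral over the square at the cost of one
  -- more derivative, so two derivatives are needed altogether.
  have key := hS.normSq_le_line hM hℓ hT 0 hmem
  have e : ∫⁻ x in Icc (θ 0) (θ 0 + ℓ),
        ENNReal.ofReal (F.normSq κ T (mkPt u v (Function.update θ 0 x))
          + F.normSq κ (F.applyOp κ r₀ DOp.rAngular T) (mkPt u v (Function.update θ 0 x))) =
      (∫⁻ x in Icc (θ 0) (θ 0 + ℓ), ENNReal.ofReal (F.normSq κ T (mkPt u v (Function.update θ 0 x)))) +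
      ∫⁻ x in Icc (θ 0) (θ 0 + ℓ), ENNReal.ofReal
        (F.normSq κ (F.applyOp κ r₀ DOp.rAngular T) (mkPt u v (Function.update θ 0 x))) := by
    rw [← lintegral_add_left']
    · exact setLIntegral_congr_fun measurableSet_Icc fun x hx =>
        ENNReal.ofReal_add (hS.normSq_nonneg (hmem x hx) _) (hS.normSq_nonneg (hmem x hx) _)
    · exact (((hS.normSq_continuousOn hT).comp hcont.continuousOn hmem).aemeasurable
        measurableSet_Icc).ennreal_ofReal
  rw [e] at key
  have key2 := key.trans (mul_le_mul_right (add_le_add (hS.lintegral_line_le hM hℓ hT hθ h0 h1)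
    (hS.lintegral_line_le hM hℓ hT' hθ h1 h2)) _)
  rw [← ENNReal.ofReal_add (by positivity) (by positivity), ← ENNReal.ofReal_mul (by positivity),
    ENNReal.ofReal_le_ofReal_iff (by positivity)] at key2
  refine key2.trans_eq ?_
  ring

end GoodSphere

end DoubleNull


namespace DoubleNull

/-! ### Pointwise consequences of the bootstrap assumptions -/

theorem ofReal_le_of_weighted {w E : ℝ} {P : ENNReal} (hw : 0 < w)
    (h : ENNReal.ofReal w * P ≤ ENNReal.ofReal E) : P ≤ ENNReal.ofReal (E / w) := by
  rw [ENNReal.ofReal_div_of_pos hw, ENNReal.le_div_iff_mul_le (by simp [hw]) (by simp), mul_comm]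
  exact h

section

variable {F : Fields} {𝔄 : SphereAtlas} {r₀ u v Cbar Cb : ℝ}

theorem patchInt_ricci_le (hr : 0 < v - u + r₀) (hR : F.RicciBootstrap r₀ 𝔄 Cbar u v)
    (hC : Cbar ≤ Cb) (i : Fin 2) (n : RicciName) (ops : List DOp) (ho : ops.length ≤ 2) :
    F.patchInt (𝔄.chart i)
        (F.applyOps (𝔄.chart i) r₀ ops (F.ricci (𝔄.chart i) r₀ n)) u v ≤
      ENNReal.ofReal (Cb / ((v - u + r₀) ^ (2 * n.index) / (v - u + r₀) ^ 2)) :=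
  ofReal_le_of_weighted (by positivity) ((hR i n ops ho).trans (ENNReal.ofReal_le_ofReal hC))

theorem patchInt_christoffel_le (hK : F.ChristoffelBootstrap r₀ 𝔄 Cbar u v)
    (hC : Cbar ≤ Cb) (i : Fin 2) (ops : List DOp) (ho : ops.length ≤ 2) :
    F.patchInt (𝔄.chart i)
        (F.applyOps (𝔄.chart i) r₀ ops (F.christoffelDiff (𝔄.chart i) r₀)) u v ≤
      ENNReal.ofReal Cb :=
  (le_self_add.trans le_self_add).trans ((hK i ops ho).trans (ENNReal.ofReal_le_ofReal hC))

theorem patchInt_christoffel_four_le (hK : F.ChristoffelBootstrap r₀ 𝔄 Cbar u v)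
    (hC : Cbar ≤ Cb) (i : Fin 2) (ops : List DOp) (ho : ops.length ≤ 2) :
    F.patchInt (𝔄.chart i)
        (F.applyOps (𝔄.chart i) r₀ (ops ++ [DOp.rFour]) (F.christoffelDiff (𝔄.chart i) r₀)) u v ≤
      ENNReal.ofReal Cb :=
  le_add_self.trans ((hK i ops ho).trans (ENNReal.ofReal_le_ofReal hC))

end

/-- The constant of the Sobolev inequality. -/
noncomputable def sobConst (M ℓ : ℝ) : ℝ := (1 / ℓ + 2 * M) ^ 2 * (8 * M)

section

variable {F : Fields} {𝔄 : SphereAtlas} {r₀ u v Cbar Cb M ℓ : ℝ} {j : Fin 2}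

theorem sobConst_pos (hM : 1 ≤ M) (hℓ : 0 < ℓ) : 0 < sobConst M ℓ := by
  unfold sobConst; positivity

/-- The bootstrap weight leaves `∫ |𝔇^k Γ_p|²` of order `r^(2-2p)`, and the Sobolev inequality
divides by the area `r²`. Hence `Γ_p` decays pointwise like `r⁻ᵖ` in norm. -/
theorem ricci_normSq_le (hS : GoodSphere F (𝔄.chart j) r₀ u v) (hM : RoundBound (𝔄.chart j) M)
    (hℓ : 0 < ℓ) (hR : F.RicciBootstrap r₀ 𝔄 Cbar u v) (hC : Cbar ≤ Cb) (hC0 : 0 ≤ Cb)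
    {θ : Plane} (hθ : square θ ℓ ⊆ (𝔄.chart j).U) (n : RicciName) :
    F.normSq (𝔄.chart j) (F.ricci (𝔄.chart j) r₀ n) (mkPt u v θ) ≤
      sobConst M ℓ * Cb / (v - u + r₀) ^ (2 * n.index) := by
  have hr := hS.r_pos
  have h := hS.sobolev hM hℓ (Fields.ricci_smooth hS.fields r₀ n) hθ (by positivity)
    (patchInt_ricci_le hr hR hC j n [] (by simp))
    (patchInt_ricci_le hr hR hC j n [DOp.rAngular] (by simp))
    (patchInt_ricci_le hr hR hC j n [DOp.rAngular, DOp.rAngular] (by simp))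
  refine h.trans_eq ?_
  unfold sobConst
  field_simp

theorem christoffel_normSq_le (hS : GoodSphere F (𝔄.chart j) r₀ u v)
    (hM : RoundBound (𝔄.chart j) M)
    (hℓ : 0 < ℓ) (hK : F.ChristoffelBootstrap r₀ 𝔄 Cbar u v) (hC : Cbar ≤ Cb) (hC0 : 0 ≤ Cb)
    {θ : Plane} (hθ : square θ ℓ ⊆ (𝔄.chart j).U) :
    F.normSq (𝔄.chart j) (F.christoffelDiff (𝔄.chart j) r₀) (mkPt u v θ) ≤
      sobConst M ℓ * Cb / (v - u + r₀) ^ 2 := by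
  have h := hS.sobolev hM hℓ (Fields.christoffelDiff_smooth hS.fields r₀) hθ hC0
    (patchInt_christoffel_le hK hC j [] (by simp))
    (patchInt_christoffel_le hK hC j [DOp.rAngular] (by simp))
    (patchInt_christoffel_le hK hC j [DOp.rAngular, DOp.rAngular] (by simp))
  refine h.trans_eq ?_
  unfold sobConst
  ring

/-- The Sobolev inequality needs two derivatives beyond `r∇_4`. They are available because the
assumption on the connection allows `k ≤ 2` after `r∇_4` has been applied. -/
theorem christoffel_four_normSq_le (hS : GoodSphere F (𝔄.chart j) r₀ u v)
    (hM : RoundBound (𝔄.chart j) M)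
    (hℓ : 0 < ℓ) (hK : F.ChristoffelBootstrap r₀ 𝔄 Cbar u v) (hC : Cbar ≤ Cb) (hC0 : 0 ≤ Cb)
    {θ : Plane} (hθ : square θ ℓ ⊆ (𝔄.chart j).U) :
    F.normSq (𝔄.chart j) (F.applyOp (𝔄.chart j) r₀ DOp.rFour
        (F.christoffelDiff (𝔄.chart j) r₀)) (mkPt u v θ) ≤
      sobConst M ℓ * Cb / (v - u + r₀) ^ 2 := by
  have h := hS.sobolev hM hℓ (Fields.applyOp_smooth hS.fields r₀ DOp.rFour
      (Fields.christoffelDiff_smooth hS.fields r₀)) hθ hC0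
    (patchInt_christoffel_four_le hK hC j [] (by simp))
    (patchInt_christoffel_four_le hK hC j [DOp.rAngular] (by simp))
    (patchInt_christoffel_four_le hK hC j [DOp.rAngular, DOp.rAngular] (by simp))
  refine h.trans_eq ?_
  unfold sobConst
  ring

/-- Components are controlled by the norm. -/
theorem GoodSphere.comp_abs_le {κ : SphereChart} (hS : GoodSphere F κ r₀ u v)
    (hM : RoundBound κ M) {θ : Plane} (hθ : θ ∈ κ.U) (T : STensor) (I : Fin T.rank → Fin 2) :
    |T.comp I (mkPt u v θ)| ≤ (2 * M) ^ T.rank * (v - u + r₀) ^ T.rank *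
      Real.sqrt (F.normSq κ T (mkPt u v θ)) := by
  have hr := hS.r_pos
  have hM1 := hM.one_le
  have h1 := (hS.pd_metric hθ).comp_sq_le (fun J => T.comp J (mkPt u v θ)) I
  have h2 : ∏ i, F.gsMat κ (mkPt u v θ) (I i) (I i) ≤ (2 * M * (v - u + r₀) ^ 2) ^ T.rank := by
    refine (Finset.prod_le_prod (fun i _ => ((hS.pd_metric hθ).diag_pos _).le)
      fun i _ => hS.diag_le hM hθ (I i)).trans_eq ?_
    simp
  have hN := hS.normSq_nonneg hθ T
  refine abs_le_of_sq_le_sq (h1.trans ?_) (by positivity)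
  change _ * F.normSq κ T (mkPt u v θ) ≤ _
  rw [mul_pow _ (Real.sqrt _), Real.sq_sqrt hN]
  refine mul_le_mul_of_nonneg_right (h2.trans ?_) hN
  have h3 : (1 : ℝ) ≤ (2 * M) ^ T.rank := one_le_pow₀ (by linarith)
  calc (2 * M * (v - u + r₀) ^ 2) ^ T.rank = (2 * M) ^ T.rank * ((v - u + r₀) ^ T.rank) ^ 2 := by
        rw [mul_pow (2 * M), ← pow_mul, ← pow_mul, mul_comm 2 T.rank]
    _ ≤ ((2 * M) ^ T.rank) ^ 2 * ((v - u + r₀) ^ T.rank) ^ 2 :=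
        mul_le_mul_of_nonneg_right (by nlinarith) (by positivity)
    _ = _ := by ring

end

/-! ### The metric stays close to the round metric -/

/-- Completing the square in either variable shows that the determinant times the square of one
component is at most the opposite diagonal entry times the form. The bounds on the determinant and
on the diagonal then control the smallest eigenvalue. -/
theorem round_lower {κ : SphereChart} {M : ℝ} (hM : RoundBound κ M) {θ : Plane} (hθ : θ ∈ κ.U)
    (a : Plane) : a 0 ^ 2 + a 1 ^ 2 ≤ 2 * M ^ 2 * ∑ A, ∑ B, κ.round θ A B * a A * a B := by
  have h0 := hM.diag θ hθ 0
  have h1 := hM.diag θ hθ 1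
  have hd := hM.det θ hθ
  have hM1 := hM.one_le
  have hp : ∀ A, 0 < κ.round θ A A := fun A => by
    have := κ.round_pos (κ.U_subset_N hθ) (a := Pi.single A 1) (by simp)
    simpa [Pi.single_apply] using this
  have hp0 := hp 0
  have hp1 := hp 1
  have hs := κ.round_symm θ 1 0
  simp only [Fin.sum_univ_two, Matrix.det_fin_two, hs] at hd ⊢
  generalize κ.round θ 0 0 = p at *
  generalize κ.round θ 0 1 = q at *
  generalize κ.round θ 1 1 = s at *
  generalize a 0 = x at *
  generalize a 1 = y at *
  set Q := p * x * x + q * x * y + (q * y * x + s * y * y) with hQ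
  have e1 : (p * s - q * q) * y ^ 2 ≤ p * Q := by nlinarith [sq_nonneg (p * x + q * y)]
  have e2 : (p * s - q * q) * x ^ 2 ≤ s * Q := by nlinarith [sq_nonneg (s * y + q * x)]
  have hQ0 : 0 ≤ Q := by
    have : 0 < p * s - q * q := by
      by_contra hcon
      push Not at hcon
      nlinarith
    have : 0 ≤ p * Q := le_trans (by positivity) e1
    exact nonneg_of_mul_nonneg_right this hp0
  have e3 : x ^ 2 ≤ M * (s * Q) := by
    calc x ^ 2 ≤ (M * (p * s - q * q)) * x ^ 2 := by nlinarith [sq_nonneg x]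
      _ = M * ((p * s - q * q) * x ^ 2) := by ring
      _ ≤ _ := by gcongr
  have e4 : y ^ 2 ≤ M * (p * Q) := by
    calc y ^ 2 ≤ (M * (p * s - q * q)) * y ^ 2 := by nlinarith [sq_nonneg y]
      _ = M * ((p * s - q * q) * y ^ 2) := by ring
      _ ≤ _ := by gcongr
  have e5 : M * (s * Q) ≤ M * (M * Q) := by gcongr
  have e6 : M * (p * Q) ≤ M * (M * Q) := by gcongr
  nlinarith

section

variable {F : Fields} {𝔄 : SphereAtlas}

/-- The quadratic form of the metric in a chart. -/
theorem gs_quad (F : Fields) (κ : SphereChart) (c : Pt) (a : Plane) :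
    ∑ A, ∑ B, F.gsMat κ c A B * a A * a B =
      F.gs (κ.place c) (∑ A, a A • κ.dPhi (ang c) A) (∑ A, a A • κ.dPhi (ang c) A) := by
  simp only [Fin.sum_univ_two, Fields.gsMat, Matrix.of_apply, map_add, map_smul,
    LinearMap.add_apply, LinearMap.smul_apply, smul_eq_mul]
  ring

/-- Comparability with `r²γ` is a statement about tangent vectors and does not depend on the chart.
It is therefore enough to verify it on the compact cores, whose images cover the sphere; a point of
the larger domain `U` is treated in the chart whose core contains it. The constant `16M²` makes the
error at most a quarter of `r²γ`, by `round_lower`. -/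
theorem goodSphere_of_close (𝔎 : Cover 𝔄) {M r₀ u v : ℝ} (hM : ∀ j, RoundBound (𝔄.chart j) M)
    (hf : ∀ j, ChartFields F (𝔄.chart j)) (hr : 0 < v - u + r₀)
    (hΩ : ∀ x : E3, ‖x‖ = 1 → F.Ω (u, v, x) ≠ 0)
    (hc : ∀ j, ∀ θ ∈ 𝔎.K j, ∀ A B, |F.gsMat (𝔄.chart j) (mkPt u v θ) A B -
      (v - u + r₀) ^ 2 * (𝔄.chart j).round θ A B| ≤ (v - u + r₀) ^ 2 / (16 * M ^ 2)) (i : Fin 2) :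
    GoodSphere F (𝔄.chart i) r₀ u v := by
  have hM1 := (hM 0).one_le
  set ρ := (v - u + r₀) ^ 2 with hρ
  have hρ0 : 0 < ρ := by positivity
  have hKU : ∀ j, 𝔎.K j ⊆ (𝔄.chart j).U := fun j =>
    (Metric.self_subset_cthickening _).trans (𝔎.thick j)
  have key : ∀ j, ∀ θ ∈ 𝔎.K j, ∀ a : Plane,
      |∑ A, ∑ B, F.gsMat (𝔄.chart j) (mkPt u v θ) A B * a A * a B -
        ρ * ∑ A, ∑ B, (𝔄.chart j).round θ A B * a A * a B| ≤
        1 / 2 * ρ * ∑ A, ∑ B, (𝔄.chart j).round θ A B * a A * a B := by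
    intro j θ hθ a
    have h1 := round_lower (hM j) (hKU j hθ) a
    have h2 := hc j θ hθ
    set Q := ∑ A, ∑ B, (𝔄.chart j).round θ A B * a A * a B with hQ
    set δ : Fin 2 → Fin 2 → ℝ := fun A B => F.gsMat (𝔄.chart j) (mkPt u v θ) A B -
      ρ * (𝔄.chart j).round θ A B with hδ
    have h3 : ∑ A, ∑ B, F.gsMat (𝔄.chart j) (mkPt u v θ) A B * a A * a B - ρ * Q =
        ∑ A, ∑ B, δ A B * (a A * a B) := by
      simp only [hQ, hδ, Fin.sum_univ_two]; ring
    have h4 : |∑ A, ∑ B, δ A B * (a A * a B)| ≤ ∑ A, ∑ B, ρ / (16 * M ^ 2) * (|a A| * |a B|) := by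
      refine (Finset.abs_sum_le_sum_abs _ _).trans (Finset.sum_le_sum fun A _ => ?_)
      refine (Finset.abs_sum_le_sum_abs _ _).trans (Finset.sum_le_sum fun B _ => ?_)
      rw [abs_mul, abs_mul]
      exact mul_le_mul_of_nonneg_right (h2 A B) (by positivity)
    rw [h3]
    refine h4.trans ?_
    simp only [Fin.sum_univ_two]
    have h5 : |a 0| * |a 0| + |a 0| * |a 1| + (|a 1| * |a 0| + |a 1| * |a 1|) ≤
        2 * (2 * M ^ 2 * Q) := by
      have e0 := abs_mul_abs_self (a 0)
      have e1 := abs_mul_abs_self (a 1)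
      nlinarith [sq_nonneg (|a 0| - |a 1|)]
    have h6 : 0 ≤ ρ / (16 * M ^ 2) := by positivity
    have h7 := mul_le_mul_of_nonneg_left h5 h6
    have h8 : ρ / (16 * M ^ 2) * (2 * (2 * M ^ 2 * Q)) = 1 / 4 * ρ * Q := by field_simp; ring
    rw [h8] at h7
    have hQ0 : 0 ≤ Q := by
      have : 0 ≤ 2 * M ^ 2 * Q := le_trans (by positivity) h1
      exact nonneg_of_mul_nonneg_right this (by positivity)
    have : 0 ≤ ρ * Q := by positivity
    nlinarith
  have key2 : ∀ θ ∈ (𝔄.chart i).U, ∀ a : Plane,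
      |∑ A, ∑ B, F.gsMat (𝔄.chart i) (mkPt u v θ) A B * a A * a B -
        ρ * ∑ A, ∑ B, (𝔄.chart i).round θ A B * a A * a B| ≤
        1 / 2 * ρ * ∑ A, ∑ B, (𝔄.chart i).round θ A B * a A * a B := by
    intro θ hθ a
    have hN := (𝔄.chart i).U_subset_N hθ
    obtain ⟨j, η, hη, e⟩ := 𝔎.cover _ ((𝔄.chart i).mem_sphere θ hN)
    have hNη := (𝔄.chart j).U_subset_N (hKU j hη)
    set X := ∑ A, a A • (𝔄.chart i).dPhi θ A with hX
    have hXp : inner ℝ ((𝔄.chart j).Φ η) X = 0 := by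
      rw [e, hX]; simp [inner_add_right, real_inner_smul_right, (𝔄.chart i).inner_phi_dPhi hN]
    have hs := (𝔄.chart j).sum_tangentComp hNη hXp
    have h1 := key j η hη ((𝔄.chart j).tangentComp η X)
    rw [gs_quad, SphereChart.round_quad, ang_mkPt, hs] at h1
    rw [gs_quad, SphereChart.round_quad, ang_mkPt, ← hX]
    simpa [SphereChart.place, ang_mkPt, e, mkPt_zero, mkPt_one] using h1
  refine ⟨hf i, hr, fun θ hθ => ?_, fun θ hθ a => ?_, fun θ hθ a => ?_⟩
  · simpa [SphereChart.place, ang_mkPt, mkPt_zero, mkPt_one] using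
      hΩ _ ((𝔄.chart i).mem_sphere θ ((𝔄.chart i).U_subset_N hθ))
  · have := (abs_le.1 (key2 θ hθ a)).1
    linarith
  · have := (abs_le.1 (key2 θ hθ a)).2
    have h3 : 0 ≤ ∑ A, ∑ B, (𝔄.chart i).round θ A B * a A * a B := by
      rw [SphereChart.round_quad]; positivity
    have : 0 ≤ ρ * ∑ A, ∑ B, (𝔄.chart i).round θ A B * a A * a B := by positivity
    nlinarith

theorem gCirc_mkPt (κ : SphereChart) (r₀ u v : ℝ) (θ : Plane) (A B : Fin 2) :
    gCirc κ r₀ (mkPt u v θ) A B = (v - u + r₀) ^ 2 * κ.round θ A B := by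
  simp [gCirc, GoodSphere.rad_mkPt, ang_mkPt]

/-- The pointwise bound for the metric. -/
theorem GoodSphere.metric_close {r₀ u v Cbar Cb M ℓ : ℝ} {j : Fin 2}
    (hS : GoodSphere F (𝔄.chart j) r₀ u v) (hM : RoundBound (𝔄.chart j) M)
    (hℓ : 0 < ℓ) (hR : F.RicciBootstrap r₀ 𝔄 Cbar u v) (hC : Cbar ≤ Cb) (hC0 : 0 ≤ Cb)
    {θ : Plane} (hθ : square θ ℓ ⊆ (𝔄.chart j).U) (A B : Fin 2) :
    |F.gsMat (𝔄.chart j) (mkPt u v θ) A B - (v - u + r₀) ^ 2 * (𝔄.chart j).round θ A B| ≤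
      (2 * M) ^ 2 * Real.sqrt (sobConst M ℓ * Cb) * (v - u + r₀) := by
  have hr := hS.r_pos
  have hM1 := hM.one_le
  have hθU : θ ∈ (𝔄.chart j).U := hθ (mem_square.2 fun i => by simp [hℓ.le])
  have h1 := ricci_normSq_le hS hM hℓ hR hC hC0 hθ RicciName.metric
  have h2 := hS.comp_abs_le hM hθU (F.ricci (𝔄.chart j) r₀ RicciName.metric) ![A, B]
  have e : (F.ricci (𝔄.chart j) r₀ RicciName.metric).comp ![A, B] (mkPt u v θ) =
      F.gsMat (𝔄.chart j) (mkPt u v θ) A B - (v - u + r₀) ^ 2 * (𝔄.chart j).round θ A B := by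
    rw [← gCirc_mkPt]; rfl
  rw [e] at h2
  refine h2.trans ?_
  have h3 := Real.sqrt_le_sqrt h1
  simp only [RicciName.index, mul_one] at h3
  rw [Real.sqrt_div (mul_nonneg (sobConst_pos hM1 hℓ).le hC0), Real.sqrt_sq hr.le] at h3
  calc (2 * M) ^ 2 * (v - u + r₀) ^ 2 *
        Real.sqrt (F.normSq (𝔄.chart j) (F.ricci (𝔄.chart j) r₀ RicciName.metric) (mkPt u v θ))
      ≤ (2 * M) ^ 2 * (v - u + r₀) ^ 2 * (Real.sqrt (sobConst M ℓ * Cb) / (v - u + r₀)) := by gcongr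
    _ = _ := by field_simp

theorem Cover.square_subset (𝔎 : Cover 𝔄) {j : Fin 2} {θ : Plane} {δ : ℝ} (hδ0 : 0 ≤ δ)
    (hθ : θ ∈ Metric.cthickening δ (𝔎.K j)) :
    square θ 𝔎.ℓ ⊆ Metric.cthickening (δ + 𝔎.ℓ) (𝔎.K j) := fun η hη => by
  rw [(𝔎.isCompact j).cthickening_eq_biUnion_closedBall hδ0] at hθ
  obtain ⟨k, hk, hθk⟩ := mem_iUnion₂.1 hθ
  have h1 := square_subset_closedBall 𝔎.pos.le hη
  rw [Metric.mem_closedBall] at h1 hθk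
  refine Metric.mem_cthickening_of_dist_le η k _ _ hk ?_
  linarith [dist_triangle η θ k]

theorem Cover.square_subset_U (𝔎 : Cover 𝔄) {j : Fin 2} {θ : Plane}
    (hθ : θ ∈ Metric.cthickening (2 * 𝔎.ℓ) (𝔎.K j)) : square θ 𝔎.ℓ ⊆ (𝔄.chart j).U :=
  (𝔎.square_subset (by have := 𝔎.pos; positivity) hθ).trans
    ((Metric.cthickening_mono (by linarith) _).trans (𝔎.thick j))

/-- A continuity argument: the metrics of all spheres are comparable to `r² γ`. -/
theorem goodSphere_of_bootstrap (𝔎 : Cover 𝔄) {M r₀ u₀ u' v₀ v' v Cg Cbar Cb : ℝ}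
    (hM : ∀ j, RoundBound (𝔄.chart j) M)
    (hF : F.IsDoubleNull 𝔄 u₀ u' v₀ v') (hI : F.InitialMetricBound r₀ 𝔄 Cg u₀ u' v₀ v')
    (hR : ∀ u ∈ Icc u₀ u', F.RicciBootstrap r₀ 𝔄 Cbar u v)
    (hC : Cbar ≤ Cb) (hC0 : 0 ≤ Cb) (hu : u₀ < u') (hv : v ∈ Icc v₀ v')
    (hr0 : 0 < v - u' + r₀)
    (hr1 : 16 * M ^ 2 * Cg ≤ v - u' + r₀)
    (hr2 : 32 * M ^ 2 * ((2 * M) ^ 2 * Real.sqrt (sobConst M 𝔎.ℓ * Cb)) ≤ v - u' + r₀)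
    {u : ℝ} (hu' : u ∈ Icc u₀ u') (j : Fin 2) : GoodSphere F (𝔄.chart j) r₀ u v := by
  have hM1 := (hM 0).one_le
  have hf := hF.chartFields
  have hKU : ∀ j, 𝔎.K j ⊆ (𝔄.chart j).U := fun j =>
    (Metric.self_subset_cthickening _).trans (𝔎.thick j)
  have hpos : ∀ u ∈ Icc u₀ u', 0 < v - u + r₀ := fun u hu => by linarith [hu.2]
  -- The condition is imposed on the compact cores only. It is then closed in `u`, and its strict
  -- form is open by compactness.
  set S : Set ℝ := {u | ∀ j, ∀ θ ∈ 𝔎.K j, ∀ A B, |F.gsMat (𝔄.chart j) (mkPt u v θ) A B -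
      (v - u + r₀) ^ 2 * (𝔄.chart j).round θ A B| ≤ (v - u + r₀) ^ 2 / (16 * M ^ 2)} with hSdef
  have hgood : ∀ u ∈ Icc u₀ u', u ∈ S → ∀ j, GoodSphere F (𝔄.chart j) r₀ u v :=
    fun u hu h => goodSphere_of_close 𝔎 hM hf (hpos u hu)
      (fun x hx => (hF.lapse_pos (u, v, x) ⟨hu, hv, hx⟩).ne') h
  have hcont : ∀ j A B, ContinuousOn (fun p : ℝ × Plane => F.gsMat (𝔄.chart j) (mkPt p.1 v p.2) A B -
      (v - p.1 + r₀) ^ 2 * (𝔄.chart j).round p.2 A B) (univ ×ˢ (𝔄.chart j).U) := by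
    intro j A B
    refine ContinuousOn.sub ?_ (ContinuousOn.mul (by fun_prop) ?_)
    · refine ((hf j).smooth_gs A B).continuousOn.comp ?_ fun p hp => ?_
      · unfold mkPt; fun_prop
      · exact GoodSphere.mem_dom _ _ hp.2
    · exact ((𝔄.chart j).contDiffOn_round A B).continuousOn.comp continuousOn_snd
        fun p hp => (𝔄.chart j).U_subset_N hp.2
  have hsub : Icc u₀ u' ⊆ S := by
    refine IsClosed.Icc_subset_of_forall_exists_gt ?_ ?_ ?_
    · have : IsClosed S := by
        simp only [hSdef, ofPred_forall]
        refine isClosed_iInter fun j => isClosed_iInter fun θ => isClosed_iInter fun hθ =>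
          isClosed_iInter fun A => isClosed_iInter fun B => isClosed_le ?_ (by fun_prop)
        refine Continuous.abs ?_
        have := (hcont j A B).comp_continuous (f := fun u : ℝ => (u, θ)) (by fun_prop)
          fun u => ⟨mem_univ _, hKU j hθ⟩
        exact this
      exact this.inter isClosed_Icc
    · intro j θ hθ A B
      have h1 := (hI j (mkPt u₀ v θ) (GoodSphere.mem_dom _ _ (hKU j hθ)) (by
        rw [mkPt_zero]; exact ⟨le_rfl, hu.le⟩) (by rwa [mkPt_one]) (Or.inl (mkPt_zero _ _ _)) A B).1
      rw [gCirc_mkPt, GoodSphere.rad_mkPt] at h1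
      refine h1.trans ?_
      rw [le_div_iff₀ (by positivity)]
      have : 16 * M ^ 2 * Cg ≤ v - u₀ + r₀ := by linarith
      nlinarith [hpos u₀ ⟨le_rfl, hu.le⟩]
    · rintro x ⟨hxS, hx⟩ y hy
      have hx' : x ∈ Icc u₀ u' := Ico_subset_Icc_self hx
      -- The improvement: on a good sphere the Sobolev inequality bounds the deviation by a constant
      -- times `r`, and for `r` as large as in `hr2` this is at most half of the allowed `r² /
      -- (16M²)`.
      have hstrict : ∀ j A B, ∀ θ ∈ 𝔎.K j, |F.gsMat (𝔄.chart j) (mkPt x v θ) A B -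
          (v - x + r₀) ^ 2 * (𝔄.chart j).round θ A B| < (v - x + r₀) ^ 2 / (16 * M ^ 2) := by
        intro j A B θ hθ
        have hsq : square θ 𝔎.ℓ ⊆ (𝔄.chart j).U := 𝔎.square_subset_U (Metric.self_subset_cthickening _ hθ)
        refine ((hgood x hx' hxS j).metric_close (hM j) 𝔎.pos (hR x hx') hC hC0 hsq A B).trans_lt ?_
        rw [lt_div_iff₀ (by positivity)]
        have hp := hpos x hx'
        have h4 : 32 * M ^ 2 * ((2 * M) ^ 2 * Real.sqrt (sobConst M 𝔎.ℓ * Cb)) ≤ v - x + r₀ := by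
          linarith [hx.2]
        nlinarith [mul_le_mul_of_nonneg_right h4 hp.le]
      have hev : ∀ j A B, ∀ᶠ t in nhds x, ∀ θ ∈ 𝔎.K j, |F.gsMat (𝔄.chart j) (mkPt t v θ) A B -
          (v - t + r₀) ^ 2 * (𝔄.chart j).round θ A B| < (v - t + r₀) ^ 2 / (16 * M ^ 2) := by
        intro j A B
        refine (𝔎.isCompact j).eventually_forall_of_forall_eventually fun θ hθ => ?_
        have hmem : univ ×ˢ (𝔄.chart j).U ∈ nhds (x, θ) :=
          (isOpen_univ.prod (𝔄.chart j).isOpen_U).mem_nhds ⟨mem_univ _, hKU j hθ⟩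
        have hca := ((hcont j A B).continuousAt hmem).abs
        exact hca.eventually_lt (g := fun p : ℝ × Plane => (v - p.1 + r₀) ^ 2 / (16 * M ^ 2))
          (by fun_prop) (hstrict j A B θ hθ)
      have hev2 : ∀ᶠ t in nhds x, t ∈ S := by
        simp only [hSdef, mem_ofPred_eq]
        rw [Filter.eventually_all]
        intro j
        have : ∀ᶠ t in nhds x, ∀ A B, ∀ θ ∈ 𝔎.K j, |F.gsMat (𝔄.chart j) (mkPt t v θ) A B -
          (v - t + r₀) ^ 2 * (𝔄.chart j).round θ A B| < (v - t + r₀) ^ 2 / (16 * M ^ 2) :=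
          Filter.eventually_all.2 fun A => Filter.eventually_all.2 fun B => hev j A B
        exact this.mono fun t ht θ hθ A B => (ht A B θ hθ).le
      obtain ⟨ε, hε, hb⟩ := Metric.eventually_nhds_iff.1 hev2
      have hxy : x < y := hy
      refine ⟨min y (x + ε / 2), hb ?_, ?_, min_le_left _ _⟩
      · rw [Real.dist_eq, abs_lt]
        constructor
        · have : x ≤ min y (x + ε / 2) := le_min hxy.le (by linarith)
          linarith
        · have := min_le_right y (x + ε / 2)
          linarith
      · exact lt_min hxy (by linarith)
  exact hgood u hu' (hsub hu') j

end

end DoubleNull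


namespace DoubleNull

/-! ### Christoffel symbols of the round metric -/

namespace SphereChart

variable (κ : SphereChart)

/-- The Christoffel symbols of the round metric. -/
noncomputable def roundChr (E A B : Fin 2) (θ : Plane) : ℝ :=
  1 / 2 * ∑ L, (κ.round θ)⁻¹ E L *
    (fderiv ℝ (fun η => κ.round η L B) θ (Pi.single A 1)
      + fderiv ℝ (fun η => κ.round η L A) θ (Pi.single B 1)
      - fderiv ℝ (fun η => κ.round η A B) θ (Pi.single L 1))

theorem contDiffOn_roundInv (A B : Fin 2) :
    ContDiffOn ℝ ∞ (fun θ => (κ.round θ)⁻¹ A B) κ.N := by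
  have h := κ.contDiffOn_round
  have hd : ContDiffOn ℝ ∞ (fun θ => (κ.round θ).det) κ.N := by
    simp only [Matrix.det_fin_two]
    exact ((h 0 0).mul (h 1 1)).sub ((h 0 1).mul (h 1 0))
  have hi := hd.inv fun θ hθ => (κ.round_det_pos hθ).ne'
  simp only [Matrix.inv_def, Ring.inverse_eq_inv', Matrix.smul_apply, smul_eq_mul,
    Matrix.adjugate_fin_two]
  refine hi.mul ?_
  fin_cases A <;> fin_cases B <;> simp
  · exact h 1 1
  · exact (h 0 1).neg
  · exact (h 1 0).neg
  · exact h 0 0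

theorem contDiffOn_roundChr (E A B : Fin 2) : ContDiffOn ℝ ∞ (κ.roundChr E A B) κ.N := by
  have hd : ∀ A B C, ContDiffOn ℝ ∞
      (fun θ => fderiv ℝ (fun η => κ.round η A B) θ (Pi.single C 1)) κ.N := fun A B C =>
    ((κ.contDiffOn_round A B).fderiv_of_isOpen κ.isOpen_N (by simp)).clm_apply contDiffOn_const
  unfold roundChr
  exact contDiffOn_const.mul (ContDiffOn.sum fun L _ => (κ.contDiffOn_roundInv E L).mul
    (((hd _ _ _).add (hd _ _ _)).sub (hd _ _ _)))

theorem exists_bound {ι : Type*} [Fintype ι] {f : ι → Plane → ℝ}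
    (hf : ∀ i, ContinuousOn (f i) κ.N) : ∃ G, 1 ≤ G ∧ ∀ i, ∀ θ ∈ κ.U, |f i θ| ≤ G := by
  have h : ∀ i, ∃ G, ∀ θ ∈ closure κ.U, ‖f i θ‖ ≤ G := fun i =>
    κ.isCompact_closure.exists_bound_of_continuousOn ((hf i).mono κ.closure_subset)
  choose G hG using h
  refine ⟨1 + ∑ i, |G i|, le_add_of_nonneg_right (Finset.sum_nonneg fun i _ => abs_nonneg _),
    fun i θ hθ => ?_⟩
  have h1 := hG i θ (subset_closure hθ)
  have h2 : |G i| ≤ ∑ i, |G i| :=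
    Finset.single_le_sum (f := fun i => |G i|) (fun i _ => abs_nonneg _) (Finset.mem_univ i)
  rw [Real.norm_eq_abs] at h1
  linarith [le_abs_self (G i)]

theorem exists_roundChr_bound : ∃ G, 1 ≤ G ∧ ∀ θ ∈ κ.U, ∀ E A B, |κ.roundChr E A B θ| ≤ G ∧
    ∀ C, |fderiv ℝ (κ.roundChr E A B) θ (Pi.single C 1)| ≤ G := by
  obtain ⟨G, h1, h2⟩ := κ.exists_bound (ι := Fin 2 × Fin 2 × Fin 2)
    (f := fun i => κ.roundChr i.1 i.2.1 i.2.2) fun i => (κ.contDiffOn_roundChr _ _ _).continuousOn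
  obtain ⟨G', h1', h2'⟩ := κ.exists_bound (ι := (Fin 2 × Fin 2 × Fin 2) × Fin 2)
    (f := fun i θ => fderiv ℝ (κ.roundChr i.1.1 i.1.2.1 i.1.2.2) θ (Pi.single i.2 1)) fun i =>
      ((((κ.contDiffOn_roundChr _ _ _).fderiv_of_isOpen (m := ∞) κ.isOpen_N (by simp))).clm_apply
        contDiffOn_const).continuousOn
  exact ⟨max G G', h1.trans (le_max_left _ _), fun θ hθ E A B =>
    ⟨(h2 (E, A, B) θ hθ).trans (le_max_left _ _), fun C =>
      (h2' ((E, A, B), C) θ hθ).trans (le_max_right _ _)⟩⟩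

end SphereChart

theorem ang_update_sph (c : Pt) (A : Fin 2) (x : ℝ) :
    ang (Function.update c (sph A) x) = Function.update (ang c) A x := by
  ext B; fin_cases A <;> fin_cases B <;> simp [ang, sph]

theorem differentiableAt_comp_ang {f : Plane → ℝ} {c : Pt} (hf : DifferentiableAt ℝ f (ang c)) :
    DifferentiableAt ℝ (fun y => f (ang y)) c :=
  DifferentiableAt.comp c hf (contDiff_ang.differentiable (by simp) c)

theorem pd_sph_comp_ang {f : Plane → ℝ} {c : Pt} (hf : DifferentiableAt ℝ f (ang c)) (A : Fin 2) :
    pd (sph A) (fun y => f (ang y)) c = fderiv ℝ f (ang c) (Pi.single A 1) := by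
  have h1 := Fields.hasDerivAt_line (differentiableAt_comp_ang hf) (sph A)
  simp only [ang_update_sph] at h1
  have h2 : HasDerivAt (fun x => Function.update (ang c) A x) (Pi.single A 1) (ang c A) :=
    hasDerivAt_update (ang c) A (ang c A)
  have h3 : HasFDerivAt f (fderiv ℝ f (ang c)) (Function.update (ang c) A (ang c A)) := by
    rw [Function.update_eq_self]; exact hf.hasFDerivAt
  have h4 := h3.comp_hasDerivAt (ang c A) h2
  rw [← ang_apply c A] at h1
  exact h1.unique h4

theorem pd_one_comp_ang {f : Plane → ℝ} {c : Pt} (hf : DifferentiableAt ℝ f (ang c)) :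
    pd 1 (fun y => f (ang y)) c = 0 := by
  have h1 := Fields.hasDerivAt_line (differentiableAt_comp_ang hf) 1
  have h2 : ∀ x, ang (Function.update c 1 x) = ang c := fun x => by
    ext B; fin_cases B <;> simp [ang]
  simp only [h2] at h1
  exact h1.unique (hasDerivAt_const _ _)

theorem pd_sph_rad (r₀ : ℝ) (c : Pt) (A : Fin 2) : pd (sph A) (rad r₀) c = 0 := by
  have h1 := Fields.hasDerivAt_line (((contDiff_rad r₀).differentiable (by simp)) c) (sph A)
  have h2 : ∀ x, rad r₀ (Function.update c (sph A) x) = rad r₀ c := fun x => by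
    fin_cases A <;> simp [rad, sph]
  simp only [h2] at h1
  exact h1.unique (hasDerivAt_const _ _)

/-- The factor `r²` is constant on each sphere and cancels between the metric and its inverse, so
these symbols depend on the angles only. -/
theorem christoffel_gCirc {κ : SphereChart} {r₀ : ℝ} {c : Pt} (hc : c ∈ κ.dom)
    (hr : rad r₀ c ≠ 0) (E A B : Fin 2) :
    christoffel sph (gCirc κ r₀) c E A B = κ.roundChr E A B (ang c) := by
  have hN : ang c ∈ κ.N := κ.U_subset_N hc
  have hd : ∀ A B, DifferentiableAt ℝ (fun η => κ.round η A B) (ang c) := fun A B =>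
    ((κ.contDiffOn_round A B).contDiffAt (κ.isOpen_N.mem_nhds hN)).differentiableAt (by simp)
  have h1 : ∀ C A B, pd (sph C) (fun y => gCirc κ r₀ y A B) c =
      rad r₀ c ^ 2 * fderiv ℝ (fun η => κ.round η A B) (ang c) (Pi.single C 1) := fun C A B => by
    have e : (fun y => gCirc κ r₀ y A B) = fun y => (rad r₀ y * rad r₀ y) * κ.round (ang y) A B := by
      ext y; simp [gCirc, sq]
    have hrd := ((contDiff_rad r₀).differentiable (by simp)) c
    rw [e, pd_mul (hrd.fun_mul hrd) (differentiableAt_comp_ang (hd A B)), pd_mul hrd hrd, pd_sph_rad,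
      pd_sph_comp_ang (hd A B)]
    ring
  have h2 : (gCirc κ r₀ c)⁻¹ = (rad r₀ c ^ 2)⁻¹ • (κ.round (ang c))⁻¹ := by
    refine Matrix.inv_eq_right_inv ?_
    rw [gCirc, Matrix.smul_mul, Matrix.mul_smul, Matrix.mul_nonsing_inv _ (κ.round_isUnit hN),
      smul_smul, mul_inv_cancel₀ (pow_ne_zero 2 hr), one_smul]
  unfold christoffel SphereChart.roundChr
  simp only [h1, h2, Matrix.smul_apply, smul_eq_mul]
  congr 1
  refine Finset.sum_congr rfl fun L _ => ?_
  field_simp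

/-! ### Pointwise bounds -/

/-- Pointwise bounds for the metric and the Ricci coefficients at a point. -/
structure PtBound (F : Fields) (κ : SphereChart) (r₀ C : ℝ) (c : Pt) : Prop where
  mem_reg : c ∈ F.reg κ r₀
  r_ge : 1 ≤ rad r₀ c
  pd_metric : PD (F.gsMat κ c)
  h_le : ∀ A B, |F.gsMat κ c A B| ≤ C * rad r₀ c ^ 2
  hInv_le : ∀ A B, |(F.gsMat κ c)⁻¹ A B| ≤ C / rad r₀ c ^ 2
  close : ∀ A B, |F.gsMat κ c A B - rad r₀ c ^ 2 * κ.round (ang c) A B| ≤ C * rad r₀ c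
  lapse : |1 / F.lapseSq κ c - 1| ≤ 1 / 2
  shift : ∀ A, |F.shift κ c A| ≤ C / rad r₀ c ^ 2
  chibar : ∀ A B, |F.chibar κ A B c| ≤ C * rad r₀ c
  chi : ∀ A B, |F.chi κ A B c| ≤ C * rad r₀ c
  trChi : |F.trace κ (F.chi κ) c| ≤ C / rad r₀ c
  chiHat : ∀ A B, |F.traceFree κ (F.chi κ) A B c| ≤ C
  eta : ∀ A, |F.eta κ A c| ≤ C
  etabar : ∀ A, |F.etabar κ A c| ≤ C / rad r₀ c
  omega : |F.omega κ c| ≤ C / rad r₀ c ^ 3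
  diff : ∀ I : Fin 3 → Fin 2, |(F.christoffelDiff κ r₀).comp I c| ≤ C * rad r₀ c ^ 2
  diffFour : ∀ I : Fin 3 → Fin 2,
    |(F.along κ (F.e4 κ) (F.christoffelDiff κ r₀)).comp I c| ≤ C * rad r₀ c
  roundChr : ∀ E A B, |κ.roundChr E A B (ang c)| ≤ C
  droundChr : ∀ E A B D, |fderiv ℝ (κ.roundChr E A B) (ang c) (Pi.single D 1)| ≤ C
  dh : ∀ D A B, |pd (sph D) (fun y => F.gsMat κ y A B) c| ≤ C * rad r₀ c ^ 2

/-- With the upper index lowered, the symbols of `gs` are linear in `∂gs`. Bounds for the difference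
tensor, and later for its `e₄` derivative, can thus be converted into bounds for derivatives of the
metric. -/
theorem christoffelDiff_comp {F : Fields} {κ : SphereChart} (hF : ChartFields F κ) {r₀ : ℝ} {c : Pt}
    (hc : c ∈ F.reg κ r₀) (I : Fin 3 → Fin 2) :
    (F.christoffelDiff κ r₀).comp I c =
      1 / 2 * (pd (sph (I 0)) (fun y => F.gsMat κ y (I 1) (I 2)) c
        + pd (sph (I 1)) (fun y => F.gsMat κ y (I 0) (I 2)) c
        - pd (sph (I 2)) (fun y => F.gsMat κ y (I 0) (I 1)) c)
      - ∑ E, F.gsMat κ c (I 2) E * κ.roundChr E (I 0) (I 1) (ang c) := by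
  have h1 := sum_mul_christoffel sph (F.gsMat κ) c hc.2.2.1 (I 2) (I 0) (I 1)
  rw [Fields.dh_symm hF hc.1 _ (I 1), Fields.dh_symm hF hc.1 _ (I 0) (I 2), ← h1]
  change ∑ D, F.gsMat κ c (I 2) D * (christoffel sph (F.gsMat κ) c D (I 0) (I 1)
    - christoffel sph (gCirc κ r₀) c D (I 0) (I 1)) = _
  simp only [mul_sub, Finset.sum_sub_distrib, christoffel_gCirc hc.1 hc.2.2.2]

theorem abs_sum_two_le {f : Fin 2 → ℝ} {K : ℝ} (h : ∀ i, |f i| ≤ K) : |∑ i, f i| ≤ 2 * K := by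
  rw [Fin.sum_univ_two]
  linarith [abs_add_le (f 0) (f 1), h 0, h 1]

theorem abs_mul_le {a b x y : ℝ} (ha : |a| ≤ x) (hb : |b| ≤ y) : |a * b| ≤ x * y := by
  rw [abs_mul]
  exact mul_le_mul ha hb (abs_nonneg _) ((abs_nonneg _).trans ha)

theorem PD.sq_le {h : Matrix (Fin 2) (Fin 2) ℝ} (hp : PD h) (A B : Fin 2) :
    h A B ^ 2 ≤ h A A * h B B := by
  have h1 := hp.det_pos
  have h2 := hp.symm 1 0
  rw [Matrix.det_fin_two, h2] at h1
  fin_cases A <;> fin_cases B <;> simp [h2] <;> nlinarith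

namespace GoodSphere

variable {F : Fields} {κ : SphereChart} {r₀ u v M : ℝ}

theorem gs_le (hS : GoodSphere F κ r₀ u v) (hM : RoundBound κ M) {θ : Plane} (hθ : θ ∈ κ.U)
    (A B : Fin 2) : |F.gsMat κ (mkPt u v θ) A B| ≤ 2 * M * (v - u + r₀) ^ 2 := by
  have hp : PD (F.gsMat κ (mkPt u v θ)) := hS.pd_metric hθ
  have hd : ∀ A, F.gsMat κ (mkPt u v θ) A A ≤ 2 * M * (v - u + r₀) ^ 2 :=
    fun A => hS.diag_le hM hθ A
  have hM1 := hM.one_le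
  refine abs_le_of_sq_le_sq ?_ (by positivity)
  calc _ ≤ _ := hp.sq_le A B
    _ ≤ (2 * M * (v - u + r₀) ^ 2) * (2 * M * (v - u + r₀) ^ 2) :=
        mul_le_mul (hd A) (hd B) (hp.diag_pos B).le (by positivity)
    _ = _ := by ring

theorem gsInv_le (hS : GoodSphere F κ r₀ u v) (hM : RoundBound κ M) {θ : Plane} (hθ : θ ∈ κ.U)
    (A B : Fin 2) : |(F.gsMat κ (mkPt u v θ))⁻¹ A B| ≤ 8 * M ^ 2 / (v - u + r₀) ^ 2 := by
  have hdet := (hS.pd_metric hθ).det_pos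
  have hr := hS.r_pos
  have hM1 := hM.one_le
  have hdge : (v - u + r₀) ^ 4 ≤ 4 * M * (F.gsMat κ (mkPt u v θ)).det := hS.det_ge hM hθ
  have h2 : |(F.gsMat κ (mkPt u v θ)).adjugate A B| ≤ 2 * M * (v - u + r₀) ^ 2 := by
    have hd := fun A B => hS.gs_le hM hθ A B
    rw [Matrix.adjugate_fin_two]
    fin_cases A <;> fin_cases B <;> simp [hd]
  rw [Matrix.inv_def, Ring.inverse_eq_inv', Matrix.smul_apply, smul_eq_mul]
  have h3 : |(F.gsMat κ (mkPt u v θ)).det⁻¹| ≤ 4 * M / (v - u + r₀) ^ 4 := by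
    rw [abs_of_pos (inv_pos.2 hdet), inv_le_comm₀ hdet (by positivity), inv_div,
      div_le_iff₀ (by positivity)]
    linarith
  refine (abs_mul_le h3 h2).trans_eq ?_
  field_simp
  ring

end GoodSphere

section

variable {F : Fields} {𝔄 : SphereAtlas} {r₀ u v Cbar Cb M ℓ B G : ℝ} {j : Fin 2}

set_option maxHeartbeats 2000000 in
/-- The pointwise bounds with an explicit constant. -/
theorem ptBound_of_bootstrap (hS : GoodSphere F (𝔄.chart j) r₀ u v)
    (hM : RoundBound (𝔄.chart j) M) (hℓ : 0 < ℓ)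
    (hR : F.RicciBootstrap r₀ 𝔄 Cbar u v) (hK : F.ChristoffelBootstrap r₀ 𝔄 Cbar u v)
    (hC : Cbar ≤ Cb) (hC0 : 0 ≤ Cb) (hsm : 4 * (sobConst M ℓ * Cb) ≤ 1)
    (hB : (2 * M) ^ 3 ≤ B)
    (hG : 1 ≤ G) (hG1 : ∀ θ ∈ (𝔄.chart j).U, ∀ E A B, |(𝔄.chart j).roundChr E A B θ| ≤ G ∧
      ∀ C, |fderiv ℝ ((𝔄.chart j).roundChr E A B) θ (Pi.single C 1)| ≤ G)
    (hr1 : 1 ≤ v - u + r₀) {θ : Plane} (hθ : square θ ℓ ⊆ (𝔄.chart j).U) :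
    PtBound F (𝔄.chart j) r₀ (8 * B ^ 3 * G) (mkPt u v θ) := by
  have hr := hS.r_pos
  have hM1 := hM.one_le
  set κ := 𝔄.chart j with hκ
  set c := mkPt u v θ with hc
  have hθU : θ ∈ κ.U := hθ (mem_square.2 fun i => by simp [hℓ.le])
  have hreg : c ∈ F.reg κ r₀ := hS.mem_reg hθU
  have hPD : PD (F.gsMat κ c) := hS.pd_metric hθU
  have hang : ang c = θ := ang_mkPt _ _ _
  have hrad : rad r₀ c = v - u + r₀ := GoodSphere.rad_mkPt _ _ _ _
  have hcirc : ∀ A B, |F.gsMat κ c A B - rad r₀ c ^ 2 * κ.round (ang c) A B| ≤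
      (2 * M) ^ 2 * Real.sqrt (sobConst M ℓ * Cb) * rad r₀ c := fun A B => by
    rw [hang, hrad]; exact hS.metric_close hM hℓ hR hC hC0 hθ A B
  set S := Real.sqrt (sobConst M ℓ * Cb) with hSdef
  have hsp := sobConst_pos hM1 hℓ
  have hS0 : 0 ≤ S := Real.sqrt_nonneg _
  have hSh : S ≤ 1 / 2 := by
    rw [hSdef, Real.sqrt_le_left (by norm_num)]; linarith
  have hm2 : 2 ≤ 2 * M := by linarith
  have hpw : ∀ k ≤ 3, (2 * M) ^ k ≤ B := fun k hk =>
    (pow_le_pow_right₀ (by linarith) hk).trans hB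
  have hB8 : 8 ≤ B := le_trans (by nlinarith [pow_le_pow_left₀ (by norm_num) hm2 3]) hB
  have hB2 : 2 * M ≤ B := by simpa using hpw 1 (by norm_num)
  -- A covariant tensor of rank `n` whose norm decays like `r⁻ᵖ` has components of order `r^(n-p)`.
  -- The factor `1/2` is the bound for the square root of the Sobolev constant times `Cb`.
  have hsqrt : ∀ (T : STensor) (p : ℕ), F.normSq κ T c ≤ sobConst M ℓ * Cb / (v - u + r₀) ^ (2 * p) →
      T.rank ≤ 3 → ∀ I, |T.comp I c| ≤ B / 2 * (v - u + r₀) ^ T.rank / (v - u + r₀) ^ p := by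
    intro T p hN hrank I
    have h1 := hS.comp_abs_le hM hθU T I
    have h2 : Real.sqrt (F.normSq κ T c) ≤ S / (v - u + r₀) ^ p := by
      refine (Real.sqrt_le_sqrt hN).trans_eq ?_
      rw [Real.sqrt_div (by positivity), mul_comm 2 p, pow_mul, Real.sqrt_sq (by positivity)]
    refine h1.trans ?_
    calc (2 * M) ^ T.rank * (v - u + r₀) ^ T.rank * Real.sqrt (F.normSq κ T c)
        ≤ B * (v - u + r₀) ^ T.rank * ((1 / 2) / (v - u + r₀) ^ p) := by
          gcongr
          · exact hpw _ hrank
          · exact h2.trans (by gcongr)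
      _ = _ := by ring
  have hN := fun n => ricci_normSq_le hS hM hℓ hR hC hC0 hθ n
  have hnorm := fun n hn I => hsqrt _ _ (hN n) hn I
  set r := v - u + r₀ with hrdef
  -- the metric
  have hh : ∀ A B', |F.gsMat κ c A B'| ≤ B * r ^ 2 := fun A B' =>
    (hS.gs_le hM hθU A B').trans (by gcongr)
  have hinv : ∀ A B', |(F.gsMat κ c)⁻¹ A B'| ≤ B ^ 2 / r ^ 2 := fun A B' => by
    refine (hS.gsInv_le hM hθU A B').trans ?_
    gcongr
    nlinarith
  -- scalars
  have hlapse : |1 / F.lapseSq κ c - 1| ≤ 1 / 2 := by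
    have h1 := hPD.comp_sq_le (n := 0)
      (fun J => (F.ricci κ r₀ RicciName.lapse).comp J c) Fin.elim0
    rw [Finset.univ_eq_empty, Finset.prod_empty, one_mul] at h1
    have h3 : F.normSq κ (F.ricci κ r₀ RicciName.lapse) c ≤ sobConst M ℓ * Cb := by
      simpa [RicciName.index] using hN RicciName.lapse
    have h2 : (1 / F.lapseSq κ c - 1) ^ 2 ≤ sobConst M ℓ * Cb := h1.trans h3
    refine abs_le_of_sq_le_sq ?_ (by norm_num)
    linarith
  have hb0 : ∀ A, |∑ B', F.gsMat κ c A B' * F.shift κ c B'| ≤ B := fun A => by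
    have h1 := hnorm RicciName.shift (by simp [Fields.ricci, STensor.ofOneForm]) ![A]
    have h2 : |∑ B', F.gsMat κ c A B' * F.shift κ c B'| ≤ B / 2 * r ^ 1 / r ^ 1 := h1
    refine h2.trans ?_
    field_simp
    linarith
  have hshift : ∀ A, |F.shift κ c A| ≤ 2 * (B ^ 3 / r ^ 2) := fun A => by
    have e : F.shift κ c A = ∑ D, (F.gsMat κ c)⁻¹ A D * ∑ B', F.gsMat κ c D B' * F.shift κ c B' := by
      have := congrFun (Matrix.mulVec_mulVec (F.shift κ c) (F.gsMat κ c)⁻¹ (F.gsMat κ c)) A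
      rw [Matrix.nonsing_inv_mul _ (Ne.isUnit hreg.2.2.1), Matrix.one_mulVec] at this
      exact this.symm
    rw [e]
    refine abs_sum_two_le fun D => (abs_mul_le (hinv A D) (hb0 D)).trans_eq ?_
    ring
  have htr : ∀ {n : RicciName} {f : ℝ}, n.index = 2 → (F.ricci κ r₀ n).rank = 0 →
      (∀ I, (F.ricci κ r₀ n).comp I c = f) → |f| ≤ B / r ^ 2 := fun {n f} h1 h2 h3 => by
    have h4 := hnorm n (by rw [h2]; norm_num) (fun _ => 0)
    rw [h3, h1, h2, pow_zero, mul_one] at h4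
    refine h4.trans ?_
    gcongr
    linarith
  -- The traces are small only after the Minkowski value `±2/r` has been removed; adding it back
  -- leaves a bound of order `1/r`. The sign `s` treats both traces at once.
  have htr2 : ∀ {t s : ℝ}, |t + s * (2 / r)| ≤ B / r ^ 2 → |s| = 1 → |t| ≤ 2 * B / r := by
    intro t s h hs
    have h1 : |t| ≤ |t + s * (2 / r)| + |s * (2 / r)| := by
      have := abs_sub (t + s * (2 / r)) (s * (2 / r))
      simpa using this
    rw [abs_mul s, hs, one_mul, abs_of_pos (by positivity : 0 < 2 / r)] at h1
    have h2 : B / r ^ 2 ≤ B / r := by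
      gcongr
      nlinarith
    have h3 : 2 / r ≤ B / r := by gcongr; linarith
    calc |t| ≤ B / r + B / r := by linarith
      _ = _ := by ring
  have htrchi : |F.trace κ (F.chi κ) c| ≤ 2 * B / r := by
    refine htr2 (s := -1) (htr (n := RicciName.trChi) rfl rfl fun I => ?_) (by simp)
    change F.trace κ (F.chi κ) c - 2 / rad r₀ c = _
    rw [hrad]; ring
  have htrchibar : |F.trace κ (F.chibar κ) c| ≤ 2 * B / r := by
    refine htr2 (s := 1) (htr (n := RicciName.trChibar) rfl rfl fun I => ?_) (by simp)
    change F.trace κ (F.chibar κ) c + 2 / rad r₀ c = _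
    rw [hrad]; ring
  have hhat : ∀ A B', |F.traceFree κ (F.chi κ) A B' c| ≤ B := fun A B' => by
    have h1 := hnorm RicciName.chiHat (by simp [Fields.ricci, STensor.ofTwoTensor]) ![A, B']
    have h2 : |F.traceFree κ (F.chi κ) A B' c| ≤ B / 2 * r ^ 2 / r ^ 2 := h1
    refine h2.trans ?_
    field_simp
    linarith
  have hhatb : ∀ A B', |F.traceFree κ (F.chibar κ) A B' c| ≤ B * r := fun A B' => by
    have h1 := hnorm RicciName.chibarHat (by simp [Fields.ricci, STensor.ofTwoTensor]) ![A, B']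
    have h2 : |F.traceFree κ (F.chibar κ) A B' c| ≤ B / 2 * r ^ 2 / r ^ 1 := h1
    refine h2.trans ?_
    field_simp
    linarith
  have hfull : ∀ (k : Fin 2 → Fin 2 → Pt → ℝ) A B', |F.traceFree κ k A B' c| ≤ B * r →
      |F.trace κ k c| ≤ 2 * B / r → |k A B' c| ≤ 2 * B ^ 2 * r := by
    intro k A B' h1 h2
    have e : k A B' c = F.traceFree κ k A B' c + 1 / 2 * (F.trace κ k c * F.gsMat κ c A B') := by
      simp only [Fields.traceFree]; ring
    have h3 := abs_mul_le h2 (hh A B')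
    have h4 : 2 * B / r * (B * r ^ 2) = 2 * B ^ 2 * r := by field_simp
    rw [h4] at h3
    rw [e]
    refine (abs_add_le _ _).trans ?_
    rw [abs_mul, abs_of_pos (by norm_num : (0 : ℝ) < 1 / 2)]
    have h5 : B * r ≤ B ^ 2 * r := by
      gcongr
      nlinarith
    linarith
  have hdiff : ∀ I : Fin 3 → Fin 2, |(F.christoffelDiff κ r₀).comp I c| ≤ B * r ^ 2 := fun I => by
    have h1 := hsqrt (F.christoffelDiff κ r₀) 1
      (by simpa using christoffel_normSq_le hS hM hℓ hK hC hC0 hθ) le_rfl I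
    have h2 : |(F.christoffelDiff κ r₀).comp I c| ≤ B / 2 * r ^ 3 / r ^ 1 := h1
    refine h2.trans ?_
    field_simp
    nlinarith
  have hdiff4 : ∀ I : Fin 3 → Fin 2,
      |(F.along κ (F.e4 κ) (F.christoffelDiff κ r₀)).comp I c| ≤ B * r := fun I => by
    have h1 := hsqrt (F.applyOp κ r₀ DOp.rFour (F.christoffelDiff κ r₀)) 1
      (by simpa using christoffel_four_normSq_le hS hM hℓ hK hC hC0 hθ) le_rfl I
    have h2 : |rad r₀ c * (F.along κ (F.e4 κ) (F.christoffelDiff κ r₀)).comp I c| ≤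
      B / 2 * r ^ 3 / r ^ 1 := h1
    rw [abs_mul, hrad, abs_of_pos hr] at h2
    have h3 : B / 2 * r ^ 3 / r ^ 1 = r * (B / 2 * r) := by field_simp
    rw [h3] at h2
    have h4 := le_of_mul_le_mul_left h2 hr
    nlinarith
  have hround : ∀ E A B', |κ.roundChr E A B' (ang c)| ≤ G := fun E A B' => by
    rw [hang]; exact (hG1 θ hθU E A B').1
  have hlow : ∀ I : Fin 3 → Fin 2, |1 / 2 * (pd (sph (I 0)) (fun y => F.gsMat κ y (I 1) (I 2)) c
        + pd (sph (I 1)) (fun y => F.gsMat κ y (I 0) (I 2)) c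
        - pd (sph (I 2)) (fun y => F.gsMat κ y (I 0) (I 1)) c)| ≤ 3 * B * G * r ^ 2 := fun I => by
    have e := christoffelDiff_comp hS.fields hreg I
    have h1 : |∑ E, F.gsMat κ c (I 2) E * κ.roundChr E (I 0) (I 1) (ang c)| ≤
        2 * (B * r ^ 2 * G) :=
      abs_sum_two_le fun E => abs_mul_le (hh _ _) (hround _ _ _)
    have h2 := hdiff I
    rw [e] at h2
    have h3 := abs_sub_abs_le_abs_sub (1 / 2 * (pd (sph (I 0)) (fun y => F.gsMat κ y (I 1) (I 2)) c
        + pd (sph (I 1)) (fun y => F.gsMat κ y (I 0) (I 2)) c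
        - pd (sph (I 2)) (fun y => F.gsMat κ y (I 0) (I 1)) c))
      (∑ E, F.gsMat κ c (I 2) E * κ.roundChr E (I 0) (I 1) (ang c))
    have h4 : B * r ^ 2 ≤ B * r ^ 2 * G := le_mul_of_one_le_right (by positivity) hG
    linarith
  -- A derivative of the metric is the sum of two Christoffel symbols of the first kind, in which
  -- the other two derivatives cancel.
  have hdh : ∀ D A B', |pd (sph D) (fun y => F.gsMat κ y A B') c| ≤ 6 * B * G * r ^ 2 := by
    intro D A B'
    have h1 : |1 / 2 * (pd (sph D) (fun y => F.gsMat κ y A B') c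
        + pd (sph A) (fun y => F.gsMat κ y D B') c
        - pd (sph B') (fun y => F.gsMat κ y D A) c)| ≤ 3 * B * G * r ^ 2 := hlow ![D, A, B']
    have h2 : |1 / 2 * (pd (sph D) (fun y => F.gsMat κ y B' A) c
        + pd (sph B') (fun y => F.gsMat κ y D A) c
        - pd (sph A) (fun y => F.gsMat κ y D B') c)| ≤ 3 * B * G * r ^ 2 := hlow ![D, B', A]
    have e1 := Fields.dh_symm hS.fields hreg.1 (sph D) A B'
    have e2 := Fields.dh_symm hS.fields hreg.1 (sph A) D B'
    have e3 := Fields.dh_symm hS.fields hreg.1 (sph B') D A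
    rw [abs_le] at h1 h2 ⊢
    constructor <;> linarith [h1.1, h1.2, h2.1, h2.2]
  have hB1 : 1 ≤ B := by linarith
  have hBB : B ≤ B ^ 3 := le_self_pow₀ hB1 (by norm_num)
  have hBB2 : B ^ 2 ≤ B ^ 3 := pow_le_pow_right₀ hB1 (by norm_num)
  have hB3 : 0 < B ^ 3 := by positivity
  have hBG : B ^ 3 ≤ B ^ 3 * G := le_mul_of_one_le_right hB3.le hG
  have k1 : B ≤ 8 * B ^ 3 * G := by nlinarith
  have k2 : B ^ 2 ≤ 8 * B ^ 3 * G := by nlinarith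
  have k3 : 2 * B ^ 3 ≤ 8 * B ^ 3 * G := by nlinarith
  have k4 : 2 * B ≤ 8 * B ^ 3 * G := by nlinarith
  have k5 : G ≤ 8 * B ^ 3 * G := by nlinarith [one_le_pow₀ hB1 (n := 3)]
  have k6 : 6 * B * G ≤ 8 * B ^ 3 * G := by gcongr; norm_num
  have k7 : 2 * B ^ 2 ≤ 8 * B ^ 3 * G := by nlinarith
  refine ⟨hreg, by rw [hrad]; exact hr1, hPD, fun A B' => ?_, fun A B' => ?_, fun A B' => ?_, hlapse,
    fun A => ?_, fun A B' => ?_, fun A B' => ?_, ?_, fun A B' => ?_, fun A => ?_, fun A => ?_, ?_,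
    fun I => ?_, fun I => ?_, fun E A B' => ?_, fun E A B' D => ?_, fun D A B' => ?_⟩
  all_goals try rw [hrad]
  · exact (hh A B').trans (by gcongr)
  · exact (hinv A B').trans (by gcongr)
  · have h1 := hcirc A B'
    rw [hrad] at h1
    refine h1.trans ?_
    have : (2 * M) ^ 2 * S ≤ B := by nlinarith [hpw 2 (by norm_num)]
    exact mul_le_mul_of_nonneg_right (this.trans k1) hr.le
  · refine (hshift A).trans ?_
    rw [← mul_div_assoc]
    gcongr
  · exact (hfull _ _ _ (hhatb A B') htrchibar).trans (by gcongr)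
  · exact (hfull _ _ _ ((hhat A B').trans (by nlinarith)) htrchi).trans (by gcongr)
  · exact htrchi.trans (by gcongr)
  · exact (hhat A B').trans k1
  · have h1 := hnorm RicciName.eta (by simp [Fields.ricci, STensor.ofOneForm]) ![A]
    have h2 : |F.eta κ A c| ≤ B / 2 * r ^ 1 / r ^ 1 := h1
    refine h2.trans (le_trans ?_ k1)
    field_simp
    linarith
  · have h1 := hnorm RicciName.etabar (by simp [Fields.ricci, STensor.ofOneForm]) ![A]
    have h2 : |F.etabar κ A c| ≤ B / 2 * r ^ 1 / r ^ 2 := h1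
    refine h2.trans ?_
    have : B / 2 * r ^ 1 / r ^ 2 = (B / 2) / r := by field_simp
    rw [this]
    gcongr
    linarith
  · have h1 := hnorm RicciName.omega (by simp [Fields.ricci, STensor.ofScalar]) (fun _ => 0)
    have h2 : |F.omega κ c| ≤ B / 2 * r ^ 0 / r ^ 3 := h1
    refine h2.trans ?_
    rw [pow_zero, mul_one]
    gcongr
    linarith
  · exact (hdiff I).trans (by gcongr)
  · exact (hdiff4 I).trans (by gcongr)
  · exact (hround E A B').trans k5
  · rw [hang]; exact ((hG1 θ hθU E A B').2 D).trans k5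
  · exact (hdh D A B').trans (by gcongr)

end

end DoubleNull


/-! ### The derivative along `e₄` and second derivatives of the shift -/

namespace DoubleNull

namespace Fields

/-- The derivative of a function along `e_4`. -/
noncomputable def four (F : Fields) (κ : SphereChart) (f : Pt → ℝ) (c : Pt) : ℝ :=
  ∑ α, F.e4 κ c α * pd α f c

theorem four_eq (F : Fields) (κ : SphereChart) (f : Pt → ℝ) (c : Pt) :
    F.four κ f c = pd 1 f c + ∑ A, F.shift κ c A * pd (sph A) f c := by
  simp [four, Fin.sum_univ_four, e4, sph]
  ring

section

variable {F : Fields} {κ : SphereChart} {f g : Pt → ℝ} {c : Pt}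

theorem four_add (hf : DifferentiableAt ℝ f c) (hg : DifferentiableAt ℝ g c) :
    F.four κ (fun y => f y + g y) c = F.four κ f c + F.four κ g c := by
  simp only [four, pd_add hf hg, mul_add, Finset.sum_add_distrib]

theorem four_sub (hf : DifferentiableAt ℝ f c) (hg : DifferentiableAt ℝ g c) :
    F.four κ (fun y => f y - g y) c = F.four κ f c - F.four κ g c := by
  simp only [four, pd_sub hf hg, mul_sub, Finset.sum_sub_distrib]

theorem four_mul (hf : DifferentiableAt ℝ f c) (hg : DifferentiableAt ℝ g c) :
    F.four κ (fun y => f y * g y) c = F.four κ f c * g c + f c * F.four κ g c := by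
  simp only [four, pd_mul hf hg, mul_add, Finset.sum_add_distrib, Finset.sum_mul, Finset.mul_sum]
  congr 1 <;> refine Finset.sum_congr rfl fun α _ => by ring

theorem four_const_mul (a : ℝ) (hf : DifferentiableAt ℝ f c) :
    F.four κ (fun y => a * f y) c = a * F.four κ f c := by
  simp only [four, pd_const_mul hf, Finset.mul_sum]
  exact Finset.sum_congr rfl fun α _ => by ring

theorem four_sum {ι : Type*} {s : Finset ι} {f : ι → Pt → ℝ}
    (hf : ∀ i ∈ s, DifferentiableAt ℝ (f i) c) :
    F.four κ (fun y => ∑ i ∈ s, f i y) c = ∑ i ∈ s, F.four κ (f i) c := by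
  simp only [four, pd_sum hf, Finset.mul_sum]
  exact Finset.sum_comm

theorem four_congr {s : Set Pt} (hs : IsOpen s) (hc : c ∈ s) (h : ∀ y ∈ s, f y = g y) :
    F.four κ f c = F.four κ g c := by
  simp only [four, pd_congr hs hc h]

theorem four_comp_ang {f : Plane → ℝ} (hf : DifferentiableAt ℝ f (ang c)) :
    F.four κ (fun y => f (ang y)) c =
      ∑ A, F.shift κ c A * fderiv ℝ f (ang c) (Pi.single A 1) := by
  simp only [four_eq, pd_one_comp_ang hf, pd_sph_comp_ang hf, zero_add]

end

variable {F : Fields} {κ : SphereChart} (hF : ChartFields F κ) {r₀ : ℝ} {c : Pt}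
include hF

/-- Coordinate derivatives commute, so the commutator of `e₄` with `∂_A` comes only from the
variable coefficients `b^B`. -/
theorem four_pd {f : Pt → ℝ} (hf : ContDiffOn ℝ ∞ f (F.reg κ r₀)) (hc : c ∈ F.reg κ r₀)
    (A : Fin 2) :
    F.four κ (pd (sph A) f) c = pd (sph A) (F.four κ f) c
      - ∑ B, pd (sph A) (fun y => F.shift κ y B) c * pd (sph B) f c := by
  have hO := isOpen_reg hF r₀
  have hb := fun B => (smooth_b hF r₀ B).diffAt hO hc
  have hp := fun μ => (contDiffOn_pd hO hf μ).diffAt hO hc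
  have e : F.four κ f = fun y => pd 1 f y + ∑ B, F.shift κ y B * pd (sph B) f y :=
    funext fun y => four_eq F κ f y
  rw [e, pd_add (hp 1) (DifferentiableAt.fun_sum fun B _ => (hb B).fun_mul (hp _)),
    pd_sum fun B _ => (hb B).fun_mul (hp _), four_eq]
  simp only [pd_mul (hb _) (hp _), Finset.sum_add_distrib, pd_comm hO hf hc (sph A)]
  ring

theorem four_metric (hc : c ∈ F.reg κ r₀) (A B : Fin 2) :
    F.four κ (fun y => F.gsMat κ y A B) c = 2 * F.chi κ A B c
      - ∑ C, (F.gsMat κ c C B * pd (sph A) (fun y => F.shift κ y C) c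
        + F.gsMat κ c C A * pd (sph B) (fun y => F.shift κ y C) c) := by
  simp only [chi_eq hF hc, hF.symm c hc.1 _ A, four]
  ring

/-- Second derivatives of the shift in terms of first derivatives of `χ`. -/
theorem metric_mul_pd_pd_shift (hc : c ∈ F.reg κ r₀) (A B C : Fin 2) :
    ∑ E, F.gsMat κ c E C * pd (sph A) (pd (sph B) (fun y => F.shift κ y E)) c =
      (pd (sph A) (F.chi κ B C) c + pd (sph B) (F.chi κ A C) c - pd (sph C) (F.chi κ A B) c)
      - 1 / 2 * (F.four κ (pd (sph A) (fun y => F.gsMat κ y B C)) c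
        + F.four κ (pd (sph B) (fun y => F.gsMat κ y A C)) c
        - F.four κ (pd (sph C) (fun y => F.gsMat κ y A B)) c)
      - 1 / 2 * ((∑ E, (pd (sph A) (fun y => F.gsMat κ y E C) c * pd (sph B) (fun y => F.shift κ y E) c
          + pd (sph A) (fun y => F.gsMat κ y E B) c * pd (sph C) (fun y => F.shift κ y E) c
          + pd (sph A) (fun y => F.shift κ y E) c * pd (sph E) (fun y => F.gsMat κ y B C) c))
        + (∑ E, (pd (sph B) (fun y => F.gsMat κ y E C) c * pd (sph A) (fun y => F.shift κ y E) c
          + pd (sph B) (fun y => F.gsMat κ y E A) c * pd (sph C) (fun y => F.shift κ y E) c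
          + pd (sph B) (fun y => F.shift κ y E) c * pd (sph E) (fun y => F.gsMat κ y A C) c))
        - (∑ E, (pd (sph C) (fun y => F.gsMat κ y E B) c * pd (sph A) (fun y => F.shift κ y E) c
          + pd (sph C) (fun y => F.gsMat κ y E A) c * pd (sph B) (fun y => F.shift κ y E) c
          + pd (sph C) (fun y => F.shift κ y E) c * pd (sph E) (fun y => F.gsMat κ y A B) c))) := by
  have hO := isOpen_reg hF r₀
  have db := fun B => smooth_b hF r₀ B
  have key : ∀ A B C, F.four κ (pd (sph A) (fun y => F.gsMat κ y B C)) c =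
      2 * pd (sph A) (F.chi κ B C) c
      - ∑ E, (F.gsMat κ c E C * pd (sph A) (pd (sph B) (fun y => F.shift κ y E)) c
        + F.gsMat κ c E B * pd (sph A) (pd (sph C) (fun y => F.shift κ y E)) c)
      - ∑ E, (pd (sph A) (fun y => F.gsMat κ y E C) c * pd (sph B) (fun y => F.shift κ y E) c
          + pd (sph A) (fun y => F.gsMat κ y E B) c * pd (sph C) (fun y => F.shift κ y E) c
          + pd (sph A) (fun y => F.shift κ y E) c * pd (sph E) (fun y => F.gsMat κ y B C) c) := by
    intro A B C
    have dh := fun A B => (smooth_h hF r₀ A B).diffAt hO hc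
    have dpb := fun A B => (contDiffOn_pd hO (db A) (sph B)).diffAt hO hc
    have dχ := (chi_smooth hF r₀ B C).diffAt hO hc
    rw [four_pd hF (smooth_h hF r₀ B C) hc, pd_congr hO hc fun y hy => four_metric hF hy B C,
      pd_sub (dχ.const_mul 2) (DifferentiableAt.fun_sum fun E _ =>
        ((dh _ _).fun_mul (dpb _ _)).fun_add ((dh _ _).fun_mul (dpb _ _))),
      pd_const_mul dχ, pd_sum fun E _ =>
        ((dh _ _).fun_mul (dpb _ _)).fun_add ((dh _ _).fun_mul (dpb _ _))]
    simp only [pd_add ((dh _ _).fun_mul (dpb _ _)) ((dh _ _).fun_mul (dpb _ _)),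
      pd_mul (dh _ _) (dpb _ _), Finset.sum_add_distrib]
    ring
  have hcomm : ∀ A B E, pd (sph A) (pd (sph B) (fun y => F.shift κ y E)) c =
      pd (sph B) (pd (sph A) (fun y => F.shift κ y E)) c := fun A B E =>
    pd_comm hO (db E) hc _ _
  -- The second derivatives of `b` are symmetric in the two differentiation indices. As in the
  -- derivation of the Christoffel symbols from `∂g`, the combination `ABC + BAC - CAB` therefore
  -- isolates one of them.
  have k1 := key A B C
  have k2 := key B A C
  have k3 := key C A B
  simp only [hcomm B A] at k2
  simp only [hcomm C A, hcomm C B] at k3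
  simp only [Finset.sum_add_distrib] at k1 k2 k3 ⊢
  linear_combination 1 / 2 * (k1 + k2 - k3)

/-- The derivative of the difference of the Christoffel symbols along `e_4`. -/
theorem four_christoffelDiff (hc : c ∈ F.reg κ r₀) (I : Fin 3 → Fin 2) :
    F.four κ ((F.christoffelDiff κ r₀).comp I) c =
      1 / 2 * (F.four κ (pd (sph (I 0)) (fun y => F.gsMat κ y (I 1) (I 2))) c
        + F.four κ (pd (sph (I 1)) (fun y => F.gsMat κ y (I 0) (I 2))) c
        - F.four κ (pd (sph (I 2)) (fun y => F.gsMat κ y (I 0) (I 1))) c)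
      - ∑ E, (F.four κ (fun y => F.gsMat κ y (I 2) E) c * κ.roundChr E (I 0) (I 1) (ang c)
        + F.gsMat κ c (I 2) E * ∑ A, F.shift κ c A *
          fderiv ℝ (κ.roundChr E (I 0) (I 1)) (ang c) (Pi.single A 1)) := by
  have hO := isOpen_reg hF r₀
  have dh := fun A B => (smooth_h hF r₀ A B).diffAt hO hc
  have dp := fun A B C => (contDiffOn_pd hO (smooth_h hF r₀ B C) (sph A)).diffAt hO hc
  have hN : ang c ∈ κ.N := κ.U_subset_N hc.1
  have dr : ∀ E A B, DifferentiableAt ℝ (κ.roundChr E A B) (ang c) := fun E A B =>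
    ((κ.contDiffOn_roundChr E A B).contDiffAt (κ.isOpen_N.mem_nhds hN)).differentiableAt (by simp)
  have dR := fun E A B => differentiableAt_comp_ang (dr E A B)
  have d1 := ((dp (I 0) (I 1) (I 2)).fun_add (dp (I 1) (I 0) (I 2))).fun_sub (dp (I 2) (I 0) (I 1))
  have d2 : ∀ E ∈ (Finset.univ : Finset (Fin 2)), DifferentiableAt ℝ
      (fun y => F.gsMat κ y (I 2) E * κ.roundChr E (I 0) (I 1) (ang y)) c := fun E _ =>
    (dh (I 2) E).fun_mul (dR E (I 0) (I 1))
  rw [four_congr hO hc fun y hy => christoffelDiff_comp hF hy I,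
    four_sub (d1.const_mul _) (DifferentiableAt.fun_sum d2), four_const_mul _ d1,
    four_sub ((dp _ _ _).fun_add (dp _ _ _)) (dp _ _ _), four_add (dp _ _ _) (dp _ _ _), four_sum d2]
  simp only [four_mul (dh _ _) (dR _ _ _), four_comp_ang (dr _ _ _)]

end Fields

/-! ### Bounds for derivatives at a point -/

namespace PtBound

open Fields

variable {F : Fields} {κ : SphereChart} {r₀ C β : ℝ} {c : Pt} (hp : PtBound F κ r₀ C c) (hC : 1 ≤ C)
  (hF : ChartFields F κ)
include hp

theorem r_pos : 0 < rad r₀ c := by linarith [hp.r_ge]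

include hC

theorem comp_abs_le (T : STensor) (I : Fin T.rank → Fin 2) :
    |T.comp I c| ≤ C ^ T.rank * rad r₀ c ^ T.rank * Real.sqrt (F.normSq κ T c) := by
  have hr := hp.r_pos
  have h1 := hp.pd_metric.comp_sq_le (fun J => T.comp J c) I
  have h0 : 0 ≤ F.normSq κ T c := hp.pd_metric.nip_nonneg _
  have h2 : ∏ i, F.gsMat κ c (I i) (I i) ≤ ((C * rad r₀ c) ^ 2) ^ T.rank := by
    refine (Finset.prod_le_prod (fun i _ => (hp.pd_metric.diag_pos _).le)
      (g := fun _ => (C * rad r₀ c) ^ 2) fun i _ => ?_).trans_eq (by simp)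
    refine (le_abs_self _).trans ((hp.h_le _ _).trans ?_)
    rw [mul_pow]
    gcongr
    exact le_self_pow₀ hC two_ne_zero
  refine abs_le_of_sq_le_sq ?_ (by positivity)
  refine h1.trans ((mul_le_mul_of_nonneg_right h2 h0).trans_eq ?_)
  rw [mul_pow _ (Real.sqrt _), Real.sq_sqrt h0]
  ring

omit hC in
theorem inv_mul_le {x : Fin 2 → ℝ} {y : ℝ} (h : ∀ B, |∑ E, F.gsMat κ c B E * x E| ≤ y) (A : Fin 2) :
    |x A| ≤ 2 * (C / rad r₀ c ^ 2 * y) := by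
  have e : x A = ∑ D, (F.gsMat κ c)⁻¹ A D * ∑ B, F.gsMat κ c D B * x B := by
    have := congrFun (Matrix.mulVec_mulVec x (F.gsMat κ c)⁻¹ (F.gsMat κ c)) A
    rw [Matrix.nonsing_inv_mul _ (Ne.isUnit hp.mem_reg.2.2.1), Matrix.one_mulVec] at this
    exact this.symm
  rw [e]
  exact abs_sum_two_le fun D => abs_mul_le (hp.hInv_le A D) (h D)

include hF

omit hC in
theorem projCov_le (A B E : Fin 2) : |F.projCov κ (eS A) B E c| ≤ 3 * C ^ 2 := by
  have hr := hp.r_pos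
  unfold Fields.projCov
  have h1 : ∀ D, |F.ip κ c (F.cov κ (eS A) (eS B) c) (eS D c)| ≤ 3 / 2 * C * rad r₀ c ^ 2 := by
    intro D
    rw [ip_cov_eS_eS hF hp.mem_reg]
    have k1 := abs_le.1 (hp.dh A D B)
    have k2 := abs_le.1 (hp.dh B D A)
    have k3 := abs_le.1 (hp.dh D A B)
    rw [abs_le]
    constructor <;> linarith [k1.1, k1.2, k2.1, k2.2, k3.1, k3.2]
  refine (abs_sum_two_le fun D => abs_mul_le (hp.hInv_le E D) (h1 D)).trans_eq ?_
  field_simp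

/-- A first derivative in terms of the covariant derivative, for one-forms. -/
theorem pd_oneForm_le {ξ : Fin 2 → Pt → ℝ} {K : ℝ} (hξ : ∀ A, |ξ A c| ≤ K) (A B : Fin 2) :
    |pd (sph A) (ξ B) c| ≤ C ^ 2 * rad r₀ c *
      Real.sqrt (F.normSq κ (F.applyOp κ r₀ DOp.rAngular (STensor.ofOneForm ξ)) c) + 6 * C ^ 2 * K := by
  have hr := hp.r_pos
  have h1 := hp.comp_abs_le hC (F.applyOp κ r₀ DOp.rAngular (STensor.ofOneForm ξ)) ![A, B]
  set N := F.normSq κ (F.applyOp κ r₀ DOp.rAngular (STensor.ofOneForm ξ)) c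
  have h2 : |rad r₀ c * ((∑ α, (eS A c) α * pd α (ξ B) c)
      - ∑ _i : Fin 1, ∑ E, F.projCov κ (eS A) B E c * ξ E c)| ≤ C ^ 2 * rad r₀ c ^ 2 * Real.sqrt N := by
    convert h1 using 1
    · change _ = |rad r₀ c * ((∑ α, (eS A c) α * pd α (ξ B) c)
      - ∑ i : Fin 1, ∑ E, F.projCov κ (eS A) (![B] i) E c * ξ (Function.update ![B] i E 0) c)|
      simp
    · rfl
  have e : ∑ α, (eS A c) α * pd α (ξ B) c = pd (sph A) (ξ B) c := by
    simp [eS, Pi.single_apply]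
  rw [e, Fin.sum_univ_one, abs_mul, abs_of_pos hr] at h2
  have h3 : |pd (sph A) (ξ B) c - ∑ E, F.projCov κ (eS A) B E c * ξ E c| ≤
      C ^ 2 * rad r₀ c * Real.sqrt N := by
    refine le_of_mul_le_mul_left (h2.trans_eq ?_) hr
    ring
  have h4 : |∑ E, F.projCov κ (eS A) B E c * ξ E c| ≤ 2 * (3 * C ^ 2 * K) :=
    abs_sum_two_le fun E => abs_mul_le (hp.projCov_le hF A B E) (hξ E)
  have h5 := abs_sub_abs_le_abs_sub (pd (sph A) (ξ B) c) (∑ E, F.projCov κ (eS A) B E c * ξ E c)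
  linarith

theorem pd_twoTensor_le {ξ : Fin 2 → Fin 2 → Pt → ℝ} {K : ℝ} (hξ : ∀ A B, |ξ A B c| ≤ K)
    (D A B : Fin 2) :
    |pd (sph D) (ξ A B) c| ≤ C ^ 3 * rad r₀ c ^ 2 *
      Real.sqrt (F.normSq κ (F.applyOp κ r₀ DOp.rAngular (STensor.ofTwoTensor ξ)) c)
        + 12 * C ^ 2 * K := by
  have hr := hp.r_pos
  have h1 := hp.comp_abs_le hC (F.applyOp κ r₀ DOp.rAngular (STensor.ofTwoTensor ξ)) ![D, A, B]
  set N := F.normSq κ (F.applyOp κ r₀ DOp.rAngular (STensor.ofTwoTensor ξ)) c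
  have h2 : |rad r₀ c * ((∑ α, (eS D c) α * pd α (ξ A B) c)
      - (∑ E, F.projCov κ (eS D) A E c * ξ E B c + ∑ E, F.projCov κ (eS D) B E c * ξ A E c))| ≤
      C ^ 3 * rad r₀ c ^ 3 * Real.sqrt N := by
    convert h1 using 1
    · change _ = |rad r₀ c * ((∑ α, (eS D c) α * pd α (ξ A B) c)
      - ∑ i : Fin 2, ∑ E, F.projCov κ (eS D) (![A, B] i) E c *
        ξ (Function.update ![A, B] i E 0) (Function.update ![A, B] i E 1) c)|
      simp [Fin.sum_univ_two]
    · rfl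
  have e : ∑ α, (eS D c) α * pd α (ξ A B) c = pd (sph D) (ξ A B) c := by
    simp [eS, Pi.single_apply]
  rw [e, abs_mul, abs_of_pos hr] at h2
  have h3 : |pd (sph D) (ξ A B) c - (∑ E, F.projCov κ (eS D) A E c * ξ E B c
      + ∑ E, F.projCov κ (eS D) B E c * ξ A E c)| ≤ C ^ 3 * rad r₀ c ^ 2 * Real.sqrt N := by
    refine le_of_mul_le_mul_left (h2.trans_eq ?_) hr
    ring
  have h4 : |∑ E, F.projCov κ (eS D) A E c * ξ E B c| ≤ 2 * (3 * C ^ 2 * K) :=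
    abs_sum_two_le fun E => abs_mul_le (hp.projCov_le hF D A E) (hξ _ _)
  have h4' : |∑ E, F.projCov κ (eS D) B E c * ξ A E c| ≤ 2 * (3 * C ^ 2 * K) :=
    abs_sum_two_le fun E => abs_mul_le (hp.projCov_le hF D B E) (hξ _ _)
  have h5 := abs_sub_abs_le_abs_sub (pd (sph D) (ξ A B) c) (∑ E, F.projCov κ (eS D) A E c * ξ E B c
      + ∑ E, F.projCov κ (eS D) B E c * ξ A E c)
  have h6 := abs_add_le (∑ E, F.projCov κ (eS D) A E c * ξ E B c)
    (∑ E, F.projCov κ (eS D) B E c * ξ A E c)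
  linarith

omit hF in
theorem pd_scalar_le (f : Pt → ℝ) (A : Fin 2) :
    |pd (sph A) f c| ≤
      C * Real.sqrt (F.normSq κ (F.applyOp κ r₀ DOp.rAngular (STensor.ofScalar f)) c) := by
  have hr := hp.r_pos
  have h1 := hp.comp_abs_le hC (F.applyOp κ r₀ DOp.rAngular (STensor.ofScalar f)) ![A]
  set N := F.normSq κ (F.applyOp κ r₀ DOp.rAngular (STensor.ofScalar f)) c
  have h2 : |rad r₀ c * (∑ α, (eS A c) α * pd α f c)| ≤ C ^ 1 * rad r₀ c ^ 1 * Real.sqrt N := by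
    convert h1 using 1
    · change _ = |rad r₀ c * ((∑ α, (eS A c) α * pd α f c)
      - ∑ i : Fin 0, ∑ E, F.projCov κ (eS A) (i.elim0) E c * f c)|
      simp
    · rfl
  have e : ∑ α, (eS A c) α * pd α f c = pd (sph A) f c := by
    simp [eS, Pi.single_apply]
  rw [e, abs_mul, abs_of_pos hr] at h2
  refine le_of_mul_le_mul_left (h2.trans_eq ?_) hr
  ring

/-- The right side keeps the norm of `r∇b`, since this norm is controlled in `L²` with one further
derivative and not pointwise. The derivative of `b^E` is recovered from that of the lowered form by
inverting `gs`. -/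
theorem pd_shift_le (A E : Fin 2) :
    |pd (sph A) (fun y => F.shift κ y E) c| ≤ 28 * C ^ 5 *
      (Real.sqrt (F.normSq κ (F.applyOp κ r₀ DOp.rAngular (F.ricci κ r₀ RicciName.shift)) c) / rad r₀ c
        + 1 / rad r₀ c ^ 2) := by
  have hr := hp.r_pos
  have hO := isOpen_reg hF r₀
  have dh := fun A B => (smooth_h hF r₀ A B).diffAt hO hp.mem_reg
  have db := fun B => (smooth_b hF r₀ B).diffAt hO hp.mem_reg
  have hb : ∀ B, |∑ E, F.gsMat κ c B E * F.shift κ c E| ≤ 2 * C ^ 2 := fun B =>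
    (abs_sum_two_le fun E => abs_mul_le (hp.h_le B E) (hp.shift E)).trans_eq (by field_simp)
  have h1 := fun B => hp.pd_oneForm_le hC hF
    (ξ := fun B y => ∑ E, F.gsMat κ y B E * F.shift κ y E) hb A B
  change ∀ B, |pd (sph A) (fun y => ∑ E, F.gsMat κ y B E * F.shift κ y E) c| ≤ C ^ 2 * rad r₀ c *
    Real.sqrt (F.normSq κ (F.applyOp κ r₀ DOp.rAngular (F.ricci κ r₀ RicciName.shift)) c)
      + 6 * C ^ 2 * (2 * C ^ 2) at h1
  set N := F.normSq κ (F.applyOp κ r₀ DOp.rAngular (F.ricci κ r₀ RicciName.shift)) c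
  have h2 : ∀ B, |∑ E, F.gsMat κ c B E * pd (sph A) (fun y => F.shift κ y E) c| ≤
      C ^ 2 * rad r₀ c * Real.sqrt N + 14 * C ^ 4 := fun B => by
    have k1 := h1 B
    rw [pd_sum fun E _ => (dh B E).fun_mul (db E)] at k1
    simp only [pd_mul (dh B _) (db _), Finset.sum_add_distrib] at k1
    have k2 : |∑ E, pd (sph A) (fun y => F.gsMat κ y B E) c * F.shift κ c E| ≤ 2 * C ^ 2 :=
      (abs_sum_two_le fun E => abs_mul_le (hp.dh A B E) (hp.shift E)).trans_eq (by field_simp)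
    have k3 : C ^ 2 ≤ C ^ 4 := pow_le_pow_right₀ hC (by norm_num)
    have k4 := abs_sub_abs_le_abs_sub (∑ E, F.gsMat κ c B E * pd (sph A) (fun y => F.shift κ y E) c)
      (-∑ E, pd (sph A) (fun y => F.gsMat κ y B E) c * F.shift κ c E)
    rw [abs_neg, sub_neg_eq_add, add_comm (∑ E, F.gsMat κ c B E * _)] at k4
    linarith
  refine (hp.inv_mul_le h2 E).trans ?_
  have e : 2 * (C / rad r₀ c ^ 2 * (C ^ 2 * rad r₀ c * Real.sqrt N + 14 * C ^ 4)) =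
      2 * C ^ 3 * (Real.sqrt N / rad r₀ c) + 28 * C ^ 5 * (1 / rad r₀ c ^ 2) := by
    field_simp
    ring
  rw [e, mul_add]
  have : C ^ 3 ≤ C ^ 5 := pow_le_pow_right₀ hC (by norm_num)
  gcongr
  norm_num

/-- The trace and the trace free part are differentiated separately because the bootstrap
assumptions concern each of them. The Minkowski part `2/r` of the trace is constant on the sphere.
Again the norms of the derivatives are kept, to be integrated along a line later. -/
theorem pd_chi_le (D A B : Fin 2) :
    |pd (sph D) (F.chi κ A B) c| ≤ C ^ 3 * rad r₀ c ^ 2 *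
      (Real.sqrt (F.normSq κ (F.applyOp κ r₀ DOp.rAngular (F.ricci κ r₀ RicciName.trChi)) c)
        + Real.sqrt (F.normSq κ (F.applyOp κ r₀ DOp.rAngular (F.ricci κ r₀ RicciName.chiHat)) c))
      + 13 * C ^ 3 * rad r₀ c := by
  have hr := hp.r_pos
  have hr1 := hp.r_ge
  have hO := isOpen_reg hF r₀
  have dh := (smooth_h hF r₀ A B).diffAt hO hp.mem_reg
  have dt := (trace_smooth hF r₀ (chi_smooth hF r₀)).diffAt hO hp.mem_reg
  have dhat := (traceFree_smooth hF r₀ (chi_smooth hF r₀) A B).diffAt hO hp.mem_reg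
  have dr : DifferentiableAt ℝ (fun y => 2 / rad r₀ y) c :=
    (contDiffOn_const.div (contDiff_rad r₀).contDiffOn fun _ hc => hc.2.2.2).diffAt hO hp.mem_reg
  have h1 := hp.pd_twoTensor_le hC hF (ξ := F.traceFree κ (F.chi κ)) hp.chiHat D A B
  have h2 := hp.pd_scalar_le hC (fun y => F.trace κ (F.chi κ) y - 2 / rad r₀ y) D
  change _ ≤ C ^ 3 * rad r₀ c ^ 2 *
    Real.sqrt (F.normSq κ (F.applyOp κ r₀ DOp.rAngular (F.ricci κ r₀ RicciName.chiHat)) c) + _ at h1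
  change _ ≤ C *
    Real.sqrt (F.normSq κ (F.applyOp κ r₀ DOp.rAngular (F.ricci κ r₀ RicciName.trChi)) c) at h2
  set N1 := F.normSq κ (F.applyOp κ r₀ DOp.rAngular (F.ricci κ r₀ RicciName.trChi)) c
  set N2 := F.normSq κ (F.applyOp κ r₀ DOp.rAngular (F.ricci κ r₀ RicciName.chiHat)) c
  have hrad : pd (sph D) (fun y => 2 / rad r₀ y) c = 0 := by
    have e : (fun y => 2 / rad r₀ y) = fun y => 2 * (1 / rad r₀ y) := by ext y; ring
    have d0 := (contDiff_rad r₀).differentiable (by simp) c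
    have d1 : DifferentiableAt ℝ (fun y => 1 / rad r₀ y) c :=
      (contDiffOn_const.div (contDiff_rad r₀).contDiffOn fun _ hc => hc.2.2.2).diffAt hO hp.mem_reg
    rw [e, pd_const_mul d1, pd_inv d0 hr.ne', pd_sph_rad]
    simp
  rw [pd_sub dt dr, hrad, sub_zero] at h2
  have e : F.chi κ A B = fun y => F.traceFree κ (F.chi κ) A B y
      + 1 / 2 * (F.trace κ (F.chi κ) y * F.gsMat κ y A B) := by
    ext y; simp only [Fields.traceFree]; ring
  rw [e, pd_add dhat ((dt.fun_mul dh).const_mul _), pd_const_mul (dt.fun_mul dh), pd_mul dt dh]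
  have h3 := abs_mul_le h2 (hp.h_le A B)
  have h4 := abs_mul_le hp.trChi (hp.dh D A B)
  have h5 : C / rad r₀ c * (C * rad r₀ c ^ 2) = C ^ 2 * rad r₀ c := by field_simp
  rw [h5] at h4
  have k2 : C ^ 2 ≤ C ^ 3 := pow_le_pow_right₀ hC (by norm_num)
  have h6 : C * Real.sqrt N1 * (C * rad r₀ c ^ 2) ≤ C ^ 3 * rad r₀ c ^ 2 * Real.sqrt N1 := by
    have : 0 ≤ rad r₀ c ^ 2 * Real.sqrt N1 := by positivity
    nlinarith
  have h7 : C ^ 2 * rad r₀ c ≤ C ^ 3 * rad r₀ c := by gcongr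
  have h8 : 12 * C ^ 2 * C ≤ 12 * C ^ 3 * rad r₀ c := by
    rw [show 12 * C ^ 2 * C = 12 * C ^ 3 by ring]
    exact le_mul_of_one_le_right (by positivity) hr1
  rw [abs_le] at h1 h3 h4 ⊢
  have h0 : 0 ≤ C ^ 3 * rad r₀ c ^ 2 * Real.sqrt N1 := by positivity
  have h0' : 0 ≤ C ^ 3 * rad r₀ c := by positivity
  constructor <;> linarith [h1.1, h1.2, h3.1, h3.2, h4.1, h4.2]

omit hC in
theorem projCov_four_le (hβ : ∀ A E, |pd (sph A) (fun y => F.shift κ y E) c| ≤ β) (A B : Fin 2) :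
    |F.projCov κ (F.e4 κ) A B c| ≤ 2 * C ^ 2 / rad r₀ c + 4 * C ^ 2 * β := by
  have hr := hp.r_pos
  unfold Fields.projCov
  have h1 : ∀ D, |F.ip κ c (F.cov κ (F.e4 κ) (eS A) c) (eS D c)| ≤
      C * rad r₀ c + 2 * (C * rad r₀ c ^ 2 * β) := by
    intro D
    rw [ip_cov_e4_eS hF hp.mem_reg]
    exact (abs_sub _ _).trans (add_le_add (hp.chi A D)
      (abs_sum_two_le fun E => abs_mul_le (hp.h_le D E) (hβ A E)))
  refine (abs_sum_two_le fun D => abs_mul_le (hp.hInv_le B D) (h1 D)).trans_eq ?_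
  field_simp
  ring

/-- The second derivatives of the shift. -/
theorem pd_pd_shift_le (hβ : ∀ A E, |pd (sph A) (fun y => F.shift κ y E) c| ≤ β) (A B E : Fin 2) :
    |pd (sph A) (pd (sph B) (fun y => F.shift κ y E)) c| ≤ 120 * C ^ 4 *
      (Real.sqrt (F.normSq κ (F.applyOp κ r₀ DOp.rAngular (F.ricci κ r₀ RicciName.trChi)) c)
        + Real.sqrt (F.normSq κ (F.applyOp κ r₀ DOp.rAngular (F.ricci κ r₀ RicciName.chiHat)) c)
        + 1 / rad r₀ c + β) := by
  have hr := hp.r_pos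
  have hr1 := hp.r_ge
  have hχ := hp.pd_chi_le hC hF
  have hβ0 : 0 ≤ β := (abs_nonneg _).trans (hβ 0 0)
  set n := Real.sqrt (F.normSq κ (F.applyOp κ r₀ DOp.rAngular (F.ricci κ r₀ RicciName.trChi)) c)
    + Real.sqrt (F.normSq κ (F.applyOp κ r₀ DOp.rAngular (F.ricci κ r₀ RicciName.chiHat)) c) with hn
  have hn0 : 0 ≤ n := by positivity
  set r := rad r₀ c with hrdef
  have c2 : C ^ 2 ≤ C ^ 3 := pow_le_pow_right₀ hC (by norm_num)
  have c1 : C ≤ C ^ 3 := le_self_pow₀ hC (by norm_num)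
  have hd : ∀ A B C', |pd (sph A) (fun y => F.gsMat κ y B C') c| ≤ C * r ^ 2 := fun A B C' => hp.dh A B C'
  -- The covariant derivative of the difference tensor along `e₄` is bounded pointwise. The
  -- correction has one term for each of the three indices, and through `∇_4 e_A` it contains `∂b`;
  -- this is the origin of the term with `β`.
  have hD4 : ∀ I : Fin 3 → Fin 2, |F.four κ ((F.christoffelDiff κ r₀).comp I) c| ≤
      13 * C ^ 3 * r + 24 * C ^ 3 * r ^ 2 * β := by
    intro I
    have k1 : |F.four κ ((F.christoffelDiff κ r₀).comp I) c - ∑ i : Fin 3, ∑ B,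
        F.projCov κ (F.e4 κ) (I i) B c * (F.christoffelDiff κ r₀).comp (Function.update I i B) c| ≤
        C * r := hp.diffFour I
    have k2 : ∀ i : Fin 3, |∑ B, F.projCov κ (F.e4 κ) (I i) B c *
        (F.christoffelDiff κ r₀).comp (Function.update I i B) c| ≤
        2 * ((2 * C ^ 2 / r + 4 * C ^ 2 * β) * (C * r ^ 2)) := fun i =>
      abs_sum_two_le fun B => abs_mul_le (hp.projCov_four_le hF hβ _ _) (hp.diff _)
    have e : 2 * ((2 * C ^ 2 / r + 4 * C ^ 2 * β) * (C * r ^ 2)) =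
        4 * C ^ 3 * r + 8 * C ^ 3 * r ^ 2 * β := by field_simp; ring
    simp only [e] at k2
    rw [Fin.sum_univ_three] at k1
    have q0 := abs_le.1 (k2 0)
    have q1 := abs_le.1 (k2 1)
    have q2 := abs_le.1 (k2 2)
    have q := abs_le.1 k1
    have c1r : C * r ≤ C ^ 3 * r := by gcongr
    rw [abs_le]
    constructor <;> linarith [q0.1, q0.2, q1.1, q1.2, q2.1, q2.2, q.1, q.2]
  have hfm : ∀ A B, |F.four κ (fun y => F.gsMat κ y A B) c| ≤ 2 * C * r + 4 * C * r ^ 2 * β := by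
    intro A B
    rw [four_metric hF hp.mem_reg]
    have k1 : |∑ E, (F.gsMat κ c E B * pd (sph A) (fun y => F.shift κ y E) c
        + F.gsMat κ c E A * pd (sph B) (fun y => F.shift κ y E) c)| ≤
        2 * (C * r ^ 2 * β + C * r ^ 2 * β) := abs_sum_two_le fun E => (abs_add_le _ _).trans
      (add_le_add (abs_mul_le (hp.h_le _ _) (hβ _ _)) (abs_mul_le (hp.h_le _ _) (hβ _ _)))
    have k2 := abs_le.1 (hp.chi A B)
    have k3 := abs_le.1 k1
    rw [abs_le]
    constructor <;> linarith [k2.1, k2.2, k3.1, k3.2]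
  -- The `e₄` derivative of the lowered symbols of `gs` is obtained from that of the difference
  -- tensor. The symbols of the round metric contribute only undifferentiated geometry times `e₄
  -- gs`, and the shift times their angular derivatives.
  have hS : ∀ A B C', |1 / 2 * (F.four κ (pd (sph A) (fun y => F.gsMat κ y B C')) c
        + F.four κ (pd (sph B) (fun y => F.gsMat κ y A C')) c
        - F.four κ (pd (sph C') (fun y => F.gsMat κ y A B)) c)| ≤
      21 * C ^ 3 * r + 32 * C ^ 3 * r ^ 2 * β := by
    intro A B C'
    have k0 := four_christoffelDiff hF hp.mem_reg ![A, B, C']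
    change _ = 1 / 2 * (F.four κ (pd (sph A) (fun y => F.gsMat κ y B C')) c
        + F.four κ (pd (sph B) (fun y => F.gsMat κ y A C')) c
        - F.four κ (pd (sph C') (fun y => F.gsMat κ y A B)) c)
      - ∑ E, (F.four κ (fun y => F.gsMat κ y C' E) c * κ.roundChr E A B (ang c)
        + F.gsMat κ c C' E * ∑ D, F.shift κ c D *
          fderiv ℝ (κ.roundChr E A B) (ang c) (Pi.single D 1)) at k0
    have k1 := abs_le.1 (hD4 ![A, B, C'])
    have k2 : |∑ E, (F.four κ (fun y => F.gsMat κ y C' E) c * κ.roundChr E A B (ang c)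
        + F.gsMat κ c C' E * ∑ D, F.shift κ c D *
          fderiv ℝ (κ.roundChr E A B) (ang c) (Pi.single D 1))| ≤
        2 * ((2 * C * r + 4 * C * r ^ 2 * β) * C + C * r ^ 2 * (2 * (C / r ^ 2 * C))) :=
      abs_sum_two_le fun E => (abs_add_le _ _).trans (add_le_add
        (abs_mul_le (hfm _ _) (hp.roundChr _ _ _)) (abs_mul_le (hp.h_le _ _)
          (abs_sum_two_le fun D => abs_mul_le (hp.shift D) (hp.droundChr _ _ _ _))))
    have e : 2 * ((2 * C * r + 4 * C * r ^ 2 * β) * C + C * r ^ 2 * (2 * (C / r ^ 2 * C))) =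
        4 * C ^ 2 * r + 8 * C ^ 2 * r ^ 2 * β + 4 * C ^ 3 := by field_simp; ring
    rw [e] at k2
    have k3 := abs_le.1 k2
    have e1 : C ^ 2 * r ≤ C ^ 3 * r := by gcongr
    have e2 : C ^ 2 * r ^ 2 * β ≤ C ^ 3 * r ^ 2 * β := by gcongr
    have e3 : C ^ 3 ≤ C ^ 3 * r := le_mul_of_one_le_right (by positivity) hr1
    rw [abs_le]
    constructor <;> linarith [k1.1, k1.2, k3.1, k3.2]
  have hQ : ∀ A B C', |∑ E, (pd (sph A) (fun y => F.gsMat κ y E C') c *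
          pd (sph B) (fun y => F.shift κ y E) c
        + pd (sph A) (fun y => F.gsMat κ y E B) c * pd (sph C') (fun y => F.shift κ y E) c
        + pd (sph A) (fun y => F.shift κ y E) c * pd (sph E) (fun y => F.gsMat κ y B C') c)| ≤
      6 * (C * r ^ 2 * β) := by
    intro A B C'
    refine (abs_sum_two_le (K := 3 * (C * r ^ 2 * β)) fun E => ?_).trans_eq (by ring)
    have k1 := abs_le.1 (abs_mul_le (hd A E C') (hβ B E))
    have k2 := abs_le.1 (abs_mul_le (hd A E B) (hβ C' E))
    have k3 := abs_le.1 (abs_mul_le (hβ A E) (hd E B C'))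
    rw [abs_le]
    constructor <;> linarith [k1.1, k1.2, k2.1, k2.2, k3.1, k3.2]
  have hmain : ∀ C', |∑ E, F.gsMat κ c C' E * pd (sph A) (pd (sph B) (fun y => F.shift κ y E)) c| ≤
      3 * C ^ 3 * r ^ 2 * n + 60 * C ^ 3 * r + 41 * C ^ 3 * r ^ 2 * β := by
    intro C'
    have k0 := metric_mul_pd_pd_shift hF hp.mem_reg A B C'
    simp only [hF.symm c hp.mem_reg.1 _ C'] at k0
    rw [k0]
    have a1 := abs_le.1 (hχ A B C')
    have a2 := abs_le.1 (hχ B A C')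
    have a3 := abs_le.1 (hχ C' A B)
    have a4 := abs_le.1 (hS A B C')
    have a5 := abs_le.1 (hQ A B C')
    have a6 := abs_le.1 (hQ B A C')
    have a7 := abs_le.1 (hQ C' A B)
    have e1 : C * r ^ 2 * β ≤ C ^ 3 * r ^ 2 * β := by gcongr
    rw [abs_le]
    constructor <;> linarith [a1.1, a1.2, a2.1, a2.2, a3.1, a3.2, a4.1, a4.2, a5.1, a5.2, a6.1, a6.2,
      a7.1, a7.2]
  refine (hp.inv_mul_le hmain E).trans ?_
  have e : 2 * (C / r ^ 2 * (3 * C ^ 3 * r ^ 2 * n + 60 * C ^ 3 * r + 41 * C ^ 3 * r ^ 2 * β)) =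
      6 * (C ^ 4 * n) + 120 * (C ^ 4 * (1 / r)) + 82 * (C ^ 4 * β) := by
    field_simp
    ring
  rw [e]
  have e1 : 0 ≤ C ^ 4 * n := by positivity
  have e2 : 0 ≤ C ^ 4 * β := by positivity
  linarith

end PtBound

/-! ### Derivatives of the shift -/

theorem mkPt_update (u v : ℝ) (θ : Plane) (A : Fin 2) (x : ℝ) :
    mkPt u v (Function.update θ A x) = Function.update (mkPt u v θ) (sph A) x := by
  ext i; fin_cases A <;> fin_cases i <;> simp [mkPt, sph]

section

variable {F : Fields} {𝔄 : SphereAtlas} {r₀ u v Cbar Cb M ℓ C : ℝ} {j : Fin 2}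

theorem sq_add_three_le (a b c d : ℝ) : (a + b + c + d) ^ 2 ≤ 4 * (a ^ 2 + b ^ 2 + c ^ 2 + d ^ 2) := by
  nlinarith [sq_nonneg (a - b), sq_nonneg (a - c), sq_nonneg (a - d), sq_nonneg (b - c),
    sq_nonneg (b - d), sq_nonneg (c - d)]

/-- With `y = ∂b` and `y' = ∂²b`, Young's inequality `|2yy'| ≤ r y² + y'²/r` has the right weight:
`y` carries the factor `1/r` in front of its energy and `y'` does not, so both terms are `1/r` times
a quantity with integrable trace. The term in `y'` that is again of the size of the bound for `y` is
absorbed since `r ≥ 1`. -/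
theorem shift_energy_le {y y' N0 N1 N2 r : ℝ} (hC : 1 ≤ C) (hr : 1 ≤ r) (h0 : 0 ≤ N0) (h1 : 0 ≤ N1)
    (h2 : 0 ≤ N2) (hy : |y| ≤ 28 * C ^ 5 * (Real.sqrt N0 / r + 1 / r ^ 2))
    (hy' : |y'| ≤ 120 * C ^ 4 * (Real.sqrt N1 + Real.sqrt N2 + 1 / r
      + 28 * C ^ 5 * (Real.sqrt N0 / r + 1 / r ^ 2))) :
    y ^ 2 ≤ 10 ^ 8 * C ^ 18 / r * (N0 + N1 + N2 + 1 / r ^ 2) ∧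
    |2 * y * y'| ≤ 1 * (10 ^ 8 * C ^ 18 / r * (N0 + N1 + N2 + 1 / r ^ 2)) := by
  have hr0 : 0 < r := by linarith
  set β := 28 * C ^ 5 * (Real.sqrt N0 / r + 1 / r ^ 2) with hβ
  have hβ2 : r * β ^ 2 ≤ 1568 * C ^ 10 * ((N0 + 1 / r ^ 2) / r) := by
    have h : β ^ 2 ≤ 784 * C ^ 10 * (2 * (N0 / r ^ 2 + 1 / r ^ 4)) := by
      have : (Real.sqrt N0 / r + 1 / r ^ 2) ^ 2 ≤ 2 * (N0 / r ^ 2 + 1 / r ^ 4) := by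
        have e1 : N0 / r ^ 2 = (Real.sqrt N0 / r) ^ 2 := by rw [div_pow, Real.sq_sqrt h0]
        have e2 : 1 / r ^ 4 = (1 / r ^ 2) ^ 2 := by rw [div_pow]; ring
        rw [e1, e2]
        nlinarith [sq_nonneg (Real.sqrt N0 / r - 1 / r ^ 2)]
      rw [hβ, mul_pow]
      calc _ ≤ (28 * C ^ 5) ^ 2 * (2 * (N0 / r ^ 2 + 1 / r ^ 4)) := by gcongr
        _ = _ := by ring
    calc r * β ^ 2 ≤ r * (784 * C ^ 10 * (2 * (N0 / r ^ 2 + 1 / r ^ 4))) := by gcongr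
      _ = _ := by field_simp; ring
  have hy2 : y ^ 2 ≤ β ^ 2 := sq_le_sq' (by linarith [(abs_le.1 hy).1]) (abs_le.1 hy).2
  have hy2' : y' ^ 2 ≤ 57600 * C ^ 8 * (N1 + N2 + 1 / r ^ 2 + β ^ 2) := by
    have k := sq_add_three_le (Real.sqrt N1) (Real.sqrt N2) (1 / r) β
    rw [Real.sq_sqrt h1, Real.sq_sqrt h2, div_pow, one_pow] at k
    calc y' ^ 2 ≤ (120 * C ^ 4 * (Real.sqrt N1 + Real.sqrt N2 + 1 / r + β)) ^ 2 :=
          sq_le_sq' (by linarith [(abs_le.1 hy').1]) (abs_le.1 hy').2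
      _ = 14400 * C ^ 8 * (Real.sqrt N1 + Real.sqrt N2 + 1 / r + β) ^ 2 := by ring
      _ ≤ 14400 * C ^ 8 * (4 * (N1 + N2 + 1 / r ^ 2 + β ^ 2)) := by gcongr
      _ = _ := by ring
  have hc8 : 1 ≤ C ^ 8 := one_le_pow₀ hC
  have hc10 : 1 ≤ C ^ 10 := one_le_pow₀ hC
  set X := (N0 + 1 / r ^ 2) / r with hX
  have hX0 : 0 ≤ X := by positivity
  set Y := (N1 + N2 + 1 / r ^ 2) / r with hY
  have hY0 : 0 ≤ Y := by positivity
  have hbr : β ^ 2 / r ≤ r * β ^ 2 := by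
    rw [div_le_iff₀ hr0]
    nlinarith [mul_nonneg (sq_nonneg β) (by nlinarith : 0 ≤ r * r - 1)]
  have hXY : X + (N1 + N2) / r = (N0 + N1 + N2 + 1 / r ^ 2) / r := by rw [hX]; ring
  have hYX : Y ≤ X + (N1 + N2) / r := by
    rw [hXY, hY]
    gcongr
    linarith
  have hN : 0 ≤ (N1 + N2) / r := by positivity
  have e0 : 10 ^ 8 * C ^ 18 / r * (N0 + N1 + N2 + 1 / r ^ 2) =
      10 ^ 8 * C ^ 18 * (X + (N1 + N2) / r) := by rw [hXY]; ring
  rw [e0, one_mul]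
  set Z := X + (N1 + N2) / r with hZ
  have hXZ : X ≤ Z := by linarith
  have hZ0 : 0 ≤ Z := by linarith
  have c18 : C ^ 8 * C ^ 10 = C ^ 18 := by ring
  have c8 : C ^ 8 ≤ C ^ 18 := pow_le_pow_right₀ hC (by norm_num)
  have c10 : C ^ 10 ≤ C ^ 18 := pow_le_pow_right₀ hC (by norm_num)
  have z1 : C ^ 10 * X ≤ C ^ 18 * Z := mul_le_mul c10 hXZ hX0 (by positivity)
  have z2 : C ^ 8 * Y ≤ C ^ 18 * Z := mul_le_mul c8 hYX hY0 (by positivity)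
  have hrb : r * β ^ 2 ≤ 1568 * (C ^ 18 * Z) := by nlinarith
  have z3 : C ^ 8 * (r * β ^ 2) ≤ 1568 * (C ^ 18 * Z) := by
    calc C ^ 8 * (r * β ^ 2) ≤ C ^ 8 * (1568 * C ^ 10 * X) := by gcongr
      _ = 1568 * (C ^ 18 * X) := by rw [← c18]; ring
      _ ≤ _ := by gcongr
  have hZ' : 0 ≤ C ^ 18 * Z := by positivity
  constructor
  · have : β ^ 2 ≤ r * β ^ 2 := le_mul_of_one_le_left (sq_nonneg β) hr
    linarith
  · have k1 : |2 * y * y'| ≤ r * y ^ 2 + y' ^ 2 / r := by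
      rw [abs_le]
      have p1 : 0 ≤ (r * y + y') ^ 2 / r := by positivity
      have p2 : 0 ≤ (r * y - y') ^ 2 / r := by positivity
      have q1 : (r * y + y') ^ 2 / r = r * y ^ 2 + 2 * y * y' + y' ^ 2 / r := by field_simp; ring
      have q2 : (r * y - y') ^ 2 / r = r * y ^ 2 - 2 * y * y' + y' ^ 2 / r := by field_simp; ring
      constructor <;> linarith
    have k2 : y' ^ 2 / r ≤ 57600 * (C ^ 8 * Y) + 57600 * (C ^ 8 * (r * β ^ 2)) := by
      calc y' ^ 2 / r ≤ 57600 * C ^ 8 * (N1 + N2 + 1 / r ^ 2 + β ^ 2) / r := by gcongr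
        _ = 57600 * (C ^ 8 * Y) + 57600 * (C ^ 8 * (β ^ 2 / r)) := by rw [hY]; ring
        _ ≤ _ := by gcongr
    have k3 : r * y ^ 2 ≤ r * β ^ 2 := by gcongr
    linarith

/-- The constant in the estimate for the first derivatives of the shift. -/
noncomputable def shiftConst (C M ℓ : ℝ) : ℝ :=
  (1 / ℓ + 1) * (10 ^ 8 * C ^ 18 * (12 * ((1 / ℓ + 2 * M) * M) + ℓ))

/-- A bound by the Sobolev inequality would require three derivatives of `b`. Instead `(∂b)²` is
controlled along a single coordinate line, where its derivative involves `∂²b`, hence first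
derivatives of `χ` and pointwise bounded terms. The line integrals of the squares of `r∇b` and `r∇χ`
use only two derivatives of these quantities and are of order `r⁻²`; the extra factor `1/r` from
`shift_energy_le` gives `r⁻³`. -/
theorem pd_shift_sq_le (hS : GoodSphere F (𝔄.chart j) r₀ u v) (hM : RoundBound (𝔄.chart j) M)
    (hℓ : 0 < ℓ) (hR : F.RicciBootstrap r₀ 𝔄 Cbar u v) (hCb : Cbar ≤ 1) (hC : 1 ≤ C) {θ : Plane}
    (hθ : square θ ℓ ⊆ (𝔄.chart j).U)
    (hP : ∀ x ∈ Icc (θ 0) (θ 0 + ℓ),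
      PtBound F (𝔄.chart j) r₀ C (mkPt u v (Function.update θ 0 x))) (A E : Fin 2) :
    pd (sph A) (fun y => F.shift (𝔄.chart j) y E) (mkPt u v θ) ^ 2 ≤
      shiftConst C M ℓ / (v - u + r₀) ^ 3 := by
  have hr := hS.r_pos
  have hM1 := hM.one_le
  have hF := hS.fields
  set κ := 𝔄.chart j with hκ
  have hrad : ∀ η, rad r₀ (mkPt u v η) = v - u + r₀ := fun η => GoodSphere.rad_mkPt _ _ _ _
  have hr1 : 1 ≤ v - u + r₀ := by
    have := (hP (θ 0) ⟨le_rfl, by linarith⟩).r_ge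
    rwa [hrad] at this
  set r := v - u + r₀ with hrdef
  set T : RicciName → STensor := fun n => F.applyOp κ r₀ DOp.rAngular (F.ricci κ r₀ n) with hT
  have hTs : ∀ n, (T n).SmoothOn (F.reg κ r₀) := fun n =>
    Fields.applyOp_smooth hF r₀ _ (Fields.ricci_smooth hF r₀ n)
  set N : RicciName → ℝ → ℝ := fun n x => F.normSq κ (T n) (mkPt u v (Function.update θ 0 x)) with hN
  have hO := Fields.isOpen_reg hF r₀
  have hbs := Fields.smooth_b hF r₀ E
  have hcN : ∀ n, ContinuousOn (N n) (Icc (θ 0) (θ 0 + ℓ)) := fun n x hx => by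
    have h1 := (Fields.normSq_smooth hF r₀ (hTs n)).continuousOn.continuousAt
      (hO.mem_nhds (hP x hx).mem_reg)
    refine ContinuousAt.continuousWithinAt ?_
    have h2 : ContinuousAt (fun x => mkPt u v (Function.update θ 0 x)) x := by
      simp only [mkPt_update]
      exact (continuous_const.update _ continuous_id).continuousAt
    exact ContinuousAt.comp (f := fun x => mkPt u v (Function.update θ 0 x)) h1 h2
  have hN0 : ∀ n, ∀ x ∈ Icc (θ 0) (θ 0 + ℓ), 0 ≤ N n x := fun n x hx =>
    (hP x hx).pd_metric.nip_nonneg _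
  set g : ℝ → ℝ := fun x => 10 ^ 8 * C ^ 18 / r *
    (N RicciName.shift x + N RicciName.trChi x + N RicciName.chiHat x + 1 / r ^ 2) with hg
  have hest : ∀ x ∈ Icc (θ 0) (θ 0 + ℓ), _ := fun x hx =>
    have hp := hP x hx
    shift_energy_le hC hr1 (hN0 RicciName.shift x hx) (hN0 RicciName.trChi x hx)
      (hN0 RicciName.chiHat x hx)
      (y := pd (sph A) (fun y => F.shift κ y E) (mkPt u v (Function.update θ 0 x)))
      (y' := pd (sph 0) (pd (sph A) (fun y => F.shift κ y E)) (mkPt u v (Function.update θ 0 x)))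
      (by have := hp.pd_shift_le hC hF A E; rwa [hrad] at this)
      (by have := hp.pd_pd_shift_le hC hF (hp.pd_shift_le hC hF) 0 A E; rwa [hrad] at this)
  have hint := ofReal_le_lintegral_of_deriv_le (g := g)
    (f := fun x => pd (sph A) (fun y => F.shift κ y E) (mkPt u v (Function.update θ 0 x)) ^ 2)
    (f' := fun x => 2 * pd (sph A) (fun y => F.shift κ y E) (mkPt u v (Function.update θ 0 x)) *
      pd (sph 0) (pd (sph A) (fun y => F.shift κ y E)) (mkPt u v (Function.update θ 0 x)))
    (a := θ 0) (K := 1) hℓ zero_le_one (fun x hx => by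
      have h1 := Fields.hasDerivAt_line ((contDiffOn_pd hO hbs (sph A)).diffAt hO (hP x hx).mem_reg)
        (sph 0)
      simp only [← mkPt_update, Function.update_idem, mkPt_sph, Function.update_self] at h1
      exact (h1.fun_pow 2).congr_deriv (by simp))
    (continuousOn_const.mul ((((hcN _).add (hcN _)).add (hcN _)).add continuousOn_const))
    (fun x hx => mul_nonneg (by positivity) (add_nonneg (add_nonneg (add_nonneg (hN0 _ x hx)
      (hN0 _ x hx)) (hN0 _ x hx)) (by positivity)))
    (fun x hx => (hest x hx).1) (fun x hx => (hest x hx).2)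
  rw [Function.update_eq_self] at hint
  -- The weight `p ≥ 1` makes the energy on the sphere at most `1`, and the trace inequality on the
  -- line gains `r⁻²` from the area.
  have hline : ∀ n : RicciName, 1 ≤ n.index → ∫⁻ x in Icc (θ 0) (θ 0 + ℓ), ENNReal.ofReal (N n x) ≤
      ENNReal.ofReal ((1 / ℓ + 2 * M) * (4 * M / r ^ 2 * 1)) := fun n hn => by
    have hE : ENNReal.ofReal (1 / (r ^ (2 * n.index) / r ^ 2)) ≤ ENNReal.ofReal 1 := by
      refine ENNReal.ofReal_le_ofReal ?_
      rw [div_le_one (by positivity), one_le_div (by positivity)]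
      exact pow_le_pow_right₀ hr1 (by omega)
    exact hS.lintegral_line_le hM hℓ (hTs n) hθ
      ((patchInt_ricci_le hr hR hCb j n [DOp.rAngular] (by simp)).trans hE)
      ((patchInt_ricci_le hr hR hCb j n [DOp.rAngular, DOp.rAngular] (by simp)).trans hE)
  have hgl : ∫⁻ x in Icc (θ 0) (θ 0 + ℓ), ENNReal.ofReal (g x) ≤ ENNReal.ofReal (10 ^ 8 * C ^ 18 / r *
      (3 * ((1 / ℓ + 2 * M) * (4 * M / r ^ 2 * 1)) + 1 / r ^ 2 * ℓ)) := by
    have hme : ∀ n, AEMeasurable (fun x => ENNReal.ofReal (N n x))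
        (volume.restrict (Icc (θ 0) (θ 0 + ℓ))) := fun n =>
      ((hcN n).aemeasurable measurableSet_Icc).ennreal_ofReal
    calc ∫⁻ x in Icc (θ 0) (θ 0 + ℓ), ENNReal.ofReal (g x)
        = ∫⁻ x in Icc (θ 0) (θ 0 + ℓ), ENNReal.ofReal (10 ^ 8 * C ^ 18 / r) *
          (ENNReal.ofReal (N RicciName.shift x) + ENNReal.ofReal (N RicciName.trChi x)
            + ENNReal.ofReal (N RicciName.chiHat x) + ENNReal.ofReal (1 / r ^ 2)) := by
          refine setLIntegral_congr_fun measurableSet_Icc fun x hx => ?_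
          have a0 := hN0 RicciName.shift x hx
          have a1 := hN0 RicciName.trChi x hx
          have a2 := hN0 RicciName.chiHat x hx
          rw [← ENNReal.ofReal_add a0 a1, ← ENNReal.ofReal_add (by positivity) a2,
            ← ENNReal.ofReal_add (by positivity) (by positivity),
            ← ENNReal.ofReal_mul (by positivity)]
      _ = ENNReal.ofReal (10 ^ 8 * C ^ 18 / r) *
          ((∫⁻ x in Icc (θ 0) (θ 0 + ℓ), ENNReal.ofReal (N RicciName.shift x))
          + (∫⁻ x in Icc (θ 0) (θ 0 + ℓ), ENNReal.ofReal (N RicciName.trChi x))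
          + (∫⁻ x in Icc (θ 0) (θ 0 + ℓ), ENNReal.ofReal (N RicciName.chiHat x))
          + ENNReal.ofReal (1 / r ^ 2) * ENNReal.ofReal ℓ) := by
          rw [lintegral_const_mul' _ _ (by simp), lintegral_add_right' _ aemeasurable_const,
            lintegral_add_right' _ (hme _), lintegral_add_right' _ (hme _), setLIntegral_const,
            Real.volume_Icc, add_sub_cancel_left]
      _ ≤ ENNReal.ofReal (10 ^ 8 * C ^ 18 / r) *
          (ENNReal.ofReal ((1 / ℓ + 2 * M) * (4 * M / r ^ 2 * 1))
          + ENNReal.ofReal ((1 / ℓ + 2 * M) * (4 * M / r ^ 2 * 1))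
          + ENNReal.ofReal ((1 / ℓ + 2 * M) * (4 * M / r ^ 2 * 1))
          + ENNReal.ofReal (1 / r ^ 2) * ENNReal.ofReal ℓ) := by
          gcongr
          · exact hline RicciName.shift le_rfl
          · exact hline RicciName.trChi one_le_two
          · exact hline RicciName.chiHat one_le_two
      _ = _ := by
          rw [← ENNReal.ofReal_mul (by positivity), ← ENNReal.ofReal_add (by positivity) (by positivity),
            ← ENNReal.ofReal_add (by positivity) (by positivity),
            ← ENNReal.ofReal_add (by positivity) (by positivity),
            ← ENNReal.ofReal_mul (by positivity)]
          congr 1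
          ring
  have hfin := hint.trans (mul_le_mul_right hgl _)
  rw [← ENNReal.ofReal_mul (by positivity), ENNReal.ofReal_le_ofReal_iff (by positivity)] at hfin
  refine hfin.trans_eq ?_
  unfold shiftConst
  field_simp
  ring

end

end DoubleNull


namespace DoubleNull

/-! ### Uniform bounds near the compact pieces of the charts -/

/-- Pointwise bounds which also include the first derivatives of the shift. -/
structure RegBound (F : Fields) (κ : SphereChart) (r₀ C K : ℝ) (c : Pt) : Prop
    extends PtBound F κ r₀ C c where
  one_le : 1 ≤ C
  dshift : ∀ A E, |pd (sph A) (fun y => F.shift κ y E) c| ≤ K / (rad r₀ c * Real.sqrt (rad r₀ c))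
  roundInv : ∀ A B, |(κ.round (ang c))⁻¹ A B| ≤ K

/-- The order of the quantifiers is essential. `Cb`, `C` and `K` depend on the charts alone, while
the constant `Cg` of the initial metric enters only the lower bound `R` for `r`. Later thresholds
for `r` may therefore depend on `C` and `K` without circularity. -/
theorem exists_regBound {𝔄 : SphereAtlas} (𝔎 : Cover 𝔄) :
    ∃ Cb : ℝ, 0 < Cb ∧ ∃ C K : ℝ, 1 ≤ C ∧ 1 ≤ K ∧ ∀ Cg : ℝ, ∃ R : ℝ, 1 ≤ R ∧
      ∀ (F : Fields) (r₀ u₀ u' v₀ v' Cbar : ℝ), Cbar ≤ Cb → u₀ < u' → R ≤ v₀ - u' + r₀ →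
        F.IsDoubleNull 𝔄 u₀ u' v₀ v' → F.InitialMetricBound r₀ 𝔄 Cg u₀ u' v₀ v' →
        (∀ u ∈ Icc u₀ u', ∀ v ∈ Icc v₀ v',
          F.RicciBootstrap r₀ 𝔄 Cbar u v ∧ F.ChristoffelBootstrap r₀ 𝔄 Cbar u v) →
        ∀ u ∈ Icc u₀ u', ∀ v ∈ Icc v₀ v', ∀ j, ∀ θ ∈ Metric.cthickening 𝔎.ℓ (𝔎.K j),
          RegBound F (𝔄.chart j) r₀ C K (mkPt u v θ) := by
  obtain ⟨M, hM⟩ : ∃ M, ∀ j, RoundBound (𝔄.chart j) M := by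
    choose M hM using fun j => exists_roundBound (𝔄.chart j)
    exact ⟨max (M 0) (M 1), Fin.forall_fin_two.2
      ⟨(hM 0).mono (le_max_left _ _), (hM 1).mono (le_max_right _ _)⟩⟩
  obtain ⟨G, hG, hGb⟩ : ∃ G, 1 ≤ G ∧ ∀ j, ∀ θ ∈ (𝔄.chart j).U, ∀ E A B,
      |(𝔄.chart j).roundChr E A B θ| ≤ G ∧
      ∀ C, |fderiv ℝ ((𝔄.chart j).roundChr E A B) θ (Pi.single C 1)| ≤ G := by
    choose G hG hGb using fun j => (𝔄.chart j).exists_roundChr_bound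
    refine ⟨max (G 0) (G 1), (hG 0).trans (le_max_left _ _), Fin.forall_fin_two.2 ⟨?_, ?_⟩⟩
    · exact fun θ hθ E A B => ⟨(hGb 0 θ hθ E A B).1.trans (le_max_left _ _), fun C =>
        ((hGb 0 θ hθ E A B).2 C).trans (le_max_left _ _)⟩
    · exact fun θ hθ E A B => ⟨(hGb 1 θ hθ E A B).1.trans (le_max_right _ _), fun C =>
        ((hGb 1 θ hθ E A B).2 C).trans (le_max_right _ _)⟩
  obtain ⟨J, hJ, hJb⟩ : ∃ J, 1 ≤ J ∧ ∀ j, ∀ θ ∈ (𝔄.chart j).U, ∀ A B,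
      |((𝔄.chart j).round θ)⁻¹ A B| ≤ J := by
    choose J hJ hJb using fun j => (𝔄.chart j).exists_bound (ι := Fin 2 × Fin 2)
      (f := fun i θ => ((𝔄.chart j).round θ)⁻¹ i.1 i.2)
      fun i => ((𝔄.chart j).contDiffOn_roundInv i.1 i.2).continuousOn
    refine ⟨max (J 0) (J 1), (hJ 0).trans (le_max_left _ _), Fin.forall_fin_two.2 ⟨?_, ?_⟩⟩
    · exact fun θ hθ A B => (hJb 0 (A, B) θ hθ).trans (le_max_left _ _)
    · exact fun θ hθ A B => (hJb 1 (A, B) θ hθ).trans (le_max_right _ _)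
  have hℓ := 𝔎.pos
  have hM1 := (hM 0).one_le
  have hsp := sobConst_pos hM1 hℓ
  -- The second entry makes the Sobolev bound for the lapse quantity at most `1/2`. The bound by `1`
  -- fixes the energies in the estimate for `∂b`.
  set Cb := min 1 (1 / (4 * sobConst M 𝔎.ℓ)) with hCb
  have hCb0 : 0 < Cb := lt_min one_pos (by positivity)
  have hCb1 : Cb ≤ 1 := min_le_left _ _
  have hsm : 4 * (sobConst M 𝔎.ℓ * Cb) ≤ 1 := by
    have h1 : Cb ≤ 1 / (4 * sobConst M 𝔎.ℓ) := min_le_right _ _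
    rw [le_div_iff₀ (by positivity)] at h1
    linarith
  set B := (2 * M) ^ 3 with hB
  have hB1 : 1 ≤ B := one_le_pow₀ (by linarith)
  set C := 8 * B ^ 3 * G with hC
  have hC1 : 1 ≤ C := by
    have : 1 ≤ B ^ 3 := one_le_pow₀ hB1
    nlinarith
  have hsh : 0 ≤ shiftConst C M 𝔎.ℓ := by unfold shiftConst; positivity
  refine ⟨Cb, hCb0, C, J + Real.sqrt (shiftConst C M 𝔎.ℓ), hC1,
    by linarith [Real.sqrt_nonneg (shiftConst C M 𝔎.ℓ)], fun Cg => ?_⟩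
  -- `R1` starts the continuity argument for the metric from the data on `{u = u₀}`, and `R2` makes
  -- the Sobolev bound improve it.
  set R1 := 16 * M ^ 2 * Cg
  set R2 := 32 * M ^ 2 * ((2 * M) ^ 2 * Real.sqrt (sobConst M 𝔎.ℓ * Cb))
  refine ⟨max 1 (max R1 R2), le_max_left _ _, ?_⟩
  intro F r₀ u₀ u' v₀ v' Cbar hCbar hu hR hF hI hboot u hu' v hv j
  have hR1 : 1 ≤ v₀ - u' + r₀ := (le_max_left _ _).trans hR
  have hR2 : R1 ≤ v₀ - u' + r₀ := (le_max_left _ _).trans ((le_max_right _ _).trans hR)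
  have hR3 : R2 ≤ v₀ - u' + r₀ := (le_max_right _ _).trans ((le_max_right _ _).trans hR)
  have hS : GoodSphere F (𝔄.chart j) r₀ u v :=
    goodSphere_of_bootstrap 𝔎 hM hF hI (fun u hu => (hboot u hu v hv).1) hCbar hCb0.le hu hv
      (by linarith [hv.1]) (by linarith [hv.1]) (by linarith [hv.1]) hu' j
  have hr1 : 1 ≤ v - u + r₀ := by linarith [hv.1, hu'.2]
  have hpt : ∀ θ ∈ Metric.cthickening (2 * 𝔎.ℓ) (𝔎.K j),
      PtBound F (𝔄.chart j) r₀ C (mkPt u v θ) := fun θ hθ =>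
    ptBound_of_bootstrap hS (hM j) hℓ (hboot u hu' v hv).1 (hboot u hu' v hv).2 hCbar hCb0.le hsm
      le_rfl hG (hGb j) hr1 (𝔎.square_subset_U hθ)
  intro θ hθ
  have hθ2 : θ ∈ Metric.cthickening (2 * 𝔎.ℓ) (𝔎.K j) := Metric.cthickening_mono (by linarith) _ hθ
  have hsq := 𝔎.square_subset hℓ.le hθ
  refine ⟨hpt θ hθ2, hC1, fun A E => ?_, fun A E => ?_⟩
  · have h1 := pd_shift_sq_le hS (hM j) hℓ (hboot u hu' v hv).1 (hCbar.trans hCb1) hC1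
      (𝔎.square_subset_U hθ2) (fun x hx => hpt _ ?_) A E
    · rw [GoodSphere.rad_mkPt]
      set r := v - u + r₀
      refine abs_le_of_sq_le_sq (h1.trans ?_) (by positivity)
      have e : (r * Real.sqrt r) ^ 2 = r ^ 3 := by
        rw [mul_pow, Real.sq_sqrt (by positivity)]; ring
      rw [div_pow, e]
      gcongr
      nlinarith [Real.sq_sqrt hsh, Real.sqrt_nonneg (shiftConst C M 𝔎.ℓ)]
    -- The line through `θ` lies in the square at `θ`, hence within `2ℓ` of the core, and squares of
    -- side `ℓ` at its points still lie in the chart.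
    · have h2 : Function.update θ 0 x ∈ square θ 𝔎.ℓ := by
        rw [mem_square, Fin.forall_fin_two]
        simp only [Function.update_self, Function.update_of_ne (one_ne_zero : (1 : Fin 2) ≠ 0)]
        exact ⟨hx, le_rfl, by linarith⟩
      have := hsq h2
      rwa [← two_mul] at this
  · rw [ang_mkPt]
    have := hJb j θ (𝔎.square_subset_U hθ2 (mem_square.2 fun i => by simp [hℓ.le])) A E
    linarith [Real.sqrt_nonneg (shiftConst C M 𝔎.ℓ)]

/-! ### Geodesics in a chart -/

/-- A solution of the geodesic equation in coordinates. -/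
structure ChartGeodesic (F : Fields) (κ : SphereChart) (I : Set ℝ) (c ξ : ℝ → Pt) : Prop where
  pos : ∀ s ∈ I, HasDerivWithinAt c (ξ s) I s
  vel : ∀ s ∈ I, HasDerivWithinAt ξ
    (fun μ => -∑ α, ∑ β, F.chr4 κ (c s) μ α β * ξ s α * ξ s β) I s

theorem fderiv_eq_sum_pd (f : Pt → ℝ) (c X : Pt) : fderiv ℝ f c X = ∑ α, X α * pd α f c := by
  conv_lhs => rw [pi_eq_sum_univ' X]
  simp only [map_sum, map_smul, smul_eq_mul]
  rfl

theorem hasDerivWithinAt_comp_pd {I : Set ℝ} {c : ℝ → Pt} {X : Pt} {s : ℝ} {f : Pt → ℝ}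
    (hf : DifferentiableAt ℝ f (c s)) (hc : HasDerivWithinAt c X I s) :
    HasDerivWithinAt (fun t => f (c t)) (∑ α, X α * pd α f (c s)) I s := by
  have := hf.hasFDerivAt.comp_hasDerivWithinAt s hc
  rwa [fderiv_eq_sum_pd] at this

theorem Fields.ip_eq_sum (F : Fields) (κ : SphereChart) (c X Y : Pt) :
    F.ip κ c X Y = ∑ μ, X μ * ∑ ν, F.gMat κ c μ ν * Y ν := by
  unfold ip
  simp only [Finset.mul_sum]
  exact Finset.sum_congr rfl fun α _ => Finset.sum_congr rfl fun β _ => by ring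

theorem Fields.sum_gMat_mul (F : Fields) (κ : SphereChart) (c Y : Pt) (μ : Fin 4) :
    ∑ ν, F.gMat κ c μ ν * Y ν = F.ip κ c (Pi.single μ 1) Y := by
  rw [ip_eq_sum]
  simp [Pi.single_apply]

namespace ChartGeodesic

open Fields

variable {F : Fields} {κ : SphereChart} {I : Set ℝ} {c ξ : ℝ → Pt} (hγ : ChartGeodesic F κ I c ξ)
  (hF : ChartFields F κ) {r₀ s : ℝ} (hs : s ∈ I) (hc : c s ∈ F.reg κ r₀)
include hγ hs

theorem eventually_mem {O : Set Pt} (hO : IsOpen O) (h : c s ∈ O) :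
    ∀ᶠ t in nhdsWithin s I, c t ∈ O :=
  (hγ.pos s hs).continuousWithinAt (hO.mem_nhds h)

theorem vel_comp (μ : Fin 4) : HasDerivWithinAt (fun t => ξ t μ)
    (-∑ α, ∑ β, F.chr4 κ (c s) μ α β * ξ s α * ξ s β) I s :=
  hasDerivWithinAt_pi.1 (hγ.vel s hs) μ

include hF hc

/-- The geodesic equation in Euler–Lagrange form. -/
theorem euler_lagrange (μ : Fin 4) :
    HasDerivWithinAt (fun t => ∑ ν, F.gMat κ (c t) μ ν * ξ t ν)
      (1 / 2 * F.dG κ (c s) μ (ξ s) (ξ s)) I s := by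
  have h1 : ∀ ν, HasDerivWithinAt (fun t => F.gMat κ (c t) μ ν * ξ t ν) _ I s := fun ν =>
    (hasDerivWithinAt_comp_pd ((smooth_gMat hF μ ν).diffAt κ.isOpen_dom hc.1) (hγ.pos s hs)).mul
      (hγ.vel_comp hs ν)
  refine (HasDerivWithinAt.fun_sum fun ν _ => h1 ν).congr_deriv ?_
  have h2 : ∑ ν, F.gMat κ (c s) μ ν * (-∑ α, ∑ β, F.chr4 κ (c s) ν α β * ξ s α * ξ s β) =
      -∑ α, ∑ β, (1 / 2 * (pd α (fun y => F.gMat κ y μ β) (c s) + pd β (fun y => F.gMat κ y μ α) (c s)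
        - pd μ (fun y => F.gMat κ y α β) (c s))) * ξ s α * ξ s β := by
    simp only [← gMat_chr4 hF hc, mul_neg, Finset.mul_sum, Finset.sum_mul, Finset.sum_neg_distrib]
    rw [neg_inj, Finset.sum_comm]
    refine Finset.sum_congr rfl fun α _ => ?_
    rw [Finset.sum_comm]
    exact Finset.sum_congr rfl fun β _ => Finset.sum_congr rfl fun ν _ => by ring
  rw [Finset.sum_add_distrib, h2]
  have h3 : ∑ α, ∑ β, pd β (fun y => F.gMat κ y μ α) (c s) * ξ s α * ξ s β =
      ∑ α, ∑ β, pd α (fun y => F.gMat κ y μ β) (c s) * ξ s α * ξ s β := by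
    rw [Finset.sum_comm]
    exact Finset.sum_congr rfl fun α _ => Finset.sum_congr rfl fun β _ => by ring
  have h4 : ∑ ν, (∑ α, ξ s α * pd α (fun y => F.gMat κ y μ ν) (c s)) * ξ s ν =
      ∑ α, ∑ β, pd α (fun y => F.gMat κ y μ β) (c s) * ξ s α * ξ s β := by
    simp only [Finset.sum_mul]
    rw [Finset.sum_comm]
    exact Finset.sum_congr rfl fun α _ => Finset.sum_congr rfl fun β _ => by ring
  have h5 : ∑ α, ∑ β, (1 / 2 * (pd α (fun y => F.gMat κ y μ β) (c s)
      + pd β (fun y => F.gMat κ y μ α) (c s) - pd μ (fun y => F.gMat κ y α β) (c s))) * ξ s α * ξ s β =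
      1 / 2 * (∑ α, ∑ β, pd α (fun y => F.gMat κ y μ β) (c s) * ξ s α * ξ s β
        + ∑ α, ∑ β, pd β (fun y => F.gMat κ y μ α) (c s) * ξ s α * ξ s β
        - ∑ α, ∑ β, pd μ (fun y => F.gMat κ y α β) (c s) * ξ s α * ξ s β) := by
    simp only [← Finset.sum_add_distrib, ← Finset.sum_sub_distrib, Finset.mul_sum]
    exact Finset.sum_congr rfl fun α _ => Finset.sum_congr rfl fun β _ => by ring
  rw [h4, h5, h3]
  unfold dG
  ring

/-- The length of the velocity is conserved. -/
theorem hasDerivWithinAt_ip :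
    HasDerivWithinAt (fun t => F.ip κ (c t) (ξ t) (ξ t)) 0 I s := by
  have h1 : ∀ μ, HasDerivWithinAt (fun t => ξ t μ * ∑ ν, F.gMat κ (c t) μ ν * ξ t ν) _ I s :=
    fun μ => (hγ.vel_comp hs μ).mul (hγ.euler_lagrange hF hs hc μ)
  have h2 := HasDerivWithinAt.fun_sum (u := Finset.univ) fun μ _ => h1 μ
  simp only [ip_eq_sum]
  refine h2.congr_deriv ?_
  have h3 := ip_chr4 hF hc (ξ s) (ξ s) (ξ s)
  unfold ip at h3
  have h4 : ∑ μ, (-∑ α, ∑ β, F.chr4 κ (c s) μ α β * ξ s α * ξ s β) *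
      ∑ ν, F.gMat κ (c s) μ ν * ξ s ν =
      -∑ μ, ∑ ν, F.gMat κ (c s) μ ν * (∑ α, ∑ β, F.chr4 κ (c s) μ α β * ξ s α * ξ s β) * ξ s ν := by
    rw [← Finset.sum_neg_distrib]
    refine Finset.sum_congr rfl fun μ _ => ?_
    rw [neg_mul, Finset.mul_sum]
    exact congrArg _ (Finset.sum_congr rfl fun ν _ => by ring)
  rw [Finset.sum_add_distrib, h4, h3]
  simp only [add_sub_cancel_right, ← Finset.sum_neg_distrib, Finset.mul_sum, ← Finset.sum_add_distrib]
  exact Finset.sum_eq_zero fun μ _ => by ring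

/-- The evolution of `p_A`. -/
theorem hasDerivWithinAt_lower (A : Fin 2) :
    HasDerivWithinAt (fun t => ∑ B, F.gsMat κ (c t) A B * F.sp κ (c t) (ξ t) B)
      (-2 * (F.eta κ A (c s) + F.etabar κ A (c s)) * (F.lapseSq κ (c s) * ξ s 0) * ξ s 1
        + 1 / 2 * ∑ B, ∑ D, pd (sph A) (fun y => F.gsMat κ y B D) (c s) *
            F.sp κ (c s) (ξ s) B * F.sp κ (c s) (ξ s) D
        - ξ s 1 * ∑ B, ∑ D, F.gsMat κ (c s) B D *
            pd (sph A) (fun y => F.shift κ y B) (c s) * F.sp κ (c s) (ξ s) D) I s := by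
  have hW := lapseSq_ne hc
  have hev := hγ.eventually_mem hs κ.isOpen_dom hc.1
  have e : ∀ c' ∈ κ.dom, ∀ X, ∑ B, F.gsMat κ c' A B * F.sp κ c' X B =
      ∑ ν, F.gMat κ c' (sph A) ν * X ν := fun c' hc' X => by
    rw [sum_gMat_mul, ip_eq hF hc']
    simp only [sp_single_sph, ite_mul, mul_ite, mul_one, mul_zero, zero_mul]
    simp [Finset.sum_ite_eq]
    fin_cases A <;> simp [sph]
  refine ((hγ.euler_lagrange hF hs hc (sph A)).congr_deriv ?_).congr_of_eventuallyEq
    (hev.mono fun t ht => e _ ht _) (e _ hc.1 _)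
  -- The derivative of the lapse enters only through `∂_A log Ω²`, the sum of the two torsion forms.
  have hWA : pd (sph A) (F.lapseSq κ) (c s) =
      F.lapseSq κ (c s) * (F.eta κ A (c s) + F.etabar κ A (c s)) := by
    rw [eta_eq hF hc, etabar_eq hF hc]
    field_simp
    ring
  rw [dG_eq hF hc.1, hWA]
  simp only [Fin.sum_univ_two, hF.symm _ hc.1 1 0]
  ring

/-- The evolution of `p⁴`. -/
theorem hasDerivWithinAt_four :
    HasDerivWithinAt (fun t => ξ t 1)
      (-1 / 2 * (∑ A, ∑ B, F.chibar κ A B (c s) * F.sp κ (c s) (ξ s) A * F.sp κ (c s) (ξ s) B)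
        - 2 * (∑ A, F.etabar κ A (c s) * F.sp κ (c s) (ξ s) A) * ξ s 1
        - F.omega κ (c s) * ξ s 1 ^ 2) I s := by
  have hW := lapseSq_ne hc
  have hev := hγ.eventually_mem hs (isOpen_reg hF r₀) hc
  -- Since `g(∂_u, ·) = -2Ω² dv`, the component `p⁴` is a quotient of a covariant component, for
  -- which the Euler–Lagrange equation holds, by the lapse.
  have e : ∀ c' ∈ F.reg κ r₀, ∀ X : Pt, X 1 =
      (∑ ν, F.gMat κ c' 0 ν * X ν) / (-2 * F.lapseSq κ c') := fun c' hc' X => by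
    have hW' := lapseSq_ne hc'
    rw [sum_gMat_mul, ip_eq hF hc'.1]
    have : ∀ A, F.sp κ c' (Pi.single 0 1) A = 0 := fun A => by fin_cases A <;> simp [sp, sph]
    simp [this]
    field_simp
  have hWd := hasDerivWithinAt_comp_pd ((smooth_W hF r₀).diffAt (isOpen_reg hF r₀) hc) (hγ.pos s hs)
  have h1 := (hγ.euler_lagrange hF hs hc 0).fun_div (hWd.const_mul (-2)) (by simpa using hW)
  refine (h1.congr_deriv ?_).congr_of_eventuallyEq (hev.mono fun t ht => e _ ht _) (e _ hc _)
  have e1 : ∑ ν, F.gMat κ (c s) 0 ν * ξ s ν = -2 * F.lapseSq κ (c s) * ξ s 1 := by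
    have := e _ hc (ξ s)
    rw [eq_div_iff (by simpa using hW)] at this
    linarith
  have hb : ∀ A, ∑ B, F.gsMat κ (c s) A B * pd 0 (fun y => F.shift κ y B) (c s) =
      2 * pd (sph A) (F.lapseSq κ) (c s) - 4 * F.lapseSq κ (c s) * F.etabar κ A (c s) := fun A => by
    rw [etabar_eq hF hc]
    field_simp
    ring
  have hh : ∀ A B, pd 0 (fun y => F.gsMat κ y A B) (c s) =
      2 * F.lapseSq κ (c s) * F.chibar κ A B (c s) := fun A B => by
    rw [chibar_eq hF hc]
    field_simp
  have ho : ∑ α, F.e4 κ (c s) α * pd α (F.lapseSq κ) (c s) = F.lapseSq κ (c s) * F.omega κ (c s) := by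
    rw [omega_eq hF hc]
    field_simp
  have hbX : ∑ A, ∑ B, F.gsMat κ (c s) A B * (pd 0 (fun y => F.shift κ y A) (c s) * ξ s 1 *
        F.sp κ (c s) (ξ s) B + F.sp κ (c s) (ξ s) A * (pd 0 (fun y => F.shift κ y B) (c s) * ξ s 1)) =
      2 * ξ s 1 * ∑ A, F.sp κ (c s) (ξ s) A * (2 * pd (sph A) (F.lapseSq κ) (c s)
        - 4 * F.lapseSq κ (c s) * F.etabar κ A (c s)) := by
    simp only [← hb, Fin.sum_univ_two, hF.symm _ hc.1 1 0]
    ring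
  rw [e1, dG_eq hF hc.1, hbX]
  simp only [hh]
  set W := F.lapseSq κ (c s) with hWdef
  -- Decomposing the velocity along `∂_u`, `e₄` and the spheres shows that the term with `∂_u Ω²`
  -- cancels the same term in the Euler–Lagrange equation. What remains is expressed by `ω` and the
  -- derivatives `∂_A Ω²`, which combine with `∂_u b` into `η̲`.
  have hd : ∑ α, ξ s α * pd α (F.lapseSq κ) (c s) = ξ s 0 * pd 0 (F.lapseSq κ) (c s)
      + ξ s 1 * (W * F.omega κ (c s))
      + ∑ A, F.sp κ (c s) (ξ s) A * pd (sph A) (F.lapseSq κ) (c s) := by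
    rw [← ho]
    simp [Fin.sum_univ_four, e4, sp, sph]
    ring
  rw [hd]
  simp only [Fin.sum_univ_two]
  field_simp
  ring

end ChartGeodesic

end DoubleNull


namespace DoubleNull

/-! ### Estimates along null geodesics in a chart -/

/-- The Cauchy–Schwarz inequality for the coordinate covector with index `A`, whose squared dual
length is `h⁻¹ A A`. -/
theorem PD.sq_le_inv_mul {h : Matrix (Fin 2) (Fin 2) ℝ} (hp : PD h) (x : Fin 2 → ℝ) (A : Fin 2) :
    x A ^ 2 ≤ h⁻¹ A A * ∑ A, ∑ B, h A B * x A * x B := by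
  have hd := hp.det_pos
  have hs := hp.symm 1 0
  have e : h⁻¹ A A = h.adjugate A A / h.det := by
    rw [Matrix.inv_def, Ring.inverse_eq_inv', Matrix.smul_apply, smul_eq_mul]; ring
  rw [e, div_mul_eq_mul_div, le_div_iff₀ hd, Matrix.adjugate_fin_two, Matrix.det_fin_two]
  simp only [Fin.sum_univ_two, hs]
  fin_cases A <;> simp
  · nlinarith [sq_nonneg (h 0 1 * x 0 + h 1 1 * x 1)]
  · nlinarith [sq_nonneg (h 0 0 * x 0 + h 0 1 * x 1)]

theorem abs_sub_le_of_deriv_le {f f' g g' : ℝ → ℝ} {S : ℝ}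
    (hf : ∀ t ∈ Icc 0 S, HasDerivWithinAt f (f' t) (Icc 0 S) t)
    (hg : ∀ t ∈ Icc 0 S, HasDerivWithinAt g (g' t) (Icc 0 S) t)
    (h : ∀ t ∈ Icc 0 S, |f' t| ≤ g' t) {t : ℝ} (ht : t ∈ Icc 0 S) : |f t - f 0| ≤ g t - g 0 := by
  have h0 : (0 : ℝ) ∈ Icc 0 S := ⟨le_rfl, ht.1.trans ht.2⟩
  have m1 : MonotoneOn (fun t => g t - f t) (Icc 0 S) := by
    refine monotoneOn_of_hasDerivWithinAt_nonneg (f' := fun t => g' t - f' t) (convex_Icc 0 S)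
      (fun t ht => ((hg t ht).sub (hf t ht)).continuousWithinAt)
      (fun t ht => ((hg t (interior_subset ht)).sub (hf t (interior_subset ht))).mono
        interior_subset) fun t ht => ?_
    have := (abs_le.1 (h t (interior_subset ht))).2
    linarith
  have m2 : MonotoneOn (fun t => g t + f t) (Icc 0 S) := by
    refine monotoneOn_of_hasDerivWithinAt_nonneg (f' := fun t => g' t + f' t) (convex_Icc 0 S)
      (fun t ht => ((hg t ht).add (hf t ht)).continuousWithinAt)
      (fun t ht => ((hg t (interior_subset ht)).add (hf t (interior_subset ht))).mono
        interior_subset) fun t ht => ?_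
    have := (abs_le.1 (h t (interior_subset ht))).1
    linarith
  have k1 := m1 h0 ht ht.1
  have k2 := m2 h0 ht ht.1
  dsimp only at k1 k2
  rw [abs_le]
  constructor <;> linarith

/-- A null geodesic in a region of controlled geometry, subject to the bounds that a continuity
argument will improve. -/
structure ControlledGeodesic (F : Fields) (κ : SphereChart) (r₀ C K C₃ P S : ℝ) (c ξ : ℝ → Pt) :
    Prop extends ChartGeodesic F κ (Icc 0 S) c ξ where
  fields : ChartFields F κ
  bound : ∀ t ∈ Icc 0 S, RegBound F κ r₀ C K (c t)
  large : ∀ t ∈ Icc 0 S, 12 * C₃ ≤ rad r₀ (c t) ^ 2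
  null : F.ip κ (c 0) (ξ 0) (ξ 0) = 0
  mom_pos : 0 < P
  initial : ξ 0 1 = P
  four_ge : ∀ t ∈ Icc 0 S, P / 2 ≤ ξ t 1
  four_le : ∀ t ∈ Icc 0 S, ξ t 1 ≤ 2 * P
  three_le : ∀ t ∈ Icc 0 S, rad r₀ (c t) ^ 2 * (F.lapseSq κ (c t) * ξ t 0) ≤ 2 * C₃ * P

namespace ControlledGeodesic

open Fields

variable {F : Fields} {κ : SphereChart} {r₀ C K C₃ P S : ℝ} {c ξ : ℝ → Pt}
  (h : ControlledGeodesic F κ r₀ C K C₃ P S c ξ) (h3 : 0 < C₃) {t : ℝ} (ht : t ∈ Icc 0 S)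
include h ht

theorem ip_eq_zero : F.ip κ (c t) (ξ t) (ξ t) = 0 := by
  have h1 := abs_sub_le_of_deriv_le (f := fun t => F.ip κ (c t) (ξ t) (ξ t)) (g := fun _ => 0)
    (fun t ht => h.hasDerivWithinAt_ip h.fields ht (h.bound t ht).mem_reg)
    (fun t _ => hasDerivWithinAt_const t _ (0 : ℝ)) (fun t _ => by simp) ht
  rw [h.null, sub_zero, sub_zero] at h1
  exact abs_nonpos_iff.1 h1

theorem null_eq : ∑ A, ∑ B, F.gsMat κ (c t) A B * F.sp κ (c t) (ξ t) A * F.sp κ (c t) (ξ t) B =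
    4 * (F.lapseSq κ (c t) * ξ t 0) * ξ t 1 := by
  have h1 := h.ip_eq_zero ht
  rw [ip_eq h.fields (h.bound t ht).mem_reg.1] at h1
  linarith

theorem four_pos : 0 < ξ t 1 := by linarith [h.four_ge t ht, h.mom_pos]

theorem quad_nonneg : 0 ≤ ∑ A, ∑ B, F.gsMat κ (c t) A B * F.sp κ (c t) (ξ t) A *
    F.sp κ (c t) (ξ t) B := by
  by_cases h0 : F.sp κ (c t) (ξ t) = 0
  · simp [h0]
  · exact ((h.bound t ht).pd_metric.pos _ h0).le

theorem three_nonneg : 0 ≤ F.lapseSq κ (c t) * ξ t 0 := by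
  have h1 := h.quad_nonneg ht
  rw [h.null_eq ht] at h1
  have := h.four_pos ht
  by_contra hn
  nlinarith

theorem lapse_bounds : 0 < F.lapseSq κ (c t) ∧ 1 / F.lapseSq κ (c t) ≤ 3 / 2 := by
  have h1 := abs_le.1 (h.bound t ht).lapse
  have h2 : 0 < 1 / F.lapseSq κ (c t) := by linarith [h1.1]
  exact ⟨one_div_pos.1 h2, by linarith [h1.2]⟩

theorem r_pos : 0 < rad r₀ (c t) := by linarith [(h.bound t ht).r_ge]

theorem three_le' : F.lapseSq κ (c t) * ξ t 0 ≤ 2 * C₃ * P / rad r₀ (c t) ^ 2 := by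
  rw [le_div_iff₀ (pow_pos (h.r_pos ht) 2), mul_comm]
  exact h.three_le t ht

theorem u_deriv_bounds : 0 ≤ ξ t 0 ∧ ξ t 0 ≤ 3 * C₃ * P / rad r₀ (c t) ^ 2 := by
  obtain ⟨hW, hW'⟩ := h.lapse_bounds ht
  have h1 := h.three_nonneg ht
  have e : ξ t 0 = 1 / F.lapseSq κ (c t) * (F.lapseSq κ (c t) * ξ t 0) := by field_simp
  refine ⟨by rw [e]; positivity, ?_⟩
  rw [e]
  calc _ ≤ 3 / 2 * (2 * C₃ * P / rad r₀ (c t) ^ 2) :=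
        mul_le_mul hW' (h.three_le' ht) h1 (by norm_num)
    _ = _ := by ring

theorem r_deriv : HasDerivWithinAt (fun t => rad r₀ (c t)) (ξ t 1 - ξ t 0) (Icc 0 S) t := by
  have h1 := fun μ => hasDerivWithinAt_pi.1 (h.pos t ht) μ
  exact ((h1 1).sub (h1 0)).add_const r₀

theorem r_deriv_ge : P / 4 ≤ ξ t 1 - ξ t 0 := by
  have h1 := (h.u_deriv_bounds ht).2
  have hr := h.r_pos ht
  have hP := h.mom_pos
  -- This is the purpose of the field `large`: the motion in `u` takes away at most half of the
  -- minimal growth `P/2` of `v`.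
  have h2 : 3 * C₃ * P / rad r₀ (c t) ^ 2 ≤ P / 4 := by
    rw [div_le_iff₀ (by positivity)]
    nlinarith [h.large t ht]
  linarith [h.four_ge t ht]

include h3

/-- The null condition gives `|p|² = 4p³p⁴ ≤ 16 C₃ P² / r²`, and a component gains another `1/r`
from the inverse metric. No separate assumption on `p^A` is needed during the continuity argument.
-/
theorem sp_le (A : Fin 2) :
    |F.sp κ (c t) (ξ t) A| ≤ 16 * C * (C₃ + 1) * P / rad r₀ (c t) ^ 2 := by
  have hr := h.r_pos ht
  have hP := h.mom_pos
  have hC := (h.bound t ht).one_le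
  have h1 := (h.bound t ht).pd_metric.sq_le_inv_mul (F.sp κ (c t) (ξ t)) A
  rw [h.null_eq ht] at h1
  have h2 := (le_abs_self _).trans ((h.bound t ht).hInv_le A A)
  have h4 := h.three_nonneg ht
  have h5 := h.four_pos ht
  refine abs_le_of_sq_le_sq ?_ (by positivity)
  calc _ ≤ _ := h1
    _ ≤ C / rad r₀ (c t) ^ 2 * (4 * (2 * C₃ * P / rad r₀ (c t) ^ 2) * (2 * P)) := by
        refine mul_le_mul h2 ?_ (by positivity) (by positivity)
        exact mul_le_mul (mul_le_mul_of_nonneg_left (h.three_le' ht) (by norm_num)) (h.four_le t ht)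
          h5.le (by positivity)
    _ = 16 * (C * C₃) * (P / rad r₀ (c t) ^ 2) ^ 2 := by ring
    _ ≤ (16 * C * (C₃ + 1)) ^ 2 * (P / rad r₀ (c t) ^ 2) ^ 2 := by
        gcongr
        nlinarith [mul_pos h3 h3, mul_pos (by linarith : 0 < C) h3,
          mul_nonneg (by linarith : 0 ≤ C - 1) h3.le, mul_pos (mul_pos h3 h3) (by linarith : 0 < C)]
    _ = _ := by ring

theorem lower_le (A : Fin 2) : |∑ B, F.gsMat κ (c t) A B * F.sp κ (c t) (ξ t) B| ≤
    2 * C * (16 * C * (C₃ + 1)) * P := by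
  have hr := h.r_pos ht
  refine (abs_sum_two_le fun B => abs_mul_le ((h.bound t ht).h_le A B)
    (h.sp_le h3 ht B)).trans_eq ?_
  field_simp

omit h3 ht in
/-- Integration of a quantity of order `P² r⁻²`. -/
theorem sub_le_of_sq {f f' : ℝ → ℝ} {k : ℝ} (hk : 0 ≤ k)
    (hf : ∀ t ∈ Icc 0 S, HasDerivWithinAt f (f' t) (Icc 0 S) t)
    (hb : ∀ t ∈ Icc 0 S, |f' t| ≤ k * P / rad r₀ (c t) ^ 2) (ht : t ∈ Icc 0 S) :
    |f t - f 0| ≤ 4 * k / rad r₀ (c 0) := by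
  -- The comparison function `-4k/r` has derivative `4k r'/r²`, and `r' ≥ P/4`.
  have h1 := abs_sub_le_of_deriv_le hf (g := fun t => -(4 * k) * (rad r₀ (c t))⁻¹)
    (fun t ht => ((h.r_deriv ht).fun_inv (h.r_pos ht).ne').const_mul _) (fun t ht => ?_) ht
  · have h2 := inv_pos.2 (h.r_pos ht)
    have : 0 ≤ 4 * k * (rad r₀ (c t))⁻¹ := by positivity
    rw [div_eq_mul_inv]
    linarith
  · have hr := h.r_pos ht
    refine (hb t ht).trans ?_
    have h2 := h.r_deriv_ge ht
    rw [mul_div_assoc', div_le_div_iff_of_pos_right (by positivity)]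
    nlinarith

omit h3 ht in
/-- Integration of a quantity of order `P² r^{-3/2}`. -/
theorem sub_le_of_sqrt {f f' : ℝ → ℝ} {k : ℝ} (hk : 0 ≤ k)
    (hf : ∀ t ∈ Icc 0 S, HasDerivWithinAt f (f' t) (Icc 0 S) t)
    (hb : ∀ t ∈ Icc 0 S, |f' t| ≤ k * P / (rad r₀ (c t) * Real.sqrt (rad r₀ (c t))))
    (ht : t ∈ Icc 0 S) :
    |f t - f 0| ≤ 8 * k / Real.sqrt (rad r₀ (c 0)) := by
  have h1 := abs_sub_le_of_deriv_le hf (g := fun t => -(8 * k) * (Real.sqrt (rad r₀ (c t)))⁻¹)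
    (fun t ht => (((h.r_deriv ht).sqrt (h.r_pos ht).ne').fun_inv
      (Real.sqrt_pos.2 (h.r_pos ht)).ne').const_mul _) (fun t ht => ?_) ht
  · have h2 := inv_pos.2 (Real.sqrt_pos.2 (h.r_pos ht))
    have : 0 ≤ 8 * k * (Real.sqrt (rad r₀ (c t)))⁻¹ := by positivity
    rw [div_eq_mul_inv]
    linarith
  · have hr := h.r_pos ht
    have hs := Real.sqrt_pos.2 hr
    refine (hb t ht).trans ?_
    have h2 := h.r_deriv_ge ht
    have e : -(8 * k) * (-((ξ t 1 - ξ t 0) / (2 * Real.sqrt (rad r₀ (c t)))) /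
        Real.sqrt (rad r₀ (c t)) ^ 2) =
        4 * k * (ξ t 1 - ξ t 0) / (rad r₀ (c t) * Real.sqrt (rad r₀ (c t))) := by
      rw [Real.sq_sqrt hr.le]
      field_simp
      ring
    rw [e, div_le_div_iff_of_pos_right (by positivity)]
    nlinarith

/-- All three terms of the equation are of order `P² r⁻³`: `χ̲` is `O(r)` in components against two
factors `r⁻²`, `η̲` is `O(r⁻¹)` against one such factor, and `ω` is `O(r⁻³)`. The weaker rate `r⁻²`
suffices for the integration. -/
theorem four_sub_le :
    |ξ t 1 - P| ≤ 4 * (14 * C * (16 * C * (C₃ + 1)) ^ 2 * P) / rad r₀ (c 0) := by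
  have hC : 1 ≤ C := (h.bound t ht).one_le
  have hP := h.mom_pos
  rw [← h.initial]
  refine h.sub_le_of_sq (by rw [h.initial]; positivity)
    (fun t ht => h.hasDerivWithinAt_four h.fields ht (h.bound t ht).mem_reg) (fun t ht => ?_) ht
  rw [h.initial]
  have hb := h.bound t ht
  have hr := h.r_pos ht
  have hsp := h.sp_le h3 ht
  set k := 16 * C * (C₃ + 1) with hk
  have hk1 : 1 ≤ k := by nlinarith
  set r := rad r₀ (c t) with hrdef
  have hr1 : 1 ≤ r := hb.r_ge
  have h4 : |ξ t 1| ≤ 2 * P := by rw [abs_of_pos (h.four_pos ht)]; exact h.four_le t ht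
  have k1 : |∑ A, ∑ B, F.chibar κ A B (c t) * F.sp κ (c t) (ξ t) A * F.sp κ (c t) (ξ t) B| ≤
      2 * (2 * (C * r * (k * P / r ^ 2) * (k * P / r ^ 2))) :=
    abs_sum_two_le fun A => abs_sum_two_le fun B =>
      abs_mul_le (abs_mul_le (hb.chibar A B) (hsp A)) (hsp B)
  have k2 : |(∑ A, F.etabar κ A (c t) * F.sp κ (c t) (ξ t) A) * ξ t 1| ≤
      2 * (C / r * (k * P / r ^ 2)) * (2 * P) :=
    abs_mul_le (abs_sum_two_le fun A => abs_mul_le (hb.etabar A) (hsp A)) h4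
  have k3 : |F.omega κ (c t) * ξ t 1 ^ 2| ≤ C / r ^ 3 * (2 * P) ^ 2 :=
    abs_mul_le hb.omega (by rw [abs_pow]; gcongr)
  have e1 : 2 * (2 * (C * r * (k * P / r ^ 2) * (k * P / r ^ 2))) = 4 * (C * k ^ 2) * (P ^ 2 / r ^ 3) := by
    field_simp
    norm_num
  have e2 : 2 * (C / r * (k * P / r ^ 2)) * (2 * P) = 4 * (C * k) * (P ^ 2 / r ^ 3) := by
    field_simp; ring
  have e3 : C / r ^ 3 * (2 * P) ^ 2 = 4 * C * (P ^ 2 / r ^ 3) := by ring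
  rw [e1] at k1
  rw [e2] at k2
  rw [e3] at k3
  have q : P ^ 2 / r ^ 3 ≤ P ^ 2 / r ^ 2 := by
    gcongr
    norm_num
  have e4 : 14 * C * k ^ 2 * P * P / r ^ 2 = 14 * (C * k ^ 2) * (P ^ 2 / r ^ 2) := by ring
  rw [e4]
  have q1 : C * k * (P ^ 2 / r ^ 3) ≤ C * k ^ 2 * (P ^ 2 / r ^ 3) := by
    gcongr
    exact le_self_pow₀ hk1 two_ne_zero
  have q2 : C * (P ^ 2 / r ^ 3) ≤ C * k ^ 2 * (P ^ 2 / r ^ 3) := by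
    gcongr
    exact le_mul_of_one_le_right (by positivity) (one_le_pow₀ hk1)
  have q3 : C * k ^ 2 * (P ^ 2 / r ^ 3) ≤ C * k ^ 2 * (P ^ 2 / r ^ 2) := by gcongr
  have a1 := abs_le.1 k1
  have a2 := abs_le.1 k2
  have a3 := abs_le.1 k3
  rw [abs_le]
  constructor <;> linarith [a1.1, a1.2, a2.1, a2.2, a3.1, a3.2]

/-- The covariant components are used because their equation contains `∂_A gs` but no other
connection coefficient of the spheres. The terms with the torsion forms and with `∂_A gs` are of
order `P² r⁻²`. The term with `∂b` is the slowest; its rate `r^(-3/2)` determines the final error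
`r(0)^(-1/2)`. -/
theorem lower_sub_le (A : Fin 2) :
    |∑ B, F.gsMat κ (c t) A B * F.sp κ (c t) (ξ t) B
      - ∑ B, F.gsMat κ (c 0) A B * F.sp κ (c 0) (ξ 0) B| ≤
    8 * ((16 * C * C₃ + 2 * C * (16 * C * (C₃ + 1)) ^ 2 + 8 * C * K * (16 * C * (C₃ + 1))) * P) /
      Real.sqrt (rad r₀ (c 0)) := by
  have hC : 1 ≤ C := (h.bound t ht).one_le
  have hK : 0 ≤ K := (abs_nonneg _).trans ((h.bound t ht).roundInv 0 0)
  have hP := h.mom_pos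
  refine h.sub_le_of_sqrt (f := fun t => ∑ B, F.gsMat κ (c t) A B * F.sp κ (c t) (ξ t) B)
    (by positivity)
    (fun t ht => h.hasDerivWithinAt_lower h.fields ht (h.bound t ht).mem_reg A) (fun t ht => ?_) ht
  have hb := h.bound t ht
  have hr := h.r_pos ht
  have hsp := h.sp_le h3 ht
  set k := 16 * C * (C₃ + 1) with hk
  have hk1 : 1 ≤ k := by nlinarith
  set r := rad r₀ (c t) with hrdef
  have hr1 : 1 ≤ r := hb.r_ge
  have h4 : |ξ t 1| ≤ 2 * P := by rw [abs_of_pos (h.four_pos ht)]; exact h.four_le t ht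
  have h5 : |F.lapseSq κ (c t) * ξ t 0| ≤ 2 * C₃ * P / r ^ 2 := by
    rw [abs_of_nonneg (h.three_nonneg ht)]; exact h.three_le' ht
  have hη : |F.eta κ A (c t) + F.etabar κ A (c t)| ≤ 2 * C := by
    have h1 := hb.etabar A
    have h2 : C / r ≤ C := div_le_self (by linarith) hr1
    exact (abs_add_le _ _).trans (by linarith [hb.eta A])
  have k1 : |-2 * (F.eta κ A (c t) + F.etabar κ A (c t)) * (F.lapseSq κ (c t) * ξ t 0) * ξ t 1| ≤
      2 * (2 * C) * (2 * C₃ * P / r ^ 2) * (2 * P) :=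
    abs_mul_le (abs_mul_le (abs_mul_le (by simp) hη) h5) h4
  have k2 : |∑ B, ∑ D, pd (sph A) (fun y => F.gsMat κ y B D) (c t) *
      F.sp κ (c t) (ξ t) B * F.sp κ (c t) (ξ t) D| ≤
      2 * (2 * (C * r ^ 2 * (k * P / r ^ 2) * (k * P / r ^ 2))) :=
    abs_sum_two_le fun B => abs_sum_two_le fun D =>
      abs_mul_le (abs_mul_le (hb.dh A B D) (hsp B)) (hsp D)
  have k3 : |ξ t 1 * ∑ B, ∑ D, F.gsMat κ (c t) B D *
      pd (sph A) (fun y => F.shift κ y B) (c t) * F.sp κ (c t) (ξ t) D| ≤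
      2 * P * (2 * (2 * (C * r ^ 2 * (K / (r * Real.sqrt r)) * (k * P / r ^ 2)))) :=
    abs_mul_le h4 (abs_sum_two_le fun B => abs_sum_two_le fun D =>
      abs_mul_le (abs_mul_le (hb.h_le B D) (hb.dshift A B)) (hsp D))
  have hs := Real.sqrt_pos.2 hr
  set X := P ^ 2 / (r * Real.sqrt r) with hX
  have q : P ^ 2 / r ^ 2 ≤ X := by
    rw [hX]
    gcongr
    rw [sq]
    gcongr
    exact Real.sqrt_le_iff.2 ⟨hr.le, le_self_pow₀ hr1 two_ne_zero⟩
  have e1 : 2 * (2 * C) * (2 * C₃ * P / r ^ 2) * (2 * P) = 16 * (C * C₃) * (P ^ 2 / r ^ 2) := by ring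
  have e2 : 2 * (2 * (C * r ^ 2 * (k * P / r ^ 2) * (k * P / r ^ 2))) =
      4 * (C * k ^ 2) * (P ^ 2 / r ^ 2) := by
    field_simp
    norm_num
  have e3 : 2 * P * (2 * (2 * (C * r ^ 2 * (K / (r * Real.sqrt r)) * (k * P / r ^ 2)))) =
      8 * (C * K * k) * X := by rw [hX]; field_simp; ring
  rw [e1] at k1
  rw [e2] at k2
  rw [e3] at k3
  have e4 : (16 * C * C₃ + 2 * C * k ^ 2 + 8 * C * K * k) * P * P / (r * Real.sqrt r) =
      16 * (C * C₃ * X) + 2 * (C * k ^ 2 * X) + 8 * (C * K * k) * X := by rw [hX]; ring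
  rw [e4]
  have q1 : C * C₃ * (P ^ 2 / r ^ 2) ≤ C * C₃ * X := by gcongr
  have q2 : C * k ^ 2 * (P ^ 2 / r ^ 2) ≤ C * k ^ 2 * X := by gcongr
  have a1 := abs_le.1 k1
  have a2 := abs_le.1 k2
  have a3 := abs_le.1 k3
  rw [abs_le]
  constructor <;> linarith [a1.1, a1.2, a2.1, a2.2, a3.1, a3.2]

theorem angle_sub_le (A : Fin 2) :
    |ang (c t) A - ang (c 0) A| ≤ 4 * (3 * (16 * C * (C₃ + 1))) / rad r₀ (c 0) := by
  have hC : 1 ≤ C := (h.bound t ht).one_le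
  simp only [ang_apply]
  refine h.sub_le_of_sq (f := fun t => c t (sph A)) (by positivity)
    (fun t ht => hasDerivWithinAt_pi.1 (h.pos t ht) (sph A)) (fun t ht => ?_) ht
  have hb := h.bound t ht
  have hr := h.r_pos ht
  have hP := h.mom_pos
  have hsp := h.sp_le h3 ht A
  set k := 16 * C * (C₃ + 1) with hk
  have h4 : |ξ t 1| ≤ 2 * P := by rw [abs_of_pos (h.four_pos ht)]; exact h.four_le t ht
  have e : ξ t (sph A) = F.sp κ (c t) (ξ t) A + F.shift κ (c t) A * ξ t 1 := by
    simp only [sp]; ring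
  rw [e]
  refine (abs_add_le _ _).trans ((add_le_add hsp (abs_mul_le (hb.shift A) h4)).trans ?_)
  have hCk : C ≤ k := by nlinarith
  have e2 : C / rad r₀ (c t) ^ 2 * (2 * P) = 2 * C * P / rad r₀ (c t) ^ 2 := by ring
  rw [e2, ← add_div]
  gcongr
  nlinarith

theorem u_sub_le : |c t 0 - c 0 0| ≤ 4 * (3 * C₃) / rad r₀ (c 0) := by
  refine h.sub_le_of_sq (f := fun t => c t 0) (by positivity)
    (fun t ht => hasDerivWithinAt_pi.1 (h.pos t ht) 0) (fun t ht => ?_) ht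
  obtain ⟨h1, h2⟩ := h.u_deriv_bounds ht
  rwa [abs_of_nonneg h1]

omit h3 in
theorem r_mono : rad r₀ (c 0) ≤ rad r₀ (c t) := by
  have h0 : (0 : ℝ) ∈ Icc 0 S := ⟨le_rfl, ht.1.trans ht.2⟩
  have m1 : MonotoneOn (fun t => rad r₀ (c t)) (Icc 0 S) := by
    refine monotoneOn_of_hasDerivWithinAt_nonneg (convex_Icc 0 S)
      (fun t ht => (h.r_deriv ht).continuousWithinAt)
      (fun t ht => (h.r_deriv (interior_subset ht)).mono interior_subset) fun t ht => ?_
    linarith [h.r_deriv_ge (interior_subset ht), h.mom_pos]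
  exact m1 h0 ht ht.1

/-- The rescaled components `r² p^A` compared with the values for the round metric. -/
theorem sp_sub_round_le (A : Fin 2) :
    |rad r₀ (c t) ^ 2 * F.sp κ (c t) (ξ t) A - ∑ B, (κ.round (ang (c t)))⁻¹ A B *
      ∑ D, F.gsMat κ (c t) B D * F.sp κ (c t) (ξ t) D| ≤
    16 * C ^ 3 * K * (16 * C * (C₃ + 1)) * P / rad r₀ (c t) := by
  have hb := h.bound t ht
  have hr := h.r_pos ht
  have hlow := h.lower_le h3 ht
  have hN : ang (c t) ∈ κ.N := κ.U_subset_N hb.mem_reg.1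
  set k := 16 * C * (C₃ + 1) with hk
  set p := F.sp κ (c t) (ξ t) with hp
  set r := rad r₀ (c t) with hrdef
  set L : Fin 2 → ℝ := fun B => ∑ D, F.gsMat κ (c t) B D * p D with hL
  set Y : Fin 2 → ℝ := fun A => ∑ B, (κ.round (ang (c t)))⁻¹ A B * L B with hY
  have hYb : ∀ A, |Y A| ≤ 2 * (K * (2 * C * k * P)) := fun A =>
    abs_sum_two_le fun B => abs_mul_le (hb.roundInv A B) (hlow B)
  have hγY : ∀ B, ∑ E, κ.round (ang (c t)) B E * Y E = L B := fun B => by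
    have := congrFun (Matrix.mulVec_mulVec L (κ.round (ang (c t))) (κ.round (ang (c t)))⁻¹) B
    rw [Matrix.mul_nonsing_inv _ (κ.round_isUnit hN), Matrix.one_mulVec] at this
    exact this
  -- The two candidates `r²p` and `Y = γ⁻¹ p_♭` satisfy `gs (r²p) = r²γ Y`, so their difference is
  -- governed by `gs - r²γ = O(r)`; inverting `gs` then leaves an error of order `1/r`.
  have hd : ∀ B, |∑ E, F.gsMat κ (c t) B E * (r ^ 2 * p E - Y E)| ≤
      2 * (C * r * (2 * (K * (2 * C * k * P)))) := fun B => by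
    have e : ∑ E, F.gsMat κ (c t) B E * (r ^ 2 * p E - Y E) =
        -∑ E, (F.gsMat κ (c t) B E - r ^ 2 * κ.round (ang (c t)) B E) * Y E := by
      have e1 : ∑ E, F.gsMat κ (c t) B E * (r ^ 2 * p E) =
          ∑ E, r ^ 2 * κ.round (ang (c t)) B E * Y E := by
        simp only [mul_assoc, ← Finset.mul_sum, hγY]
        rw [hL, Finset.mul_sum]
        exact Finset.sum_congr rfl fun E _ => by ring
      simp only [mul_sub, sub_mul, Finset.sum_sub_distrib, e1]
      ring
    rw [e, abs_neg]
    exact abs_sum_two_le fun E => abs_mul_le (hb.close B E) (hYb E)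
  refine (hb.inv_mul_le hd A).trans_eq ?_
  rw [← hrdef]
  field_simp
  ring

end ControlledGeodesic

theorem abs_mul_sub_mul_le {a b a' b' x y dx dy : ℝ} (ha : |a| ≤ x) (hb' : |b'| ≤ y)
    (h1 : |a - a'| ≤ dx) (h2 : |b - b'| ≤ dy) : |a * b - a' * b'| ≤ x * dy + dx * y := by
  have e : a * b - a' * b' = a * (b - b') + (a - a') * b' := by ring
  rw [e]
  exact (abs_add_le _ _).trans (add_le_add (abs_mul_le ha h2) (abs_mul_le h1 hb'))

/-- All momentum components stay close to their initial values if `r` is large initially and the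
inverse round metric varies little along the geodesic. -/
theorem exists_geodesic_estimate {C K C₃ : ℝ} (hC : 1 ≤ C) (hK : 1 ≤ K) (h3 : 0 < C₃) :
    ∃ k : ℝ, 1 ≤ k ∧ ∀ (F : Fields) (κ : SphereChart) (r₀ P S δ : ℝ) (c ξ : ℝ → Pt),
      ControlledGeodesic F κ r₀ C K C₃ P S c ξ → 0 ≤ δ → 1 ≤ δ ^ 2 * rad r₀ (c 0) → δ ≤ 1 →
      ∀ t ∈ Icc 0 S,
        |ξ t 1 - P| ≤ k * δ * P ∧ (∀ A, |ang (c t) A - ang (c 0) A| ≤ k * δ) ∧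
        (∀ A, |rad r₀ (c t) ^ 2 * F.sp κ (c t) (ξ t) A| ≤ k * P) ∧
        ∀ ε, 0 ≤ ε → (∀ A B, |(κ.round (ang (c t)))⁻¹ A B - (κ.round (ang (c 0)))⁻¹ A B| ≤ ε) →
          (∀ A, |rad r₀ (c t) ^ 2 * F.sp κ (c t) (ξ t) A - rad r₀ (c 0) ^ 2 * F.sp κ (c 0) (ξ 0) A| ≤
            k * (δ + ε) * P) ∧
          |rad r₀ (c t) ^ 2 * (F.lapseSq κ (c t) * ξ t 0) * ξ t 1
            - rad r₀ (c 0) ^ 2 * (F.lapseSq κ (c 0) * ξ 0 0) * ξ 0 1| ≤ k * (δ + ε) * P ^ 2 := by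
  set k0 := 16 * C * (C₃ + 1) with hk0
  set k4 := 16 * C * C₃ + 2 * C * k0 ^ 2 + 8 * C * K * k0 with hk4
  set k5 := 32 * C ^ 3 * K * k0 + 16 * K * k4 + 4 * C * k0 with hk5
  have hk01 : 1 ≤ k0 := by nlinarith
  have hk40 : 0 ≤ k4 := by positivity
  have hk50 : 0 ≤ k5 := by positivity
  set k := 56 * C * k0 ^ 2 + 12 * k0 + k0 + k5 + (4 * C * k0 * k5 + 16 * k4 * k0) with hk
  have p1 : 0 ≤ 56 * C * k0 ^ 2 := by positivity
  have p2 : 0 ≤ 4 * C * k0 * k5 + 16 * k4 * k0 := by positivity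
  refine ⟨k, by linarith, fun F κ r₀ P S δ c ξ h hδ0 hδ hδ1 t ht => ?_⟩
  have h0 : (0 : ℝ) ∈ Icc 0 S := ⟨le_rfl, ht.1.trans ht.2⟩
  have hP := h.mom_pos
  have hr0 := h.r_pos h0
  have hmono := h.r_mono ht
  set ρ := rad r₀ (c 0) with hρ
  -- The parameter `δ` dominates `r(0)^(-1/2)`, the slowest rate that occurs, and a fortiori
  -- `r(0)⁻¹` since `δ ≤ 1`.
  have d1 : 1 / ρ ≤ δ := by
    rw [div_le_iff₀ hr0]
    have := mul_le_mul_of_nonneg_right hδ1 (mul_nonneg hδ0 hr0.le)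
    linarith
  have d2 : 1 / Real.sqrt ρ ≤ δ := by
    rw [div_le_iff₀ (Real.sqrt_pos.2 hr0)]
    refine one_le_sq_iff₀ (by positivity) |>.1 ?_
    rwa [mul_pow, Real.sq_sqrt hr0.le]
  have dd : ∀ x, 0 ≤ x → x / ρ ≤ x * δ := fun x hx => by
    rw [div_eq_mul_one_div]; gcongr
  have ds : ∀ x, 0 ≤ x → x / Real.sqrt ρ ≤ x * δ := fun x hx => by
    rw [div_eq_mul_one_div]; gcongr
  have hsp : ∀ t ∈ Icc 0 S, ∀ A, |rad r₀ (c t) ^ 2 * F.sp κ (c t) (ξ t) A| ≤ k0 * P := by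
    intro t ht A
    have h1 := h.sp_le h3 ht A
    have hr := h.r_pos ht
    rw [le_div_iff₀ (by positivity)] at h1
    rw [abs_mul, abs_of_pos (by positivity : 0 < rad r₀ (c t) ^ 2), mul_comm]
    exact h1
  have hL := h.lower_sub_le h3 ht
  have hL0 := h.lower_le h3 h0
  have hLt := h.lower_le h3 ht
  have hZt := h.sp_sub_round_le h3 ht
  have hZ0 := h.sp_sub_round_le h3 h0
  rw [← hk0] at hL0 hLt hZt hZ0
  rw [← hk0, ← hk4] at hL
  refine ⟨?_, fun A => ?_, fun A => (hsp t ht A).trans ?_, fun ε hε hεb => ?_⟩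
  · refine (h.four_sub_le h3 ht).trans ((dd _ (by positivity)).trans ?_)
    rw [← hk0]
    have : 0 ≤ δ * P := by positivity
    nlinarith
  · refine (h.angle_sub_le h3 ht A).trans ((dd _ (by positivity)).trans ?_)
    rw [← hk0]
    nlinarith
  · nlinarith
  have hLd : ∀ A, |∑ B, F.gsMat κ (c t) A B * F.sp κ (c t) (ξ t) B
      - ∑ B, F.gsMat κ (c 0) A B * F.sp κ (c 0) (ξ 0) B| ≤ 8 * (k4 * P) * δ := fun A =>
    (hL A).trans (ds _ (by positivity))
  have hZ : ∀ A, |rad r₀ (c t) ^ 2 * F.sp κ (c t) (ξ t) A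
      - rad r₀ (c 0) ^ 2 * F.sp κ (c 0) (ξ 0) A| ≤ k5 * (δ + ε) * P := by
    intro A
    have e1 : 16 * C ^ 3 * K * k0 * P / rad r₀ (c t) ≤ 16 * C ^ 3 * K * k0 * P * δ :=
      (div_le_div_of_nonneg_left (by positivity) hr0 hmono).trans (dd _ (by positivity))
    have e2 : 16 * C ^ 3 * K * k0 * P / ρ ≤ 16 * C ^ 3 * K * k0 * P * δ := dd _ (by positivity)
    -- The variation of the inverse round metric enters as a separate parameter `ε`, because its
    -- smallness follows only from the bound on the angles just proved, by a modulus of continuity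
    -- chosen outside.
    have e3 : |∑ B, ((κ.round (ang (c t)))⁻¹ A B * (∑ D, F.gsMat κ (c t) B D * F.sp κ (c t) (ξ t) D)
        - (κ.round (ang (c 0)))⁻¹ A B * ∑ D, F.gsMat κ (c 0) B D * F.sp κ (c 0) (ξ 0) D)| ≤
        2 * (K * (8 * (k4 * P) * δ) + ε * (2 * C * k0 * P)) := abs_sum_two_le fun B =>
      abs_mul_sub_mul_le ((h.bound t ht).roundInv A B) (hL0 B) (hεb A B) (hLd B)
    rw [Finset.sum_sub_distrib] at e3
    have a1 := abs_le.1 ((hZt A).trans e1)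
    have a2 := abs_le.1 ((hZ0 A).trans e2)
    have a3 := abs_le.1 e3
    have e4 : k5 * (δ + ε) * P = 2 * (16 * C ^ 3 * K * k0 * P * δ)
        + 2 * (K * (8 * (k4 * P) * δ) + ε * (2 * C * k0 * P))
        + ((32 * C ^ 3 * K * k0 + 16 * K * k4) * ε * P + 4 * C * k0 * δ * P) := by rw [hk5]; ring
    have e5 : 0 ≤ (32 * C ^ 3 * K * k0 + 16 * K * k4) * ε * P + 4 * C * k0 * δ * P := by positivity
    rw [e4, abs_le]
    constructor <;> linarith [a1.1, a1.2, a2.1, a2.2, a3.1, a3.2]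
  have hkk : k5 ≤ k := by linarith
  refine ⟨fun A => (hZ A).trans (by gcongr), ?_⟩
  -- The null condition expresses `r²p³p⁴` by the pairing of `p_A` with `r²p^A`, both of which are
  -- almost constant. No equation for `p³` is needed.
  have e0 : ∀ t ∈ Icc 0 S, rad r₀ (c t) ^ 2 * (F.lapseSq κ (c t) * ξ t 0) * ξ t 1 =
      1 / 4 * ∑ A, (∑ B, F.gsMat κ (c t) A B * F.sp κ (c t) (ξ t) B) *
        (rad r₀ (c t) ^ 2 * F.sp κ (c t) (ξ t) A) := fun t ht => by
    have h1 := h.null_eq ht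
    have e : ∑ A, (∑ B, F.gsMat κ (c t) A B * F.sp κ (c t) (ξ t) B) *
        (rad r₀ (c t) ^ 2 * F.sp κ (c t) (ξ t) A) = rad r₀ (c t) ^ 2 * ∑ A, ∑ B,
        F.gsMat κ (c t) A B * F.sp κ (c t) (ξ t) A * F.sp κ (c t) (ξ t) B := by
      simp only [Finset.mul_sum, Finset.sum_mul]
      exact Finset.sum_congr rfl fun A _ => Finset.sum_congr rfl fun B _ => by ring
    rw [e, h1]
    ring
  rw [e0 t ht, e0 0 h0, ← mul_sub, ← Finset.sum_sub_distrib, abs_mul]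
  have e1 := abs_sum_two_le fun A => abs_mul_sub_mul_le (hLt A) (hsp 0 h0 A) (hLd A) (hZ A)
  have e2 : 2 * (2 * C * k0 * P * (k5 * (δ + ε) * P) + 8 * (k4 * P) * δ * (k0 * P)) +
      16 * k4 * k0 * ε * P ^ 2 = (4 * C * k0 * k5 + 16 * k4 * k0) * (δ + ε) * P ^ 2 := by ring
  have e3 : 0 ≤ 16 * k4 * k0 * ε * P ^ 2 := by positivity
  have e4 : (4 * C * k0 * k5 + 16 * k4 * k0) * (δ + ε) * P ^ 2 ≤ k * (δ + ε) * P ^ 2 := by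
    gcongr
    linarith
  have e5 : |(1 : ℝ) / 4| = 1 / 4 := abs_of_pos (by norm_num)
  rw [e5]
  have e6 := abs_nonneg (∑ A, ((∑ B, F.gsMat κ (c t) A B * F.sp κ (c t) (ξ t) B) *
        (rad r₀ (c t) ^ 2 * F.sp κ (c t) (ξ t) A) - (∑ B, F.gsMat κ (c 0) A B * F.sp κ (c 0) (ξ 0) B) *
        (rad r₀ (c 0) ^ 2 * F.sp κ (c 0) (ξ 0) A)))
  linarith

end DoubleNull


/-! ### Continuity induction, and geodesics in coordinates -/

namespace DoubleNull

-- The induction runs on the set of `s` with `[0, s]` contained in `G`, so the step may use the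
-- whole past of `s`, as integrated estimates require. Closedness is asked only within `[0, T]`,
-- where the curves are defined.
open Filter in
theorem continuity_induction {T : ℝ} {G : Set ℝ} (hcl : IsClosed (G ∩ Icc 0 T)) (h0 : (0 : ℝ) ∈ G)
    (hstep : ∀ s ∈ Icc 0 T, Icc 0 s ⊆ G → G ∈ nhdsWithin s (Icc 0 T)) : Icc 0 T ⊆ G := by
  have key : Icc 0 T ⊆ {s | Icc 0 s ⊆ G} := by
    refine IsClosed.Icc_subset_of_forall_mem_nhdsWithin ?_ (by simpa using h0) ?_
    · refine isClosed_of_closure_subset fun s hs => ?_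
      have hsT : s ∈ Icc 0 T := by
        have := closure_mono inter_subset_right hs
        rwa [isClosed_Icc.closure_eq] at this
      have h1 : ∀ t ∈ Ico 0 s, t ∈ G := fun t ht => by
        obtain ⟨y, hy, hy2⟩ := mem_closure_iff.1 hs (Ioi t) isOpen_Ioi ht.2
        exact hy2.1 ⟨ht.1, hy.le⟩
      refine ⟨fun t ht => ?_, hsT⟩
      rcases eq_or_lt_of_le ht.2 with rfl | hlt
      · rcases eq_or_lt_of_le ht.1 with rfl | hpos
        · exact h0
        · have h2 : t ∈ closure (G ∩ Icc 0 T) := by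
            have h3 : t ∈ closure (Ico 0 t) := by
              rw [closure_Ico hpos.ne]; exact ⟨hpos.le, le_rfl⟩
            exact closure_mono (show Ico 0 t ⊆ G ∩ Icc 0 T from
            fun y hy => ⟨h1 y hy, hy.1, hy.2.le.trans hsT.2⟩) h3
          rw [hcl.closure_eq] at h2
          exact h2.1
      · exact h1 t ⟨ht.1, hlt⟩
    · rintro s ⟨hs, hsT⟩
      have h1 := hstep s (Ico_subset_Icc_self hsT) hs
      obtain ⟨ε, hε, h2⟩ := Metric.mem_nhdsWithin_iff.1 h1
      have h3 : Ioo s (min T (s + ε)) ∈ nhdsWithin s (Ioi s) :=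
        Ioo_mem_nhdsGT (lt_min hsT.2 (by linarith))
      filter_upwards [h3] with y hy t ht
      rcases le_or_gt t s with hts | hts
      · exact hs ⟨ht.1, hts⟩
      · have h4 : t < min T (s + ε) := ht.2.trans_lt hy.2
        refine h2 ⟨?_, ht.1, (h4.trans_le (min_le_left _ _)).le⟩
        rw [Metric.mem_ball, Real.dist_eq, abs_of_pos (by linarith)]
        linarith [h4.trans_le (min_le_right _ _)]
  exact fun s hs => key hs ⟨hs.1, le_rfl⟩

/-! ### Points and vectors in coordinates -/

namespace SphereChart

variable {κ : SphereChart}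

theorem coord_mem_dom {w : Event} (hw : w.2.2 ∈ κ.range) : κ.coord w ∈ κ.dom := by
  change ang (κ.coord w) ∈ κ.U
  rw [coord, ang_mkPt]
  exact κ.theta_mem hw

theorem place_coord {w : Event} (hw : w.2.2 ∈ κ.range) : κ.place (κ.coord w) = w := by
  unfold place coord
  rw [ang_mkPt, mkPt_zero, mkPt_one, κ.phi_theta hw]

theorem sum_coordVel {w X : Event} (hw : w.2.2 ∈ κ.range) (hX : inner ℝ w.2.2 X.2.2 = 0) :
    ∑ μ, κ.coordVel w X μ • κ.dPlace (κ.coord w) μ = X := by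
  rw [sum_smul_dPlace]
  unfold coordVel coord
  simp only [mkPt_zero, mkPt_one, mkPt_sph, ang_mkPt]
  have hN := κ.U_subset_N (κ.theta_mem hw)
  rw [κ.sum_tangentComp hN]
  rwa [κ.phi_theta hw]

end SphereChart

namespace Fields

variable {F : Fields} {κ : SphereChart} {w X : Event}

theorem radius_eq (r₀ : ℝ) : radius r₀ w = rad r₀ (κ.coord w) := by
  simp [radius, rad, SphereChart.coord, mkPt_zero, mkPt_one]

theorem p4_eq : p4 X = κ.coordVel w X 1 := by simp [p4, SphereChart.coordVel, mkPt_one]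

theorem p3_eq (hw : w.2.2 ∈ κ.range) :
    F.p3 w X = F.lapseSq κ (κ.coord w) * κ.coordVel w X 0 := by
  simp [p3, lapseSq, SphereChart.place_coord hw, SphereChart.coordVel, mkPt_zero]

theorem pS_eq (hw : w.2.2 ∈ κ.range) (A : Fin 2) :
    F.pS κ w X A = F.sp κ (κ.coord w) (κ.coordVel w X) A := by
  unfold pS sp shift
  rw [SphereChart.place_coord hw, κ.tangentComp_sub, κ.tangentComp_smul]
  simp only [SphereChart.coordVel, SphereChart.coord, mkPt_one, mkPt_sph, ang_mkPt]
  simp [mul_comm]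

theorem g_eq (hF : ChartFields F κ) (hw : w.2.2 ∈ κ.range) (hX : inner ℝ w.2.2 X.2.2 = 0) :
    F.g w X X = F.ip κ (κ.coord w) (κ.coordVel w X) (κ.coordVel w X) := by
  rw [ip_eq hF (SphereChart.coord_mem_dom hw), ← g_frame hF (SphereChart.coord_mem_dom hw),
    SphereChart.sum_coordVel hw hX, SphereChart.place_coord hw]

end Fields

namespace Fields.IsGeodesic

variable {F : Fields} {𝔄 : SphereAtlas} {u₀ u' v₀ v' T : ℝ} {γ γ' : ℝ → Event}
  (hγ : F.IsGeodesic 𝔄 u₀ u' v₀ v' T γ γ') {s : ℝ} (hs : s ∈ Icc 0 T)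
include hγ hs

theorem norm_eq : ‖(γ s).2.2‖ = 1 := (hγ s hs).1.2.2

theorem hasDeriv_sphere : HasDerivWithinAt (fun t => (γ t).2.2) (γ' s).2.2 (Icc 0 T) s :=
  ((hγ s hs).2.1.snd).snd

theorem eventually_mem_range {i : Fin 2} (hi : (γ s).2.2 ∈ (𝔄.chart i).range) :
    ∀ᶠ t in nhdsWithin s (Icc 0 T), (γ t).2.2 ∈ (𝔄.chart i).range := by
  have h1 := (hγ.hasDeriv_sphere hs).continuousWithinAt.eventually
    ((𝔄.chart i).eventually_mem_range hi)
  filter_upwards [h1, self_mem_nhdsWithin] with t ht htT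
  exact ht (hγ.norm_eq htT)

/-- The coordinate function is defined on the sphere only, so a smooth extension to a neighbourhood
is differentiated. Its derivative is identified with the tangential components by differentiating `Φ
∘ θ = γ`. The condition `0 < T` makes one-sided derivatives unique. -/
theorem hasDeriv_coord (hT : 0 < T) {i : Fin 2} (hi : (γ s).2.2 ∈ (𝔄.chart i).range) :
    HasDerivWithinAt (fun t => (𝔄.chart i).coord (γ t)) ((𝔄.chart i).coordVel (γ s) (γ' s))
      (Icc 0 T) s := by
  set κ := 𝔄.chart i
  obtain ⟨ψ, hψ, hev⟩ := κ.exists_theta_extension hi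
  have hx := hγ.hasDeriv_sphere hs
  have hev' : ∀ᶠ t in nhdsWithin s (Icc 0 T), κ.theta (γ t).2.2 = ψ (γ t).2.2 := by
    filter_upwards [hx.continuousWithinAt.eventually hev, self_mem_nhdsWithin] with t ht htT
    exact (ht (hγ.norm_eq htT)).1
  have hθs : κ.theta (γ s).2.2 = ψ (γ s).2.2 := (hev.self_of_nhds (hγ.norm_eq hs)).1
  have hθ : HasDerivWithinAt (fun t => κ.theta (γ t).2.2) (fderiv ℝ ψ (γ s).2.2 (γ' s).2.2)
      (Icc 0 T) s :=
    ((hψ.differentiableAt (by simp)).hasFDerivAt.comp_hasDerivWithinAt s hx).congr_of_eventuallyEq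
      hev' hθs
  set y := fderiv ℝ ψ (γ s).2.2 (γ' s).2.2
  have hN := κ.U_subset_N (κ.theta_mem hi)
  have h1 : HasDerivWithinAt (fun t => (γ t).2.2) (fderiv ℝ κ.Φ (κ.theta (γ s).2.2) y) (Icc 0 T) s :=
    ((κ.hasFDerivAt_phi hN).comp_hasDerivWithinAt s hθ).congr_of_eventuallyEq
      ((hγ.eventually_mem_range hs hi).mono fun t ht => (κ.phi_theta ht).symm) (κ.phi_theta hi).symm
  have h2 : fderiv ℝ κ.Φ (κ.theta (γ s).2.2) y = (γ' s).2.2 :=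
    (uniqueDiffOn_Icc hT s hs).eq_deriv _ h1 hx
  have h3 : κ.tangentComp (κ.theta (γ s).2.2) (γ' s).2.2 = y := by
    rw [← h2, κ.fderiv_phi_apply, κ.tangentComp_sum hN]
  have hd := (hγ s hs).2.1
  rw [hasDerivWithinAt_pi]
  have hu := hd.fst
  have hv := hd.snd.fst
  have hA := fun A => hasDerivWithinAt_pi.1 hθ A
  unfold SphereChart.coord SphereChart.coordVel
  rw [h3]
  intro μ
  fin_cases μ
  · exact hu
  · exact hv
  · exact hA 0
  · exact hA 1

theorem chartGeodesic (hT : 0 < T) {i : Fin 2}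
    (hi : ∀ t ∈ Icc 0 s, (γ t).2.2 ∈ (𝔄.chart i).range) :
    ChartGeodesic F (𝔄.chart i) (Icc 0 s) (fun t => (𝔄.chart i).coord (γ t))
      (fun t => (𝔄.chart i).coordVel (γ t) (γ' t)) where
  pos t ht := (hγ.hasDeriv_coord ⟨ht.1, ht.2.trans hs.2⟩ hT (hi t ht)).mono
    (Icc_subset_Icc_right hs.2)
  vel t ht := ((hγ t ⟨ht.1, ht.2.trans hs.2⟩).2.2 i (hi t ht)).mono (Icc_subset_Icc_right hs.2)

theorem continuousWithinAt_vel (μ : Fin 4) {i : Fin 2} (hi : (γ s).2.2 ∈ (𝔄.chart i).range) :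
    ContinuousWithinAt (fun t => (𝔄.chart i).coordVel (γ t) (γ' t) μ) (Icc 0 T) s :=
  (hasDerivWithinAt_pi.1 ((hγ s hs).2.2 i hi) μ).continuousWithinAt

theorem exists_chart : ∃ i, (γ s).2.2 ∈ (𝔄.chart i).range := 𝔄.cover _ (hγ.norm_eq hs)

theorem continuousWithinAt_p4 : ContinuousWithinAt (fun t => p4 (γ' t)) (Icc 0 T) s := by
  obtain ⟨i, hi⟩ := hγ.exists_chart hs
  have := hγ.continuousWithinAt_vel hs 1 hi
  simpa only [← p4_eq] using this

theorem continuousWithinAt_p3 (hF : ∀ i, ChartFields F (𝔄.chart i)) (hT : 0 < T) :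
    ContinuousWithinAt (fun t => F.p3 (γ t) (γ' t)) (Icc 0 T) s := by
  obtain ⟨i, hi⟩ := hγ.exists_chart hs
  have h1 := hγ.continuousWithinAt_vel hs 0 hi
  have h2 : ContinuousWithinAt (fun t => F.lapseSq (𝔄.chart i) ((𝔄.chart i).coord (γ t)))
      (Icc 0 T) s :=
    ((smooth_lapseSq (hF i)).diffAt (𝔄.chart i).isOpen_dom
      (SphereChart.coord_mem_dom hi)).continuousAt.comp_continuousWithinAt
      (f := fun t => (𝔄.chart i).coord (γ t)) (hγ.hasDeriv_coord hs hT hi).continuousWithinAt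
  exact (h2.mul h1).congr_of_eventuallyEq
    ((hγ.eventually_mem_range hs hi).mono fun t ht => p3_eq ht) (p3_eq hi)

theorem continuousWithinAt_radius (r₀ : ℝ) :
    ContinuousWithinAt (fun t => radius r₀ (γ t)) (Icc 0 T) s := by
  have h1 := (hγ s hs).2.1.continuousWithinAt
  unfold radius
  fun_prop

end Fields.IsGeodesic

end DoubleNull


namespace DoubleNull

/-! ### Uniform continuity of the changes of charts -/

namespace SphereChart

variable (κ : SphereChart)

/-- By injectivity on the closure, the distance of the images has a positive minimum on the compact
set of pairs at distance at least `ε`. -/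
theorem exists_inverse_modulus {ε : ℝ} (hε : 0 < ε) : ∃ ρ > 0, ∀ θ ∈ κ.U, ∀ η ∈ κ.U,
    dist (κ.Φ θ) (κ.Φ η) < ρ → dist θ η < ε := by
  have hcU : ContinuousOn κ.Φ (closure κ.U) := κ.smooth.continuousOn.mono κ.closure_subset
  set A : Set (Plane × Plane) := (closure κ.U ×ˢ closure κ.U) ∩ {p | ε ≤ dist p.1 p.2} with hA
  have hAc : IsCompact A := (κ.isCompact_closure.prod κ.isCompact_closure).inter_right
    (isClosed_le continuous_const (by fun_prop))
  have hf1 : ContinuousOn (fun p : Plane × Plane => κ.Φ p.1) A :=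
    hcU.comp continuousOn_fst fun p hp => hp.1.1
  have hf2 : ContinuousOn (fun p : Plane × Plane => κ.Φ p.2) A :=
    hcU.comp continuousOn_snd fun p hp => hp.1.2
  have hf : ContinuousOn (fun p : Plane × Plane => dist (κ.Φ p.1) (κ.Φ p.2)) A :=
    fun p hp => (hf1 p hp).dist (hf2 p hp)
  obtain ⟨ρ, hρ, h⟩ := hAc.exists_forall_le' (a := 0) hf fun p hp => by
    refine dist_pos.2 fun h => ?_
    have := κ.injOn (κ.closure_subset hp.1.1) (κ.closure_subset hp.1.2) h
    have h2 : ε ≤ dist p.1 p.2 := hp.2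
    rw [this, dist_self] at h2
    linarith
  refine ⟨ρ, hρ, fun θ hθ η hη hd => ?_⟩
  by_contra hn
  exact absurd (h (θ, η) ⟨⟨subset_closure hθ, subset_closure hη⟩, not_lt.1 hn⟩) (not_le.2 hd)

/-- The components in the chart `κ` of the coordinate vector fields of another chart. -/
noncomputable def transition (κ' : SphereChart) (η : Plane) (A B : Fin 2) : ℝ :=
  κ.tangentComp (κ.theta (κ'.Φ η)) (κ'.dPhi η B) A

/-- The coordinates in the two charts are treated as independent variables. The overlap of the
charts need not be compact, but the product of the two closures is, and it yields uniform bounds and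
moduli for the transition matrix. -/
theorem continuousOn_tangentComp_dPhi (κ' : SphereChart) (A B : Fin 2) :
    ContinuousOn (fun p : Plane × Plane => κ.tangentComp p.1 (κ'.dPhi p.2 B) A) (κ.N ×ˢ κ'.N) := by
  unfold tangentComp Matrix.mulVec dotProduct
  refine continuousOn_finsetSum _ fun E _ => ContinuousOn.mul ?_ ?_
  · exact (κ.contDiffOn_roundInv A E).continuousOn.comp continuousOn_fst fun p hp => hp.1
  · exact ((κ.contDiffOn_dPhi E).continuousOn.comp continuousOn_fst fun p hp => hp.1).inner
      ((κ'.contDiffOn_dPhi B).continuousOn.comp continuousOn_snd fun p hp => hp.2)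

theorem exists_transition_bound (κ' : SphereChart) : ∃ G, 0 ≤ G ∧ ∀ η ∈ κ'.U,
    κ'.Φ η ∈ κ.range → ∀ A B, |κ.transition κ' η A B| ≤ G := by
  have h : ∀ i : Fin 2 × Fin 2, ∃ G, ∀ p ∈ closure κ.U ×ˢ closure κ'.U,
      ‖κ.tangentComp p.1 (κ'.dPhi p.2 i.2) i.1‖ ≤ G := fun i =>
    (κ.isCompact_closure.prod κ'.isCompact_closure).exists_bound_of_continuousOn
      ((κ.continuousOn_tangentComp_dPhi κ' i.1 i.2).mono
        (prod_mono κ.closure_subset κ'.closure_subset))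
  choose G hG using h
  refine ⟨∑ i, |G i|, Finset.sum_nonneg fun i _ => abs_nonneg _, fun η hη hr A B => ?_⟩
  have h1 := hG (A, B) (κ.theta (κ'.Φ η), η) ⟨subset_closure (κ.theta_mem hr), subset_closure hη⟩
  exact h1.trans ((le_abs_self _).trans (Finset.single_le_sum (f := fun i => |G i|)
    (fun i _ => abs_nonneg _) (Finset.mem_univ (A, B))))

theorem exists_modulus {f : Plane → ℝ} (hf : ContinuousOn f κ.N) {ε : ℝ} (hε : 0 < ε) :
    ∃ ρ > 0, ∀ θ ∈ κ.U, ∀ η ∈ κ.U, dist θ η < ρ → |f θ - f η| ≤ ε := by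
  obtain ⟨ρ, hρ, h⟩ := Metric.uniformContinuousOn_iff.1
    (κ.isCompact_closure.uniformContinuousOn_of_continuous (hf.mono κ.closure_subset)) ε hε
  exact ⟨ρ, hρ, fun θ hθ η hη hd => (h θ (subset_closure hθ) η (subset_closure hη) hd).le⟩

theorem exists_transition_modulus (κ' : SphereChart) (A B : Fin 2) {ε : ℝ} (hε : 0 < ε) :
    ∃ ρ > 0, ∀ θ ∈ κ'.U, ∀ η ∈ κ'.U, κ'.Φ θ ∈ κ.range → κ'.Φ η ∈ κ.range → dist θ η < ρ →
      |κ.transition κ' θ A B - κ.transition κ' η A B| ≤ ε := by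
  obtain ⟨ρ₁, h1, hu⟩ := Metric.uniformContinuousOn_iff.1
    ((κ.isCompact_closure.prod κ'.isCompact_closure).uniformContinuousOn_of_continuous
      ((κ.continuousOn_tangentComp_dPhi κ' A B).mono
        (prod_mono κ.closure_subset κ'.closure_subset))) ε hε
  obtain ⟨ρ₂, h2, hi⟩ := κ.exists_inverse_modulus h1
  obtain ⟨ρ₃, h3, hΦ⟩ := Metric.uniformContinuousOn_iff.1
    (κ'.isCompact_closure.uniformContinuousOn_of_continuous
      (κ'.smooth.continuousOn.mono κ'.closure_subset)) ρ₂ h2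
  refine ⟨min ρ₁ ρ₃, lt_min h1 h3, fun θ hθ η hη hrθ hrη hd => ?_⟩
  have k1 := hΦ θ (subset_closure hθ) η (subset_closure hη) (hd.trans_le (min_le_right _ _))
  have k2 := hi _ (κ.theta_mem hrθ) _ (κ.theta_mem hrη) (by rwa [κ.phi_theta hrθ, κ.phi_theta hrη])
  refine (hu (κ.theta (κ'.Φ θ), θ) ⟨subset_closure (κ.theta_mem hrθ), subset_closure hθ⟩
    (κ.theta (κ'.Φ η), η) ⟨subset_closure (κ.theta_mem hrη), subset_closure hη⟩ ?_).le
  rw [Prod.dist_eq]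
  exact max_lt k2 (hd.trans_le (min_le_left _ _))

end SphereChart

/-- The components in another chart. -/
theorem Fields.pS_transition {F : Fields} {κ κ' : SphereChart} {w X : Event}
    (hw' : w.2.2 ∈ κ'.range) (hX : inner ℝ w.2.2 X.2.2 = 0)
    (hb : inner ℝ w.2.2 (F.b w) = 0) (A : Fin 2) :
    F.pS κ w X A = ∑ B, F.pS κ' w X B * κ.transition κ' (κ'.theta w.2.2) A B := by
  have hN := κ'.U_subset_N (κ'.theta_mem hw')
  have h1 : X.2.2 - X.2.1 • F.b w = ∑ B, F.pS κ' w X B • κ'.dPhi (κ'.theta w.2.2) B := by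
    refine (κ'.sum_tangentComp hN ?_).symm
    rw [κ'.phi_theta hw', inner_sub_right, inner_smul_right, hX, hb, mul_zero, sub_zero]
  unfold SphereChart.transition
  rw [κ'.phi_theta hw', pS, h1, Fin.sum_univ_two, κ.tangentComp_add, κ.tangentComp_smul,
    κ.tangentComp_smul, Fin.sum_univ_two]
  rfl

theorem Fields.IsGeodesic.inner_vel {F : Fields} {𝔄 : SphereAtlas} {u₀ u' v₀ v' T : ℝ}
    {γ γ' : ℝ → Event} (hγ : F.IsGeodesic 𝔄 u₀ u' v₀ v' T γ γ') {s : ℝ} (hs : s ∈ Icc 0 T)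
    (hT : 0 < T) : inner ℝ (γ s).2.2 (γ' s).2.2 = 0 := by
  have h1 := (hγ.hasDeriv_sphere hs).inner ℝ (hγ.hasDeriv_sphere hs)
  have h2 : HasDerivWithinAt (fun t => inner ℝ (γ t).2.2 (γ t).2.2) 0 (Icc 0 T) s := by
    refine (hasDerivWithinAt_const s (Icc 0 T) (1 : ℝ)).congr (fun t ht => ?_) ?_
    · rw [real_inner_self_eq_norm_sq, hγ.norm_eq ht, one_pow]
    · rw [real_inner_self_eq_norm_sq, hγ.norm_eq hs, one_pow]
  have h3 := (uniqueDiffOn_Icc hT s hs).eq_deriv _ h1 h2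
  rw [real_inner_comm (γ s).2.2 (γ' s).2.2] at h3
  linarith

/-! ### The continuity argument along a null geodesic -/

/-- A spacetime region in which the geometry is controlled. -/
structure Region (F : Fields) {𝔄 : SphereAtlas} (𝔎 : Cover 𝔄) (u₀ u' v₀ v' r₀ C K R : ℝ) : Prop where
  doubleNull : F.IsDoubleNull 𝔄 u₀ u' v₀ v'
  bound : ∀ u ∈ Icc u₀ u', ∀ v ∈ Icc v₀ v', ∀ j, ∀ θ ∈ Metric.cthickening 𝔎.ℓ (𝔎.K j),
    RegBound F (𝔄.chart j) r₀ C K (mkPt u v θ)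
  r_ge : R ≤ v₀ - u' + r₀

theorem exists_finite_modulus {ι : Type*} [Fintype ι] {Q : ι → ℝ → Prop}
    (hmono : ∀ i ρ ρ', ρ' ≤ ρ → Q i ρ → Q i ρ') (h : ∀ i, ∃ ρ > 0, Q i ρ) : ∃ ρ > 0, ∀ i, Q i ρ := by
  choose ρ h0 hQ using h
  by_cases hne : Nonempty ι
  · refine ⟨Finset.univ.inf' Finset.univ_nonempty ρ, (Finset.lt_inf'_iff _).2 fun i _ => h0 i,
      fun i => hmono i _ _ (Finset.inf'_le _ (Finset.mem_univ i)) (hQ i)⟩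
  · exact ⟨1, one_pos, fun i => (hne ⟨i⟩).elim⟩

/-- The initial bounds for the momentum of a geodesic. -/
def MomentumBound (F : Fields) (𝔄 : SphereAtlas) (r₀ C₃ : ℝ) (CA : Fin 2 → ℝ) (q : Event × Event) :
    Prop :=
  0 ≤ Fields.p4 q.2 ∧ 0 ≤ radius r₀ q.1 ^ 2 * F.p3 q.1 q.2 ∧
    radius r₀ q.1 ^ 2 * F.p3 q.1 q.2 ≤ C₃ * Fields.p4 q.2 ∧
    ∀ i, q.1.2.2 ∈ (𝔄.chart i).range → ∀ A,
      |radius r₀ q.1 ^ 2 * F.pS (𝔄.chart i) q.1 q.2 A| ≤ CA A * Fields.p4 q.2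

set_option maxHeartbeats 1000000 in
open Fields in
/-- Geodesics with nonzero initial momentum. -/
theorem exists_geodesic_bounds {𝔄 : SphereAtlas} (𝔎 : Cover 𝔄) {C K C₃ : ℝ} {CA : Fin 2 → ℝ}
    (hC : 1 ≤ C) (hK : 1 ≤ K) (h3 : 0 < C₃) (hA : ∀ A, 0 < CA A) :
    ∃ R, 1 ≤ R ∧ ∀ (F : Fields) (u₀ u' v₀ v' r₀ : ℝ), Region F 𝔎 u₀ u' v₀ v' r₀ C K R →
      ∀ (T : ℝ) (γ γ' : ℝ → Event), 0 < T → F.IsGeodesic 𝔄 u₀ u' v₀ v' T γ γ' →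
      (γ 0, γ' 0) ∈ F.massShell u₀ u' v₀ v' → MomentumBound F 𝔄 r₀ C₃ CA (γ 0, γ' 0) →
      0 < p4 (γ' 0) → ∃ j, ∀ s ∈ Icc 0 T, (γ s).2.2 ∈ (𝔄.chart j).range ∧
        1 / 2 * p4 (γ' 0) ≤ p4 (γ' s) ∧ p4 (γ' s) ≤ 3 / 2 * p4 (γ' 0) ∧
        0 ≤ radius r₀ (γ s) ^ 2 * F.p3 (γ s) (γ' s) ∧
        radius r₀ (γ s) ^ 2 * F.p3 (γ s) (γ' s) ≤ 2 * C₃ * p4 (γ' 0) ∧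
        (∀ i, (γ 0).2.2 ∈ (𝔄.chart i).range → (γ s).2.2 ∈ (𝔄.chart i).range → ∀ A,
          |radius r₀ (γ s) ^ 2 * F.pS (𝔄.chart i) (γ s) (γ' s) A| ≤ 2 * CA A * p4 (γ' 0)) ∧
        |(γ s).1 - (γ 0).1| ≤ 32 * C₃ / radius r₀ (γ 0) := by
  obtain ⟨k, hk1, hest⟩ := exists_geodesic_estimate hC hK h3
  choose G hG0 hG using fun p : Fin 2 × Fin 2 =>
    (𝔄.chart p.1).exists_transition_bound (𝔄.chart p.2)
  set Gs := ∑ p, G p with hGs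
  have hGs0 : 0 ≤ Gs := Finset.sum_nonneg fun p _ => hG0 p
  have hGle : ∀ p, G p ≤ Gs := fun p =>
    Finset.single_le_sum (fun p _ => hG0 p) (Finset.mem_univ p)
  set m := min C₃ (min (CA 0) (CA 1)) with hm
  have hm0 : 0 < m := lt_min h3 (lt_min (hA 0) (hA 1))
  have hm3 : m ≤ C₃ := min_le_left _ _
  have hmA : ∀ A, m ≤ CA A := Fin.forall_fin_two.2
    ⟨(min_le_right _ _).trans (min_le_left _ _), (min_le_right _ _).trans (min_le_right _ _)⟩
  -- The constant is chosen so that the total error in a momentum component, including the passage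
  -- to another chart with transition coefficients up to `Gs`, is at most `m P`, with `m` below each
  -- of the given constants.
  set ε := m / (8 * k * (1 + 2 * Gs)) with hε
  have hε0 : 0 < ε := by positivity
  have hεe : 8 * k * ε * (1 + 2 * Gs) = m := by rw [hε]; field_simp
  obtain ⟨ρ₁, hρ₁, hmod₁⟩ := exists_finite_modulus (ι := Fin 2 × Fin 2 × Fin 2)
    (Q := fun i ρ => ∀ θ ∈ (𝔄.chart i.1).U, ∀ η ∈ (𝔄.chart i.1).U, dist θ η < ρ →
      |((𝔄.chart i.1).round θ)⁻¹ i.2.1 i.2.2 - ((𝔄.chart i.1).round η)⁻¹ i.2.1 i.2.2| ≤ ε)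
    (fun i ρ ρ' hle h θ hθ η hη hd => h θ hθ η hη (hd.trans_le hle))
    (fun i => (𝔄.chart i.1).exists_modulus
      ((𝔄.chart i.1).contDiffOn_roundInv i.2.1 i.2.2).continuousOn hε0)
  obtain ⟨ρ₂, hρ₂, hmod₂⟩ := exists_finite_modulus (ι := Fin 2 × Fin 2 × Fin 2 × Fin 2)
    (Q := fun i ρ => ∀ θ ∈ (𝔄.chart i.2.1).U, ∀ η ∈ (𝔄.chart i.2.1).U,
      (𝔄.chart i.2.1).Φ θ ∈ (𝔄.chart i.1).range → (𝔄.chart i.2.1).Φ η ∈ (𝔄.chart i.1).range →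
      dist θ η < ρ →
      |(𝔄.chart i.1).transition (𝔄.chart i.2.1) θ i.2.2.1 i.2.2.2
        - (𝔄.chart i.1).transition (𝔄.chart i.2.1) η i.2.2.1 i.2.2.2| ≤ ε)
    (fun i ρ ρ' hle h θ hθ η hη h1 h2 hd => h θ hθ η hη h1 h2 (hd.trans_le hle))
    (fun i => (𝔄.chart i.1).exists_transition_modulus (𝔄.chart i.2.1) i.2.2.1 i.2.2.2 hε0)
  have hℓ := 𝔎.pos
  set d := min ε (min (1 / 4) (min 𝔎.ℓ (min ρ₁ ρ₂))) with hd
  have hd0 : 0 < d := lt_min hε0 (lt_min (by norm_num) (lt_min hℓ (lt_min hρ₁ hρ₂)))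
  have hdε : d ≤ ε := min_le_left _ _
  have hd' := min_le_right ε (min (1 / 4) (min 𝔎.ℓ (min ρ₁ ρ₂)))
  have hd4 : d ≤ 1 / 4 := hd'.trans (min_le_left _ _)
  have hdℓ : d ≤ 𝔎.ℓ := hd'.trans ((min_le_right _ _).trans (min_le_left _ _))
  have hd₁ : d ≤ ρ₁ :=
    hd'.trans ((min_le_right _ _).trans ((min_le_right _ _).trans (min_le_left _ _)))
  have hd₂ : d ≤ ρ₂ :=
    hd'.trans ((min_le_right _ _).trans ((min_le_right _ _).trans (min_le_right _ _)))
  -- Then the angles move by at most `kδ = d/2`, which keeps the geodesic strictly inside the ball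
  -- of radius `ℓ` and within both moduli of continuity.
  set δ := d / (2 * k) with hδ
  have hδ0 : 0 < δ := by positivity
  have hkδ : k * δ = d / 2 := by rw [hδ]; field_simp
  have hδd : δ ≤ d := by nlinarith
  have hδ1 : δ ≤ 1 := by linarith
  -- The term `1/δ²` provides `1 ≤ δ² r(0)`, and `12 C₃` provides the growth of `r`.
  refine ⟨1 + 1 / δ ^ 2 + 12 * C₃, by have : 0 < 1 / δ ^ 2 := by positivity
                                      linarith, ?_⟩
  intro F u₀ u' v₀ v' r₀ hreg T γ γ' hT hγ hq hmom hP
  set P := p4 (γ' 0) with hPdef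
  have h0T : (0 : ℝ) ∈ Icc 0 T := ⟨le_rfl, hT.le⟩
  have hF := hreg.doubleNull.chartFields
  have hδ2 : 0 < 1 / δ ^ 2 := by positivity
  have hrad : ∀ s ∈ Icc 0 T, 1 + 1 / δ ^ 2 + 12 * C₃ ≤ radius r₀ (γ s) := fun s hs => by
    have h1 := (hγ s hs).1
    have h2 := h1.1.2
    have h4 := h1.2.1.1
    have := hreg.r_ge
    unfold radius
    linarith
  obtain ⟨j, θ₀, hθ₀, hΦ₀⟩ := 𝔎.cover _ (hγ.norm_eq h0T)
  set κ := 𝔄.chart j with hκ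
  have hball : Metric.closedBall θ₀ 𝔎.ℓ ⊆ Metric.cthickening 𝔎.ℓ (𝔎.K j) :=
    Metric.closedBall_subset_cthickening hθ₀ _
  have hballU : Metric.closedBall θ₀ 𝔎.ℓ ⊆ κ.U :=
    hball.trans ((Metric.cthickening_mono (by linarith) _).trans (𝔎.thick j))
  have hθ₀U : θ₀ ∈ κ.U := hballU (Metric.mem_closedBall_self hℓ.le)
  have hr0 : (γ 0).2.2 ∈ κ.range := ⟨θ₀, hθ₀U, hΦ₀⟩
  have hth0 : κ.theta (γ 0).2.2 = θ₀ := by rw [← hΦ₀, κ.theta_phi hθ₀U]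
  -- The bounds to be improved. The closed ball is centred at the initial point, which lies in a
  -- compact core, so membership also keeps the geodesic where the geometry is controlled. The
  -- bounds for `r²p^A` and the lower bound for `p³` are conclusions and need no place here.
  set Gd : Set ℝ := {t | (γ t).2.2 ∈ κ.Φ '' Metric.closedBall θ₀ 𝔎.ℓ ∧ P / 2 ≤ p4 (γ' t) ∧
    p4 (γ' t) ≤ 2 * P ∧ radius r₀ (γ t) ^ 2 * F.p3 (γ t) (γ' t) ≤ 2 * C₃ * P} with hGd
  have hGrange : ∀ t ∈ Gd, (γ t).2.2 ∈ κ.range ∧ κ.theta (γ t).2.2 ∈ Metric.closedBall θ₀ 𝔎.ℓ := by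
    rintro t ⟨⟨η, hη, hηx⟩, -⟩
    refine ⟨⟨η, hballU hη, hηx⟩, ?_⟩
    rwa [← hηx, κ.theta_phi (hballU hη)]
  have main : ∀ s ∈ Icc 0 T, Icc 0 s ⊆ Gd →
      dist (κ.theta (γ s).2.2) θ₀ < 𝔎.ℓ ∧ |p4 (γ' s) - P| ≤ P / 4 ∧
      0 ≤ radius r₀ (γ s) ^ 2 * F.p3 (γ s) (γ' s) ∧
      radius r₀ (γ s) ^ 2 * F.p3 (γ s) (γ' s) < 2 * C₃ * P ∧
      (∀ i, (γ 0).2.2 ∈ (𝔄.chart i).range → (γ s).2.2 ∈ (𝔄.chart i).range → ∀ A,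
          |radius r₀ (γ s) ^ 2 * F.pS (𝔄.chart i) (γ s) (γ' s) A| ≤ 2 * CA A * P) ∧
        |(γ s).1 - (γ 0).1| ≤ 32 * C₃ / radius r₀ (γ 0) := by
    intro s hs hsG
    have hs0 : s ∈ Icc 0 s := ⟨hs.1, le_rfl⟩
    have h00 : (0 : ℝ) ∈ Icc 0 s := ⟨le_rfl, hs.1⟩
    have hsub : ∀ t ∈ Icc 0 s, t ∈ Icc 0 T := fun t ht => ⟨ht.1, ht.2.trans hs.2⟩
    have hra : ∀ t ∈ Icc 0 s, (γ t).2.2 ∈ κ.range := fun t ht => (hGrange t (hsG ht)).1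
    have hctrl : ControlledGeodesic F κ r₀ C K C₃ P s (fun t => κ.coord (γ t))
        (fun t => κ.coordVel (γ t) (γ' t)) :=
      { toChartGeodesic := hγ.chartGeodesic hs hT hra
        fields := hF j
        bound := fun t ht => by
          have h1 := (hγ t (hsub t ht)).1
          exact hreg.bound _ h1.1 _ h1.2.1 j _ (hball (hGrange t (hsG ht)).2)
        large := fun t ht => by
          have h1 := hrad t (hsub t ht)
          rw [← radius_eq]
          have h2 := hδ2
          refine le_trans (by linarith) (le_self_pow₀ (by linarith) two_ne_zero)
        null := by
          rw [← g_eq (hF j) hr0 (hγ.inner_vel h0T hT)]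
          exact hq.2.2.1
        mom_pos := hP
        initial := p4_eq.symm
        four_ge := fun t ht => by
          rw [← p4_eq]
          exact (hsG ht).2.1
        four_le := fun t ht => by
          rw [← p4_eq]
          exact (hsG ht).2.2.1
        three_le := fun t ht => by
          rw [← p3_eq (hra t ht), ← radius_eq]
          exact (hsG ht).2.2.2 }
    have hr0le := hrad 0 h0T
    have hr0pos : 0 < radius r₀ (γ 0) := by linarith
    obtain ⟨e1, e2, e3, e4⟩ := hest F κ r₀ P s δ _ _ hctrl hδ0.le (by
      rw [← radius_eq]
      have h1 : 1 / δ ^ 2 ≤ radius r₀ (γ 0) := by linarith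
      rwa [div_le_iff₀ (by positivity), mul_comm] at h1) hδ1 s hs0
    have e5 := hctrl.three_nonneg hs0
    have e6 := hctrl.u_sub_le h3 hs0
    have e2' : dist (κ.theta (γ s).2.2) θ₀ ≤ d / 2 := by
      rw [dist_pi_le_iff (by linarith)]
      intro A
      rw [Real.dist_eq, ← hth0, ← hkδ]
      simpa only [SphereChart.coord, ang_mkPt] using e2 A
    have e2d : dist (κ.theta (γ s).2.2) θ₀ < d := by linarith
    have hsr := hra s hs0
    have hsU := κ.theta_mem hsr
    obtain ⟨e7, e8⟩ := e4 ε hε0.le fun A B => by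
      simp only [SphereChart.coord, ang_mkPt, hth0]
      exact hmod₁ (j, A, B) _ hsU _ hθ₀U (e2d.trans_le hd₁)
    simp only [← radius_eq, ← p3_eq hsr, ← p3_eq hr0, ← p4_eq, ← pS_eq hsr, ← pS_eq hr0]
      at e1 e3 e5 e7 e8
    have hkε : k * (δ + ε) ≤ 2 * (k * ε) := by
      linarith [mul_le_mul_of_nonneg_left (hδd.trans hdε) (zero_le_one.trans hk1)]
    have hk0 : 0 < k * ε := by positivity
    have hkm : 8 * (k * ε) ≤ m := by linarith [mul_nonneg hk0.le hGs0]
    have e1' : |p4 (γ' s) - P| ≤ P / 4 := e1.trans (by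
      rw [hkδ]
      linarith [mul_le_mul_of_nonneg_right hd4 hP.le])
    have e1a := abs_le.1 e1'
    have e8a := (abs_le.1 e8).2
    have hth := hmom.2.2.1
    simp only [] at hth
    refine ⟨e2d.trans_le hdℓ, e1', by positivity, ?_, fun i hi0 his A => ?_, ?_⟩
    · set q := radius r₀ (γ s) ^ 2 * F.p3 (γ s) (γ' s) with hqd
      -- Almost conservation gives `r²p³ · p⁴ ≤ (1 + 1/4) C₃ P²`, whereas failure of the bound would
      -- give at least `2 · (3/4) C₃ P²`, because `p⁴ ≥ (3/4) P`.
      by_contra hcon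
      have h1 : 2 * C₃ * P * (3 / 4 * P) ≤ q * p4 (γ' s) :=
        mul_le_mul (not_lt.1 hcon) (by linarith) (by positivity)
          ((by positivity : (0 : ℝ) ≤ 2 * C₃ * P).trans (not_lt.1 hcon))
      have h2 : radius r₀ (γ 0) ^ 2 * F.p3 (γ 0) (γ' 0) * P ≤ C₃ * P * P :=
        mul_le_mul_of_nonneg_right hth hP.le
      have h4 : k * (δ + ε) * P ^ 2 ≤ C₃ / 4 * P ^ 2 :=
        mul_le_mul_of_nonneg_right (by linarith) (by positivity)
      have h5 : 0 < C₃ * P ^ 2 := by positivity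
      linarith [show 2 * C₃ * P * (3 / 4 * P) = 3 / 2 * (C₃ * P ^ 2) by ring,
        show C₃ * P * P = C₃ * P ^ 2 by ring, show C₃ / 4 * P ^ 2 = 1 / 4 * (C₃ * P ^ 2) by ring]
    · have hb := fun t ht => hreg.doubleNull.shift_tangent (γ t) (hγ.norm_eq (s := t) ht)
      have hpi := hmom.2.2.2 i hi0 A
      simp only [] at hpi
      rw [pS_transition hr0 (hγ.inner_vel h0T hT) (hb 0 h0T), Finset.mul_sum] at hpi
      rw [pS_transition hsr (hγ.inner_vel hs hT) (hb s hs), Finset.mul_sum]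
      -- The components in chart `i` are products of the almost constant components in the working
      -- chart with transition coefficients that vary by at most `ε`. Only the initial and the
      -- present point have to lie in chart `i`.
      have hdiff : |∑ B, radius r₀ (γ s) ^ 2 * (F.pS κ (γ s) (γ' s) B *
            (𝔄.chart i).transition κ (κ.theta (γ s).2.2) A B)
          - ∑ B, radius r₀ (γ 0) ^ 2 * (F.pS κ (γ 0) (γ' 0) B *
            (𝔄.chart i).transition κ (κ.theta (γ 0).2.2) A B)| ≤
          2 * (k * P * ε + k * (δ + ε) * P * Gs) := by
        rw [← Finset.sum_sub_distrib]
        refine abs_sum_two_le fun B => ?_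
        rw [← mul_assoc, ← mul_assoc]
        refine abs_mul_sub_mul_le (e3 B) ?_ (e7 B) ?_
        · rw [hth0]
          exact (hG (i, j) θ₀ hθ₀U (by rw [← hκ, hΦ₀]; exact hi0) A B).trans (hGle _)
        · rw [hth0]
          exact hmod₂ (i, j, A, B) _ hsU _ hθ₀U (by rw [← hκ, κ.phi_theta hsr]; exact his)
            (by rw [← hκ, hΦ₀]; exact hi0) (e2d.trans_le hd₂)
      have h5 : 2 * (k * P * ε + k * (δ + ε) * P * Gs) ≤ m * P := by
        have h6 : k * (δ + ε) * P * Gs ≤ 2 * (k * ε) * P * Gs := by gcongr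
        have h7 : 8 * (k * ε) * (1 + 2 * Gs) * P = m * P := by rw [← hεe]; ring
        have h8 : 0 ≤ k * ε * P := by positivity
        have h9 : 0 ≤ k * ε * P * Gs := by positivity
        linarith [show 8 * (k * ε) * (1 + 2 * Gs) * P = 8 * (k * ε * P) + 16 * (k * ε * P * Gs) by
          ring, show k * P * ε = k * ε * P by ring,
          show 2 * (k * ε) * P * Gs = 2 * (k * ε * P * Gs) by ring]
      have h6 : m * P ≤ CA A * P := mul_le_mul_of_nonneg_right (hmA A) hP.le
      have h7 := abs_sub_abs_le_abs_sub
        (∑ B, radius r₀ (γ s) ^ 2 * (F.pS κ (γ s) (γ' s) B *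
            (𝔄.chart i).transition κ (κ.theta (γ s).2.2) A B))
        (∑ B, radius r₀ (γ 0) ^ 2 * (F.pS κ (γ 0) (γ' 0) B *
            (𝔄.chart i).transition κ (κ.theta (γ 0).2.2) A B))
      linarith
    · simp only [SphereChart.coord, mkPt_zero] at e6
      exact e6.trans (div_le_div_of_nonneg_right (by linarith) hr0pos.le)
  have hr0t := hmom.2.2.1
  have hall : Icc 0 T ⊆ Gd := by
    have hc4 := fun s (hs : s ∈ Icc 0 T) => hγ.continuousWithinAt_p4 hs
    have hcr := fun s (hs : s ∈ Icc 0 T) => ((hγ.continuousWithinAt_radius hs r₀).pow 2).mul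
      (hγ.continuousWithinAt_p3 hs hF hT)
    have hcx := fun s (hs : s ∈ Icc 0 T) => (hγ.hasDeriv_sphere hs).continuousWithinAt
    refine continuity_induction ?_ ?_ fun s hs hsG => ?_
    · have hcl : IsClosed (κ.Φ '' Metric.closedBall θ₀ 𝔎.ℓ) :=
        ((isCompact_closedBall θ₀ 𝔎.ℓ).image_of_continuousOn (κ.smooth.continuousOn.mono
          (hballU.trans κ.U_subset_N))).isClosed
      have e : Gd ∩ Icc 0 T = (((Icc 0 T ∩ {t | (γ t).2.2 ∈ κ.Φ '' Metric.closedBall θ₀ 𝔎.ℓ}) ∩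
          (Icc 0 T ∩ {t | p4 (γ' t) ∈ Icc (P / 2) (2 * P)})) ∩
          (Icc 0 T ∩ {t | radius r₀ (γ t) ^ 2 * F.p3 (γ t) (γ' t) ∈ Iic (2 * C₃ * P)})) := by
        ext t
        simp only [hGd, mem_inter_iff, mem_ofPred_eq, mem_Icc, mem_Iic]
        tauto
      rw [e]
      exact ((ContinuousOn.preimage_isClosed_of_isClosed hcx isClosed_Icc hcl).inter
        (ContinuousOn.preimage_isClosed_of_isClosed hc4 isClosed_Icc isClosed_Icc)).inter
        (ContinuousOn.preimage_isClosed_of_isClosed hcr isClosed_Icc isClosed_Iic)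
    · refine ⟨⟨θ₀, Metric.mem_closedBall_self hℓ.le, hΦ₀⟩, by linarith, by linarith, ?_⟩
      have : 0 < C₃ * P := by positivity
      linarith
    · obtain ⟨m1, m2, -, m4, -⟩ := main s hs hsG
      have m2' := abs_le.1 m2
      have hsr := (hGrange s (hsG ⟨hs.1, le_rfl⟩)).1
      have hθc : ContinuousWithinAt (fun t => κ.theta (γ t).2.2) (Icc 0 T) s := by
        have h1 := (hγ.hasDeriv_coord hs hT hsr).continuousWithinAt
        rw [continuousWithinAt_pi] at h1 ⊢
        intro A
        have h2 := h1 (sph A)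
        simpa only [SphereChart.coord, mkPt_sph] using h2
      filter_upwards [(hθc.dist continuousWithinAt_const).eventually (gt_mem_nhds m1),
        (hc4 s hs).eventually (lt_mem_nhds (show P / 2 < p4 (γ' s) by linarith)),
        (hc4 s hs).eventually (gt_mem_nhds (show p4 (γ' s) < 2 * P by linarith)),
        (hcr s hs).eventually (gt_mem_nhds m4), hγ.eventually_mem_range hs hsr]
        with t t1 t2 t3 t4 t5
      exact ⟨⟨_, Metric.mem_closedBall.2 t1.le, κ.phi_theta t5⟩, t2.le, t3.le, t4.le⟩
  refine ⟨j, fun s hs => ?_⟩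
  obtain ⟨m1, m2, m3, m4, m5, m6⟩ := main s hs fun t ht => hall ⟨ht.1, ht.2.trans hs.2⟩
  have m2' := abs_le.1 m2
  exact ⟨(hGrange s (hall hs)).1, by linarith [m2'.1], by linarith [m2'.2], m3, m4.le, m5, m6⟩

end DoubleNull


namespace DoubleNull

/-! ### Covariance of the geodesic equation -/

theorem Fields.IsDoubleNull.pd_gsMat {F : Fields} {𝔄 : SphereAtlas} {u₀ u' v₀ v' : ℝ}
    (hF : F.IsDoubleNull 𝔄 u₀ u' v₀ v') {i : Fin 2} {c : Pt} (hc : c ∈ (𝔄.chart i).dom)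
    (hw : (𝔄.chart i).place c ∈ rect u₀ u' v₀ v') : PD (F.gsMat (𝔄.chart i) c) where
  symm := (hF.chartFields i).symm c hc
  pos a ha := by
    set κ := 𝔄.chart i
    have hN : ang c ∈ κ.N := κ.U_subset_N hc
    have h1 := hF.gs_pos _ hw (∑ A, a A • κ.dPhi (ang c) A) (by
      simp only [inner_sum, inner_smul_right]
      exact Finset.sum_eq_zero fun A _ => by
        rw [show (κ.place c).2.2 = κ.Φ (ang c) from rfl, κ.inner_phi_dPhi hN, mul_zero]) fun h0 => ha (by
      rw [← κ.tangentComp_sum hN a, h0]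
      ext A
      simp [SphereChart.tangentComp, Matrix.mulVec, dotProduct])
    refine h1.trans_eq ?_
    simp only [Fin.sum_univ_two, map_add, map_smul, LinearMap.add_apply, LinearMap.smul_apply,
      smul_eq_mul, gsMat, Matrix.of_apply]
    ring

theorem Fields.IsDoubleNull.mem_reg {F : Fields} {𝔄 : SphereAtlas} {u₀ u' v₀ v' r₀ : ℝ}
    (hF : F.IsDoubleNull 𝔄 u₀ u' v₀ v') {i : Fin 2} {c : Pt} (hc : c ∈ (𝔄.chart i).dom)
    (hw : (𝔄.chart i).place c ∈ rect u₀ u' v₀ v') (hr : rad r₀ c ≠ 0) :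
    c ∈ F.reg (𝔄.chart i) r₀ :=
  ⟨hc, (hF.lapse_pos _ hw).ne', (hF.pd_gsMat hc hw).det_pos.ne', hr⟩

namespace SphereChart

variable {κ κ' : SphereChart}

theorem place_mem_range {c : Pt} (hc : c ∈ κ.dom) : (κ.place c).2.2 ∈ κ.range := ⟨ang c, hc, rfl⟩

theorem norm_place {c : Pt} (hc : c ∈ κ.dom) : ‖(κ.place c).2.2‖ = 1 :=
  κ.mem_sphere _ (κ.U_subset_N hc)

theorem coord_place {c : Pt} (hc : c ∈ κ.dom) : κ.coord (κ.place c) = c := by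
  unfold coord place
  simp only []
  rw [κ.theta_phi hc, mkPt_ang]

theorem coordVel_sum {c : Pt} (hc : c ∈ κ.dom) (X : Pt) :
    κ.coordVel (κ.place c) (∑ μ, X μ • κ.dPlace c μ) = X := by
  rw [sum_smul_dPlace]
  unfold coordVel place
  simp only []
  rw [κ.theta_phi hc, κ.tangentComp_sum (κ.U_subset_N hc)]
  ext μ
  fin_cases μ <;> simp [mkPt, sph]

theorem inner_sum_dPlace {c : Pt} (hc : c ∈ κ.dom) (X : Pt) :
    inner ℝ (κ.place c).2.2 (∑ μ, X μ • κ.dPlace c μ).2.2 = 0 := by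
  rw [sum_smul_dPlace]
  simp only [inner_sum, inner_smul_right]
  exact Finset.sum_eq_zero fun A _ => by
    rw [show (κ.place c).2.2 = κ.Φ (ang c) from rfl, κ.inner_phi_dPhi (κ.U_subset_N hc), mul_zero]

theorem hasDerivWithinAt_place {I : Set ℝ} {c : ℝ → Pt} {X : Pt} {s : ℝ} (hc : c s ∈ κ.dom)
    (h : HasDerivWithinAt c X I s) :
    HasDerivWithinAt (fun t => κ.place (c t)) (∑ μ, X μ • κ.dPlace (c s) μ) I s := by
  have hμ := fun μ => hasDerivWithinAt_pi.1 h μ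
  have ha : HasDerivWithinAt (fun t => ang (c t)) (ang X) I s := by
    rw [hasDerivWithinAt_pi]
    intro A
    simp only [ang_apply]
    exact hμ _
  have hp := (κ.hasFDerivAt_phi (κ.U_subset_N hc)).comp_hasDerivWithinAt s ha
  rw [κ.fderiv_phi_apply] at hp
  rw [sum_smul_dPlace]
  simp only [ang_apply] at hp
  exact (hμ 0).prodMk ((hμ 1).prodMk hp)

theorem hasDerivWithinAt_add_smul (c X : Pt) :
    HasDerivWithinAt (fun t : ℝ => c + t • X) X univ 0 := by
  have := (((hasDerivAt_id (0 : ℝ)).smul_const X).const_add c).hasDerivWithinAt (s := univ)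
  rwa [one_smul] at this

theorem tendsto_add_smul (c X : Pt) :
    Filter.Tendsto (fun t : ℝ => c + t • X) (nhdsWithin 0 univ) (nhds c) := by
  simpa [ContinuousWithinAt] using (hasDerivWithinAt_add_smul c X).continuousWithinAt

theorem hasDerivWithinAt_comp_add_smul {E : Type*} [NormedAddCommGroup E] [NormedSpace ℝ E]
    {f : Pt → E} {f' : Pt →L[ℝ] E} {c : Pt} (hf : HasFDerivAt f f' c) (X : Pt) :
    HasDerivWithinAt (fun t : ℝ => f (c + t • X)) (f' X) univ 0 :=
  HasFDerivAt.comp_hasDerivWithinAt (f := fun t : ℝ => c + t • X) 0 (by simpa using hf)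
    (hasDerivWithinAt_add_smul c X)

/-- The change of coordinates between two charts. -/
theorem exists_transition_map {c₀ : Pt} (hc : c₀ ∈ κ'.dom) (hr : (κ'.place c₀).2.2 ∈ κ.range) :
    ∃ ψ : Pt → Pt, ContDiffAt ℝ ∞ ψ c₀ ∧ ∀ᶠ c in nhds c₀, c ∈ κ'.dom ∧ ψ c ∈ κ.dom ∧
      κ.place (ψ c) = κ'.place c ∧
      ∀ X : Pt, ∑ μ, (fderiv ℝ ψ c X) μ • κ.dPlace (ψ c) μ = ∑ μ, X μ • κ'.dPlace c μ := by
  obtain ⟨φ, hφ, hev⟩ := κ.exists_theta_extension hr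
  have hN : ang c₀ ∈ κ'.N := κ'.U_subset_N hc
  have hang : ContDiff ℝ ∞ ang := by
    rw [contDiff_pi]
    intro A
    simp only [ang_apply]
    fun_prop
  have hΦ : ContDiffAt ℝ ∞ (fun c => κ'.Φ (ang c)) c₀ :=
    (κ'.contDiffAt_phi hN).comp c₀ hang.contDiffAt
  set ψ : Pt → Pt := fun c => mkPt (c 0) (c 1) (φ (κ'.Φ (ang c))) with hψ
  have hψs : ContDiffAt ℝ ∞ ψ c₀ := by
    have h1 : ContDiffAt ℝ ∞ (fun c => φ (κ'.Φ (ang c))) c₀ := hφ.comp c₀ hΦ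
    rw [contDiffAt_pi] at h1 ⊢
    intro μ
    fin_cases μ
    · exact contDiffAt_apply (n := ∞) ℝ ℝ (0 : Fin 4) c₀
    · exact contDiffAt_apply (n := ∞) ℝ ℝ (1 : Fin 4) c₀
    · exact h1 0
    · exact h1 1
  have hbase : ∀ᶠ c in nhds c₀, c ∈ κ'.dom ∧ ψ c ∈ κ.dom ∧ κ.place (ψ c) = κ'.place c := by
    filter_upwards [κ'.isOpen_dom.mem_nhds hc, hΦ.continuousAt.eventually hev] with c h1 h2
    obtain ⟨h3, h4⟩ := h2 (norm_place h1)
    have h5 : ang (ψ c) = κ.theta (κ'.Φ (ang c)) := by rw [hψ, ang_mkPt, h3]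
    refine ⟨h1, ?_, ?_⟩
    · change ang (ψ c) ∈ κ.U
      rw [h5]
      exact κ.theta_mem h4
    · unfold place
      rw [h5, κ.phi_theta h4]
      simp only [hψ, mkPt_zero, mkPt_one]
  have hd : ∀ᶠ c in nhds c₀, ContDiffAt ℝ 1 ψ c := (hψs.of_le (by simp)).eventually (by simp)
  refine ⟨ψ, hψs, ?_⟩
  filter_upwards [hbase, hbase.eventually_nhds, hd] with c h1 h2 h3
  refine ⟨h1.1, h1.2.1, h1.2.2, fun X => ?_⟩
  have hl := hasDerivWithinAt_add_smul c X
  have e0 : c + (0 : ℝ) • X = c := by simp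
  have k1 := hasDerivWithinAt_place (κ := κ') (c := fun t : ℝ => c + t • X) (s := 0)
    (by simpa using h1.1) hl
  have hl1 := hasDerivWithinAt_comp_add_smul (h3.differentiableAt (by simp)).hasFDerivAt X
  have k2 := hasDerivWithinAt_place (κ := κ) (c := fun t : ℝ => ψ (c + t • X)) (s := 0)
    (by simpa using h1.2.1) hl1
  have k3 : (fun t : ℝ => κ.place (ψ (c + t • X))) =ᶠ[nhdsWithin 0 univ]
      fun t => κ'.place (c + t • X) :=
    ((tendsto_add_smul c X).eventually h2).mono fun t ht => ht.2.2
  have k4 := uniqueDiffWithinAt_univ.eq_deriv _ (k2.congr_of_eventuallyEq k3.symm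
    (by simpa using h1.2.2.symm)) k1
  simpa only [zero_smul, add_zero] using k4

end SphereChart

namespace Fields

variable {F : Fields} {κ : SphereChart}

theorem hasDerivWithinAt_ip_comp (hF : ChartFields F κ) {I : Set ℝ} {c X Y : ℝ → Pt}
    {c' X' Y' : Pt} {s : ℝ} (hc : c s ∈ κ.dom) (h : HasDerivWithinAt c c' I s)
    (hX : HasDerivWithinAt X X' I s) (hY : HasDerivWithinAt Y Y' I s) :
    HasDerivWithinAt (fun t => F.ip κ (c t) (X t) (Y t))
      (∑ α, c' α * F.dG κ (c s) α (X s) (Y s) + F.ip κ (c s) X' (Y s) + F.ip κ (c s) (X s) Y') I s := by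
  have h1 : ∀ μ ν, HasDerivWithinAt (fun t => F.gMat κ (c t) μ ν * X t μ * Y t ν) _ I s := fun μ ν =>
    ((hasDerivWithinAt_comp_pd ((smooth_gMat hF μ ν).diffAt κ.isOpen_dom hc) h).mul
      (hasDerivWithinAt_pi.1 hX μ)).mul (hasDerivWithinAt_pi.1 hY ν)
  unfold ip
  refine (HasDerivWithinAt.fun_sum fun μ _ => HasDerivWithinAt.fun_sum fun ν _ => h1 μ ν).congr_deriv ?_
  have h2 : ∑ α, c' α * F.dG κ (c s) α (X s) (Y s) = ∑ μ, ∑ ν,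
      (∑ α, c' α * pd α (fun y => F.gMat κ y μ ν) (c s)) * X s μ * Y s ν := by
    unfold dG
    simp only [Finset.mul_sum, Finset.sum_mul]
    rw [Finset.sum_comm]
    refine Finset.sum_congr rfl fun μ _ => ?_
    rw [Finset.sum_comm]
    exact Finset.sum_congr rfl fun ν _ => Finset.sum_congr rfl fun α _ => by ring
  rw [h2]
  simp only [← Finset.sum_add_distrib]
  exact Finset.sum_congr rfl fun μ _ => Finset.sum_congr rfl fun ν _ => by
    rw [Pi.mul_apply]
    ring

theorem ip_symm (hF : ChartFields F κ) {c : Pt} (hc : c ∈ κ.dom) (X Y : Pt) :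
    F.ip κ c X Y = F.ip κ c Y X := by
  unfold ip
  rw [Finset.sum_comm]
  exact Finset.sum_congr rfl fun μ _ => Finset.sum_congr rfl fun ν _ => by
    rw [gMat_symm hF hc]
    ring

theorem eq_zero_of_ip_eq_zero (hF : ChartFields F κ) {r₀ : ℝ} {c : Pt} (hc : c ∈ F.reg κ r₀) {X : Pt}
    (h : ∀ Y, F.ip κ c X Y = 0) : X = 0 := by
  refine Matrix.eq_zero_of_vecMul_eq_zero (det_gMat_ne hF hc) ?_
  ext ν
  have h1 := h (Pi.single ν 1)
  simp only [ip, Pi.single_apply, mul_ite, mul_one, mul_zero, Finset.sum_ite_eq', Finset.mem_univ,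
    if_true] at h1
  simp only [Matrix.vecMul, dotProduct, Pi.zero_apply]
  rw [← h1]
  exact Finset.sum_congr rfl fun μ _ => mul_comm _ _

end Fields

namespace ChartGeodesic

open Fields

variable {F : Fields} {κ κ' : SphereChart} {I : Set ℝ} {c ξ : ℝ → Pt}

set_option maxHeartbeats 400000 in
/-- The geodesic equation holds in every chart if it holds in one. -/
theorem change_chart (hγ : ChartGeodesic F κ' I c ξ) (hF' : ChartFields F κ') (hF : ChartFields F κ)
    {r₀ s : ℝ} (hs : s ∈ I) (hI : UniqueDiffWithinAt ℝ I s) (hc : c s ∈ F.reg κ' r₀)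
    (hr : (κ'.place (c s)).2.2 ∈ κ.range) (hreg : κ.coord (κ'.place (c s)) ∈ F.reg κ r₀) :
    HasDerivWithinAt (fun t => κ.coordVel (κ'.place (c t)) (∑ μ, ξ t μ • κ'.dPlace (c t) μ))
      (fun μ => -∑ α, ∑ β, F.chr4 κ (κ.coord (κ'.place (c s))) μ α β *
        κ.coordVel (κ'.place (c s)) (∑ μ, ξ s μ • κ'.dPlace (c s) μ) α *
        κ.coordVel (κ'.place (c s)) (∑ μ, ξ s μ • κ'.dPlace (c s) μ) β) I s := by
  obtain ⟨ψ, hψ, hev⟩ := SphereChart.exists_transition_map hc.1 hr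
  obtain ⟨-, hd, hp, hD⟩ := hev.self_of_nhds
  have hcoord : ∀ y, ψ y ∈ κ.dom → κ.place (ψ y) = κ'.place y → κ.coord (κ'.place y) = ψ y :=
    fun y h1 h2 => by rw [← h2, SphereChart.coord_place h1]
  have hvel : ∀ y, ψ y ∈ κ.dom → κ.place (ψ y) = κ'.place y →
      (∀ X : Pt, ∑ μ, (fderiv ℝ ψ y X) μ • κ.dPlace (ψ y) μ = ∑ μ, X μ • κ'.dPlace y μ) → ∀ X : Pt,
      κ.coordVel (κ'.place y) (∑ μ, X μ • κ'.dPlace y μ) = fderiv ℝ ψ y X := fun y h1 h2 h3 X => by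
    rw [← h3, ← h2, SphereChart.coordVel_sum h1]
  have hip : ∀ y, y ∈ κ'.dom ∧ ψ y ∈ κ.dom ∧ κ.place (ψ y) = κ'.place y ∧
      (∀ X : Pt, ∑ μ, (fderiv ℝ ψ y X) μ • κ.dPlace (ψ y) μ = ∑ μ, X μ • κ'.dPlace y μ) → ∀ X Y : Pt,
      F.ip κ (ψ y) (fderiv ℝ ψ y X) (fderiv ℝ ψ y Y) = F.ip κ' y X Y := fun y h X Y => by
    rw [ip_eq hF h.2.1, ← g_frame hF h.2.1, h.2.2.1, h.2.2.2, h.2.2.2, g_frame hF' h.1, ip_eq hF' h.1]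
  rw [hcoord _ hd hp] at hreg ⊢
  rw [hvel _ hd hp hD]
  set ζ : ℝ → Pt := fun t => fderiv ℝ ψ (c t) (ξ t) with hζ
  have hevI : ∀ᶠ t in nhdsWithin s I, _ := (hγ.pos s hs).continuousWithinAt.eventually hev
  have hψ1 : HasFDerivAt ψ (fderiv ℝ ψ (c s)) (c s) := (hψ.differentiableAt (by simp)).hasFDerivAt
  have hψ2 : HasFDerivAt (fderiv ℝ ψ) (fderiv ℝ (fderiv ℝ ψ) (c s)) (c s) :=
    ((hψ.fderiv_right (m := 1) (by norm_cast)).differentiableAt (by simp)).hasFDerivAt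
  have hsymm : ∀ X Y, fderiv ℝ (fderiv ℝ ψ) (c s) X Y = fderiv ℝ (fderiv ℝ ψ) (c s) Y X :=
    fun X Y => (hψ.isSymmSndFDerivAt (by simpa using (WithTop.coe_le_coe.2 le_top : ((2 : ℕ∞) : WithTop ℕ∞) ≤ ((⊤ : ℕ∞) : WithTop ℕ∞)))) X Y
  have hDc : HasDerivWithinAt (fun t => fderiv ℝ ψ (c t)) (fderiv ℝ (fderiv ℝ ψ) (c s) (ξ s)) I s :=
    hψ2.comp_hasDerivWithinAt s (hγ.pos s hs)
  have hζd : HasDerivWithinAt ζ _ I s := hDc.clm_apply (hγ.vel s hs)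
  set a := fderiv ℝ (fderiv ℝ ψ) (c s) (ξ s) (ξ s) + fderiv ℝ ψ (c s)
    (fun μ => -∑ α, ∑ β, F.chr4 κ' (c s) μ α β * ξ s α * ξ s β) with ha
  refine (hζd.congr_of_eventuallyEq (hevI.mono fun t ht => hvel _ ht.2.1 ht.2.2.1 ht.2.2.2 _)
    (hvel _ hd hp hD _)).congr_deriv ?_
  have hz : ∀ X, F.ip κ' (c s) X 0 = 0 := fun X => by simp [ip]
  have hz' : ∀ X, F.ip κ' (c s) 0 X = 0 := fun X => by simp [ip]
  -- The transformation law of the Christoffel symbols is avoided. The change of coordinates is an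
  -- isometry, so the Euler–Lagrange equation in the first chart computes the derivative of `g(ζ, Dψ
  -- Z)` along the curve, and hence the product of the acceleration with `Dψ Z`.
  have key : ∀ Z : Pt, F.ip κ (ψ (c s)) a (fderiv ℝ ψ (c s) Z) =
      1 / 2 * ∑ α, fderiv ℝ ψ (c s) Z α * F.dG κ (ψ (c s)) α (ζ s) (ζ s)
        - ∑ α, ζ s α * F.dG κ (ψ (c s)) α (ζ s) (fderiv ℝ ψ (c s) Z) := fun Z => by
    have k1 : HasDerivWithinAt (fun t => F.ip κ (ψ (c t)) (ζ t) (fderiv ℝ ψ (c t) Z)) _ I s :=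
      hasDerivWithinAt_ip_comp hF hd (hψ1.comp_hasDerivWithinAt s (hγ.pos s hs)) hζd
        (hDc.clm_apply (hasDerivWithinAt_const s I Z))
    have k2 : HasDerivWithinAt (fun t => ∑ μ, Z μ * ∑ ν, F.gMat κ' (c t) μ ν * ξ t ν) _ I s :=
      HasDerivWithinAt.fun_sum fun μ _ => (hγ.euler_lagrange hF' hs hc μ).const_mul (Z μ)
    have k3 := hI.eq_deriv _ (k1.congr_of_eventuallyEq (hevI.mono fun t ht => by
      rw [← ip_eq_sum, ip_symm hF' ht.1]
      exact (hip _ ht _ _).symm) (by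
      rw [← ip_eq_sum, ip_symm hF' hc.1]
      exact (hip _ ⟨hc.1, hd, hp, hD⟩ _ _).symm)) k2
    have hl := SphereChart.hasDerivWithinAt_add_smul (c s) Z
    have e0 : c s + (0 : ℝ) • Z = c s := by simp
    have hl1 := SphereChart.hasDerivWithinAt_comp_add_smul hψ1 Z
    have hl2 : HasDerivWithinAt (fun t : ℝ => fderiv ℝ ψ (c s + t • Z) (ξ s))
        (fderiv ℝ (fderiv ℝ ψ) (c s) Z (ξ s)) univ 0 := by
      have := (SphereChart.hasDerivWithinAt_comp_add_smul hψ2 Z).clm_apply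
        (hasDerivWithinAt_const (0 : ℝ) univ (ξ s))
      simpa only [map_zero, add_zero] using this
    -- Differentiating the isometry relation in the direction `Z` at fixed `ξ` relates the
    -- derivatives of the two metrics. Symmetry of the second derivative of `ψ` then eliminates the
    -- remaining term `D²ψ(ξ, Z)`.
    have m1 := hasDerivWithinAt_ip_comp hF (c := fun t : ℝ => ψ (c s + t • Z)) (s := 0)
      (by simpa using hd) hl1 hl2 hl2
    have m2 := hasDerivWithinAt_ip_comp hF' (c := fun t : ℝ => c s + t • Z) (s := 0)
      (by simpa using hc.1) hl (hasDerivWithinAt_const (0 : ℝ) univ (ξ s))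
      (hasDerivWithinAt_const (0 : ℝ) univ (ξ s))
    have hevl := (SphereChart.tendsto_add_smul (c s) Z).eventually hev
    have m3 := uniqueDiffWithinAt_univ.eq_deriv _ (m1.congr_of_eventuallyEq
      (hevl.mono fun t ht => (hip _ ht _ _).symm)
      (by simpa using (hip _ ⟨hc.1, hd, hp, hD⟩ (ξ s) (ξ s)).symm)) m2
    simp only [e0, hz, hz', add_zero] at m3
    rw [ip_symm hF hd _ (fderiv ℝ ψ (c s) (ξ s)), hsymm Z] at m3
    simp only [map_zero, add_zero] at k3
    have k4 : ∑ μ, Z μ * (1 / 2 * F.dG κ' (c s) μ (ξ s) (ξ s)) =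
        1 / 2 * ∑ μ, Z μ * F.dG κ' (c s) μ (ξ s) (ξ s) := by
      rw [Finset.mul_sum]
      exact Finset.sum_congr rfl fun μ _ => by ring
    rw [k4] at k3
    linarith
  -- It remains to see that acceleration plus Christoffel term is orthogonal to every vector; each
  -- vector is of the form `Dψ Z`, and the metric is nondegenerate.
  refine (neg_eq_of_add_eq_zero_left ?_).symm
  refine eq_zero_of_ip_eq_zero hF hreg fun W => ?_
  obtain ⟨Z, rfl⟩ : ∃ Z, fderiv ℝ ψ (c s) Z = W := by
    refine ⟨κ'.coordVel (κ'.place (c s)) (∑ μ, W μ • κ.dPlace (ψ (c s)) μ), ?_⟩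
    have h1 := SphereChart.sum_coordVel (κ := κ') (SphereChart.place_mem_range hc.1)
      (X := ∑ μ, W μ • κ.dPlace (ψ (c s)) μ) (by rw [← hp]; exact SphereChart.inner_sum_dPlace hd W)
    rw [SphereChart.coord_place hc.1, ← hD] at h1
    rw [← SphereChart.coordVel_sum hd (fderiv ℝ ψ (c s) _), h1, SphereChart.coordVel_sum hd]
  have h2 := ip_chr4 hF hreg (ζ s) (ζ s) (fderiv ℝ ψ (c s) Z)
  have h3 := ip_add_left F κ (ψ (c s)) a
    (fun μ => ∑ α, ∑ β, F.chr4 κ (ψ (c s)) μ α β * ζ s α * ζ s β) (fderiv ℝ ψ (c s) Z)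
  rw [key, h2, Finset.sum_sub_distrib, Finset.sum_add_distrib] at h3
  exact h3.trans (by ring)

end ChartGeodesic

end DoubleNull


namespace DoubleNull

/-! ### Existence and uniqueness of geodesics -/

open Filter in
/-- The solutions of an ordinary differential equation with initial values close to `y₀` stay in a
given neighbourhood of `y₀` for a uniform time. -/
theorem exists_local_solutions {E : Type*} [NormedAddCommGroup E] [NormedSpace ℝ E] [CompleteSpace E]
    {f : E → E} {y₀ : E} (hf : ContDiffAt ℝ 1 f y₀) {O : Set E} (hO : O ∈ nhds y₀) :
    ∃ N ∈ nhds y₀, ∃ δ > (0 : ℝ), ∀ y ∈ N, ∃ α : ℝ → E, α 0 = y ∧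
      ∀ t ∈ Icc (-δ) δ, HasDerivAt α (f (α t)) t ∧ α t ∈ O := by
  obtain ⟨ε, hε, a, r, L, K, hr, hpl⟩ := IsPicardLindelof.of_contDiffAt_one hf
  obtain ⟨α, hα, hc⟩ := (hpl 0).exists_forall_mem_closedBall_eq_hasDerivWithinAt_continuousOn
  simp only [zero_sub, zero_add] at hα hc
  have hr' : (0 : ℝ) < r := hr
  have h0 : ((y₀, 0) : E × ℝ) ∈ Metric.closedBall y₀ (r : ℝ) ×ˢ Icc (-ε) ε :=
    ⟨Metric.mem_closedBall_self hr'.le, by linarith, hε.le⟩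
  have hn : Metric.closedBall y₀ (r : ℝ) ×ˢ Icc (-ε) ε ∈ nhds ((y₀, 0) : E × ℝ) :=
    prod_mem_nhds (Metric.closedBall_mem_nhds _ hr') (Icc_mem_nhds (by linarith) hε)
  have h1 : ∀ᶠ p in nhds ((y₀, 0) : E × ℝ), α p ∈ O := by
    have := (hc _ h0).continuousAt hn
    refine this.eventually ?_
    rwa [(hα y₀ (Metric.mem_closedBall_self hr'.le)).1]
  rw [nhds_prod_eq] at h1
  obtain ⟨pa, ha, pb, hb, hab⟩ := eventually_prod_iff.1 h1
  obtain ⟨η, hη, hηb⟩ := Metric.eventually_nhds_iff.1 hb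
  refine ⟨{y | pa y} ∩ Metric.closedBall y₀ r,
    inter_mem ha (Metric.closedBall_mem_nhds _ hr'), min (ε / 2) (η / 2), by positivity,
    fun y hy => ⟨fun t => α (y, t), (hα y hy.2).1, fun t ht => ?_⟩⟩
  have k1 := min_le_left (ε / 2) (η / 2)
  have k2 := min_le_right (ε / 2) (η / 2)
  refine ⟨((hα y hy.2).2 t ⟨by linarith [ht.1], by linarith [ht.2]⟩).hasDerivAt
    (Icc_mem_nhds (by linarith [ht.1]) (by linarith [ht.2])), hab hy.1 (hηb ?_)⟩
  rw [Real.dist_eq, sub_zero, abs_lt]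
  exact ⟨by linarith [ht.1], by linarith [ht.2]⟩

namespace Fields

variable {F : Fields} {κ : SphereChart}

/-- The geodesic vector field. -/
noncomputable def geoField (F : Fields) (κ : SphereChart) (y : Pt × Pt) : Pt × Pt :=
  (y.2, fun μ => -∑ α, ∑ β, F.chr4 κ y.1 μ α β * y.2 α * y.2 β)

theorem contDiffAt_geoField (hF : ChartFields F κ) {r₀ : ℝ} {y : Pt × Pt} (hy : y.1 ∈ F.reg κ r₀) :
    ContDiffAt ℝ 1 (F.geoField κ) y := by
  refine contDiffAt_snd.prodMk (contDiffAt_pi.2 fun μ => ContDiffAt.neg ?_)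
  refine ContDiffAt.sum fun α _ => ContDiffAt.sum fun β _ => ?_
  have h1 : ContDiffAt ℝ 1 (fun y : Pt × Pt => F.chr4 κ y.1 μ α β) y :=
    (((smooth_chr4 hF r₀ μ α β).contDiffAt ((isOpen_reg hF r₀).mem_nhds hy)).of_le (by simp)).comp y
      contDiffAt_fst
  have h2 : ∀ ν, ContDiffAt ℝ 1 (fun y : Pt × Pt => y.2 ν) y := fun ν =>
    (contDiffAt_apply (n := 1) ℝ ℝ ν y.2).comp y contDiffAt_snd
  exact (h1.mul (h2 α)).mul (h2 β)

theorem geoField_zero (c : Pt) : F.geoField κ (c, 0) = 0 := by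
  ext μ <;> simp [geoField]

/-- A geodesic with vanishing initial velocity is constant. -/
theorem IsGeodesic.eq_const {𝔄 : SphereAtlas} {u₀ u' v₀ v' T r₀ : ℝ} {γ γ' : ℝ → Event}
    (hγ : F.IsGeodesic 𝔄 u₀ u' v₀ v' T γ γ') (hT : 0 < T) (hF : F.IsDoubleNull 𝔄 u₀ u' v₀ v')
    (hr : 0 < radius r₀ (γ 0)) (h0 : γ' 0 = 0) : ∀ s ∈ Icc 0 T, γ s = γ 0 ∧ γ' s = 0 := by
  have h0T : (0 : ℝ) ∈ Icc 0 T := ⟨le_rfl, hT.le⟩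
  obtain ⟨j, hj⟩ := hγ.exists_chart h0T
  set κ := 𝔄.chart j with hκ
  have hreg : κ.coord (γ 0) ∈ F.reg κ r₀ := by
    refine hF.mem_reg (SphereChart.coord_mem_dom hj) ?_ (by rw [← radius_eq]; exact hr.ne')
    rw [SphereChart.place_coord hj]
    exact (hγ 0 h0T).1
  set y : ℝ → Pt × Pt := fun t => (κ.coord (γ t), κ.coordVel (γ t) (γ' t)) with hy
  set G : Set ℝ := {t | (γ t).2.2 ∈ κ.range ∧ y t = (κ.coord (γ 0), 0)} with hG
  have hGiff : ∀ t ∈ Icc 0 T, t ∈ G ↔ γ t = γ 0 ∧ γ' t = 0 := fun t ht => by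
    constructor
    · rintro ⟨h1, h2⟩
      rw [hy, Prod.ext_iff] at h2
      obtain ⟨h2, h3⟩ := h2
      refine ⟨?_, ?_⟩
      · rw [← SphereChart.place_coord h1, ← SphereChart.place_coord hj]
        exact congrArg κ.place h2
      · rw [← SphereChart.sum_coordVel h1 (hγ.inner_vel ht hT), show κ.coordVel (γ t) (γ' t) = 0 from h3]
        simp
    · rintro ⟨h1, h2⟩
      refine ⟨by rw [h1]; exact hj, ?_⟩
      rw [hy, Prod.ext_iff]
      refine ⟨by simp only [h1], ?_⟩
      simp only [h2]
      ext μ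
      fin_cases μ <;> simp [SphereChart.coordVel, mkPt, SphereChart.tangentComp, Matrix.mulVec,
        dotProduct]
  have hyd : ∀ s ∈ Icc 0 T, (γ s).2.2 ∈ κ.range →
      HasDerivWithinAt y (F.geoField κ (y s)) (Icc 0 T) s := fun s hs hs' =>
    (hγ.hasDeriv_coord hs hT hs').prodMk ((hγ s hs).2.2 j hs')
  have key : Icc 0 T ⊆ G := by
    refine continuity_induction ?_ ((hGiff 0 h0T).2 ⟨rfl, h0⟩) fun s hs hsG => ?_
    · refine isClosed_of_closure_subset fun s hs => ?_
      have hsT : s ∈ Icc 0 T := by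
        have := closure_mono inter_subset_right hs
        rwa [isClosed_Icc.closure_eq] at this
      have h1 : γ s = γ 0 := by
        have hcl : IsClosed (Icc 0 T ∩ γ ⁻¹' {γ 0}) := ContinuousOn.preimage_isClosed_of_isClosed
          (fun t ht => (hγ t ht).2.1.continuousWithinAt) isClosed_Icc isClosed_singleton
        have h2 : G ∩ Icc 0 T ⊆ Icc 0 T ∩ γ ⁻¹' {γ 0} := fun t ht => ⟨ht.2, ((hGiff t ht.2).1 ht.1).1⟩
        exact (closure_minimal h2 hcl hs).2
      have hsr : (γ s).2.2 ∈ κ.range := by rw [h1]; exact hj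
      refine ⟨⟨hsr, ?_⟩, hsT⟩
      have h2 : ContinuousWithinAt y (G ∩ Icc 0 T) s :=
        (hyd s hsT hsr).continuousWithinAt.mono inter_subset_right
      have h3 := h2.mem_closure hs (t := {(κ.coord (γ 0), 0)}) fun t ht => ht.1.2
      simpa using h3
    · obtain ⟨hsr, hsy⟩ := hsG ⟨hs.1, le_rfl⟩
      obtain ⟨L, O, hO, hL⟩ := (contDiffAt_geoField (hF.chartFields j)
        (y := (κ.coord (γ 0), 0)) hreg).exists_lipschitzOnWith
      have hys := (hyd s hs hsr).continuousWithinAt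
      have hev : ∀ᶠ t in nhdsWithin s (Icc 0 T), y t ∈ O ∧ (γ t).2.2 ∈ κ.range := by
        refine (hys.eventually ?_).and (hγ.eventually_mem_range hs hsr)
        rwa [hsy]
      obtain ⟨η, hη, hball⟩ := Metric.mem_nhdsWithin_iff.1 hev
      refine Metric.mem_nhdsWithin_iff.2 ⟨η, hη, fun b hb => ?_⟩
      rcases le_or_gt b s with hbs | hbs
      · exact hsG ⟨hb.2.1, hbs⟩
      have hmem : ∀ t ∈ Icc s b, t ∈ Metric.ball s η ∩ Icc 0 T := fun t ht => by
        refine ⟨?_, hs.1.trans ht.1, ht.2.trans hb.2.2⟩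
        have := hb.1
        rw [Metric.mem_ball, Real.dist_eq, abs_of_nonneg (by linarith [ht.1])] at this ⊢
        linarith [ht.2]
      -- The geodesic field vanishes at points with zero velocity, so near such a point the
      -- difference from the constant solution satisfies `|y'| ≤ L |y - y₀|`, and Grönwall's
      -- inequality applies.
      have hz := eq_zero_of_abs_deriv_le_mul_abs_self_of_eq_zero_right (K := L)
        (f := fun t => y t - (κ.coord (γ 0), 0)) (f' := fun t => F.geoField κ (y t)) (a := s) (b := b)
        (fun t ht => ((hyd t (hmem t ht).2 (hball (hmem t ht)).2).continuousWithinAt.mono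
          fun x hx => (hmem x hx).2).sub continuousWithinAt_const)
        (fun t ht => (((hyd t (hmem t ⟨ht.1, ht.2.le⟩).2
          (hball (hmem t ⟨ht.1, ht.2.le⟩)).2).mono_of_mem_nhdsWithin (by
            refine Filter.mem_of_superset (Icc_mem_nhdsGE ht.2) fun x hx => ?_
            exact (hmem x ⟨ht.1.trans hx.1, hx.2⟩).2)).sub_const _))
        (by simp only [hsy, sub_self])
        (fun t ht => by
          have := hL.norm_sub_le (hball (hmem t ⟨ht.1, ht.2.le⟩)).1 (mem_of_mem_nhds hO)
          rwa [geoField_zero, sub_zero] at this) b ⟨hbs.le, le_rfl⟩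
      exact ⟨(hball hb).2, sub_eq_zero.1 hz⟩
  exact fun s hs => (hGiff s hs).1 (key hs)

end Fields

end DoubleNull


namespace DoubleNull

/-! ### Operations on geodesics -/

theorem SphereChart.coordVel_smul (κ : SphereChart) (l : ℝ) (w X : Event) :
    κ.coordVel w (l • X) = l • κ.coordVel w X := by
  unfold coordVel
  rw [Prod.smul_snd, Prod.smul_snd, κ.tangentComp_smul]
  ext μ
  fin_cases μ <;> simp [mkPt]

/-- At the junction the derivatives from both sides must coincide. For geodesics they do, since the
right side of the equation depends only on position and velocity. -/
theorem hasDerivWithinAt_glue {E : Type*} [NormedAddCommGroup E] [NormedSpace ℝ E]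
    {f f₁ f₂ : ℝ → E} {D : E} {T₁ T₂ s : ℝ} (h1 : 0 ≤ T₁) (h2 : 0 ≤ T₂) (hs : s ∈ Icc 0 (T₁ + T₂))
    (e₁ : ∀ t ∈ Icc 0 T₁, f t = f₁ t) (e₂ : ∀ t ∈ Icc 0 T₂, f (t + T₁) = f₂ t)
    (d₁ : s ≤ T₁ → HasDerivWithinAt f₁ D (Icc 0 T₁) s)
    (d₂ : T₁ ≤ s → HasDerivWithinAt f₂ D (Icc 0 T₂) (s - T₁)) :
    HasDerivWithinAt f D (Icc 0 (T₁ + T₂)) s := by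
  rw [← Icc_union_Icc_eq_Icc h1 (by linarith : T₁ ≤ T₁ + T₂)]
  refine HasDerivWithinAt.union ?_ ?_
  · rcases le_or_gt s T₁ with h | h
    · exact (d₁ h).congr e₁ (e₁ s ⟨hs.1, h⟩)
    · refine HasFDerivWithinAt.of_notMem_closure ?_
      rw [isClosed_Icc.closure_eq]
      exact fun h' => absurd h'.2 (not_le.2 h)
  · rcases le_or_gt T₁ s with h | h
    · have k1 : HasDerivWithinAt (fun t => f₂ (t - T₁)) ((1 : ℝ) • D) (Icc T₁ (T₁ + T₂)) s :=
        (d₂ h).scomp (s := Icc T₁ (T₁ + T₂)) (h := fun t => t - T₁) s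
          ((hasDerivWithinAt_id s _).sub_const T₁)
          fun t ht => ⟨by linarith [ht.1], by linarith [ht.2]⟩
      rw [one_smul] at k1
      have e : ∀ t ∈ Icc T₁ (T₁ + T₂), f t = f₂ (t - T₁) := fun t ht => by
        rw [← e₂ (t - T₁) ⟨by linarith [ht.1], by linarith [ht.2]⟩, sub_add_cancel]
      exact k1.congr e (e s ⟨h, hs.2⟩)
    · refine HasFDerivWithinAt.of_notMem_closure ?_
      rw [isClosed_Icc.closure_eq]
      exact fun h' => absurd h'.1 (not_le.2 h)

namespace Fields

variable {F : Fields} {𝔄 : SphereAtlas} {u₀ u' v₀ v' : ℝ}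

theorem isGeodesic_const {w : Event} (hw : w ∈ rect u₀ u' v₀ v') (X : Event) :
    F.IsGeodesic 𝔄 u₀ u' v₀ v' 0 (fun _ => w) (fun _ => X) := by
  intro s _
  rw [Icc_self]
  have h : ∀ {E : Type} [NormedAddCommGroup E] [NormedSpace ℝ E] (f : ℝ → E) (D : E),
      HasDerivWithinAt f D {(0 : ℝ)} s := fun f D =>
    HasFDerivWithinAt.of_subsingleton subsingleton_singleton
  exact ⟨hw, h _ _, fun i _ => h _ _⟩

theorem IsGeodesic.rescale {T : ℝ} {γ γ' : ℝ → Event} (hγ : F.IsGeodesic 𝔄 u₀ u' v₀ v' T γ γ')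
    {l : ℝ} (hl : 0 < l) :
    F.IsGeodesic 𝔄 u₀ u' v₀ v' (T / l) (fun t => γ (l * t)) (fun t => l • γ' (l * t)) := by
  intro s hs
  have hmap : MapsTo (fun t => l * t) (Icc 0 (T / l)) (Icc 0 T) := fun t ht =>
    ⟨mul_nonneg hl.le ht.1, (le_div_iff₀' hl).1 ht.2⟩
  obtain ⟨h1, h2, h3⟩ := hγ (l * s) (hmap hs)
  have hd : HasDerivWithinAt (fun t => l * t) l (Icc 0 (T / l)) s := by
    simpa using (hasDerivWithinAt_id s (Icc 0 (T / l))).const_mul l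
  refine ⟨h1, h2.scomp s hd hmap, fun i hi => ?_⟩
  have h4 := ((h3 i hi).scomp s hd hmap).const_smul l
  simp only [SphereChart.coordVel_smul]
  refine h4.congr_deriv ?_
  ext μ
  simp only [Pi.smul_apply, smul_eq_mul, mul_neg, Finset.mul_sum]
  exact congrArg _ (Finset.sum_congr rfl fun α _ => Finset.sum_congr rfl fun β _ => by ring)

theorem IsGeodesic.concat {T₁ T₂ : ℝ} {γ₁ γ₁' γ₂ γ₂' : ℝ → Event} (h1 : 0 ≤ T₁) (h2 : 0 ≤ T₂)
    (hγ₁ : F.IsGeodesic 𝔄 u₀ u' v₀ v' T₁ γ₁ γ₁') (hγ₂ : F.IsGeodesic 𝔄 u₀ u' v₀ v' T₂ γ₂ γ₂')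
    (e : γ₁ T₁ = γ₂ 0) (e' : γ₁' T₁ = γ₂' 0) : ∃ γ γ' : ℝ → Event,
    F.IsGeodesic 𝔄 u₀ u' v₀ v' (T₁ + T₂) γ γ' ∧ (γ 0, γ' 0) = (γ₁ 0, γ₁' 0) ∧
      (γ (T₁ + T₂), γ' (T₁ + T₂)) = (γ₂ T₂, γ₂' T₂) := by
  have glue : ∀ {f₁ f₂ : ℝ → Event}, f₁ T₁ = f₂ 0 → ∃ f : ℝ → Event,
      (∀ t ∈ Icc 0 T₁, f t = f₁ t) ∧ ∀ t ∈ Icc 0 T₂, f (t + T₁) = f₂ t := fun {f₁ f₂} h => by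
    refine ⟨fun t => if t ≤ T₁ then f₁ t else f₂ (t - T₁), fun t ht => if_pos ht.2, fun t ht => ?_⟩
    simp only [add_sub_cancel_right]
    split_ifs with h3
    · have : t = 0 := by linarith [ht.1]
      rw [this, zero_add, h]
    · rfl
  obtain ⟨γ, a1, a2⟩ := glue e
  obtain ⟨γ', b1, b2⟩ := glue e'
  refine ⟨γ, γ', fun s hs => ?_, ?_, ?_⟩
  · have hcase : s ≤ T₁ → s ∈ Icc 0 T₁ := fun h => ⟨hs.1, h⟩
    have hcase' : T₁ ≤ s → s - T₁ ∈ Icc 0 T₂ ∧ γ s = γ₂ (s - T₁) ∧ γ' s = γ₂' (s - T₁) := fun h => by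
      have h3 : s - T₁ ∈ Icc 0 T₂ := ⟨by linarith, by linarith [hs.2]⟩
      rw [← a2 _ h3, ← b2 _ h3, sub_add_cancel]
      exact ⟨h3, rfl, rfl⟩
    refine ⟨?_, hasDerivWithinAt_glue h1 h2 hs a1 a2 (fun h => ?_) (fun h => ?_), fun i hi =>
      hasDerivWithinAt_glue h1 h2 hs (fun t ht => by rw [a1 t ht, b1 t ht])
        (f₂ := fun t => (𝔄.chart i).coordVel (γ₂ t) (γ₂' t))
        (fun t ht => by rw [a2 t ht, b2 t ht]) (fun h => ?_) (fun h => ?_)⟩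
    · rcases le_total s T₁ with h | h
      · rw [a1 s (hcase h)]
        exact (hγ₁ s (hcase h)).1
      · rw [(hcase' h).2.1]
        exact (hγ₂ _ (hcase' h).1).1
    · rw [b1 s (hcase h)]
      exact (hγ₁ s (hcase h)).2.1
    · rw [(hcase' h).2.2]
      exact (hγ₂ _ (hcase' h).1).2.1
    · rw [a1 s (hcase h)] at hi ⊢
      rw [b1 s (hcase h)]
      exact (hγ₁ s (hcase h)).2.2 i hi
    · rw [(hcase' h).2.1] at hi ⊢
      rw [(hcase' h).2.2]
      exact (hγ₂ _ (hcase' h).1).2.2 i hi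
  · rw [a1 0 ⟨le_rfl, h1⟩, b1 0 ⟨le_rfl, h1⟩]
  · rw [add_comm T₁ T₂, a2 T₂ ⟨h2, le_rfl⟩, b2 T₂ ⟨h2, le_rfl⟩]

theorem g_smul (w X : Event) (l : ℝ) : F.g w (l • X) (l • X) = l ^ 2 * F.g w X X := by
  have e : (l • X).2.2 - (l • X).2.1 • F.b w = l • (X.2.2 - X.2.1 • F.b w) := by
    simp only [Prod.smul_snd, Prod.smul_fst, smul_sub, smul_eq_mul, mul_smul]
  unfold g
  rw [e]
  simp only [Prod.smul_snd, Prod.smul_fst, map_smul, LinearMap.smul_apply, smul_eq_mul]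
  ring

theorem smul_mem_massShell {w X : Event} (h : (w, X) ∈ F.massShell u₀ u' v₀ v') {l : ℝ} (hl : 0 ≤ l) :
    (w, l • X) ∈ F.massShell u₀ u' v₀ v' := by
  obtain ⟨h1, h2, h3, h4, h5⟩ := h
  refine ⟨h1, ?_, ?_, mul_nonneg hl h4, mul_nonneg hl h5⟩
  · simp only [Prod.smul_snd, inner_smul_right]
    rw [show inner ℝ w.2.2 X.2.2 = 0 from h2, mul_zero]
  · simp only []
    rw [g_smul, show F.g w X X = 0 from h3, mul_zero]

end Fields

/-- A geodesic in a chart defines a geodesic. -/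
theorem ChartGeodesic.isGeodesic {F : Fields} {𝔄 : SphereAtlas} {u₀ u' v₀ v' r₀ T : ℝ}
    (hF : F.IsDoubleNull 𝔄 u₀ u' v₀ v') (hT : 0 < T) {j : Fin 2} {c ξ : ℝ → Pt}
    (hγ : ChartGeodesic F (𝔄.chart j) (Icc 0 T) c ξ)
    (hc : ∀ t ∈ Icc 0 T, c t ∈ (𝔄.chart j).dom ∧ (𝔄.chart j).place (c t) ∈ rect u₀ u' v₀ v' ∧
      rad r₀ (c t) ≠ 0) :
    F.IsGeodesic 𝔄 u₀ u' v₀ v' T (fun t => (𝔄.chart j).place (c t))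
      (fun t => ∑ μ, ξ t μ • (𝔄.chart j).dPlace (c t) μ) := by
  intro s hs
  obtain ⟨h1, h2, h3⟩ := hc s hs
  refine ⟨h2, SphereChart.hasDerivWithinAt_place h1 (hγ.pos s hs), fun i hi => ?_⟩
  refine hγ.change_chart (hF.chartFields j) (hF.chartFields i) hs (uniqueDiffOn_Icc hT s hs)
    (hF.mem_reg h1 h2 h3) hi (hF.mem_reg (SphereChart.coord_mem_dom hi) ?_ ?_)
  · rwa [SphereChart.place_coord hi]
  · rwa [← Fields.radius_eq, Fields.radius_eq (κ := 𝔄.chart j), SphereChart.coord_place h1]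

end DoubleNull


namespace DoubleNull

/-! ### Past extension of null geodesics -/

/-- Each initial value has a neighbourhood with a common existence time, and compactness leaves
finitely many of these times. -/
theorem exists_uniform_solutions {E : Type*} [NormedAddCommGroup E] [NormedSpace ℝ E]
    [CompleteSpace E] {f : E → E} {S O : Set E} (hS : IsCompact S) (hO : IsOpen O) (hSO : S ⊆ O)
    (hf : ∀ y ∈ S, ContDiffAt ℝ 1 f y) : ∃ δ > (0 : ℝ), ∀ y ∈ S, ∃ α : ℝ → E, α 0 = y ∧
      ∀ t ∈ Icc (-δ) δ, HasDerivAt α (f (α t)) t ∧ α t ∈ O := by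
  refine hS.induction_on (p := fun s => ∃ δ > (0 : ℝ), ∀ y ∈ s, ∃ α : ℝ → E, α 0 = y ∧
      ∀ t ∈ Icc (-δ) δ, HasDerivAt α (f (α t)) t ∧ α t ∈ O) ⟨1, one_pos, by simp⟩
    (fun s t hst ⟨δ, h0, h⟩ => ⟨δ, h0, fun y hy => h y (hst hy)⟩) ?_ fun y hy => ?_
  · rintro s t ⟨δ₁, h1, hs⟩ ⟨δ₂, h2, ht⟩
    refine ⟨min δ₁ δ₂, lt_min h1 h2, ?_⟩
    rintro y (hy | hy)
    · obtain ⟨α, e, h⟩ := hs y hy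
      exact ⟨α, e, fun t ht => h t (Icc_subset_Icc (neg_le_neg (min_le_left _ _)) (min_le_left _ _) ht)⟩
    · obtain ⟨α, e, h⟩ := ht y hy
      exact ⟨α, e, fun t ht =>
        h t (Icc_subset_Icc (neg_le_neg (min_le_right _ _)) (min_le_right _ _) ht)⟩
  · obtain ⟨N, hN, δ, h0, h⟩ := exists_local_solutions (hf y hy) (hO.mem_nhds (hSO hy))
    exact ⟨N, mem_nhdsWithin_of_mem_nhds hN, δ, h0, h⟩

namespace Fields

variable {F : Fields} {κ : SphereChart}

/-- The components of a normalised null vector are bounded. -/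
theorem abs_null_le (hF : ChartFields F κ) {r₀ C K : ℝ} {c ξ : Pt} (hb : RegBound F κ r₀ C K c)
    (hn : F.ip κ c ξ ξ = 0) (h0 : 0 ≤ ξ 0) (h1 : 0 ≤ ξ 1) (hs : ξ 0 + ξ 1 = 1) (μ : Fin 4) :
    |ξ μ| ≤ 2 + 9 * C := by
  have hC := hb.one_le
  have hr := hb.r_ge
  have hl := (abs_le.1 hb.lapse).1
  have hW : 0 < F.lapseSq κ c := one_div_pos.1 (by linarith)
  have hW2 : F.lapseSq κ c ≤ 2 := by
    have h2 : 1 / 2 ≤ 1 / F.lapseSq κ c := by linarith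
    exact (one_div_le_one_div (by norm_num : (0 : ℝ) < 2) hW).1 h2
  have hdiv : C / rad r₀ c ^ 2 ≤ C := div_le_self (by linarith) (one_le_pow₀ hr)
  have hsph : ∀ A, |ξ (sph A)| ≤ 2 + 9 * C := fun A => by
    have e : ξ (sph A) = F.sp κ c ξ A + F.shift κ c A * ξ 1 := by unfold sp; ring
    have k1 := hb.pd_metric.sq_le_inv_mul (F.sp κ c ξ) A
    rw [ip_eq hF hb.mem_reg.1] at hn
    have k2 : ∑ A, ∑ B, F.gsMat κ c A B * F.sp κ c ξ A * F.sp κ c ξ B =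
      F.lapseSq κ c * (4 * (ξ 0 * ξ 1)) := by linarith
    have k3 : F.lapseSq κ c * (4 * (ξ 0 * ξ 1)) ≤ 2 * 4 := by
      have : ξ 0 * ξ 1 ≤ 1 := by nlinarith
      have : 0 ≤ ξ 0 * ξ 1 := mul_nonneg h0 h1
      gcongr
      linarith
    have k4 : F.sp κ c ξ A ^ 2 ≤ C * (2 * 4) := by
      rw [k2] at k1
      refine k1.trans (mul_le_mul ((le_abs_self _).trans ((hb.hInv_le A A).trans hdiv)) k3 ?_
        (by linarith))
      have : 0 ≤ ξ 0 * ξ 1 := mul_nonneg h0 h1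
      positivity
    have k5 : |F.sp κ c ξ A| ≤ 1 + 8 * C := by
      rw [← sq_abs] at k4
      nlinarith [abs_nonneg (F.sp κ c ξ A), sq_nonneg (|F.sp κ c ξ A| - 1)]
    have k6 : |F.shift κ c A * ξ 1| ≤ C * 1 :=
      abs_mul_le ((hb.shift A).trans hdiv) (by rw [abs_of_nonneg h1]; linarith)
    rw [e]
    linarith [abs_add_le (F.sp κ c ξ A) (F.shift κ c A * ξ 1)]
  fin_cases μ
  · change |ξ 0| ≤ _
    rw [abs_of_nonneg h0]; linarith
  · change |ξ 1| ≤ _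
    rw [abs_of_nonneg h1]; linarith
  · exact hsph 0
  · exact hsph 1

/-- The points and vectors at which the metric is regular and the vector is future directed if it
is causal. -/
def futureSet (F : Fields) (κ : SphereChart) (r₀ : ℝ) : Set (Pt × Pt) :=
  {y | (y.1 ∈ F.reg κ r₀ ∧ 0 < F.gsMat κ y.1 0 0 ∧ 0 < (F.gsMat κ y.1).det) ∧
    1 / 2 < y.2 0 + y.2 1}

theorem isOpen_futureSet (hF : ChartFields F κ) (r₀ : ℝ) : IsOpen (F.futureSet κ r₀) := by
  have h1 : ContinuousOn (fun c => (F.gsMat κ c 0 0, (F.gsMat κ c).det)) (F.reg κ r₀) :=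
    ((hF.smooth_gs 0 0).continuousOn.prodMk (contDiffOn_det hF.smooth_gs).continuousOn).mono
      (reg_subset_dom r₀)
  have h2 := h1.isOpen_inter_preimage (isOpen_reg hF r₀) ((isOpen_Ioi (a := (0 : ℝ))).prod (isOpen_Ioi (a := (0 : ℝ))))
  have h3 : IsOpen {y : Pt × Pt | 1 / 2 < y.2 0 + y.2 1} :=
    isOpen_lt continuous_const (by fun_prop)
  exact (h2.preimage continuous_fst).inter h3

/-- The null condition forces `ξ⁰ ξ¹ ≥ 0`, and a positive sum then excludes negative components. The
set can thus be open, as the flow requires, while future directedness follows from conservation of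
the length. -/
theorem future_of_null (hF : ChartFields F κ) {r₀ : ℝ} {c ξ : Pt} (h : (c, ξ) ∈ F.futureSet κ r₀)
    (hn : F.ip κ c ξ ξ = 0) : 0 ≤ ξ 0 ∧ 0 ≤ ξ 1 := by
  obtain ⟨⟨h1, h2, h3⟩, h4⟩ := h
  simp only [] at h1 h2 h3 h4
  have hW : 0 < F.lapseSq κ c := by
    have := h1.2.1
    unfold lapseSq
    positivity
  have hq : 0 ≤ ∑ A, ∑ B, F.gsMat κ c A B * F.sp κ c ξ A * F.sp κ c ξ B := by
    refine nonneg_of_mul_nonneg_right (b := ∑ A, ∑ B, F.gsMat κ c A B * F.sp κ c ξ A * F.sp κ c ξ B)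
      ?_ h2
    have e : F.gsMat κ c 0 0 * ∑ A, ∑ B, F.gsMat κ c A B * F.sp κ c ξ A * F.sp κ c ξ B =
        (F.gsMat κ c 0 0 * F.sp κ c ξ 0 + F.gsMat κ c 0 1 * F.sp κ c ξ 1) ^ 2
          + (F.gsMat κ c).det * F.sp κ c ξ 1 ^ 2 := by
      simp only [Fin.sum_univ_two, Matrix.det_fin_two, hF.symm c h1.1 1 0]
      ring
    rw [e]
    positivity
  rw [ip_eq hF h1.1] at hn
  have hp : 0 ≤ ξ 0 * ξ 1 := by
    by_contra hneg
    have : F.lapseSq κ c * (ξ 0 * ξ 1) < 0 := mul_neg_of_pos_of_neg hW (not_le.1 hneg)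
    linarith
  constructor
  · by_contra hneg
    nlinarith
  · by_contra hneg
    nlinarith

end Fields

open Fields in
set_option maxHeartbeats 400000 in
/-- A null geodesic can be extended to the past for a uniform time or up to one of the initial
hypersurfaces. -/
theorem exists_past_extension {F : Fields} {𝔄 : SphereAtlas} {𝔎 : Cover 𝔄}
    {u₀ u' v₀ v' r₀ C K R : ℝ} (hreg : Region F 𝔎 u₀ u' v₀ v' r₀ C K R) :
    ∃ δ > (0 : ℝ), ∀ w X : Event, (w, X) ∈ F.massShell u₀ u' v₀ v' → X.1 + X.2.1 = 1 →
      u₀ < w.1 → v₀ < w.2.1 → ∃ (T : ℝ) (γ γ' : ℝ → Event), 0 < T ∧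
      F.IsGeodesic 𝔄 u₀ u' v₀ v' T γ γ' ∧ γ T = w ∧ γ' T = X ∧
      (γ 0, γ' 0) ∈ F.massShell u₀ u' v₀ v' ∧ 0 < (γ' 0).1 + (γ' 0).2.1 ∧
      ((γ 0).1 = u₀ ∨ (γ 0).2.1 = v₀ ∨ (γ 0).1 + (γ 0).2.1 ≤ w.1 + w.2.1 - δ) := by
  have hdn := hreg.doubleNull
  have hsol : ∀ j, ∃ δ > (0 : ℝ), ∀ u ∈ Icc u₀ u', ∀ v ∈ Icc v₀ v', ∀ θ ∈ 𝔎.K j, ∀ ξ : Pt,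
      F.ip (𝔄.chart j) (mkPt u v θ) ξ ξ = 0 → 0 ≤ ξ 0 → 0 ≤ ξ 1 → ξ 0 + ξ 1 = 1 →
      ∃ α : ℝ → Pt × Pt, α 0 = (mkPt u v θ, ξ) ∧ ∀ t ∈ Icc (-δ) δ,
        HasDerivAt α (F.geoField (𝔄.chart j) (α t)) t ∧ α t ∈ F.futureSet (𝔄.chart j) r₀ := by
    intro j
    have hb : ∀ u ∈ Icc u₀ u', ∀ v ∈ Icc v₀ v', ∀ θ ∈ 𝔎.K j,
        RegBound F (𝔄.chart j) r₀ C K (mkPt u v θ) := fun u hu v hv θ hθ =>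
      hreg.bound u hu v hv j θ (Metric.self_subset_cthickening _ hθ)
    -- Normalised future directed null vectors over the rectangle are bounded in the chart, so they
    -- lie in this compact set. The null condition is not imposed on it.
    set S : Set (Pt × Pt) :=
      ((fun p : ℝ × ℝ × Plane => mkPt p.1 p.2.1 p.2.2) '' (Icc u₀ u' ×ˢ Icc v₀ v' ×ˢ 𝔎.K j)) ×ˢ
        (Icc (fun _ => -(2 + 9 * C)) (fun _ => 2 + 9 * C) ∩ {ξ | ξ 0 + ξ 1 = 1}) with hS
    have hSc : IsCompact S := by
      refine IsCompact.prod ?_ (isCompact_Icc.inter_right (isClosed_eq (by fun_prop) (by fun_prop)))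
      refine (isCompact_Icc.prod (isCompact_Icc.prod (𝔎.isCompact j))).image ?_
      refine continuous_pi fun μ => ?_
      fin_cases μ <;> simp [mkPt] <;> fun_prop
    have hSO : S ⊆ F.futureSet (𝔄.chart j) r₀ := by
      rintro ⟨-, ξ⟩ ⟨⟨⟨u, v, θ⟩, ⟨hu, hv, hθ⟩, rfl⟩, -, hξ⟩
      have h1 := hb u hu v hv θ hθ
      refine ⟨⟨h1.mem_reg, h1.pd_metric.diag_pos 0, h1.pd_metric.det_pos⟩, ?_⟩
      rw [show ξ 0 + ξ 1 = 1 from hξ]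
      norm_num
    obtain ⟨δ, hδ, h⟩ := exists_uniform_solutions hSc (isOpen_futureSet (hdn.chartFields j) r₀) hSO
      fun y hy => contDiffAt_geoField (hdn.chartFields j) (hSO hy).1.1
    refine ⟨δ, hδ, fun u hu v hv θ hθ ξ hn h0 h1 hs => h _ ⟨⟨(u, v, θ), ⟨hu, hv, hθ⟩, rfl⟩, ?_, hs⟩⟩
    have h2 := fun μ => abs_le.1 (abs_null_le (hdn.chartFields j) (hb u hu v hv θ hθ) hn h0 h1 hs μ)
    exact ⟨fun μ => (h2 μ).1, fun μ => (h2 μ).2⟩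
  obtain ⟨δ, hδ, hsol⟩ := exists_finite_modulus (fun j ρ ρ' hle h u hu v hv θ hθ ξ hn h0 h1 hs => by
    obtain ⟨α, e, hα⟩ := h u hu v hv θ hθ ξ hn h0 h1 hs
    exact ⟨α, e, fun t ht => hα t (Icc_subset_Icc (neg_le_neg hle) hle ht)⟩) hsol
  -- Along the solution `u + v` grows at a rate above `1/2`, so a parameter time `δ` backwards
  -- lowers it by at least `δ/2`.
  refine ⟨δ / 2, by positivity, fun w X hq hX hu hv => ?_⟩
  obtain ⟨hw, hX1, hX2, hX3, hX4⟩ := hq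
  simp only [] at hw hX1 hX2 hX3 hX4
  obtain ⟨j, θ, hθ, hΦ⟩ := 𝔎.cover _ hw.2.2
  set κ := 𝔄.chart j with hκ
  have hF := hdn.chartFields j
  have hθU : θ ∈ κ.U := 𝔎.thick j (Metric.self_subset_cthickening _ hθ)
  have hr : w.2.2 ∈ κ.range := ⟨θ, hθU, hΦ⟩
  have hcoord : κ.coord w = mkPt w.1 w.2.1 θ := by
    unfold SphereChart.coord
    rw [← hΦ, κ.theta_phi hθU]
  obtain ⟨α, hα0, hα⟩ := hsol j w.1 hw.1 w.2.1 hw.2.1 θ hθ (κ.coordVel w X)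
    (by rw [← hcoord, ← g_eq hF hr hX1, hX2]) (by simpa [SphereChart.coordVel, mkPt_zero] using hX3)
    (by simpa [SphereChart.coordVel, mkPt_one] using hX4)
    (by simpa [SphereChart.coordVel, mkPt_zero, mkPt_one] using hX)
  rw [← hcoord] at hα0
  set c : ℝ → Pt := fun t => (α (t - δ)).1 with hc
  set ξ : ℝ → Pt := fun t => (α (t - δ)).2 with hξ
  have hsub : ∀ t ∈ Icc 0 δ, t - δ ∈ Icc (-δ) δ := fun t ht => ⟨by linarith [ht.1], by linarith [ht.2]⟩
  have hfut : ∀ t ∈ Icc 0 δ, (c t, ξ t) ∈ F.futureSet κ r₀ := fun t ht => (hα _ (hsub t ht)).2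
  have hder : ∀ t ∈ Icc 0 δ, HasDerivAt (fun t => α (t - δ)) (F.geoField κ (c t, ξ t)) t := fun t ht =>
    (hα _ (hsub t ht)).1.comp_sub_const t δ
  have hcd : ∀ t ∈ Icc 0 δ, HasDerivAt c (ξ t) t := fun t ht => (hder t ht).fst
  have hξd : ∀ t ∈ Icc 0 δ, HasDerivAt ξ
      (fun μ => -∑ α, ∑ β, F.chr4 κ (c t) μ α β * ξ t α * ξ t β) t := fun t ht => (hder t ht).snd
  have hδ0 : δ ∈ Icc 0 δ := ⟨hδ.le, le_rfl⟩
  have hend : c δ = κ.coord w ∧ ξ δ = κ.coordVel w X := by simp [hc, hξ, hα0]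
  have hcg : ∀ τ, 0 ≤ τ → ChartGeodesic F κ (Icc 0 (δ - τ)) (fun t => c (t + τ)) fun t => ξ (t + τ) :=
    fun τ hτ =>
    { pos := fun t ht => ((hcd (t + τ) ⟨by linarith [ht.1], by linarith [ht.2]⟩).comp_add_const
        t τ).hasDerivWithinAt
      vel := fun t ht => ((hξd (t + τ) ⟨by linarith [ht.1], by linarith [ht.2]⟩).comp_add_const
        t τ).hasDerivWithinAt }
  have hnull : ∀ t ∈ Icc 0 δ, F.ip κ (c t) (ξ t) (ξ t) = 0 := by
    have h0 := hcg 0 le_rfl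
    simp only [sub_zero, add_zero] at h0
    have h1 : ∀ t ∈ Icc 0 δ, F.ip κ (c t) (ξ t) (ξ t) = F.ip κ (c 0) (ξ 0) (ξ 0) := fun t ht => by
      have := abs_sub_le_of_deriv_le (f := fun t => F.ip κ (c t) (ξ t) (ξ t)) (g := fun _ => 0)
        (fun t ht => h0.hasDerivWithinAt_ip hF ht (hfut t ht).1.1)
        (fun t _ => hasDerivWithinAt_const t _ (0 : ℝ)) (fun t _ => by simp) ht
      rw [sub_zero] at this
      exact sub_eq_zero.1 (abs_nonpos_iff.1 this)
    intro t ht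
    rw [h1 t ht, ← h1 δ hδ0, hend.1, hend.2, ← g_eq hF hr hX1, hX2]
  have hpos : ∀ t ∈ Icc 0 δ, 0 ≤ ξ t 0 ∧ 0 ≤ ξ t 1 := fun t ht =>
    future_of_null hF (hfut t ht) (hnull t ht)
  have hcμ : ∀ μ, ∀ t ∈ Icc 0 δ, HasDerivAt (fun t => c t μ) (ξ t μ) t := fun μ t ht =>
    hasDerivAt_pi.1 (hcd t ht) μ
  have hmono : ∀ μ, (∀ t ∈ Icc 0 δ, 0 ≤ ξ t μ) → MonotoneOn (fun t => c t μ) (Icc 0 δ) := fun μ h =>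
    monotoneOn_of_hasDerivWithinAt_nonneg (convex_Icc _ _)
      (fun t ht => (hcμ μ t ht).continuousAt.continuousWithinAt)
      (fun t ht => (hcμ μ t (interior_subset ht)).hasDerivWithinAt)
      fun t ht => h t (interior_subset ht)
  have m0 := hmono 0 fun t ht => (hpos t ht).1
  have m1 := hmono 1 fun t ht => (hpos t ht).2
  have hendu : c δ 0 = w.1 ∧ c δ 1 = w.2.1 := by
    rw [hend.1]
    simp [SphereChart.coord, mkPt_zero, mkPt_one]
  -- If the backward curve leaves the rectangle, the smaller of `u - u₀` and `v - v₀` vanishes at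
  -- some `τ` by the intermediate value theorem. Since `u` and `v` are monotone, the curve lies in
  -- the rectangle from `τ` on.
  obtain ⟨τ, hτ, hτδ, hτu, hτv, hτ'⟩ : ∃ τ, 0 ≤ τ ∧ τ < δ ∧ u₀ ≤ c τ 0 ∧ v₀ ≤ c τ 1 ∧
      (c τ 0 = u₀ ∨ c τ 1 = v₀ ∨ c τ 0 + c τ 1 ≤ w.1 + w.2.1 - δ / 2) := by
    by_cases hcase : u₀ ≤ c 0 0 ∧ v₀ ≤ c 0 1
    · refine ⟨0, le_rfl, hδ, hcase.1, hcase.2, Or.inr (Or.inr ?_)⟩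
      have := abs_sub_le_of_deriv_le (f := fun t => 1 / 2 * t) (g := fun t => c t 0 + c t 1)
        (f' := fun _ => 1 / 2) (S := δ)
        (fun t _ => by simpa using (hasDerivWithinAt_id t (Icc 0 δ)).const_mul (1 / 2 : ℝ))
        (fun t ht => ((hcμ 0 t ht).add (hcμ 1 t ht)).hasDerivWithinAt)
        (fun t ht => by
          rw [abs_of_pos (by norm_num)]
          exact (hfut t ht).2.le) hδ0
      have h2 := (le_abs_self _).trans this
      rw [hendu.1, hendu.2] at h2
      linarith
    · have hcont : ContinuousOn (fun t => min (c t 0 - u₀) (c t 1 - v₀)) (Icc 0 δ) := fun t ht =>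
        ContinuousAt.continuousWithinAt (((hcμ 0 t ht).continuousAt.sub continuousAt_const).min
          ((hcμ 1 t ht).continuousAt.sub continuousAt_const))
      have hlt : min (c 0 0 - u₀) (c 0 1 - v₀) ≤ 0 := by
        by_contra hn
        have := lt_min_iff.1 (not_le.1 hn)
        exact hcase ⟨by linarith [this.1], by linarith [this.2]⟩
      have hgt : 0 < min (c δ 0 - u₀) (c δ 1 - v₀) := by
        rw [hendu.1, hendu.2]
        exact lt_min (by linarith) (by linarith)
      obtain ⟨τ, hτ, hm⟩ := intermediate_value_Icc hδ.le hcont ⟨hlt, hgt.le⟩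
      simp only [] at hm
      refine ⟨τ, hτ.1, lt_of_le_of_ne hτ.2 fun h => ?_, ?_, ?_, ?_⟩
      · rw [h] at hm
        exact hgt.ne' hm
      · linarith [min_le_left (c τ 0 - u₀) (c τ 1 - v₀)]
      · linarith [min_le_right (c τ 0 - u₀) (c τ 1 - v₀)]
      · rcases min_choice (c τ 0 - u₀) (c τ 1 - v₀) with h | h
        · exact Or.inl (by linarith)
        · exact Or.inr (Or.inl (by linarith))
  have hmem : ∀ t ∈ Icc 0 (δ - τ), t + τ ∈ Icc 0 δ ∧ τ ≤ t + τ := fun t ht =>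
    ⟨⟨by linarith [ht.1], by linarith [ht.2]⟩, by linarith [ht.1]⟩
  have hτI : τ ∈ Icc 0 δ := ⟨hτ, hτδ.le⟩
  have hrect : ∀ t ∈ Icc 0 (δ - τ), κ.place (c (t + τ)) ∈ rect u₀ u' v₀ v' := fun t ht => by
    obtain ⟨h1, h2⟩ := hmem t ht
    have k0 := m0 hτI h1 h2
    have k1 := m1 hτI h1 h2
    have l0 := m0 h1 hδ0 h1.2
    have l1 := m1 h1 hδ0 h1.2
    simp only [] at k0 k1 l0 l1
    rw [hendu.1] at l0
    rw [hendu.2] at l1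
    exact ⟨⟨hτu.trans k0, l0.trans hw.1.2⟩, ⟨hτv.trans k1, l1.trans hw.2.1.2⟩,
      SphereChart.norm_place (hfut _ h1).1.1.1⟩
  have hT : 0 < δ - τ := by linarith
  have hgeo := (hcg τ hτ).isGeodesic (r₀ := r₀) hdn hT fun t ht =>
    ⟨(hfut _ (hmem t ht).1).1.1.1, hrect t ht, (hfut _ (hmem t ht).1).1.1.2.2.2⟩
  have e1 : δ - τ + τ = δ := by ring
  have e0 : 0 + τ = τ := zero_add τ
  have hfτ := hfut τ hτI
  refine ⟨δ - τ, _, _, hT, hgeo, ?_, ?_, ⟨?_, ?_, ?_, ?_, ?_⟩, ?_, ?_⟩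
  · simp only [e1]
    rw [hend.1]
    exact SphereChart.place_coord hr
  · simp only [e1]
    rw [hend.1, hend.2]
    exact SphereChart.sum_coordVel hr hX1
  · exact hrect 0 ⟨le_rfl, hT.le⟩
  · exact SphereChart.inner_sum_dPlace (by rw [e0]; exact hfτ.1.1.1) _
  · simp only [e0]
    rw [g_frame hF hfτ.1.1.1, ← ip_eq hF hfτ.1.1.1]
    exact hnull τ hτI
  all_goals simp only [e0, sum_smul_dPlace]
  · exact (hpos τ hτI).1
  · exact (hpos τ hτI).2
  · linarith [show 1 / 2 < ξ τ 0 + ξ τ 1 from hfτ.2]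
  · exact hτ'

end DoubleNull


/-! ### Zero momenta, origin of null geodesics and the support of `f` -/

namespace DoubleNull

open Fields

theorem Fields.IsDoubleNull.eq_zero_of_massShell {F : Fields} {𝔄 : SphereAtlas} {u₀ u' v₀ v' : ℝ}
    (hF : F.IsDoubleNull 𝔄 u₀ u' v₀ v') {w X : Event} (hq : (w, X) ∈ F.massShell u₀ u' v₀ v')
    (h3 : X.1 = 0) (h4 : X.2.1 = 0) : X = 0 := by
  obtain ⟨hw, h1, h2, -, -⟩ := hq
  simp only [] at hw h1 h2
  have h5 : X.2.2 = 0 := by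
    by_contra hne
    have := hF.gs_pos w hw X.2.2 h1 hne
    simp only [g, h3, h4, zero_smul, sub_zero, mul_zero, add_zero, zero_add] at h2
    exact this.ne' h2
  exact Prod.ext h3 (Prod.ext h4 h5)

/-- The bounds for the momentum and the position along a geodesic. -/
theorem exists_momentum_bounds {𝔄 : SphereAtlas} (𝔎 : Cover 𝔄) {C K C₃ : ℝ} {CA : Fin 2 → ℝ}
    (hC : 1 ≤ C) (hK : 1 ≤ K) (h3 : 0 < C₃) (hA : ∀ A, 0 < CA A) :
    ∃ R, 1 ≤ R ∧ ∀ (F : Fields) (u₀ u' v₀ v' r₀ : ℝ), Region F 𝔎 u₀ u' v₀ v' r₀ C K R →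
      ∀ (T : ℝ) (γ γ' : ℝ → Event), 0 ≤ T → F.IsGeodesic 𝔄 u₀ u' v₀ v' T γ γ' →
      (γ 0, γ' 0) ∈ F.massShell u₀ u' v₀ v' → MomentumBound F 𝔄 r₀ C₃ CA (γ 0, γ' 0) →
      ∃ j, ∀ s ∈ Icc 0 T, (γ s).2.2 ∈ (𝔄.chart j).range ∧
        1 / 2 * p4 (γ' 0) ≤ p4 (γ' s) ∧ p4 (γ' s) ≤ 3 / 2 * p4 (γ' 0) ∧
        0 ≤ radius r₀ (γ s) ^ 2 * F.p3 (γ s) (γ' s) ∧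
        radius r₀ (γ s) ^ 2 * F.p3 (γ s) (γ' s) ≤ 2 * C₃ * p4 (γ' 0) ∧
        (∀ i, (γ 0).2.2 ∈ (𝔄.chart i).range → (γ s).2.2 ∈ (𝔄.chart i).range → ∀ A,
          |radius r₀ (γ s) ^ 2 * F.pS (𝔄.chart i) (γ s) (γ' s) A| ≤ 2 * CA A * p4 (γ' 0)) ∧
        |(γ s).1 - (γ 0).1| ≤ 32 * C₃ / radius r₀ (γ 0) := by
  obtain ⟨R, hR, hmain⟩ := exists_geodesic_bounds (𝔄 := 𝔄) 𝔎 hC hK h3 hA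
  refine ⟨R, hR, fun F u₀ u' v₀ v' r₀ hreg T γ γ' hT hγ hq hm => ?_⟩
  have h0T : (0 : ℝ) ∈ Icc 0 T := ⟨le_rfl, hT⟩
  have hr : 0 < radius r₀ (γ 0) := by
    have h1 := (hγ 0 h0T).1
    have := hreg.r_ge
    unfold radius
    linarith [h1.1.2, h1.2.1.1]
  obtain ⟨m1, m2, m3, m4⟩ := hm
  simp only [] at m1 m2 m3 m4
  -- Constant geodesics satisfy the bounds trivially. This includes `T = 0`, where one-sided
  -- derivatives are not unique, and zero momentum, where `r` need not grow.
  by_cases hconst : ∀ s ∈ Icc 0 T, γ s = γ 0 ∧ γ' s = γ' 0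
  · obtain ⟨j, hj⟩ := hγ.exists_chart h0T
    refine ⟨j, fun s hs => ?_⟩
    obtain ⟨e1, e2⟩ := hconst s hs
    rw [e1, e2]
    have hC3 : 0 ≤ C₃ * p4 (γ' 0) := mul_nonneg h3.le m1
    refine ⟨hj, by linarith, by linarith, m2, by linarith, fun i hi _ A => ?_, ?_⟩
    · have : 0 ≤ CA A * p4 (γ' 0) := mul_nonneg (hA A).le m1
      linarith [m4 i hi A]
    · rw [sub_self, abs_zero]
      positivity
  rcases eq_or_lt_of_le hT with rfl | hT
  · refine absurd (fun s hs => ?_) hconst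
    rw [Icc_self, mem_singleton_iff] at hs
    rw [hs]
    exact ⟨rfl, rfl⟩
  rcases eq_or_lt_of_le m1 with hP | hP
  -- If `p⁴` vanishes, the initial bound forces `p³ = 0`, and a null vector with both components
  -- zero is zero because `gs` is positive definite.
  · have hX : γ' 0 = 0 := by
      refine hreg.doubleNull.eq_zero_of_massShell hq ?_ hP.symm
      have hΩ := hreg.doubleNull.lapse_pos _ (hγ 0 h0T).1
      rw [← hP, mul_zero] at m3
      have h5 := le_antisymm m3 m2
      rw [p3] at h5
      have h6 : radius r₀ (γ 0) ^ 2 * F.Ω (γ 0) ^ 2 ≠ 0 := by positivity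
      rw [← mul_assoc] at h5
      exact (mul_eq_zero.1 h5).resolve_left h6
    refine absurd (fun s hs => ?_) hconst
    have := hγ.eq_const hT hreg.doubleNull hr hX s hs
    rwa [hX]
  · exact hmain F u₀ u' v₀ v' r₀ hreg T γ γ' hT hγ hq ⟨m1, m2, m3, m4⟩ hP

/-- Every null geodesic originates on one of the initial hypersurfaces. -/
theorem exists_past_geodesic {F : Fields} {𝔄 : SphereAtlas} {𝔎 : Cover 𝔄}
    {u₀ u' v₀ v' r₀ C K R : ℝ} (hreg : Region F 𝔎 u₀ u' v₀ v' r₀ C K R) {w X : Event}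
    (hq : (w, X) ∈ F.massShell u₀ u' v₀ v') (hX : 0 < X.1 + X.2.1) :
    ∃ (T : ℝ) (γ γ' : ℝ → Event), 0 ≤ T ∧ F.IsGeodesic 𝔄 u₀ u' v₀ v' T γ γ' ∧
      (γ T, γ' T) = (w, X) ∧ (γ 0, γ' 0) ∈ F.massShell u₀ u' v₀ v' ∧
      ((γ 0).1 = u₀ ∨ (γ 0).2.1 = v₀) := by
  obtain ⟨δ, hδ, hstep⟩ := exists_past_extension hreg
  have key : ∀ (n : ℕ) (w X : Event), (w, X) ∈ F.massShell u₀ u' v₀ v' → 0 < X.1 + X.2.1 →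
      w.1 + w.2.1 ≤ u₀ + v₀ + n * δ →
      ∃ (T : ℝ) (γ γ' : ℝ → Event), 0 ≤ T ∧ F.IsGeodesic 𝔄 u₀ u' v₀ v' T γ γ' ∧
      (γ T, γ' T) = (w, X) ∧ (γ 0, γ' 0) ∈ F.massShell u₀ u' v₀ v' ∧
      ((γ 0).1 = u₀ ∨ (γ 0).2.1 = v₀) := by
    intro n
    induction n with
    | zero =>
      intro w X hq _ hn
      rw [Nat.cast_zero, zero_mul, add_zero] at hn
      refine ⟨0, _, _, le_rfl, isGeodesic_const hq.1 X, rfl, hq, Or.inl ?_⟩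
      linarith [hq.1.1.1, hq.1.2.1.1]
    | succ n ih =>
      intro w X hq hX hn
      by_cases hb : w.1 = u₀ ∨ w.2.1 = v₀
      · exact ⟨0, _, _, le_rfl, isGeodesic_const hq.1 X, rfl, hq, hb⟩
      rw [not_or] at hb
      -- The vector is rescaled so that the uniform extension applies; the resulting geodesic is
      -- then reparametrised to end with the original velocity. Either it starts on an initial
      -- hypersurface or `u + v` has dropped by `δ`, which consumes one step of the induction.
      set l := X.1 + X.2.1 with hl
      obtain ⟨T, γ, γ', hT, hγ, e1, e2, hq0, hX0, hend⟩ := hstep w (l⁻¹ • X)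
        (smul_mem_massShell hq (inv_nonneg.2 hX.le))
        (by
          simp only [Prod.smul_fst, Prod.smul_snd, smul_eq_mul]
          rw [← mul_add, inv_mul_cancel₀ hX.ne'])
        (lt_of_le_of_ne hq.1.1.1 (Ne.symm hb.1)) (lt_of_le_of_ne hq.1.2.1.1 (Ne.symm hb.2))
      have hγl := hγ.rescale hX
      have hTl : l * (T / l) = T := mul_div_cancel₀ T hX.ne'
      have he : (γ (l * (T / l)), l • γ' (l * (T / l))) = (w, X) := by
        rw [hTl, e1, e2, smul_smul, mul_inv_cancel₀ hX.ne', one_smul]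
      have hq0' : (γ (l * 0), l • γ' (l * 0)) ∈ F.massShell u₀ u' v₀ v' := by
        rw [mul_zero]
        exact smul_mem_massShell hq0 hX.le
      have hT' : 0 ≤ T / l := by positivity
      rw [← or_assoc] at hend
      rcases hend with hend | hend
      · exact ⟨T / l, _, _, hT', hγl, he, hq0', by simpa only [mul_zero] using hend⟩
      · obtain ⟨S, β, β', hS, hβ, d1, d2, d3⟩ := ih (γ (l * 0)) (l • γ' (l * 0)) hq0' (by
          simp only [Prod.smul_fst, Prod.smul_snd, smul_eq_mul, mul_zero]
          rw [← mul_add]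
          positivity) (by
          rw [mul_zero]
          push_cast at hn
          linarith)
        obtain ⟨d4, d5⟩ := Prod.ext_iff.1 d1
        obtain ⟨σ, σ', hσ, s1, s2⟩ := hβ.concat hS hT' hγl d4 d5
        refine ⟨S + T / l, σ, σ', by positivity, hσ, s2.trans he, by rw [s1]; exact d2, ?_⟩
        rwa [show σ 0 = β 0 from (Prod.ext_iff.1 s1).1]
  obtain ⟨n, hn⟩ := exists_nat_ge ((w.1 + w.2.1 - (u₀ + v₀)) / δ)
  refine key n w X hq hX ?_
  rw [div_le_iff₀ hδ] at hn
  linarith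

/-- A bound for `u` on the support of a solution of the Vlasov equation. -/
theorem u_le_of_mem_supp {F : Fields} {𝔄 : SphereAtlas} {𝔎 : Cover 𝔄}
    {u₀ u' v₀ v' r₀ C K R b : ℝ} (hreg : Region F 𝔎 u₀ u' v₀ v' r₀ C K R) {f : Event × Event → ℝ}
    (hf : F.IsVlasov 𝔄 u₀ u' v₀ v' f)
    (hf0 : ∀ q ∈ F.massShell u₀ u' v₀ v', q.1.1 = u₀ → f q = 0)
    (hb : ∀ (T : ℝ) (γ γ' : ℝ → Event), 0 ≤ T → F.IsGeodesic 𝔄 u₀ u' v₀ v' T γ γ' →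
      (γ 0, γ' 0) ∈ F.initialSupp u₀ u' v₀ v' f → ∀ s ∈ Icc 0 T, (γ s).1 ≤ b) :
    ∀ q ∈ F.supp u₀ u' v₀ v' f, q.1.1 ≤ b := by
  have h1 : ∀ w X, (w, X) ∈ F.massShell u₀ u' v₀ v' → f (w, X) ≠ 0 → 0 < X.1 + X.2.1 → w.1 ≤ b := by
    intro w X hq hne hX
    obtain ⟨T, γ, γ', hT, hγ, e, hq0, hbd⟩ := exists_past_geodesic hreg hq hX
    have ht := hf.transport T γ γ' hT hγ hq0
    rw [e] at ht
    rw [ht] at hne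
    -- A start on `{u = u₀}` is excluded, since `f` vanishes there and is constant along the
    -- geodesic.
    have hv : (γ 0).2.1 = v₀ := hbd.resolve_left fun h => hne (hf0 _ hq0 h)
    have := hb T γ γ' hT hγ ⟨hq0, hv, subset_closure ⟨hq0, hv, hne⟩⟩ T ⟨hT, le_rfl⟩
    rwa [show γ T = w from (Prod.ext_iff.1 e).1] at this
  have h2 : ∀ w X, (w, X) ∈ F.massShell u₀ u' v₀ v' → f (w, X) ≠ 0 → w.1 ≤ b := by
    intro w X hq hne
    by_cases hX : 0 < X.1 + X.2.1
    · exact h1 w X hq hne hX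
    have k3 : 0 ≤ X.1 := hq.2.2.2.1
    have k4 : 0 ≤ X.2.1 := hq.2.2.2.2
    have hX0 : X = 0 := hreg.doubleNull.eq_zero_of_massShell hq (by linarith) (by linarith)
    subst hX0
    -- The zero vector cannot be traced back to the boundary. It is the limit of the null vectors `t
    -- ∂_u`, and by continuity `f` is nonzero on them for small `t > 0`.
    have hpath : ∀ t ∈ Ici (0 : ℝ), (w, ((t, 0, 0) : Event)) ∈ F.massShell u₀ u' v₀ v' := fun t ht =>
      ⟨hq.1, by simp, by simp [g], ht, le_rfl⟩
    have hcont : ContinuousWithinAt (fun t : ℝ => f (w, ((t, 0, 0) : Event))) (Ici 0) 0 :=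
      ContinuousWithinAt.comp (t := F.massShell u₀ u' v₀ v') (hf.continuousOn _ (hpath 0 (by simp)))
        (by fun_prop) hpath
    have hev := (hcont.eventually_ne hne).filter_mono (nhdsWithin_mono 0 Ioi_subset_Ici_self)
    obtain ⟨t, ht, ht0⟩ := (hev.and self_mem_nhdsWithin).exists
    have ht0' : (0 : ℝ) < t := ht0
    exact h1 w _ (hpath t ht0'.le) ht (by simpa using ht0')
  rintro q ⟨-, hq⟩
  have hcl : IsClosed {q : Event × Event | q.1.1 ≤ b} := isClosed_le (by fun_prop) continuous_const
  exact closure_minimal (fun p hp => h2 p.1 p.2 hp.1 hp.2) hcl hq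

end DoubleNull

theorem proposition7p1 (𝔄 : DoubleNull.SphereAtlas) :
    ∃ Cbar₀ : ℝ, 0 < Cbar₀ ∧
    ∀ (u₀ u_f Cg C₃ : ℝ) (CA : Fin 2 → ℝ), u₀ < u_f → 0 < C₃ → (∀ A, 0 < CA A) →
    ∃ V : ℝ, ∀ (v₀ r₀ u' v' Cbar : ℝ), V ≤ v₀ → 0 < r₀ → u₀ < u' → u' ≤ u_f → v₀ < v' →
      Cbar ≤ Cbar₀ →
    ∀ (F : DoubleNull.Fields) (f : DoubleNull.Event × DoubleNull.Event → ℝ),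
      F.IsDoubleNull 𝔄 u₀ u' v₀ v' →
      F.InitialMetricBound r₀ 𝔄 Cg u₀ u' v₀ v' →
      (∀ u ∈ Set.Icc u₀ u', ∀ v ∈ Set.Icc v₀ v',
        F.RicciBootstrap r₀ 𝔄 Cbar u v ∧ F.ChristoffelBootstrap r₀ 𝔄 Cbar u v) →
      F.IsVlasov 𝔄 u₀ u' v₀ v' f →
      F.InitialMatterBound 𝔄 r₀ u₀ u' v₀ v' C₃ CA f →
      (∀ (T : ℝ) (γ γ' : ℝ → DoubleNull.Event), 0 ≤ T →
        F.IsGeodesic 𝔄 u₀ u' v₀ v' T γ γ' →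
        (γ 0, γ' 0) ∈ F.initialSupp u₀ u' v₀ v' f →
        (∀ s ∈ Set.Icc 0 T,
          1 / 2 * DoubleNull.Fields.p4 (γ' 0) ≤ DoubleNull.Fields.p4 (γ' s) ∧
          DoubleNull.Fields.p4 (γ' s) ≤ 3 / 2 * DoubleNull.Fields.p4 (γ' 0) ∧
          0 ≤ DoubleNull.radius r₀ (γ s) ^ 2 * F.p3 (γ s) (γ' s) ∧
          DoubleNull.radius r₀ (γ s) ^ 2 * F.p3 (γ s) (γ' s)
            ≤ 2 * C₃ * DoubleNull.Fields.p4 (γ' 0) ∧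
          (∀ i, (∀ t ∈ Set.Icc 0 s, (γ t).2.2 ∈ (𝔄.chart i).range) → ∀ A,
            |DoubleNull.radius r₀ (γ s) ^ 2 * F.pS (𝔄.chart i) (γ s) (γ' s) A|
              ≤ 2 * CA A * DoubleNull.Fields.p4 (γ' 0)) ∧
          |(γ s).1 - (γ 0).1| ≤ 32 * C₃ / DoubleNull.radius r₀ (γ 0)) ∧
        ∃ i, ∀ s ∈ Set.Icc 0 T, (γ s).2.2 ∈ (𝔄.chart i).range) ∧
      ((∀ q ∈ F.initialSupp u₀ u' v₀ v' f,
          q.1.1 + 32 * C₃ / DoubleNull.radius r₀ q.1 + 1 ≤ u_f) →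
        (∀ (T : ℝ) (γ γ' : ℝ → DoubleNull.Event), 0 ≤ T →
          F.IsGeodesic 𝔄 u₀ u' v₀ v' T γ γ' →
          (γ 0, γ' 0) ∈ F.initialSupp u₀ u' v₀ v' f →
          ∀ s ∈ Set.Icc 0 T, (γ s).1 ≤ u_f - 1) ∧
        ∀ q ∈ F.supp u₀ u' v₀ v' f, q.1.1 ≤ u_f - 1) := by
  obtain ⟨𝔎⟩ := DoubleNull.exists_cover 𝔄
  obtain ⟨Cb, hCb, C, K, hC, hK, hbound⟩ := DoubleNull.exists_regBound 𝔎
  refine ⟨Cb, hCb, fun u₀ u_f Cg C₃ CA _ h3 hA => ?_⟩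
  obtain ⟨R₁, -, hR₁⟩ := hbound Cg
  obtain ⟨R₂, -, hR₂⟩ := DoubleNull.exists_momentum_bounds 𝔎 hC hK h3 hA
  -- With `u' ≤ u_f` and `r₀ > 0` this makes `v₀ - u' + r₀`, the minimum of `r` over the rectangle,
  -- exceed both thresholds.
  refine ⟨max R₁ R₂ + u_f, fun v₀ r₀ u' v' Cbar hV hr₀ hu hu' _ hCbar F f hF hg hboot hf hm => ?_⟩
  have hreg : DoubleNull.Region F 𝔎 u₀ u' v₀ v' r₀ C K R₂ :=
    ⟨hF, hR₁ F r₀ u₀ u' v₀ v' Cbar hCbar hu (by linarith [le_max_left R₁ R₂]) hF hg hboot,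
      by linarith [le_max_right R₁ R₂]⟩
  have main : ∀ (T : ℝ) (γ γ' : ℝ → DoubleNull.Event), 0 ≤ T → F.IsGeodesic 𝔄 u₀ u' v₀ v' T γ γ' →
      (γ 0, γ' 0) ∈ F.initialSupp u₀ u' v₀ v' f → _ := fun T γ γ' hT hγ hq =>
    hR₂ F u₀ u' v₀ v' r₀ hreg T γ γ' hT hγ hq.1 (hm.2 _ hq)
  refine ⟨fun T γ γ' hT hγ hq => ?_, fun hlarge => ?_⟩
  · obtain ⟨j, hj⟩ := main T γ γ' hT hγ hq
    refine ⟨fun s hs => ?_, j, fun s hs => (hj s hs).1⟩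
    obtain ⟨-, k1, k2, k3, k4, k5, k6⟩ := hj s hs
    exact ⟨k1, k2, k3, k4, fun i hi => k5 i (hi 0 ⟨le_rfl, hs.1⟩) (hi s ⟨hs.1, le_rfl⟩), k6⟩
  · have hu : ∀ (T : ℝ) (γ γ' : ℝ → DoubleNull.Event), 0 ≤ T →
        F.IsGeodesic 𝔄 u₀ u' v₀ v' T γ γ' → (γ 0, γ' 0) ∈ F.initialSupp u₀ u' v₀ v' f →
        ∀ s ∈ Set.Icc 0 T, (γ s).1 ≤ u_f - 1 := fun T γ γ' hT hγ hq s hs => by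
      obtain ⟨j, hj⟩ := main T γ γ' hT hγ hq
      have h1 := (abs_le.1 (hj s hs).2.2.2.2.2.2).2
      have h2 := hlarge _ hq
      simp only [] at h2
      linarith
    exact ⟨hu, DoubleNull.u_le_of_mem_supp hreg hf hm.1 hu⟩
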